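/- **Setting.** Let $\mathtt b\ge 2$ be an integer and let $\mu$ be a probability measure on $\mathbb N=\{0,1,2,\dots\}$ with $\sum_{k} k\mu(k)=1$. *Words and trees.* For a set $A$, let $\mathbb W^*_A$ be the set of words $u=(a_k)_{k\le h}$ with $h\in\mathbb Z$ and letters $a_k\in A$; $|u|=h$ is the relative height of $u$, $\mathrm{end}(u)=a_h$, the parent of $u$ is $(a_k)_{k\le h-1}$, $u_{|l}=(a_k)_{k\le \min(h,l)}$, $u*(i)$ is $u$ followed by the letter $i$, and $\varphi_l(u)=(a_{k+l})_{k\le h-l}$. An ordered tree (with an infinite line of ancestors) is a non-empty set $t$ of words in $\mathbb W^*_{\{1,2,\dots\}}$ that contains the parents of its elements, such that any $u,v\in t$ satisfy $u_{|l}=v_{|l}$ for some $l$, and such that for each $u\in t$ there is a finite number $k_u(t)$ with $u*(i)\in t$ iff $1\le i\le k_u(t)$. The lexicographical order $<_t$ is: $u<_t v$ iff $u$ is a strict ancestor of $v$, or there is $l<\min(|u|,|v|)$ with $u_{|l}=v_{|l}$ and $\mathrm{end}(u_{|l+1})<\mathrm{end}(v_{|l+1})$. The successor $\mathrm{scc}(u)$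 is the least vertex after $u$ (and $\mathrm{scc}(u)=u$ if there is none). The subtree of $t$ stemming from $u$ is $\theta_u t=\{w: u*w\in t\}$, a set of finite words $w$. A pointed labelled tree is $(t,\varrho;(x_v)_{v\in t})$ with $\varrho\in t$ and labels $x_v\in \mathbb W^*_{\{1,\dots,\mathtt b\}}$; the space of these is equipped with the Borel sigma-field of local convergence. *Right-successor map.* For $\Theta=(t,\varrho;(x_v))$, $\mathrm{scc}(\Theta)$ is obtained by moving the distinguished vertex to $\varrho_1=\mathrm{scc}(\varrho)$, applying $\varphi_{|\varrho_1|}$ to all vertices, and $\varphi_{|x_{\varrho_1}|}$ to all labels. The right part $[\Theta]^+$ is the unique pointed labelled tree $(t',\varrho';x')$ for which there is a bijection $\psi$ from $t'$ onto $\{\varrho_{|p};p\le|\varrho|\}\cup\{v\in t:\varrho<_tv\}$, increasing for the lexicographical orders and preserving relative heights, with $\psi(\varrho')=\varrho$ and $x'_v=x_{\psi(v)}$. Put $\mathrm{scc}^+(\Theta)=[\mathrm{scc}(\Theta)]^+$. *The random tree.* $(\tau^*,\varrho)$ is the right part of an infinite pointed $\mathrm{GW}(\mu)$-tree: a.s.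 $|\varrho|=0$, and, with $\varrho(p)=\varrho_{|-p}$, the pairs $S_p=(\mathrm{end}(\varrho(p)),k_{\varrho(p+1)}(\tau^*))$, $p\ge0$, are i.i.d. with law $r(j,k)=\mathbf 1_{\{j=1\}}\sum_{l\ge k}\mu(l)$, $k\ge j\ge1$; conditionally given $(S_p)_{p\ge0}$, the subtree stemming from $\varrho$ and the subtrees stemming from the children of the $\varrho(p+1)$ other than $\varrho(p)$, $p\ge0$, are independent Galton–Watson trees with offspring distribution $\mu$. *The branching random walk.* Let $\mathbf o=(U_k)_{k\le 0}$ be a sequence of independent uniform random variables on $\{1,\dots,\mathtt b\}$, independent of $(\tau^*,\varrho)$. Conditionally given $(\tau^*,\varrho)$ and $\mathbf o$, the labels $(X_v)_{v\in\tau^*}$ form the branching random walk with $X_\varrho=\mathbf o$ and transition kernel $p_{\mathtt b}$ which, from $x$, moves to the parent of $x$ with probability $1/2$ and to $x*(i)$ with probability $1/(2\mathtt b)$, $1\le i\le\mathtt b$. That is, for each finite connected set $F$ of vertices containing $\varrho$, the joint law of $(X_v)_{v\in F}$ is $\delta_{\mathbf o}(dy_\varrho)\prod_{v\in F\setminus\{\varrho\}}p_{\mathtt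 b}(y_{v'},dy_v)$, where $v'$ is the neighbour of $v$ on the path from $v$ to $\varrho$. Set $\Theta=(\tau^*,\varrho;(X_v)_{v\in\tau^*})$. **Theorem.** 1. $\mathrm{scc}^+(\Theta)$ has the same law as $\Theta$. 2. Let $v_0=\varrho$ and $v_{n+1}=\mathrm{scc}(v_n)$. Almost surely, $(v_n)_{n\ge0}$ is strictly increasing and lists all the vertices $v\in\tau^*$ such that $v=\varrho$ or $\varrho<_{\tau^*}v$, and $$\frac1n\,\#\{X_{v_k}:1\le k\le n\}\ \xrightarrow[n\to\infty]{}\ c_{\mu,\mathtt b}:=\mathbf P\big(\mathbf o\notin\{X_{v_n}:n\ge1\}\big),$$ a constant that depends only on $\mu$ and $\mathtt b$. 3. If moreover $\sum_{k}k(\log k)^{1+\beta}\mu(k)<\infty$ for some $\beta>1$, then $c_{\mu,\mathtt b}>0$. -/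

import Mathlib

open MeasureTheory ProbabilityTheory Filter Topology
open scoped ENNReal

noncomputable section

/-! ### Bilateral words with an infinite past -/

/-- An `A`-bilateral word `(a_k)_{k ≤ h}` of depth `-∞`, of relative height `h : ℤ`.
The letters are listed backwards from the last one: `letter j` is `a_{h - j}`. -/
@[ext]
structure BiWord (A : Type*) where
  height : ℤ
  letter : ℕ → A

namespace BiWord

variable {A : Type*}

/-- The last letter `end(u)`. -/
def last (u : BiWord A) : A := u.letter 0

/-- The parent of `u`: the last letter is erased. -/
def parent (u : BiWord A) : BiWord A := ⟨u.height - 1, fun j => u.letter (j + 1)⟩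

/-- The word `u ∗ (i)`. -/
def child (u : BiWord A) (i : A) : BiWord A :=
  ⟨u.height + 1, fun j => match j with
    | 0 => i
    | j + 1 => u.letter j⟩

/-- The concatenation `u ∗ w` of `u` with the finite word `w`. -/
def append (u : BiWord A) (w : List A) : BiWord A := w.foldl child u

/-- The truncation `u_{|l} = (a_k)_{k ≤ min(h, l)}`. -/
def trunc (u : BiWord A) (l : ℤ) : BiWord A :=
  ⟨min u.height l, fun j => u.letter (j + (u.height - l).toNat)⟩

/-- The shift `φ_l (u) = (a_{k + l})_{k ≤ h - l}`. -/
def shift (l : ℤ) (u : BiWord A) : BiWord A := ⟨u.height - l, u.letter⟩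

/-- The sigma-field of local convergence (product sigma-field). -/
instance [MeasurableSpace A] : MeasurableSpace (BiWord A) :=
  MeasurableSpace.comap (fun u => (u.height, u.letter)) inferInstance

/-- The strict lexicographical order between words that share an ancestor: either `u` is a strict
ancestor of `v`, or `u` and `v` branch after height `l` and `u` takes the smaller letter. -/
def LexLT (u v : BiWord ℕ) : Prop :=
  (u.height < v.height ∧ v.trunc u.height = u) ∨
    ∃ l : ℤ, l < u.height ∧ l < v.height ∧ u.trunc l = v.trunc l ∧
      (u.trunc (l + 1)).last < (v.trunc (l + 1)).last

open Classical in
/-- The `u`-parent of `v ≠ u`: the neighbour of `v` on the path from `v` to `u`. -/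
def parentToward (u v : BiWord A) : BiWord A :=
  if u.trunc v.height = v then u.trunc (v.height + 1) else v.parent

end BiWord

/-! ### Rooted ordered trees and Galton--Watson trees -/

/-- Rooted ordered trees, as sets of finite words on the alphabet `{1, 2, …}`. -/
structure IsRootedTree (t : Set (List ℕ)) : Prop where
  nil_mem : [] ∈ t
  parent_mem : ∀ w i, w ++ [i] ∈ t → w ∈ t
  children : ∀ w ∈ t, ∃ k : ℕ, ∀ i, w ++ [i] ∈ t ↔ 1 ≤ i ∧ i ≤ k

/-- `ν` is the law of a Galton--Watson tree with offspring distribution `μ`. The sigma-field on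
sets of words is generated by the events `{t | w ∈ t}`. -/
structure IsGWLaw (μ : PMF ℕ) (ν : Measure (Set (List ℕ))) : Prop where
  isProbabilityMeasure : IsProbabilityMeasure ν
  ae_tree : ∀ᵐ t ∂ν, IsRootedTree t
  offspring : ∀ k : ℕ, ν {t | {i | [i] ∈ t}.ncard = k} = μ k
  subtrees_indep : ∀ k : ℕ, 1 ≤ k → μ k ≠ 0 →
    iIndepFun (fun (i : Fin k) (t : Set (List ℕ)) => {w : List ℕ | ((i : ℕ) + 1) :: w ∈ t})
      (ProbabilityTheory.cond ν {t | {i | [i] ∈ t}.ncard = k})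
  subtrees_law : ∀ k : ℕ, 1 ≤ k → μ k ≠ 0 → ∀ i : Fin k,
    (ProbabilityTheory.cond ν {t | {i | [i] ∈ t}.ncard = k}).map
      (fun t => {w : List ℕ | ((i : ℕ) + 1) :: w ∈ t}) = ν

/-! ### Ordered trees with an infinite line of ancestors -/

/-- Ordered trees with an infinite line of ancestors (depth `-∞`). -/
structure IsOrderedTree (t : Set (BiWord ℕ)) : Prop where
  nonempty : t.Nonempty
  parent_mem : ∀ u ∈ t, u.parent ∈ t
  common : ∀ u ∈ t, ∀ v ∈ t, ∃ l : ℤ, u.trunc l = v.trunc l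
  children : ∀ u ∈ t, ∃ k : ℕ, ∀ i, u.child i ∈ t ↔ 1 ≤ i ∧ i ≤ k

/-- Pointed ordered trees `(t, ϱ)` with an infinite line of ancestors. -/
structure PTree where
  carrier : Set (BiWord ℕ)
  isTree : IsOrderedTree carrier
  pt : BiWord ℕ
  pt_mem : pt ∈ carrier

/-- Pointed `E`-labelled trees `(t, ϱ; (x_v)_{v ∈ t})` with an infinite line of ancestors. -/
structure LTree (E : Type*) extends PTree where
  label : carrier → E

namespace PTree

/-- The ancestor `ϱ(p)` of the distinguished point, `p` generations before it. -/
def spine (T : PTree) (p : ℕ) : BiWord ℕ := T.pt.trunc (T.pt.height - p)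

/-- The number of children `k_u(t)`. -/
def numChildren (T : PTree) (u : BiWord ℕ) : ℕ := {i | u.child i ∈ T.carrier}.ncard

/-- The subtree `θ_u t` stemming from `u`. -/
def subtree (T : PTree) (u : BiWord ℕ) : Set (List ℕ) := {w | u.append w ∈ T.carrier}

/-- The distinguished point as a vertex. -/
def root (T : PTree) : T.carrier := ⟨T.pt, T.pt_mem⟩

/-- The Borel sigma-field of local convergence. A pointed tree is encoded by `ϱ` and by the
subtrees stemming from its ancestors; each truncation at height `-q` below and `q` above is a
function of `ϱ` and one of these subtrees, and these truncations conversely determine the code. -/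
instance : MeasurableSpace PTree :=
  MeasurableSpace.comap (fun T => (T.pt, fun p : ℕ => T.subtree (T.spine p))) inferInstance

open Classical in
/-- The successor `scc(u)` of a vertex: the least vertex after `u` in the lexicographical order,
if there is one, and `u` otherwise. -/
def succ (T : PTree) (u : T.carrier) : T.carrier :=
  if h : ∃ v : T.carrier, BiWord.LexLT u v ∧
      ∀ w : T.carrier, BiWord.LexLT u w → v = w ∨ BiWord.LexLT v w
  then h.choose else u

/-- The vertices `v_0 = ϱ, v_1 = scc(v_0), v_2 = scc(v_1), …`. -/
def vertex (T : PTree) (n : ℕ) : T.carrier := T.succ^[n] T.root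

end PTree

namespace LTree

variable {E : Type*}

/-- The label (spatial position) of the distinguished point. -/
def rootLabel (T : LTree E) : E := T.label T.root

/-- The Borel sigma-field of local convergence on labelled trees: it is generated by the underlying
pointed tree and by the labels of the vertices `ϱ(p) ∗ w`, where these are vertices. -/
instance [MeasurableSpace E] : MeasurableSpace (LTree E) :=
  MeasurableSpace.comap LTree.toPTree inferInstance ⊔
    MeasurableSpace.generateFrom
      {S | ∃ (p : ℕ) (w : List ℕ) (B : Set E), MeasurableSet B ∧
        S = {T : LTree E | ∃ h : (T.spine p).append w ∈ T.carrier, T.label ⟨_, h⟩ ∈ B}}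

/-- The centering map for trees labelled by bilateral words: the tree is shifted so that `ϱ` gets
relative height `0`, and the labels so that the label of `ϱ` gets relative height `0`. -/
def cent {A : Type*} (T : LTree (BiWord A)) : LTree (BiWord A) where
  carrier := {w | w.shift (-T.pt.height) ∈ T.carrier}
  isTree := by
    have key : ∀ (l : ℤ) (u : BiWord ℕ), (u.shift l).shift (-l) = u := by
      intro l u
      simp [BiWord.shift]
    refine ⟨⟨T.pt.shift T.pt.height, ?_⟩, ?_, ?_, ?_⟩
    · show (T.pt.shift T.pt.height).shift (-T.pt.height) ∈ T.carrier
      rw [key]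
      exact T.pt_mem
    · intro u hu
      have h := T.isTree.parent_mem _ hu
      have e : (u.shift (-T.pt.height)).parent = u.parent.shift (-T.pt.height) := by
        simp only [BiWord.shift, BiWord.parent, BiWord.mk.injEq, and_true]
        ring
      rw [e] at h
      exact h
    · intro u hu v hv
      obtain ⟨l, hl⟩ := T.isTree.common _ hu _ hv
      refine ⟨l - T.pt.height, ?_⟩
      have e : ∀ u : BiWord ℕ, u.trunc (l - T.pt.height) =
          ((u.shift (-T.pt.height)).trunc l).shift T.pt.height := by
        intro u
        ext
        · simp only [BiWord.shift, BiWord.trunc]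
          omega
        · simp only [BiWord.shift, BiWord.trunc]
          congr 3
          omega
      rw [e u, e v, hl]
    · intro u hu
      obtain ⟨k, hk⟩ := T.isTree.children _ hu
      refine ⟨k, fun i => ?_⟩
      rw [← hk i]
      have e : (u.shift (-T.pt.height)).child i = (u.child i).shift (-T.pt.height) := by
        simp only [BiWord.shift, BiWord.child, BiWord.mk.injEq, and_true]
        ring
      rw [e]
      rfl
  pt := T.pt.shift T.pt.height
  pt_mem := by
    show (T.pt.shift T.pt.height).shift (-T.pt.height) ∈ T.carrier
    have : (T.pt.shift T.pt.height).shift (-T.pt.height) = T.pt := by simp [BiWord.shift]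
    rw [this]
    exact T.pt_mem
  label w := (T.label ⟨w.1.shift (-T.pt.height), w.2⟩).shift T.rootLabel.height

/-- The successor map: the distinguished point is moved to its successor, and the result is
centered. -/
def scc {A : Type*} (T : LTree (BiWord A)) : LTree (BiWord A) :=
  cent { T with
    pt := T.succ T.root
    pt_mem := (T.succ T.root).2 }

/-- `T'` is the right part of `T`: it is the ordered tree that is put in correspondence, by an
increasing map which preserves relative heights and labels, with the ancestors of `ϱ`, the
point `ϱ` itself, and the vertices after `ϱ` in the lexicographical order. -/
def IsRightPart (T T' : LTree E) : Prop :=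
  ∃ ψ : T'.carrier → T.carrier,
    Function.Injective ψ ∧
    (∀ v : T.carrier, v ∈ Set.range ψ ↔
      (∃ p : ℤ, p ≤ T.pt.height ∧ (v : BiWord ℕ) = T.pt.trunc p) ∨ BiWord.LexLT T.pt v) ∧
    ψ T'.root = T.root ∧
    (∀ u v : T'.carrier, BiWord.LexLT u v → BiWord.LexLT (ψ u) (ψ v)) ∧
    (∀ v : T'.carrier, (ψ v : BiWord ℕ).height = (v : BiWord ℕ).height) ∧
    ∀ v : T'.carrier, T'.label v = T.label (ψ v)

open Classical in
/-- The right part `[T]⁺` of a labelled pointed tree (it exists and is unique). -/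
def rightPart (T : LTree E) : LTree E :=
  if h : ∃ T', IsRightPart T T' then h.choose else T

/-- The right-successor map `scc⁺`. -/
def sccPlus {A : Type*} (T : LTree (BiWord A)) : LTree (BiWord A) := T.scc.rightPart

end LTree

/-! ### Infinite pointed Galton--Watson trees -/

/-- `τ` is an infinite pointed Galton--Watson tree with offspring distribution `μ` and dispatching
measure `r`. The conditional law of the subtrees grafted on the line of ancestors, given the
discrete sequence `S`, is expressed by conditioning on the values of `S_0, …, S_{m-1}`, for all `m`.
The subtree stemming from `ϱ` itself is one of these Galton--Watson trees (index `none`); the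
others stem from the children `ϱ(p+1) ∗ (i)` of `ϱ(p+1)` that differ from `ϱ(p)`. -/
structure IsInfPointedGW (μ : PMF ℕ) (r : ℕ × ℕ → ℝ≥0∞) {Ω : Type*} [MeasurableSpace Ω]
    (P : Measure Ω) (τ : Ω → PTree) : Prop where
  measurable : Measurable τ
  height_eq : ∀ᵐ ω ∂P, (τ ω).pt.height = 0
  spine_indep : iIndepFun
    (fun (p : ℕ) (ω : Ω) =>
      (((τ ω).spine p).last, (τ ω).numChildren ((τ ω).spine (p + 1)))) P
  spine_law : ∀ (p : ℕ) (s : ℕ × ℕ),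
    P {ω | (((τ ω).spine p).last, (τ ω).numChildren ((τ ω).spine (p + 1))) = s} = r s
  subtrees : ∃ ν : Measure (Set (List ℕ)), IsGWLaw μ ν ∧
    ∀ (m : ℕ) (s : ℕ → ℕ × ℕ),
      let C : Set Ω := {ω | ∀ p < m,
        (((τ ω).spine p).last, (τ ω).numChildren ((τ ω).spine (p + 1))) = s p}
      let f : Option {q : ℕ × ℕ // q.1 < m ∧ 1 ≤ q.2 ∧ q.2 ≤ (s q.1).2 ∧ q.2 ≠ (s q.1).1} →
          Ω → Set (List ℕ) := fun a ω => match a with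
        | none => (τ ω).subtree (τ ω).pt
        | some q => (τ ω).subtree (((τ ω).spine (q.1.1 + 1)).child q.1.2)
      P C ≠ 0 →
        iIndepFun f (ProbabilityTheory.cond P C) ∧
        ∀ a, (ProbabilityTheory.cond P C).map (f a) = ν

open Classical in
/-- The dispatching measure `r(j, k) = 1_{j = 1} m_μ⁻¹ ∑_{l ≥ k} μ(l)`, for `k ≥ j ≥ 1`. -/
def rightDispatch (μ : PMF ℕ) (s : ℕ × ℕ) : ℝ≥0∞ :=
  if s.1 = 1 ∧ 1 ≤ s.2 then
    (∑' l : ℕ, if s.2 ≤ l then μ l else 0) / (∑' l : ℕ, (l : ℝ≥0∞) * μ l)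
  else 0

/-- `τ` is the right part of an infinite pointed `GW(μ)`-tree (an `IPGW⁺(μ)`-tree). -/
def IsIPGWPlus (μ : PMF ℕ) {Ω : Type*} [MeasurableSpace Ω] (P : Measure Ω) (τ : Ω → PTree) :
    Prop :=
  IsInfPointedGW μ (rightDispatch μ) P τ

/-! ### Branching random walks with values in the `b`-ary tree -/

open Classical in
/-- The transition probabilities: `1/2` to the parent of `x`, and `1/(2b)` to each `x ∗ (i)`. -/
def stepProb {b : ℕ} (x y : BiWord (Fin b)) : ℝ≥0∞ :=
  (if y = x.parent then 2⁻¹ else 0) +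
    ∑ i : Fin b, if y = x.child i then (2 * (b : ℝ≥0∞))⁻¹ else 0

open Classical in
/-- `Q` is the law of the branching random walk indexed by the pointed tree `t` and started at the
deterministic position `o`, which is the position of the distinguished vertex `ϱ`. Its labels take
countably many values, and the joint law on each finite set `F` of vertices that contains `ϱ` and
all the `ϱ`-parents of its elements is the product of the transition probabilities. -/
def IsBRWLaw {b : ℕ} (o : BiWord (Fin b)) (t : PTree) (Q : Measure (LTree (BiWord (Fin b)))) :
    Prop :=
  ∃ m : Measure (t.carrier → BiWord (Fin b)),
    IsProbabilityMeasure m ∧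
    (∀ F : Finset (BiWord ℕ), (↑F : Set (BiWord ℕ)) ⊆ t.carrier → t.pt ∈ F →
      (∀ v ∈ F, v ≠ t.pt → BiWord.parentToward t.pt v ∈ F) →
      ∀ y : BiWord ℕ → BiWord (Fin b),
        m {x | ∀ v : t.carrier, (v : BiWord ℕ) ∈ F → x v = y v} =
          (if y t.pt = o then 1 else 0) *
            ∏ v ∈ F.erase t.pt, stepProb (y (BiWord.parentToward t.pt v)) (y v)) ∧
    Q = m.map (fun x => ({ t with label := x } : LTree (BiWord (Fin b))))

/-- `Θ` is a branching random walk with values in the `b`-ary tree with infinite past, indexed by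
an `IPGW⁺(μ)`-tree and started from a uniform random word `(U_k)_{k ≤ 0}` which is independent of
the tree: given the tree `τ` and the word `o`, its conditional law is that of `IsBRWLaw o τ`. -/
structure IsUniformBRW (μ : PMF ℕ) (b : ℕ) {Ω : Type*} [MeasurableSpace Ω] (P : Measure Ω)
    (Θ : Ω → LTree (BiWord (Fin b))) : Prop where
  measurable : Measurable Θ
  tree : IsIPGWPlus μ P (fun ω => (Θ ω).toPTree)
  origin_height : ∀ᵐ ω ∂P, (Θ ω).rootLabel.height = 0
  origin_indep : iIndepFun (fun (j : ℕ) (ω : Ω) => (Θ ω).rootLabel.letter j) P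
  origin_uniform : ∀ (j : ℕ) (i : Fin b), P {ω | (Θ ω).rootLabel.letter j = i} = (b : ℝ≥0∞)⁻¹
  origin_indep_tree : IndepFun (fun ω => (Θ ω).rootLabel) (fun ω => (Θ ω).toPTree) P
  cond_law : ∃ Q : Kernel (BiWord (Fin b) × PTree) (LTree (BiWord (Fin b))),
    (∀ o t, IsBRWLaw o t (Q (o, t))) ∧
    ∀ (C : Set (BiWord (Fin b) × PTree)) (D : Set (LTree (BiWord (Fin b)))),
      MeasurableSet C → MeasurableSet D →
      P {ω | ((Θ ω).rootLabel, (Θ ω).toPTree) ∈ C ∧ Θ ω ∈ D} =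
        ∫⁻ ω in {ω | ((Θ ω).rootLabel, (Θ ω).toPTree) ∈ C},
          Q ((Θ ω).rootLabel, (Θ ω).toPTree) D ∂P

end

/-! The right part of a tree is explored in lexicographical order, and all that this requires is
kept in a code: the body of the distinguished vertex (its number of children and the marks,
offspring number and step of the walk, of its descendants), the letters of its label, and along the
ancestral line the successive steps of the labels with the bodies on the right. Under `codeM` all
entries are independent; the body of the vertex has root law `μ`, those of its ancestors have the
tail law `ρ(r) = ∑_{l > r} μ(l)`. The successor becomes `next`: climb to the first non-empty body,
then go to its first child. The code of `Θ` has the law `codeM` up to `reset`, which erases the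
marks outside of the tree and commutes with `next`.

Invariance (`measurePreserving_next`) rests on the reversibility of the walk started from a uniform
word: a step leaves a uniform word, and the reversed step is independent of it and has the same law.
Let `G` be the probability that the successor falls in a given set when the search starts from an
ancestor, and `F r` the same probability from a vertex with `r + 1` children left. Then `G = ρ(0) G
+ ∑ ρ(r+1) F r`. Since `μ(0) + ρ(0) = 1`, the successor falls in the set with probability `μ(0) G +
∑ μ(r+1) F r = ∑ (ρ(r+1) + μ(r+1)) F r = ∑ ρ(r) F r`, which is its probability under `codeM`.

Range. The distinct labels are counted by the times whose label is not seen again, and by the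
ergodic theorem these have the escape probability as density (`ae_tendsto_range`). If `μ` is not the
Dirac mass at `1`, the grafted trees are almost surely finite, and crossing them shows that a set
invariant under `next` depends only on the ancestral line and is invariant under `climb`. The map
`climb` is ergodic: the reversed steps are i.i.d., and they determine the whole walk because the
walk goes arbitrarily far down, so that each letter is written by some reversed step. If `μ` is the
Dirac mass at `1`, the labels are those of the walk along a single line.

Positivity. A stationary process that comes back only finitely often to its starting point escapes
with positive probability: otherwise there would be no last visit (`measure_escape_pos`). By
criticality, the mean number of visits of `z` in a tree grafted at `x` is at most the Green
function, which is of order `2⁻ᵐ` when `x` is `m` levels below `z`. By time `p` the walk along the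
ancestral line has gone down by an amount of order `p^α`, for any `α < 1/2`; stopping it there, the
Green function at time `p` is in mean at most of order `exp(-c p^α)`. The moment condition bounds
the number of trees grafted on the `p`-th ancestor by `exp(p^{1/(1+β)})` for large `p`, and `1/(1+β)
< 1/2`, so the visits have a finite sum. -/

noncomputable section

/-! ### Bilateral words: extensions, ancestors, truncations, lexicographical order. -/

namespace BiWord

variable {A : Type*}

@[simp] theorem height_child (u : BiWord A) (i : A) : (u.child i).height = u.height + 1 := rfl

@[simp] theorem last_child (u : BiWord A) (i : A) : (u.child i).last = i := rfl

@[simp] theorem height_parent (u : BiWord A) : u.parent.height = u.height - 1 := rfl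

@[simp] theorem parent_child (u : BiWord A) (i : A) : (u.child i).parent = u := by
  ext <;> simp [child, parent]

@[simp] theorem child_parent_last (u : BiWord A) : u.parent.child u.last = u := by
  ext j
  · simp [child, parent]
  · cases j <;> rfl

theorem child_injective {u v : BiWord A} {i j : A} : u.child i = v.child j ↔ u = v ∧ i = j := by
  refine ⟨fun h => ⟨?_, ?_⟩, fun h => by rw [h.1, h.2]⟩
  · simpa using congrArg parent h
  · simpa using congrArg last h

@[simp] theorem append_nil (u : BiWord A) : u.append [] = u := rfl

@[simp] theorem append_cons (u : BiWord A) (i : A) (w : List A) :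
    u.append (i :: w) = (u.child i).append w := rfl

@[simp] theorem append_append (u : BiWord A) (w w' : List A) :
    u.append (w ++ w') = (u.append w).append w' := by
  simp [append, List.foldl_append]

theorem append_concat (u : BiWord A) (w : List A) (i : A) :
    u.append (w ++ [i]) = (u.append w).child i := by
  simp

@[simp] theorem height_append (u : BiWord A) (w : List A) :
    (u.append w).height = u.height + w.length := by
  induction w generalizing u with
  | nil => simp
  | cons i w ih => simp [ih]; ring

theorem parent_iterate_append (u : BiWord A) (w : List A) :
    parent^[w.length] (u.append w) = u := by
  induction w using List.reverseRecOn with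
  | nil => rfl
  | append_singleton w i ih =>
    rw [List.length_append, List.length_singleton, Function.iterate_succ_apply, append_concat,
      parent_child, ih]

@[simp] theorem height_parent_iterate (u : BiWord A) (n : ℕ) :
    (parent^[n] u).height = u.height - n := by
  induction n with
  | zero => simp
  | succ n ih => rw [Function.iterate_succ_apply', height_parent, ih]; push_cast; ring

theorem letter_parent_iterate (u : BiWord A) (n j : ℕ) :
    (parent^[n] u).letter j = u.letter (j + n) := by
  induction n generalizing j with
  | zero => simp
  | succ n ih =>
    rw [Function.iterate_succ_apply']
    show (parent^[n] u).letter (j + 1) = _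
    rw [ih]; congr 1; ring

theorem exists_eq_append (u : BiWord A) (n : ℕ) :
    ∃ w : List A, w.length = n ∧ u = (parent^[n] u).append w := by
  induction n with
  | zero => exact ⟨[], rfl, rfl⟩
  | succ n ih =>
    obtain ⟨w, hw, h⟩ := ih
    refine ⟨(parent^[n] u).last :: w, by simp [hw], ?_⟩
    rw [append_cons, Function.iterate_succ_apply', child_parent_last]
    exact h

theorem append_eq_append {u v : BiWord A} {w w' : List A} (hl : w.length = w'.length)
    (h : u.append w = v.append w') : u = v ∧ w = w' := by
  induction w using List.reverseRecOn generalizing w' with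
  | nil =>
    have : w' = [] := List.length_eq_zero_iff.1 hl.symm
    subst this
    exact ⟨h, rfl⟩
  | append_singleton w i ih =>
    rcases List.eq_nil_or_concat w' with rfl | ⟨w'', j, rfl⟩
    · simp at hl
    · rw [List.concat_eq_append] at hl h ⊢
      rw [append_concat, append_concat, child_injective] at h
      obtain ⟨h1, h2⟩ := ih (by simpa using hl) h.1
      exact ⟨h1, by rw [h2, h.2]⟩

theorem append_right_inj (u : BiWord A) {w w' : List A} : u.append w = u.append w' ↔ w = w' := by
  refine ⟨fun h => ?_, fun h => by rw [h]⟩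
  have hl : w.length = w'.length := by
    have := congrArg height h
    simpa using this
  exact (append_eq_append hl h).2

theorem trunc_eq_self (u : BiWord A) {l : ℤ} (h : u.height ≤ l) : u.trunc l = u := by
  ext j
  · simp [trunc, h]
  · simp only [trunc]
    rw [Int.toNat_of_nonpos (by omega)]
    rfl

theorem trunc_sub (u : BiWord A) (n : ℕ) : u.trunc (u.height - n) = parent^[n] u := by
  ext j
  · rw [height_parent_iterate]; simp [trunc]
  · rw [letter_parent_iterate]
    simp only [trunc]
    congr 2
    omega

theorem trunc_append (u : BiWord A) (w : List A) {l : ℤ} (hl : l ≤ u.height) :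
    (u.append w).trunc l = u.trunc l := by
  obtain ⟨n, rfl⟩ : ∃ n : ℕ, l = u.height - n := ⟨(u.height - l).toNat, by omega⟩
  have : u.height - n = (u.append w).height - ((n + w.length : ℕ) : ℤ) := by
    simp
  rw [trunc_sub]
  conv_lhs => rw [this]
  rw [trunc_sub, Function.iterate_add_apply, parent_iterate_append]

theorem trunc_append_take (u : BiWord A) (w : List A) (n : ℕ) :
    (u.append w).trunc (u.height + n) = u.append (w.take n) := by
  rcases le_or_gt w.length n with h | h
  · rw [List.take_of_length_le h, trunc_eq_self]
    simp; omega
  · conv_lhs => rw [← List.take_append_drop n w, append_append]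
    have hh : (u.append (w.take n)).height = u.height + n := by
      simp only [height_append, List.length_take]; omega
    rw [trunc_append _ _ hh.ge, trunc_eq_self _ hh.le]

/-- Any two vertices of a tree extend a common ancestor, so this reduces every comparison of
vertices to the lexicographical order of finite lists. -/
theorem lexLT_append_iff (a : BiWord ℕ) (w w' : List ℕ) :
    LexLT (a.append w) (a.append w') ↔ w < w' := by
  constructor
  · rintro (⟨h1, h2⟩ | ⟨l, h1, h2, h3, h4⟩)
    · rw [height_append] at h2
      rw [trunc_append_take, append_right_inj] at h2
      rw [height_append, height_append] at h1
      have : w' = w ++ w'.drop w.length := by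
        conv_lhs => rw [← List.take_append_drop w.length w']
        rw [h2]
      rw [this]
      have hne : w'.drop w.length ≠ [] := by
        intro h
        rw [List.drop_eq_nil_iff] at h
        omega
      obtain ⟨i, v, hv⟩ := List.exists_cons_of_ne_nil hne
      rw [hv]
      clear * -
      induction w with
      | nil => exact List.Lex.nil
      | cons j w ih => exact List.Lex.cons ih
    · rcases lt_or_ge l a.height with hl | hl
      · rw [trunc_append _ _ (by omega), trunc_append _ _ (by omega)] at h4
        exact absurd h4 (lt_irrefl _)
      · obtain ⟨n, rfl⟩ : ∃ n : ℕ, l = a.height + n := ⟨(l - a.height).toNat, by omega⟩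
        rw [trunc_append_take, trunc_append_take, append_right_inj] at h3
        have e : a.height + (n : ℤ) + 1 = a.height + ((n + 1 : ℕ) : ℤ) := by push_cast; ring
        rw [e, trunc_append_take, trunc_append_take] at h4
        simp only [height_append] at h1 h2
        have g1 : n < w.length := by omega
        have g2 : n < w'.length := by omega
        rw [List.take_succ_eq_append_getElem g1, List.take_succ_eq_append_getElem g2, append_concat,
          append_concat, last_child, last_child] at h4
        have e1 : w = w.take n ++ w[n] :: w.drop (n + 1) := by simp
        have e2 : w' = w.take n ++ w'[n] :: w'.drop (n + 1) := by rw [h3]; simp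
        rw [e1, e2]
        generalize w.take n = c
        induction c with
        | nil => exact List.Lex.rel h4
        | cons j c ih => exact List.Lex.cons ih
  · intro h
    induction h generalizing a with
    | @nil i v =>
      refine Or.inl ⟨by simp; omega, ?_⟩
      simpa using trunc_append_take a (i :: v) 0
    | @cons i v v' h ih => exact ih _
    | @rel i v j v' h =>
      refine Or.inr ⟨a.height, by simp; omega, by simp; omega, ?_, ?_⟩
      · rw [trunc_append _ _ le_rfl, trunc_append _ _ le_rfl]
      · have := trunc_append_take a (i :: v) 1
        have h2 := trunc_append_take a (j :: v') 1
        simp only [Nat.cast_one, List.take_succ_cons, List.take_zero, append_cons,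
          append_nil] at this h2
        simp only [append_cons]
        rw [this, h2]
        exact h

theorem parentToward_parent_iterate (u : BiWord A) (n : ℕ) :
    parentToward u (parent^[n + 1] u) = parent^[n] u := by
  have e : (parent^[n + 1] u).height = u.height - ((n + 1 : ℕ) : ℤ) := height_parent_iterate u _
  have e' : (parent^[n + 1] u).height + 1 = u.height - (n : ℤ) := by rw [e]; push_cast; ring
  rw [parentToward, if_pos (by rw [e, trunc_sub]), e', trunc_sub]

@[simp] theorem shift_shift (l k : ℤ) (u : BiWord A) : (u.shift l).shift k = u.shift (l + k) := by
  simp [shift]; ring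

@[simp] theorem shift_zero (u : BiWord A) : u.shift 0 = u := by
  simp [shift]

@[simp] theorem height_shift (l : ℤ) (u : BiWord A) : (u.shift l).height = u.height - l := rfl

theorem shift_injective (l : ℤ) : Function.Injective (shift l : BiWord A → BiWord A) := by
  intro u v h
  have := congrArg (shift (-l)) h
  simpa using this

theorem shift_parent (l : ℤ) (u : BiWord A) : u.parent.shift l = (u.shift l).parent := by
  simp [shift, parent]; ring

theorem shift_parent_iterate (l : ℤ) (u : BiWord A) (n : ℕ) :
    (parent^[n] u).shift l = parent^[n] (u.shift l) := by
  induction n generalizing u with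
  | zero => rfl
  | succ n ih => rw [Function.iterate_succ_apply, ih, shift_parent, Function.iterate_succ_apply]

end BiWord

/-! ### Pointed trees: the ancestral line, the total order on the vertices, successors. -/

namespace PTree

open BiWord

variable (T : PTree)

theorem spine_eq (p : ℕ) : T.spine p = parent^[p] T.pt := trunc_sub _ _

@[simp] theorem spine_zero : T.spine 0 = T.pt := T.spine_eq 0

theorem spine_succ (p : ℕ) : T.spine (p + 1) = (T.spine p).parent := by
  rw [spine_eq, spine_eq, Function.iterate_succ_apply']

theorem spine_eq_child (p : ℕ) : T.spine p = (T.spine (p + 1)).child (T.spine p).last := by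
  rw [spine_succ, child_parent_last]

@[simp] theorem height_spine (p : ℕ) : (T.spine p).height = T.pt.height - p := by
  rw [spine_eq, height_parent_iterate]

theorem parent_iterate_mem {u : BiWord ℕ} (hu : u ∈ T.carrier) (n : ℕ) :
    parent^[n] u ∈ T.carrier := by
  induction n with
  | zero => exact hu
  | succ n ih => rw [Function.iterate_succ_apply']; exact T.isTree.parent_mem _ ih

theorem spine_mem (p : ℕ) : T.spine p ∈ T.carrier := by
  rw [spine_eq]; exact T.parent_iterate_mem T.pt_mem p

variable {T}

theorem mem_of_append_mem {u : BiWord ℕ} {w : List ℕ} (h : u.append w ∈ T.carrier) :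
    u ∈ T.carrier := by
  have := T.parent_iterate_mem h w.length
  rwa [parent_iterate_append] at this

theorem child_mem_iff {u : BiWord ℕ} (hu : u ∈ T.carrier) (i : ℕ) :
    u.child i ∈ T.carrier ↔ 1 ≤ i ∧ i ≤ T.numChildren u := by
  obtain ⟨k, hk⟩ := T.isTree.children u hu
  have : {i | u.child i ∈ T.carrier} = Set.Icc 1 k := by
    ext i; exact hk i
  rw [hk, numChildren, this, ← Finset.coe_Icc, Set.ncard_coe_finset, Nat.card_Icc]
  simp

theorem exists_append_spine {u : BiWord ℕ} (hu : u ∈ T.carrier) :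
    ∃ p w, u = (T.spine p).append w := by
  obtain ⟨l, hl⟩ := T.isTree.common u hu T.pt T.pt_mem
  -- The common height `l` may exceed that of either word; `toNat` then gives `0` and the truncation
  -- does nothing.
  set p := (T.pt.height - l).toNat
  have h1 : T.pt.trunc l = T.spine p := by
    rcases le_or_gt l T.pt.height with h | h
    · rw [spine]; congr; omega
    · have : p = 0 := by omega
      rw [this, spine_zero, trunc_eq_self _ h.le]
  set n := (u.height - l).toNat
  have h2 : u.trunc l = parent^[n] u := by
    rcases le_or_gt l u.height with h | h
    · rw [← trunc_sub]; congr; omega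
    · have : n = 0 := by omega
      rw [this, trunc_eq_self _ h.le]
      rfl
  obtain ⟨w, -, hw⟩ := exists_eq_append u n
  exact ⟨p, w, by rw [← h1, ← hl, h2]; exact hw⟩

theorem exists_append_spine_add (T : PTree) (p n : ℕ) :
    ∃ w, T.spine p = (T.spine (p + n)).append w := by
  obtain ⟨w, -, hw⟩ := exists_eq_append (T.spine p) n
  refine ⟨w, ?_⟩
  rw [T.spine_eq (p + n), add_comm, Function.iterate_add_apply, ← spine_eq]
  exact hw

theorem exists_append_spine_ge {u : BiWord ℕ} (hu : u ∈ T.carrier) :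
    ∃ p, ∀ q ≥ p, ∃ w, u = (T.spine q).append w := by
  obtain ⟨p, w, rfl⟩ := exists_append_spine hu
  refine ⟨p, fun q hq => ?_⟩
  obtain ⟨n, rfl⟩ := Nat.exists_eq_add_of_le hq
  obtain ⟨w', hw'⟩ := T.exists_append_spine_add p n
  exact ⟨w' ++ w, by rw [append_append, ← hw']⟩

theorem exists_common_append {u v : BiWord ℕ} (hu : u ∈ T.carrier) (hv : v ∈ T.carrier) :
    ∃ (a : BiWord ℕ) (w w' : List ℕ), u = a.append w ∧ v = a.append w' := by
  obtain ⟨p, hp⟩ := exists_append_spine_ge hu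
  obtain ⟨q, hq⟩ := exists_append_spine_ge hv
  obtain ⟨w, hw⟩ := hp (max p q) (le_max_left _ _)
  obtain ⟨w', hw'⟩ := hq (max p q) (le_max_right _ _)
  exact ⟨_, w, w', hw, hw'⟩

theorem exists_common_append₃ {u v x : BiWord ℕ} (hu : u ∈ T.carrier) (hv : v ∈ T.carrier)
    (hx : x ∈ T.carrier) :
    ∃ (a : BiWord ℕ) (w w' w'' : List ℕ), u = a.append w ∧ v = a.append w' ∧ x = a.append w'' := by
  obtain ⟨p, hp⟩ := exists_append_spine_ge hu
  obtain ⟨q, hq⟩ := exists_append_spine_ge hv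
  obtain ⟨r, hr⟩ := exists_append_spine_ge hx
  obtain ⟨w, hw⟩ := hp (max (max p q) r) (by omega)
  obtain ⟨w', hw'⟩ := hq (max (max p q) r) (by omega)
  obtain ⟨w'', hw''⟩ := hr (max (max p q) r) (by omega)
  exact ⟨_, w, w', w'', hw, hw', hw''⟩

theorem lexLT_irrefl (u : BiWord ℕ) : ¬ LexLT u u := by
  have := lexLT_append_iff u [] []
  simp only [append_nil] at this
  rw [this]
  exact lt_irrefl _

theorem lexLT_trans {u v x : BiWord ℕ} (hu : u ∈ T.carrier) (hv : v ∈ T.carrier)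
    (hx : x ∈ T.carrier) (h1 : LexLT u v) (h2 : LexLT v x) : LexLT u x := by
  obtain ⟨a, w, w', w'', rfl, rfl, rfl⟩ := exists_common_append₃ hu hv hx
  rw [lexLT_append_iff] at *
  exact h1.trans h2

theorem lexLT_trichotomy {u v : BiWord ℕ} (hu : u ∈ T.carrier) (hv : v ∈ T.carrier) :
    LexLT u v ∨ u = v ∨ LexLT v u := by
  obtain ⟨a, w, w', rfl, rfl⟩ := exists_common_append hu hv
  rw [lexLT_append_iff, lexLT_append_iff, append_right_inj]
  exact lt_trichotomy w w'

theorem lexLT_child (u : BiWord ℕ) (i : ℕ) : LexLT u (u.child i) := by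
  have := (lexLT_append_iff u [] [i]).2 List.Lex.nil
  simpa using this

theorem lexLT_child_iff (u : BiWord ℕ) (i j : ℕ) : LexLT (u.child i) (u.child j) ↔ i < j := by
  have := lexLT_append_iff u [i] [j]
  rw [List.cons_lt_cons_iff] at this
  simpa using this

theorem lexLT_parent (u : BiWord ℕ) : LexLT u.parent u := by
  conv_rhs => rw [← child_parent_last u]
  exact lexLT_child _ _

/-- `v` is the successor of `u`. -/
def IsSucc (T : PTree) (u v : T.carrier) : Prop :=
  LexLT u v ∧ ∀ w : T.carrier, LexLT u w → v = w ∨ LexLT v w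

theorem succ_eq_of_isSucc {u v : T.carrier} (h : T.IsSucc u v) : T.succ u = v := by
  have hex : ∃ v : T.carrier, LexLT u v ∧ ∀ w : T.carrier, LexLT u w → v = w ∨ LexLT v w := ⟨v, h⟩
  rw [succ, dif_pos hex]
  have hc := hex.choose_spec
  rcases hc.2 v h.1 with h1 | h1
  · exact h1
  · rcases h.2 _ hc.1 with h2 | h2
    · exact h2.symm
    · exact absurd (lexLT_trans (T := T) hex.choose.2 v.2 hex.choose.2 h1 h2) (lexLT_irrefl _)

theorem isSucc_succ {u : T.carrier} (h : ∃ v, T.IsSucc u v) : T.IsSucc u (T.succ u) := by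
  obtain ⟨v, hv⟩ := h
  rwa [succ_eq_of_isSucc hv]

/-- The parent is the last vertex of its generation before a given vertex. -/
theorem eq_parent_or_lexLT {u v : BiWord ℕ} (hu : u ∈ T.carrier) (hv : v ∈ T.carrier)
    (h : LexLT u v) (hh : u.height = v.height - 1) : u = v.parent ∨ LexLT u v.parent := by
  rcases lexLT_trichotomy hu (T.isTree.parent_mem _ hv) with h1 | h1 | h1
  · exact Or.inr h1
  · exact Or.inl h1
  -- If the parent strictly preceded `u`, these two words of equal length would differ at some
  -- letter, and `u` would come after every extension of the parent, `v` included.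
  · exfalso
    obtain ⟨a, w, w', w'', rfl, h2, h3⟩ :=
      exists_common_append₃ hu hv (T.isTree.parent_mem _ hv)
    have e : w' = w'' ++ [v.last] := by
      rw [← append_right_inj a, append_concat, ← h3, ← h2, child_parent_last]
    have hl : w.length = w''.length := by
      rw [h2, e] at hh
      simp at hh
      omega
    rw [h3, lexLT_append_iff] at h1
    rw [h2, e, lexLT_append_iff] at h
    clear * - h h1 hl
    induction w generalizing w'' with
    | nil =>
      obtain rfl : w'' = [] := List.length_eq_zero_iff.1 hl.symm
      exact lt_irrefl _ h1
    | cons i w ih =>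
      cases w'' with
      | nil => simp at hl
      | cons j w'' =>
        simp only [List.cons_append, List.cons_lt_cons_iff] at h h1
        rcases h1 with h1 | ⟨rfl, h1⟩
        · rcases h with h | ⟨rfl, h⟩
          · omega
          · exact lt_irrefl _ h1
        · rcases h with h | ⟨-, h⟩
          · exact lt_irrefl _ h
          · exact ih _ h h1 (by simpa using hl)

end PTree

/-! ### How the identification of a right part with a subset of the tree acts on parents and
children. -/

/-- A strictly increasing map from `{1, …, k'}` onto `{ℓ + 1, …, k}` is a translation. -/
theorem strictMono_onto_interval {f : ℕ → ℕ} {k' l k : ℕ} (hlk : l ≤ k)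
    (h1 : ∀ i, 1 ≤ i → i ≤ k' → l < f i ∧ f i ≤ k)
    (h2 : ∀ i i', 1 ≤ i → i < i' → i' ≤ k' → f i < f i')
    (h3 : ∀ j, l < j → j ≤ k → ∃ i, 1 ≤ i ∧ i ≤ k' ∧ f i = j) :
    k' = k - l ∧ ∀ i, 1 ≤ i → i ≤ k' → f i = l + i := by
  have key : ∀ i, 1 ≤ i → i ≤ k' → f i = l + i := by
    intro i
    induction i using Nat.strong_induction_on with
    | _ i ih =>
      intro hi hi'
      have hlow : l + i ≤ f i := by
        rcases Nat.lt_or_ge 1 i with h | h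
        · have e := ih (i - 1) (by omega) (by omega) (by omega)
          have := h2 (i - 1) i (by omega) (by omega) hi'
          omega
        · have := h1 i hi hi'
          omega
      obtain ⟨i', ha, hb, hc⟩ := h3 (l + i) (by omega) (hlow.trans (h1 i hi hi').2)
      rcases lt_trichotomy i' i with h | h | h
      · have := ih i' h ha hb
        omega
      · rw [← h]; omega
      · have := h2 i i' hi h hb
        omega
  refine ⟨?_, key⟩
  rcases Nat.eq_zero_or_pos k' with h | h
  · rcases hlk.eq_or_lt with e | e
    · omega
    · obtain ⟨i, ha, hb, -⟩ := h3 (l + 1) (by omega) e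
      omega
  · have e1 := key k' h le_rfl
    have e2 := (h1 k' h le_rfl).2
    obtain ⟨i, ha, hb, hc⟩ := h3 k (by omega) le_rfl
    have := key i ha hb
    omega

namespace PTree

open BiWord

/-- `ψ` identifies `T'` with the part of `T` on the right of the vertex `r`. -/
structure RightMap (T : PTree) (r : BiWord ℕ) (T' : PTree) (ψ : T'.carrier → T.carrier) (h : ℤ) :
    Prop where
  mem : r ∈ T.carrier
  inj : Function.Injective ψ
  range : ∀ v : T.carrier, v ∈ Set.range ψ ↔
    (∃ n : ℕ, (v : BiWord ℕ) = parent^[n] r) ∨ LexLT r v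
  root : (ψ T'.root : BiWord ℕ) = r
  mono : ∀ u v : T'.carrier, LexLT u v → LexLT (ψ u) (ψ v)
  height : ∀ v : T'.carrier, (ψ v : BiWord ℕ).height = (v : BiWord ℕ).height + h

namespace RightMap

variable {T T' : PTree} {r : BiWord ℕ} {ψ : T'.carrier → T.carrier} {h : ℤ}

/-- The parent of a vertex of a tree. -/
abbrev par (v : T.carrier) : T.carrier := ⟨(v : BiWord ℕ).parent, T.isTree.parent_mem _ v.2⟩

theorem lexLT_iff (H : RightMap T r T' ψ h) (u v : T'.carrier) :
    LexLT (ψ u) (ψ v) ↔ LexLT u v := by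
  refine ⟨fun h => ?_, H.mono u v⟩
  rcases lexLT_trichotomy u.2 v.2 with h1 | h1 | h1
  · exact h1
  · rw [Subtype.ext h1] at h
    exact absurd h (lexLT_irrefl _)
  · exact absurd (lexLT_trans (ψ u).2 (ψ v).2 (ψ u).2 h (H.mono _ _ h1)) (lexLT_irrefl _)

theorem parent_mem_range (H : RightMap T r T' ψ h) {v : T.carrier} (hv : v ∈ Set.range ψ) :
    par v ∈ Set.range ψ := by
  rw [H.range] at hv ⊢
  rcases hv with ⟨n, hn⟩ | hv
  · exact Or.inl ⟨n + 1, by rw [Function.iterate_succ_apply', ← hn]⟩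
  · rcases lexLT_trichotomy H.mem (par v).2 with h1 | h1 | h1
    · exact Or.inr h1
    · exact Or.inl ⟨0, h1.symm⟩
    · left
      obtain ⟨a, w, w', h2, h3⟩ := exists_common_append H.mem (par v).2
      have e : (v : BiWord ℕ) = a.append (w' ++ [(v : BiWord ℕ).last]) := by
        rw [append_concat, ← h3, child_parent_last]
      rw [e, h2, lexLT_append_iff] at hv
      rw [h2, h3, lexLT_append_iff] at h1
      -- Only extensions of `w'` lie between `w'` and `w'` followed by one letter.
      have : ∃ w'', w = w' ++ w'' := by
        clear * - hv h1
        induction w' generalizing w with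
        | nil => exact ⟨w, rfl⟩
        | cons i w' ih =>
          cases w with
          | nil => cases h1
          | cons j w =>
            simp only [List.cons_append, List.cons_lt_cons_iff] at hv h1
            rcases h1 with h1 | ⟨rfl, h1⟩
            · omega
            · rcases hv with hv | ⟨-, hv⟩
              · omega
              · obtain ⟨w'', rfl⟩ := ih _ h1 hv
                exact ⟨w'', rfl⟩
      obtain ⟨w'', rfl⟩ := this
      refine ⟨w''.length, ?_⟩
      rw [h2, append_append, parent_iterate_append]
      exact h3

/-- Order and heights determine the parent: it is the last vertex of its generation before `v`
(`eq_parent_or_lexLT`), both in `T'` and, since the range contains the parents of its elements, in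
`T`. -/
theorem map_parent (H : RightMap T r T' ψ h) (v : T'.carrier) : ψ (par v) = par (ψ v) := by
  obtain ⟨u, hu⟩ := H.parent_mem_range ⟨v, rfl⟩
  have hu' : (ψ u : BiWord ℕ) = (ψ v : BiWord ℕ).parent := congrArg Subtype.val hu
  have h1 : LexLT u v := by
    rw [← H.lexLT_iff, hu']
    exact lexLT_parent _
  have h2 : (u : BiWord ℕ).height = (v : BiWord ℕ).height - 1 := by
    have a1 := H.height u
    have a2 := H.height v
    rw [hu', height_parent] at a1
    omega
  rcases eq_parent_or_lexLT u.2 v.2 h1 h2 with h3 | h3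
  · have : u = par v := Subtype.ext h3
    rw [← this, hu]
  · exfalso
    have h4 : LexLT (ψ u) (ψ (par v)) := H.mono _ _ h3
    have h5 : LexLT (ψ (par v)) (ψ v) := H.mono _ _ (lexLT_parent _)
    have h6 : (ψ (par v) : BiWord ℕ).height = (ψ v : BiWord ℕ).height - 1 := by
      have a1 := H.height (par v)
      have a2 := H.height v
      simp only [height_parent] at a1
      omega
    rcases eq_parent_or_lexLT (ψ (par v)).2 (ψ v).2 h5 h6 with h7 | h7
    · rw [h7, ← hu'] at h4
      exact lexLT_irrefl _ h4
    · rw [← hu'] at h7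
      exact lexLT_irrefl _ (lexLT_trans (ψ u).2 (ψ (par v)).2 (ψ u).2 h4 h7)

theorem map_spine (H : RightMap T r T' ψ h) (p : ℕ) :
    (ψ ⟨T'.spine p, T'.spine_mem p⟩ : BiWord ℕ) = parent^[p] r := by
  induction p with
  | zero =>
    have : (⟨T'.spine 0, T'.spine_mem 0⟩ : T'.carrier) = T'.root := Subtype.ext T'.spine_zero
    rw [this, H.root]
    rfl
  | succ p ih =>
    have : (⟨T'.spine (p + 1), T'.spine_mem (p + 1)⟩ : T'.carrier) =
        par ⟨T'.spine p, T'.spine_mem p⟩ := Subtype.ext (T'.spine_succ p)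
    rw [this, H.map_parent, Function.iterate_succ_apply', ← ih]

theorem lexLT_parent_iterate (u : BiWord ℕ) (n : ℕ) :
    LexLT (parent^[n + 1] u) u := by
  obtain ⟨w, hw, h⟩ := exists_eq_append u (n + 1)
  conv_rhs => rw [h]
  obtain ⟨i, w', rfl⟩ := List.exists_cons_of_length_eq_add_one hw
  exact (lexLT_append_iff _ [] _).2 List.Lex.nil

/-- A left sibling of an ancestor would be sent to a vertex of the same generation that precedes the
corresponding ancestor of `r`; such a vertex is neither an ancestor of `r` nor after `r`. -/
theorem spine_last (H : RightMap T r T' ψ h) (p : ℕ) : (T'.spine p).last = 1 := by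
  have hp := T'.spine_mem p
  rw [T'.spine_eq_child p, child_mem_iff (T'.spine_mem _)] at hp
  by_contra hne
  have hm : (T'.spine (p + 1)).child 1 ∈ T'.carrier := by
    rw [child_mem_iff (T'.spine_mem _)]
    omega
  have hlt : LexLT ((T'.spine (p + 1)).child 1) (T'.spine p) := by
    conv_rhs => rw [T'.spine_eq_child p]
    rw [lexLT_child_iff]
    omega
  have h1 := H.mono ⟨_, hm⟩ ⟨_, T'.spine_mem p⟩ hlt
  have hh := H.height ⟨_, hm⟩
  have hh' := H.height ⟨_, T'.spine_mem p⟩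
  rw [H.map_spine] at h1 hh'
  have hpm := T.parent_iterate_mem H.mem p
  rcases (H.range (ψ ⟨_, hm⟩)).1 ⟨_, rfl⟩ with ⟨n, hn⟩ | h2
  · have : n = p := by
      rw [hn] at hh
      simp only [height_parent_iterate, height_child, height_spine] at hh hh'
      omega
    rw [hn, this] at h1
    exact lexLT_irrefl _ h1
  · have h3 := lexLT_trans H.mem (ψ ⟨_, hm⟩).2 hpm h2 h1
    cases p with
    | zero => exact lexLT_irrefl _ h3
    | succ p =>
      exact lexLT_irrefl _ (lexLT_trans H.mem hpm H.mem h3 (lexLT_parent_iterate _ _))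

/-- The children of a vertex of the right part. -/
theorem map_children (H : RightMap T r T' ψ h) (v : T'.carrier) (l : ℕ)
    (hlk : l ≤ T.numChildren (ψ v))
    (hl : ∀ (j : ℕ) (hj : (ψ v : BiWord ℕ).child j ∈ T.carrier),
      (⟨_, hj⟩ : T.carrier) ∈ Set.range ψ ↔ l < j) :
    T'.numChildren v = T.numChildren (ψ v) - l ∧
    (∀ i, (v : BiWord ℕ).child (1 + i) ∈ T'.carrier ↔
      (ψ v : BiWord ℕ).child (l + 1 + i) ∈ T.carrier) ∧
    ∀ i (hi : (v : BiWord ℕ).child (1 + i) ∈ T'.carrier),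
      (ψ ⟨_, hi⟩ : BiWord ℕ) = (ψ v : BiWord ℕ).child (l + 1 + i) := by
  classical
  -- `f i` is the letter of the image of the `i`-th child. It increases from `{1, …, k'}` onto `{l +
  -- 1, …, k}`, hence is a translation.
  let f : ℕ → ℕ := fun i =>
    if hi : (v : BiWord ℕ).child i ∈ T'.carrier then (ψ ⟨_, hi⟩ : BiWord ℕ).last else 0
  have hf : ∀ i (hi : (v : BiWord ℕ).child i ∈ T'.carrier),
      (ψ ⟨_, hi⟩ : BiWord ℕ) = (ψ v : BiWord ℕ).child (f i) := by
    intro i hi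
    have h1 := H.map_parent ⟨_, hi⟩
    have h2 : (par ⟨_, hi⟩ : T'.carrier) = v := Subtype.ext (parent_child _ _)
    rw [h2] at h1
    have h3 : (ψ v : BiWord ℕ) = (ψ ⟨_, hi⟩ : BiWord ℕ).parent := congrArg Subtype.val h1
    simp only [f, dif_pos hi]
    rw [h3, child_parent_last]
  have hmem := child_mem_iff v.2
  have hmem' := child_mem_iff (ψ v).2
  obtain ⟨hk, hfi⟩ : T'.numChildren v = T.numChildren (ψ v) - l ∧
      ∀ i, 1 ≤ i → i ≤ T'.numChildren v → f i = l + i := by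
    refine strictMono_onto_interval hlk ?_ ?_ ?_
    · intro i h1 h2
      have hi := (hmem i).2 ⟨h1, h2⟩
      have hj : (ψ v : BiWord ℕ).child (f i) ∈ T.carrier := by
        rw [← hf i hi]; exact (ψ _).2
      refine ⟨(hl _ hj).1 ⟨⟨_, hi⟩, Subtype.ext (hf i hi)⟩, ((hmem' _).1 hj).2⟩
    · intro i i' h1 h2 h3
      have hi := (hmem i).2 ⟨h1, by omega⟩
      have hi' := (hmem i').2 ⟨by omega, h3⟩
      have := H.mono ⟨_, hi⟩ ⟨_, hi'⟩ ((lexLT_child_iff _ _ _).2 h2)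
      rwa [hf i hi, hf i' hi', lexLT_child_iff] at this
    · intro j h1 h2
      have hj := (hmem' j).2 ⟨by omega, h2⟩
      obtain ⟨u, hu⟩ := (hl j hj).2 h1
      have hu' := congrArg Subtype.val hu
      simp only at hu'
      have h3 : par u = v := by
        apply H.inj
        rw [H.map_parent]
        exact Subtype.ext (by show (ψ u : BiWord ℕ).parent = _; rw [hu', parent_child])
      have h4 : (v : BiWord ℕ).child (u : BiWord ℕ).last ∈ T'.carrier := by
        rw [← h3, child_parent_last]; exact u.2
      refine ⟨(u : BiWord ℕ).last, ((hmem _).1 h4).1, ((hmem _).1 h4).2, ?_⟩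
      have h5 : (⟨_, h4⟩ : T'.carrier) = u := Subtype.ext (by simp only [← h3, child_parent_last])
      simp only [f, dif_pos h4, h5, hu', last_child]
  refine ⟨hk, fun i => ?_, fun i hi => ?_⟩
  · rw [hmem, hmem']
    omega
  · rw [hf _ hi, hfi _ (by omega) ((hmem _).1 hi).2]
    congr 1
    omega

theorem map_children_of_ge (H : RightMap T r T' ψ h) (v : T'.carrier)
    (hv : (ψ v : BiWord ℕ) = r ∨ LexLT r (ψ v)) :
    T'.numChildren v = T.numChildren (ψ v) ∧
    (∀ i, (v : BiWord ℕ).child (1 + i) ∈ T'.carrier ↔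
      (ψ v : BiWord ℕ).child (1 + i) ∈ T.carrier) ∧
    ∀ i (hi : (v : BiWord ℕ).child (1 + i) ∈ T'.carrier),
      (ψ ⟨_, hi⟩ : BiWord ℕ) = (ψ v : BiWord ℕ).child (1 + i) := by
  have := H.map_children v 0 (Nat.zero_le _) (fun j hj => ?_)
  · simpa using this
  · rw [H.range]
    have h1 := ((child_mem_iff (ψ v).2 j).1 hj).1
    refine ⟨fun _ => h1, fun _ => Or.inr ?_⟩
    rcases hv with hv | hv
    · have := lexLT_child (ψ v : BiWord ℕ) j
      exact hv ▸ this
    · exact lexLT_trans H.mem (ψ v).2 hj hv (lexLT_child _ _)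

theorem append_mem_iff (H : RightMap T r T' ψ h) (v : T'.carrier)
    (hv : (ψ v : BiWord ℕ) = r ∨ LexLT r (ψ v)) (w : List ℕ) :
    ((v : BiWord ℕ).append w ∈ T'.carrier ↔ (ψ v : BiWord ℕ).append w ∈ T.carrier) ∧
    ∀ hw : (v : BiWord ℕ).append w ∈ T'.carrier,
      (ψ ⟨_, hw⟩ : BiWord ℕ) = (ψ v : BiWord ℕ).append w := by
  induction w generalizing v with
  | nil => exact ⟨by simp [v.2, (ψ v).2], fun _ => rfl⟩
  | cons i w ih =>
    simp only [append_cons]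
    obtain ⟨-, h1, h2⟩ := H.map_children_of_ge v hv
    rcases Nat.eq_zero_or_pos i with hi | hi
    · have n1 : (v : BiWord ℕ).child i ∉ T'.carrier := by
        rw [child_mem_iff v.2]; omega
      have n2 : (ψ v : BiWord ℕ).child i ∉ T.carrier := by
        rw [child_mem_iff (ψ v).2]; omega
      exact ⟨⟨fun h => absurd (mem_of_append_mem h) n1, fun h => absurd (mem_of_append_mem h) n2⟩,
        fun h => absurd (mem_of_append_mem h) n1⟩
    · obtain ⟨j, rfl⟩ := Nat.exists_eq_add_of_le hi
      by_cases hm : (v : BiWord ℕ).child (1 + j) ∈ T'.carrier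
      · have e := h2 j hm
        have := ih ⟨_, hm⟩ ?_
        · rwa [e] at this
        · right
          rw [e]
          have hm' := (h1 j).1 hm
          rcases hv with hv | hv
          · rw [hv]; exact lexLT_child _ _
          · exact lexLT_trans H.mem (ψ v).2 hm' hv (lexLT_child _ _)
      · exact ⟨⟨fun h => absurd (mem_of_append_mem h) hm,
          fun h => absurd (mem_of_append_mem h) (mt (h1 j).2 hm)⟩,
          fun h => absurd (mem_of_append_mem h) hm⟩

/-- The children of an ancestor of the distinguished point in the right part. -/
theorem map_children_spine (H : RightMap T r T' ψ h) (p : ℕ) :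
    T'.numChildren (T'.spine (p + 1)) =
      T.numChildren (parent^[p + 1] r) - ((parent^[p] r).last - 1) ∧
    (∀ i, (T'.spine (p + 1)).child (2 + i) ∈ T'.carrier ↔
      (parent^[p + 1] r).child ((parent^[p] r).last + 1 + i) ∈ T.carrier) ∧
    ∀ i (hi : (T'.spine (p + 1)).child (2 + i) ∈ T'.carrier),
      (ψ ⟨_, hi⟩ : BiWord ℕ) = (parent^[p + 1] r).child ((parent^[p] r).last + 1 + i) := by
  have e := H.map_spine (p + 1)
  have e1 : (parent^[p + 1] r).child (parent^[p] r).last = parent^[p] r := by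
    rw [Function.iterate_succ_apply', child_parent_last]
  have m1 := T.parent_iterate_mem H.mem (p + 1)
  have m0 := T.parent_iterate_mem H.mem p
  have m0' := m0
  rw [← e1, child_mem_iff m1] at m0'
  -- The children that are kept are the one on the line and those on its right, so the first `last -
  -- 1` children are lost. In `T'` the child on the line is the first one, and the others start at
  -- the letter `2`.
  have := H.map_children ⟨T'.spine (p + 1), T'.spine_mem _⟩ ((parent^[p] r).last - 1)
    (by rw [e]; omega) (fun j hj => ?_)
  · obtain ⟨h1, h2, h3⟩ := this
    rw [e] at h1
    refine ⟨h1, fun i => ?_, fun i hi => ?_⟩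
    · have h2' := h2 (1 + i)
      rw [e] at h2'
      have e2 : 1 + (1 + i) = 2 + i := by omega
      have e3 : (parent^[p] r).last - 1 + 1 + (1 + i) = (parent^[p] r).last + 1 + i := by omega
      rwa [e2, e3] at h2'
    · have e2 : 2 + i = 1 + (1 + i) := by omega
      have h3' := h3 (1 + i) (by rw [← e2]; exact hi)
      rw [e] at h3'
      have e3 : (parent^[p] r).last - 1 + 1 + (1 + i) = (parent^[p] r).last + 1 + i := by omega
      rw [e3] at h3'
      rw [← h3']
      refine congrArg (fun u => (ψ u : BiWord ℕ)) ?_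
      exact Subtype.ext (congrArg (T'.spine (p + 1)).child e2)
  · rw [H.range]
    simp only [e] at hj ⊢
    have hle : j < (parent^[p] r).last → LexLT ((parent^[p + 1] r).child j) (parent^[p] r) := by
      intro hlt
      rw [← lexLT_child_iff (parent^[p + 1] r), e1] at hlt
      exact hlt
    have hp : ∀ u ∈ T.carrier, LexLT u (parent^[p] r) → LexLT u r := by
      intro u hu hlt
      cases p with
      | zero => exact hlt
      | succ p => exact lexLT_trans hu m0 H.mem hlt (lexLT_parent_iterate _ _)
    constructor
    · intro hor
      by_contra hlt
      have h5 := hle (by omega)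
      rcases hor with ⟨n, hn⟩ | hr
      · have : n = p := by
          have := congrArg BiWord.height hn
          simp only [height_child, height_parent_iterate] at this
          push_cast at this
          omega
        rw [hn, this] at h5
        exact lexLT_irrefl _ h5
      · exact lexLT_irrefl _ (lexLT_trans H.mem hj H.mem hr (hp _ hj h5))
    · intro hlt
      rcases Nat.lt_or_ge (parent^[p] r).last j with h6 | h6
      · right
        obtain ⟨w, -, hw⟩ := exists_eq_append r p
        conv_lhs => rw [hw, ← e1]
        have := (lexLT_append_iff (parent^[p + 1] r) ((parent^[p] r).last :: w) [j]).2
          (List.Lex.rel h6)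
        simpa only [append_cons, append_nil] using this
      · left
        refine ⟨p, ?_⟩
        have : j = (parent^[p] r).last := by omega
        rw [this, e1]

/-- The successor commutes with the identification of the right part. -/
theorem map_isSucc (H : RightMap T r T' ψ h) {v : T'.carrier}
    (hv : (ψ v : BiWord ℕ) = r ∨ LexLT r (ψ v)) {s : T.carrier} (hs : T.IsSucc (ψ v) s) :
    ∃ s', ψ s' = s ∧ T'.IsSucc v s' := by
  have h1 : s ∈ Set.range ψ := by
    rw [H.range]
    right
    rcases hv with hv | hv
    · rw [← hv]; exact hs.1
    · exact lexLT_trans H.mem (ψ v).2 s.2 hv hs.1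
  obtain ⟨s', rfl⟩ := h1
  refine ⟨s', rfl, (H.lexLT_iff _ _).1 hs.1, fun w hw => ?_⟩
  rcases hs.2 (ψ w) (H.mono _ _ hw) with h2 | h2
  · exact Or.inl (H.inj h2)
  · exact Or.inr ((H.lexLT_iff _ _).1 h2)

end RightMap

end PTree

/-! ### Existence of the right part when all ancestral letters but the last are `1`. -/

theorem List.append_lt_iff_of_not_extends {w w' v : List ℕ}
    (h : ¬ ∃ i v', w' = w ++ i :: v') (hv : v ≠ []) :
    (w ++ v < w' ↔ w < w') ∧ (w' < w ++ v ↔ w' = w ∨ w' < w) := by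
  induction w generalizing w' with
  | nil =>
    cases w' with
    | nil =>
      obtain ⟨i, v', rfl⟩ := List.exists_cons_of_ne_nil hv
      simp
    | cons i w' => exact absurd ⟨i, w', rfl⟩ h
  | cons j w ih =>
    cases w' with
    | nil => simp
    | cons i w' =>
      by_cases hij : i = j
      · subst hij
        have := @ih w' (by
          rintro ⟨i', v', rfl⟩
          exact h ⟨i', v', rfl⟩)
        simp only [List.cons_append, List.cons_lt_cons_iff, this.1, this.2, List.cons.injEq]
        tauto
      · simp only [List.cons_append, List.cons_lt_cons_iff, List.cons.injEq, hij, Ne.symm hij,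
          false_and, or_false, and_self, false_or]

namespace BiWord

theorem trunc_trunc {A : Type*} (u : BiWord A) {l k : ℤ} (h : k ≤ l) :
    (u.trunc l).trunc k = u.trunc k := by
  ext j
  · simp only [trunc]; omega
  · simp only [trunc]
    congr 1
    omega

/-- `v` is a strict descendant of `a`. -/
def Above (a v : BiWord ℕ) : Prop := ∃ i w, v = a.append (i :: w)

theorem Above.height_lt {a v : BiWord ℕ} (h : Above a v) : a.height < v.height := by
  obtain ⟨i, w, rfl⟩ := h
  simp only [height_append, List.length_cons]
  omega

theorem not_above_self (a : BiWord ℕ) : ¬ Above a a := fun h => lt_irrefl _ h.height_lt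

open Classical in
/-- Translation by `d` of the children of `a`. -/
def bump (a : BiWord ℕ) (d : ℕ) (v : BiWord ℕ) : BiWord ℕ :=
  if h : Above a v then a.append ((h.choose + d) :: h.choose_spec.choose) else v

theorem bump_append (a : BiWord ℕ) (d i : ℕ) (w : List ℕ) :
    bump a d (a.append (i :: w)) = a.append ((i + d) :: w) := by
  have h : Above a (a.append (i :: w)) := ⟨i, w, rfl⟩
  have e := h.choose_spec.choose_spec
  rw [append_right_inj, List.cons.injEq] at e
  rw [bump, dif_pos h, ← e.2, ← e.1]

theorem bump_of_not_above {a v : BiWord ℕ} (d : ℕ) (h : ¬ Above a v) : bump a d v = v := by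
  rw [bump, dif_neg h]

theorem bump_self (a : BiWord ℕ) (d : ℕ) : bump a d a = a := bump_of_not_above d (not_above_self a)

theorem above_bump_iff (a : BiWord ℕ) (d : ℕ) (v : BiWord ℕ) : Above a (bump a d v) ↔ Above a v := by
  by_cases h : Above a v
  · obtain ⟨i, w, rfl⟩ := h
    rw [bump_append]
    exact ⟨fun _ => ⟨_, _, rfl⟩, fun _ => ⟨_, _, rfl⟩⟩
  · rw [bump_of_not_above d h]

theorem bump_injective (a : BiWord ℕ) (d : ℕ) : Function.Injective (bump a d) := by
  intro u v h
  by_cases hu : Above a u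
  · have hv : Above a v := by rwa [← above_bump_iff a d, ← h, above_bump_iff]
    obtain ⟨i, w, rfl⟩ := hu
    obtain ⟨i', w', rfl⟩ := hv
    rw [bump_append, bump_append, append_right_inj, List.cons.injEq] at h
    rw [h.2, Nat.add_right_cancel h.1]
  · have hv : ¬ Above a v := by rwa [← above_bump_iff a d, ← h, above_bump_iff]
    rwa [bump_of_not_above d hu, bump_of_not_above d hv] at h

@[simp] theorem height_bump (a : BiWord ℕ) (d : ℕ) (v : BiWord ℕ) :
    (bump a d v).height = v.height := by
  by_cases h : Above a v
  · obtain ⟨i, w, rfl⟩ := h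
    rw [bump_append]
    simp only [height_append, List.length_cons]
  · rw [bump_of_not_above d h]

theorem bump_child (a : BiWord ℕ) (d : ℕ) {v : BiWord ℕ} (hv : v ≠ a) (i : ℕ) :
    bump a d (v.child i) = (bump a d v).child i := by
  by_cases h : Above a v
  · obtain ⟨k, w, rfl⟩ := h
    rw [bump_append, ← append_concat, ← append_concat]
    exact bump_append a d k (w ++ [i])
  · rw [bump_of_not_above d h, bump_of_not_above]
    rintro ⟨k, w, e⟩
    rcases List.eq_nil_or_concat w with rfl | ⟨w, j, rfl⟩
    · exact hv (child_injective.1 e).1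
    · rw [List.concat_eq_append, ← List.cons_append, append_concat, child_injective] at e
      exact h ⟨_, _, e.1⟩

theorem bump_child_self (a : BiWord ℕ) (d : ℕ) (i : ℕ) :
    bump a d (a.child i) = a.child (i + d) := bump_append a d i []

theorem bump_parent (a : BiWord ℕ) (d : ℕ) (v : BiWord ℕ) :
    bump a d v.parent = (bump a d v).parent := by
  conv_rhs => rw [← child_parent_last v]
  by_cases h : v.parent = a
  · rw [h, bump_child_self, parent_child, bump_self]
  · rw [bump_child a d h, parent_child]

theorem trunc_bump (a : BiWord ℕ) (d : ℕ) (v : BiWord ℕ) {l : ℤ} (hl : l ≤ a.height) :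
    (bump a d v).trunc l = v.trunc l := by
  by_cases h : Above a v
  · obtain ⟨i, w, rfl⟩ := h
    rw [bump_append, trunc_append _ _ hl, trunc_append _ _ hl]
  · rw [bump_of_not_above d h]

/-- The letters that follow `a` play no part in the comparison with a word that does not extend `a`.
Renumbering the children of `a` therefore keeps the order. -/
theorem lexLT_append_left_iff {a v c : BiWord ℕ} {α γ w : List ℕ} (ha : a = c.append α)
    (hv : v = c.append γ) (h : ¬ Above a v) (hw : w ≠ []) :
    (LexLT (a.append w) v ↔ LexLT a v) ∧ (LexLT v (a.append w) ↔ v = a ∨ LexLT v a) := by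
  subst ha hv
  rw [← append_append, lexLT_append_iff, lexLT_append_iff, lexLT_append_iff, lexLT_append_iff,
    append_right_inj]
  refine List.append_lt_iff_of_not_extends ?_ hw
  rintro ⟨i, v', rfl⟩
  exact h ⟨i, v', by rw [append_append]⟩

end BiWord

namespace LTree

open BiWord PTree

variable {E : Type*}

/-- The ancestors of the distinguished point, itself, and the vertices after it. -/
def rightSet (z : PTree) : Set (BiWord ℕ) :=
  {v | v ∈ z.carrier ∧ ((∃ n, v = z.spine n) ∨ LexLT z.pt v)}

theorem parent_mem_rightSet {z : PTree} {v : BiWord ℕ} (hv : v ∈ rightSet z) :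
    v.parent ∈ rightSet z := by
  refine ⟨z.isTree.parent_mem _ hv.1, ?_⟩
  rcases hv.2 with ⟨n, rfl⟩ | hlt
  · exact Or.inl ⟨n + 1, by rw [spine_succ]⟩
  · rcases lexLT_trichotomy z.pt_mem (z.isTree.parent_mem _ hv.1) with h1 | h1 | h1
    · exact Or.inr h1
    · exact Or.inl ⟨0, by rw [spine_zero, h1]⟩
    · left
      obtain ⟨c, α, γ, e1, e2⟩ := exists_common_append z.pt_mem (z.isTree.parent_mem _ hv.1)
      by_contra hne
      have hna : ¬ Above v.parent z.pt := by
        rintro ⟨i, w, e⟩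
        refine hne ⟨(i :: w).length, ?_⟩
        rw [spine_eq, e, parent_iterate_append]
      have := (lexLT_append_left_iff e2 e1 hna (w := [v.last]) (by simp)).2
      rw [append_cons, child_parent_last, append_nil] at this
      rcases this.1 hlt with h2 | h2
      · rw [← h2] at h1
        exact lexLT_irrefl _ h1
      · exact lexLT_irrefl _ (lexLT_trans z.pt_mem (z.isTree.parent_mem _ hv.1) z.pt_mem h2 h1)

section
variable {z : PTree} (hz : ∀ n, (z.spine (n + 1)).last = 1)

theorem one_le_last_pt (z : PTree) : 1 ≤ z.pt.last := by
  have := z.spine_mem 0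
  rw [z.spine_eq_child 0, child_mem_iff (z.spine_mem _)] at this
  simpa using this.1

theorem pt_eq_child (z : PTree) : (z.spine 1).child z.pt.last = z.pt := by
  have := z.spine_eq_child 0
  rw [spine_zero] at this
  exact this.symm

theorem append_mem_rightSet {i : ℕ} {w : List ℕ} (h : (z.spine 1).append (i :: w) ∈ rightSet z) :
    z.pt.last ≤ i := by
  rcases h.2 with ⟨n, hn⟩ | hlt
  · have := congrArg BiWord.height hn
    simp only [height_append, height_spine, List.length_cons] at this
    have hn0 : n = 0 ∧ w = [] := by
      constructor
      · omega
      · rw [← List.length_eq_zero_iff]; push_cast at this; omega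
    obtain ⟨rfl, rfl⟩ := hn0
    rw [spine_zero] at hn
    conv_rhs at hn => rw [← pt_eq_child z]
    exact (child_injective.1 hn).2.ge
  · have := lexLT_append_iff (z.spine 1) [z.pt.last] (i :: w)
    rw [append_cons, append_nil, pt_eq_child] at this
    rw [this, List.cons_lt_cons_iff] at hlt
    omega

theorem child_mem_rightSet {i : ℕ} :
    (z.spine 1).child i ∈ rightSet z ↔ (z.spine 1).child i ∈ z.carrier ∧ z.pt.last ≤ i := by
  refine ⟨fun h => ⟨h.1, append_mem_rightSet (w := []) h⟩, fun h => ⟨h.1, ?_⟩⟩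
  rcases h.2.eq_or_lt with h2 | h2
  · exact Or.inl ⟨0, by rw [← h2, pt_eq_child, spine_zero]⟩
  · right
    rw [← lexLT_child_iff (z.spine 1), pt_eq_child] at h2
    exact h2

-- From `ϱ(1)` on, the ancestral letters are `1`: the ancestors beyond `ϱ(1)` have no child before
-- the line, so that only `ϱ(1)` loses children.
include hz in
theorem child_mem_rightSet_of_ne {u : BiWord ℕ} (hu : u ∈ rightSet z) (hne : u ≠ z.spine 1)
    (i : ℕ) : u.child i ∈ rightSet z ↔ u.child i ∈ z.carrier := by
  refine ⟨fun h => h.1, fun h => ⟨h, ?_⟩⟩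
  rcases hu.2 with ⟨n, rfl⟩ | hlt
  · cases n with
    | zero => exact Or.inr (by rw [spine_zero]; exact lexLT_child _ _)
    | succ n =>
      have e := z.spine_eq_child n
      have hn : n ≠ 0 := by rintro rfl; exact hne rfl
      obtain ⟨m, rfl⟩ := Nat.exists_eq_succ_of_ne_zero hn
      rw [Nat.succ_eq_add_one] at *
      rw [hz] at e
      have h1 := ((child_mem_iff hu.1 i).1 h).1
      rcases h1.eq_or_lt with h2 | h2
      · exact Or.inl ⟨m + 1, by rw [e, h2]⟩
      · right
        obtain ⟨w, hw⟩ := z.exists_append_spine_add 0 (m + 1)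
        rw [zero_add, spine_zero] at hw
        rw [e, ← append_cons] at hw
        conv_lhs => rw [hw]
        exact (lexLT_append_iff (z.spine (m + 1 + 1)) (1 :: w) [i]).2 (List.Lex.rel h2)
  · exact Or.inr (lexLT_trans z.pt_mem hu.1 h hlt (lexLT_child _ _))

end

/-- The right part of a tree all of whose ancestral letters but the last one are equal to `1`. -/
def rightTree (z : LTree E) (hz : ∀ n, (z.spine (n + 1)).last = 1) : LTree E where
  -- Only the children of `ϱ(1)` are renumbered: `ϱ` becomes the first one, and the new letter `i`
  -- stands for the old letter `i + z.pt.last - 1`.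
  carrier := {v | bump (z.spine 1) (z.pt.last - 1) v ∈ rightSet z.toPTree}
  pt := (z.spine 1).child 1
  pt_mem := by
    have := one_le_last_pt z.toPTree
    show bump (z.spine 1) (z.pt.last - 1) _ ∈ rightSet z.toPTree
    rw [bump_child_self, show 1 + (z.pt.last - 1) = z.pt.last by omega, pt_eq_child]
    exact ⟨z.pt_mem, Or.inl ⟨0, by rw [spine_zero]⟩⟩
  isTree := by
    have hl := one_le_last_pt z.toPTree
    refine ⟨⟨(z.spine 1), ?_⟩, fun u hu => ?_, fun u hu v hv => ?_, fun u hu => ?_⟩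
    · show bump (z.spine 1) (z.pt.last - 1) _ ∈ rightSet z.toPTree
      rw [bump_self]
      exact ⟨z.spine_mem 1, Or.inl ⟨1, rfl⟩⟩
    · show bump (z.spine 1) (z.pt.last - 1) _ ∈ rightSet z.toPTree
      rw [bump_parent]
      exact parent_mem_rightSet hu
    · obtain ⟨l, hl⟩ := z.isTree.common _ hu.1 _ hv.1
      refine ⟨min l (z.spine 1).height, ?_⟩
      rw [← trunc_bump (z.spine 1) (z.pt.last - 1) u (min_le_right _ _),
        ← trunc_bump (z.spine 1) (z.pt.last - 1) v (min_le_right _ _),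
        ← trunc_trunc _ (min_le_left l _), hl, trunc_trunc _ (min_le_left l _)]
    · by_cases hne : u = z.spine 1
      · subst hne
        refine ⟨z.numChildren (z.spine 1) - (z.pt.last - 1), fun i => ?_⟩
        show bump (z.spine 1) (z.pt.last - 1) _ ∈ rightSet z.toPTree ↔ _
        rw [bump_child_self, child_mem_rightSet, child_mem_iff (z.spine_mem 1)]
        omega
      · refine ⟨z.numChildren (bump (z.spine 1) (z.pt.last - 1) u), fun i => ?_⟩
        show bump (z.spine 1) (z.pt.last - 1) _ ∈ rightSet z.toPTree ↔ _
        rw [bump_child _ _ hne, child_mem_rightSet_of_ne hz hu, child_mem_iff hu.1]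
        intro h
        have h' : bump (z.spine 1) (z.pt.last - 1) u =
          bump (z.spine 1) (z.pt.last - 1) (z.spine 1) := by rw [h, bump_self]
        exact hne (bump_injective _ _ h')
  label v := z.label ⟨bump (z.spine 1) (z.pt.last - 1) v, v.2.1⟩

theorem bump_lexLT {z : PTree} {d : ℕ} {u v : BiWord ℕ} (hu : bump (z.spine 1) d u ∈ z.carrier)
    (hv : bump (z.spine 1) d v ∈ z.carrier) (h : LexLT u v) :
    LexLT (bump (z.spine 1) d u) (bump (z.spine 1) d v) := by
  by_cases h1 : Above (z.spine 1) u
  · obtain ⟨i, w, rfl⟩ := h1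
    by_cases h2 : Above (z.spine 1) v
    · obtain ⟨i', w', rfl⟩ := h2
      rw [bump_append, bump_append, lexLT_append_iff] at *
      rw [List.cons_lt_cons_iff] at *
      rcases h with h | ⟨h, h'⟩
      · exact Or.inl (by omega)
      · exact Or.inr ⟨by omega, h'⟩
    · rw [bump_of_not_above d h2] at hv ⊢
      rw [bump_append] at hu ⊢
      obtain ⟨c, α, γ, e1, e2⟩ := exists_common_append (z.spine_mem 1) hv
      rw [(lexLT_append_left_iff e1 e2 h2 (by simp)).1] at h ⊢
      exact h
  · rw [bump_of_not_above d h1] at hu ⊢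
    by_cases h2 : Above (z.spine 1) v
    · obtain ⟨i', w', rfl⟩ := h2
      obtain ⟨c, α, γ, e1, e2⟩ := exists_common_append (z.spine_mem 1) hu
      rw [bump_append, (lexLT_append_left_iff e1 e2 h1 (by simp)).2] at *
      exact h
    · rwa [bump_of_not_above d h2]

theorem isRightPart_rightTree (z : LTree E) (hz : ∀ n, (z.spine (n + 1)).last = 1) :
    IsRightPart z (rightTree z hz) := by
  have hl := one_le_last_pt z.toPTree
  refine ⟨fun v => ⟨bump (z.spine 1) (z.pt.last - 1) v, v.2.1⟩, ?_, ?_, ?_, ?_, ?_, ?_⟩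
  · intro u v h
    exact Subtype.ext (bump_injective _ _ (congrArg Subtype.val h))
  · intro v
    have hanc : (∃ p : ℤ, p ≤ z.pt.height ∧ (v : BiWord ℕ) = z.pt.trunc p) ↔
        ∃ n, (v : BiWord ℕ) = z.spine n := by
      constructor
      · rintro ⟨p, hp, e⟩
        refine ⟨(z.pt.height - p).toNat, ?_⟩
        rw [e, PTree.spine]
        congr
        omega
      · rintro ⟨n, e⟩
        exact ⟨_, by omega, e⟩
    rw [hanc]
    constructor
    · rintro ⟨u, rfl⟩
      exact u.2.2
    · intro h
      have hv : (v : BiWord ℕ) ∈ rightSet z.toPTree := ⟨v.2, h⟩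
      have hex : ∃ u, bump (z.spine 1) (z.pt.last - 1) u = v := by
        by_cases ha : Above (z.spine 1) v
        · obtain ⟨i, w, e⟩ := ha
          rw [e] at hv
          have := append_mem_rightSet hv
          refine ⟨(z.spine 1).append ((i - (z.pt.last - 1)) :: w), ?_⟩
          rw [bump_append, e]
          congr 2
          omega
        · exact ⟨v, bump_of_not_above _ ha⟩
      obtain ⟨u, hu⟩ := hex
      exact ⟨⟨u, by show bump _ _ u ∈ rightSet z.toPTree; rwa [hu]⟩, Subtype.ext hu⟩
  · refine Subtype.ext ?_
    show bump (z.spine 1) (z.pt.last - 1) ((z.spine 1).child 1) = z.pt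
    rw [bump_child_self, show 1 + (z.pt.last - 1) = z.pt.last by omega, pt_eq_child]
  · intro u v h
    exact bump_lexLT u.2.1 v.2.1 h
  · intro v
    exact height_bump _ _ _
  · intro v
    rfl

theorem isRightPart_rightPart (z : LTree E) (hz : ∀ n, (z.spine (n + 1)).last = 1) :
    IsRightPart z z.rightPart := by
  have h : ∃ T', IsRightPart z T' := ⟨_, isRightPart_rightTree z hz⟩
  rw [rightPart, dif_pos h]
  exact h.choose_spec

/-- The right-successor of a tree, as a part of that tree. -/
theorem exists_rightMap_sccPlus {A : Type*} (x : LTree (BiWord A))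
    (hx : ∀ n, (parent^[n + 1] (x.succ x.root : BiWord ℕ)).last = 1) :
    ∃ ψ : x.sccPlus.carrier → x.carrier,
      PTree.RightMap x.toPTree (x.succ x.root) x.sccPlus.toPTree ψ
        (x.succ x.root : BiWord ℕ).height ∧
      x.sccPlus.pt.height = 0 ∧
      ∀ v, x.sccPlus.label v = (x.label (ψ v)).shift (x.label (x.succ x.root)).height := by
  set s := x.succ x.root
  have hpt : x.scc.pt = (s : BiWord ℕ).shift (s : BiWord ℕ).height := rfl
  have hz : ∀ n, (x.scc.spine (n + 1)).last = 1 := by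
    intro n
    rw [spine_eq, hpt, ← shift_parent_iterate]
    exact hx n
  obtain ⟨ψ, h1, h2, h3, h4, h5, h6⟩ : IsRightPart x.scc x.sccPlus :=
    isRightPart_rightPart x.scc hz
  have hlex : ∀ (k : ℤ) (u v : BiWord ℕ), LexLT u v → LexLT (u.shift k) (v.shift k) := by
    intro k u v h
    have ht : ∀ (u : BiWord ℕ) (l : ℤ), (u.shift k).trunc (l - k) = (u.trunc l).shift k := by
      intro u l
      ext j
      · simp only [trunc, shift]; omega
      · simp only [trunc, shift]; congr 2; omega
    rcases h with ⟨ha, hb⟩ | ⟨l, ha, hb, hc, hd⟩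
    · exact Or.inl ⟨by simpa using ha, by rw [height_shift, ht, hb]⟩
    · refine Or.inr ⟨l - k, by simpa using ha, by simpa using hb, by rw [ht, ht, hc], ?_⟩
      rw [show l - k + 1 = (l + 1) - k by ring, ht, ht]
      exact hd
  have hback : ∀ u : BiWord ℕ, (u.shift (-(s : BiWord ℕ).height)).shift (s : BiWord ℕ).height = u :=
    fun u => by simp
  have hforth : ∀ u : BiWord ℕ,
      (u.shift (s : BiWord ℕ).height).shift (-(s : BiWord ℕ).height) = u := fun u => by simp
  refine ⟨fun v => ⟨(ψ v : BiWord ℕ).shift (-(s : BiWord ℕ).height), (ψ v).2⟩,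
    ⟨s.2, ?_, ?_, ?_, ?_, ?_⟩, ?_, ?_⟩
  · intro u v h
    exact h1 (Subtype.ext (shift_injective _ (congrArg Subtype.val h)))
  · intro v
    have hm : (v : BiWord ℕ).shift (s : BiWord ℕ).height ∈ x.scc.carrier := by
      show BiWord.shift _ _ ∈ x.carrier
      rw [show -(({ x with pt := x.succ x.root, pt_mem := (x.succ x.root).2 } :
        LTree (BiWord A)).pt.height) = -(s : BiWord ℕ).height from rfl, hforth]
      exact v.2
    have hr := h2 ⟨_, hm⟩
    have e1 : v ∈ Set.range (fun v => (⟨(ψ v : BiWord ℕ).shift (-(s : BiWord ℕ).height),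
        (ψ v).2⟩ : x.carrier)) ↔ (⟨_, hm⟩ : x.scc.carrier) ∈ Set.range ψ := by
      constructor
      · rintro ⟨u, rfl⟩
        exact ⟨u, Subtype.ext (hback _).symm⟩
      · rintro ⟨u, hu⟩
        refine ⟨u, Subtype.ext ?_⟩
        simp only [hu, hforth]
    rw [e1, hr, hpt]
    refine or_congr ⟨?_, ?_⟩ ⟨fun h => ?_, hlex _ _ _⟩
    · rintro ⟨p, hp, e⟩
      refine ⟨(-p).toNat, ?_⟩
      simp only at e
      rw [show p = ((s : BiWord ℕ).shift (s : BiWord ℕ).height).height - ((-p).toNat : ℤ) by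
        simp only [height_shift] at hp ⊢; omega, trunc_sub, ← shift_parent_iterate] at e
      exact shift_injective _ e
    · rintro ⟨n, e⟩
      refine ⟨((s : BiWord ℕ).shift (s : BiWord ℕ).height).height - (n : ℤ), by omega, ?_⟩
      simp only
      rw [trunc_sub, ← shift_parent_iterate, e]
    · have := hlex (-(s : BiWord ℕ).height) _ _ h
      rwa [hforth, hforth] at this
  · show BiWord.shift _ (ψ _ : BiWord ℕ) = _
    rw [show ψ x.sccPlus.root = x.scc.root from h3]
    show BiWord.shift _ (x.scc.pt) = _
    rw [hpt, hforth]
  · intro u v h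
    exact hlex _ _ _ (h4 u v h)
  · intro v
    rw [height_shift, h5]
    ring
  · have := h5 x.sccPlus.root
    rw [show ψ x.sccPlus.root = x.scc.root from h3] at this
    rw [show x.sccPlus.pt = (x.sccPlus.root : BiWord ℕ) from rfl, ← this]
    show x.scc.pt.height = 0
    rw [hpt]
    simp
  · intro v
    exact h6 v

end LTree

/-! ### Codes, and the successor map on codes. -/

/-- The steps of the walk: `none` is the step to the parent, `some i` the step to the child `i`. -/
abbrev Step (b : ℕ) := Option (Fin b)

/-- Words with an infinite past, up to shifts; the letters are listed backwards. -/
abbrev Word (b : ℕ) := ℕ → Fin b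

/-- A family of offspring numbers and of steps indexed by all finite words. -/
abbrev Mark (b : ℕ) := List ℕ → ℕ × Step b

/-- The number of children of a vertex, and the marks of the trees stemming from these. -/
abbrev Body (b : ℕ) := ℕ × (ℕ → Mark b)

/-- The steps between the successive ancestors of a vertex, with the bodies on their right. -/
abbrev Spine (b : ℕ) := ℕ → Step b × Body b

/-- The code of a labelled tree. -/
abbrev Code (b : ℕ) := Body b × Word b × Spine b

/-- The sequence `a, f 0, f 1, …`. -/
def consSeq {X : Type*} (a : X) (f : ℕ → X) : ℕ → X
  | 0 => a
  | n + 1 => f n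

namespace Code

variable {b : ℕ}

/-- The effect of a step on a word. -/
def move (w : Word b) : Step b → Word b
  | none => fun j => w (j + 1)
  | some i => consSeq i w

/-- The step that undoes a step. -/
def rev (w : Word b) : Step b → Step b
  | none => some (w 0)
  | some _ => none

/-- The height of a step. -/
def dh : Step b → ℤ
  | none => -1
  | some _ => 1

theorem move_move_rev (w : Word b) (s : Step b) : move (move w s) (rev w s) = w := by
  funext j
  cases s with
  | none => cases j <;> rfl
  | some i => rfl

theorem rev_move_rev (w : Word b) (s : Step b) : rev (move w s) (rev w s) = s := by
  cases s <;> rfl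

theorem dh_rev (w : Word b) (s : Step b) : dh (rev w s) = - dh s := by
  cases s <;> rfl

/-- The effect of a step on a bilateral word. -/
def moveBi (x : BiWord (Fin b)) : Step b → BiWord (Fin b)
  | none => x.parent
  | some i => x.child i

@[simp] theorem letter_moveBi (x : BiWord (Fin b)) (s : Step b) :
    (moveBi x s).letter = move x.letter s := by
  funext j
  cases s with
  | none => rfl
  | some i => cases j <;> rfl

@[simp] theorem height_moveBi (x : BiWord (Fin b)) (s : Step b) :
    (moveBi x s).height = x.height + dh s := by
  cases s <;> rfl

/-- Adjacency in the tree of words. -/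
def Adj (x y : BiWord (Fin b)) : Prop := y = x.parent ∨ x = y.parent

theorem Adj.symm {x y : BiWord (Fin b)} (h : Adj x y) : Adj y x := Or.symm h

open Classical in
/-- The step from a word to an adjacent word. -/
def stepOf (x y : BiWord (Fin b)) : Step b := if y = x.parent then none else some y.last

theorem moveBi_stepOf {x y : BiWord (Fin b)} (h : Adj x y) : moveBi x (stepOf x y) = y := by
  by_cases h1 : y = x.parent
  · rw [stepOf, if_pos h1]; exact h1.symm
  · rw [stepOf, if_neg h1]
    rcases h with h | h
    · exact absurd h h1
    · show x.child y.last = y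
      rw [h, BiWord.child_parent_last]

theorem stepOf_moveBi (x : BiWord (Fin b)) (s : Step b) : stepOf x (moveBi x s) = s := by
  cases s with
  | none => exact if_pos rfl
  | some i =>
    rw [stepOf, if_neg]
    · rfl
    · intro h
      have := congrArg BiWord.height h
      simp [moveBi] at this
      omega

theorem adj_moveBi (x : BiWord (Fin b)) (s : Step b) : Adj x (moveBi x s) := by
  cases s with
  | none => exact Or.inl rfl
  | some i => exact Or.inr (BiWord.parent_child _ _).symm

theorem moveBi_injective (x : BiWord (Fin b)) : Function.Injective (moveBi x) := by
  intro s s' h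
  rw [← stepOf_moveBi x s, h, stepOf_moveBi]

theorem moveBi_moveBi_rev (x : BiWord (Fin b)) (s : Step b) :
    moveBi (moveBi x s) (rev x.letter s) = x := by
  cases s with
  | none => exact BiWord.child_parent_last x
  | some i => exact BiWord.parent_child _ _

theorem rev_stepOf {x y : BiWord (Fin b)} (h : Adj x y) :
    rev x.letter (stepOf x y) = stepOf y x := by
  have := moveBi_moveBi_rev x (stepOf x y)
  rw [moveBi_stepOf h] at this
  conv_rhs => rw [← this, stepOf_moveBi]

theorem stepOf_shift (k : ℤ) (x y : BiWord (Fin b)) :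
    stepOf (x.shift k) (y.shift k) = stepOf x y := by
  unfold stepOf
  rw [← BiWord.shift_parent, (BiWord.shift_injective k).eq_iff]
  rfl

theorem Adj.shift {x y : BiWord (Fin b)} (h : Adj x y) (k : ℤ) : Adj (x.shift k) (y.shift k) := by
  rcases h with h | h
  · exact Or.inl (by rw [h, BiWord.shift_parent])
  · exact Or.inr (by rw [h, BiWord.shift_parent])

/-- The mark of the root, and the body stemming from it. -/
def splitMark (m : Mark b) : Step b × Body b := ((m []).2, (m []).1, fun i w => m ((i + 1) :: w))

/-- The shift of a walk. -/
def climb {Y : Type*} (v : Word b × (ℕ → Step b × Y)) : Word b × (ℕ → Step b × Y) :=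
  (move v.1 (v.2 0).1, fun n => v.2 (n + 1))

/-- Moving to the next ancestor. -/
def climbC (c : Code b) : Code b := ((c.2.2 0).2, climb c.2)

/-- Moving to the first child. -/
def launch (r : ℕ) (N : ℕ → Mark b) (v : Word b × Spine b) : Code b :=
  ((splitMark (N 0)).2, move v.1 (splitMark (N 0)).1,
    -- The vertex left behind becomes the first ancestor, with the step back to it and its `r`
    -- children on the right of the new vertex.
    consSeq (rev v.1 (splitMark (N 0)).1, (r, fun i => N (i + 1))) v.2)

/-- The first ancestor (or the vertex itself) that has a child on the right. -/
def HasNext (c : Code b) : Prop := ∃ p, (climbC^[p] c).1.1 ≠ 0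

open Classical in
/-- The right-successor map on codes. -/
def next [NeZero b] (c : Code b) : Code b :=
  if h : HasNext c then
    launch ((climbC^[Nat.find h] c).1.1 - 1) (climbC^[Nat.find h] c).1.2 (climbC^[Nat.find h] c).2
  -- Junk value, on an event that is almost surely avoided (`ae_hasNext`).
  else default

open Classical in
/-- The difference of heights between the label of the successor and the label of the vertex. -/
def disp (c : Code b) : ℤ :=
  if h : HasNext c then
    (∑ i ∈ Finset.range (Nat.find h), dh (c.2.2 i).1) +
      dh (splitMark ((climbC^[Nat.find h] c).1.2 0)).1
  else 0

theorem climbC_iterate_spine (c : Code b) (p n : ℕ) : (climbC^[p] c).2.2 n = c.2.2 (n + p) := by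
  induction p generalizing n with
  | zero => rfl
  | succ p ih =>
    rw [Function.iterate_succ_apply']
    show (climbC^[p] c).2.2 (n + 1) = _
    rw [ih, Nat.add_assoc, Nat.add_comm 1 p]

theorem hasNext_climbC {c : Code b} (h : c.1.1 = 0) : HasNext (climbC c) ↔ HasNext c := by
  constructor
  · rintro ⟨p, hp⟩
    exact ⟨p + 1, hp⟩
  · rintro ⟨p, hp⟩
    cases p with
    | zero => exact absurd h hp
    | succ p => exact ⟨p, hp⟩

theorem next_of_eq_succ [NeZero b] {c : Code b} {r : ℕ} (h : c.1.1 = r + 1) :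
    next c = launch r c.1.2 c.2 := by
  classical
  have hn : HasNext c := ⟨0, by simp [h]⟩
  have h0 : Nat.find hn = 0 := (Nat.find_eq_zero hn).2 (by simp [h])
  rw [next, dif_pos hn]
  simp [h0, h]

theorem next_of_eq_zero [NeZero b] {c : Code b} (h : c.1.1 = 0) : next c = next (climbC c) := by
  classical
  by_cases hn : HasNext c
  · have hn' := (hasNext_climbC h).2 hn
    have e : Nat.find hn = Nat.find hn' + 1 :=
      Nat.find_comp_succ hn hn' (by simp [h])
    rw [next, next, dif_pos hn, dif_pos hn', e, Function.iterate_succ_apply]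
  · rw [next, next, dif_neg hn, dif_neg (mt (hasNext_climbC h).1 hn)]

theorem disp_of_ne_zero {c : Code b} (h : c.1.1 ≠ 0) : disp c = dh (splitMark (c.1.2 0)).1 := by
  classical
  have hn : HasNext c := ⟨0, h⟩
  have h0 : Nat.find hn = 0 := (Nat.find_eq_zero hn).2 h
  rw [disp, dif_pos hn]
  simp [h0]

theorem disp_of_eq_zero {c : Code b} (h : c.1.1 = 0) (hn : HasNext c) :
    disp c = dh (c.2.2 0).1 + disp (climbC c) := by
  classical
  have hn' := (hasNext_climbC h).2 hn
  have e : Nat.find hn = Nat.find hn' + 1 := Nat.find_comp_succ hn hn' (by simp [h])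
  rw [disp, disp, dif_pos hn, dif_pos hn', e, Function.iterate_succ_apply, Finset.sum_range_succ',
    add_comm (Finset.sum _ _), add_assoc]
  rfl

end Code

/-! ### The code of a labelled tree, and the position of the successor in the tree. -/

instance {A : Type*} [Inhabited A] : Inhabited (BiWord A) := ⟨⟨0, fun _ => default⟩⟩

namespace LTree

open BiWord PTree Code

open Classical in
/-- The label of a vertex, with a default value outside of the tree. -/
def lab {E : Type*} [Inhabited E] (x : LTree E) (v : BiWord ℕ) : E :=
  if h : v ∈ x.carrier then x.label ⟨v, h⟩ else default

theorem lab_eq {E : Type*} [Inhabited E] (x : LTree E) {v : BiWord ℕ} (h : v ∈ x.carrier) :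
    x.lab v = x.label ⟨v, h⟩ := dif_pos h

variable {b : ℕ} [NeZero b]

open Classical in
/-- The offspring number and the step of a vertex. -/
def markAt (x : LTree (BiWord (Fin b))) (u : BiWord ℕ) : ℕ × Step b :=
  if u ∈ x.carrier then (x.numChildren u, stepOf (x.lab u.parent) (x.lab u)) else (0, none)

/-- The body that stems from a vertex, without its first `l` children. -/
def bodyFrom (x : LTree (BiWord (Fin b))) (u : BiWord ℕ) (l : ℕ) : Body b :=
  (x.numChildren u - l, fun i w => x.markAt ((u.child (l + 1 + i)).append w))

/-- The ancestral line of a vertex. -/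
def spineFrom (x : LTree (BiWord (Fin b))) (u : BiWord ℕ) : Spine b := fun p =>
  (stepOf (x.lab (parent^[p] u)) (x.lab (parent^[p + 1] u)),
    x.bodyFrom (parent^[p + 1] u) (parent^[p] u).last)

/-- The code of the right part of a tree at a vertex, without its first `l` children. -/
def codeFrom (x : LTree (BiWord (Fin b))) (u : BiWord ℕ) (l : ℕ) : Code b :=
  (x.bodyFrom u l, (x.lab u).letter, x.spineFrom u)

/-- The code of a tree. -/
def code (x : LTree (BiWord (Fin b))) : Code b := x.codeFrom x.pt 0

/-- The labels of neighbours are neighbours. -/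
def AdjLabels (x : LTree (BiWord (Fin b))) : Prop :=
  ∀ v ∈ x.carrier, Adj (x.lab v.parent) (x.lab v)

variable {x : LTree (BiWord (Fin b))}

/-- Climbing from `u` loses the children of the parent up to `u` itself, that is the first `u.last`
ones. -/
theorem climbC_codeFrom (hx : x.AdjLabels) {u : BiWord ℕ} (hu : u ∈ x.carrier) (l : ℕ) :
    climbC (x.codeFrom u l) = x.codeFrom u.parent u.last := by
  refine Prod.ext rfl (Prod.ext ?_ rfl)
  show move (x.lab u).letter (stepOf (x.lab u) (x.lab u.parent)) = (x.lab u.parent).letter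
  rw [← letter_moveBi, moveBi_stepOf (hx u hu).symm]

/-- The `r` remaining siblings of the new vertex are the children of `u` from the letter `l + 2` on;
they form the body on the right of the new ancestral line. -/
theorem launch_codeFrom (hx : x.AdjLabels) {u : BiWord ℕ} {l r : ℕ}
    (hu : u ∈ x.carrier) (hr : x.numChildren u - l = r + 1) :
    launch r (x.bodyFrom u l).2 (x.codeFrom u l).2 = x.codeFrom (u.child (l + 1)) 0 := by
  have hm : u.child (l + 1) ∈ x.carrier := by
    rw [child_mem_iff hu]; omega
  have hadj := hx _ hm
  rw [parent_child] at hadj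
  have e0 : splitMark ((x.bodyFrom u l).2 0) =
      (stepOf (x.lab u) (x.lab (u.child (l + 1))), x.bodyFrom (u.child (l + 1)) 0) := by
    have e1 : (x.bodyFrom u l).2 0 [] =
        (x.numChildren (u.child (l + 1)), stepOf (x.lab u) (x.lab (u.child (l + 1)))) := by
      show x.markAt _ = _
      rw [append_nil, add_zero, markAt, if_pos hm, parent_child]
    rw [splitMark, e1]
    refine Prod.ext rfl (Prod.ext ?_ ?_)
    · show _ = _ - 0
      rw [Nat.sub_zero]
    · funext i w
      show x.markAt _ = x.markAt _
      rw [append_cons, add_zero, zero_add, add_comm 1 i]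
  rw [launch, e0]
  refine Prod.ext rfl (Prod.ext ?_ ?_)
  · show move (x.lab u).letter _ = _
    rw [← letter_moveBi, moveBi_stepOf hadj]
    rfl
  · funext p
    cases p with
    | zero =>
      refine Prod.ext ?_ (Prod.ext ?_ ?_)
      · show rev (x.lab u).letter _ = stepOf _ (x.lab (u.child (l + 1)).parent)
        rw [rev_stepOf hadj, parent_child]
        rfl
      · show r = x.numChildren (u.child (l + 1)).parent - (l + 1)
        rw [parent_child]
        omega
      · funext i w
        show x.markAt _ = x.markAt (((u.child (l + 1)).parent.child (l + 1 + 1 + i)).append w)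
        rw [parent_child, show l + 1 + (i + 1) = l + 1 + 1 + i by ring]
    | succ p =>
      show x.spineFrom u p = x.spineFrom (u.child (l + 1)) (p + 1)
      simp only [spineFrom, Function.iterate_succ_apply, parent_child]

/-- The number of children of the `p`-th ancestor of `v` on the left of `v`, inclusively. -/
def leftCount (v : BiWord ℕ) : ℕ → ℕ
  | 0 => 0
  | p + 1 => (parent^[p] v).last

theorem climbC_iterate_codeFrom (hx : x.AdjLabels) {u : BiWord ℕ} (hu : u ∈ x.carrier) (p : ℕ) :
    climbC^[p] (x.codeFrom u 0) = x.codeFrom (parent^[p] u) (leftCount u p) := by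
  induction p with
  | zero => rfl
  | succ p ih =>
    rw [Function.iterate_succ_apply', ih, climbC_codeFrom hx (x.parent_iterate_mem hu p),
      Function.iterate_succ_apply']
    rfl

/-- A later vertex of this subtree would branch off at `v` or at one of the ancestors up to the
`q`-th, through a child on the right of the path to `v`, and `hq` says that there is none. -/
theorem not_lexLT_append {T : PTree} {v : BiWord ℕ} (hv : v ∈ T.carrier) {q : ℕ}
    (hq : ∀ q' ≤ q, T.numChildren (parent^[q'] v) ≤ leftCount v q') (w : List ℕ)
    (hw : (parent^[q] v).append w ∈ T.carrier) : ¬ LexLT v ((parent^[q] v).append w) := by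
  induction q generalizing w with
  | zero =>
    intro h
    have := (lexLT_append_iff v [] w).1 h
    cases w with
    | nil => exact lt_irrefl _ this
    | cons i w =>
      have h1 := mem_of_append_mem (u := v.child i) (w := w) hw
      rw [child_mem_iff hv] at h1
      have := hq 0 le_rfl
      simp only [leftCount, Function.iterate_zero, id_eq] at this
      omega
  | succ q ih =>
    intro h
    obtain ⟨w', -, hw'⟩ := exists_eq_append v q
    have e : v = (parent^[q + 1] v).append ((parent^[q] v).last :: w') := by
      rw [Function.iterate_succ_apply', append_cons, child_parent_last]
      exact hw'
    have hlt : ((parent^[q] v).last :: w') < w := by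
      rw [← lexLT_append_iff (parent^[q + 1] v), ← e]
      exact h
    cases w with
    | nil => cases hlt
    | cons i w =>
      have h1 := mem_of_append_mem (u := (parent^[q + 1] v).child i) (w := w) hw
      rw [child_mem_iff (T.parent_iterate_mem hv _)] at h1
      have h2 := hq (q + 1) le_rfl
      simp only [leftCount] at h2
      rw [List.cons_lt_cons_iff] at hlt
      have h3 : i = (parent^[q] v).last := by
        rcases hlt with h3 | h3
        · omega
        · exact h3.1.symm
      have e' : (parent^[q + 1] v).append (i :: w) = (parent^[q] v).append w := by
        rw [h3, Function.iterate_succ_apply', append_cons, child_parent_last]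
      rw [e'] at hw h
      exact ih (fun q' hq' => hq q' (by omega)) w hw h

/-- The successor is the next sibling of an ancestor. -/
theorem isSucc_child {T : PTree} {v : T.carrier} {p : ℕ}
    (hp : leftCount (v : BiWord ℕ) p < T.numChildren (parent^[p] (v : BiWord ℕ)))
    (hq : ∀ q < p, T.numChildren (parent^[q] (v : BiWord ℕ)) ≤ leftCount (v : BiWord ℕ) q)
    (hm : (parent^[p] (v : BiWord ℕ)).child (leftCount (v : BiWord ℕ) p + 1) ∈ T.carrier) :
    T.IsSucc v ⟨_, hm⟩ := by
  set a := parent^[p] (v : BiWord ℕ)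
  obtain ⟨β, hβ, hv⟩ : ∃ β : List ℕ, β < [leftCount (v : BiWord ℕ) p + 1] ∧
      (v : BiWord ℕ) = a.append β := by
    cases p with
    | zero => exact ⟨[], List.Lex.nil, rfl⟩
    | succ p =>
      obtain ⟨w', -, hw'⟩ := exists_eq_append (v : BiWord ℕ) p
      refine ⟨(parent^[p] (v : BiWord ℕ)).last :: w', List.Lex.rel (Nat.lt_succ_self _), ?_⟩
      simp only [a]
      rw [Function.iterate_succ_apply', append_cons, child_parent_last]
      exact hw'
  have hlt : LexLT (v : BiWord ℕ) (a.child (leftCount (v : BiWord ℕ) p + 1)) := by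
    rw [hv]
    exact (lexLT_append_iff a β [_]).2 (by rw [← hv]; exact hβ)
  refine ⟨hlt, fun w hw => ?_⟩
  rcases lexLT_trichotomy hm w.2 with h | h | h
  · exact Or.inr h
  · exact Or.inl (Subtype.ext h)
  · exfalso
    -- A vertex outside of the subtree of `a` lies on the same side of `v`, `a` and the new child,
    -- so it cannot be between `v` and that child.
    have hwa : ∃ δ, (w : BiWord ℕ) = a.append δ := by
      by_contra hne
      have ham : a ∈ T.carrier := T.parent_iterate_mem v.2 p
      obtain ⟨c, α, γ, e1, e2⟩ := exists_common_append ham w.2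
      have hna : ¬ Above a w := by
        rintro ⟨i, u, hu⟩
        exact hne ⟨_, hu⟩
      have k1 := (lexLT_append_left_iff e1 e2 hna
        (w := [leftCount (v : BiWord ℕ) p + 1]) (by simp)).2.1 h
      have k2 : LexLT a w := by
        cases β with
        | nil =>
          rw [append_nil] at hv
          rwa [hv] at hw
        | cons i β =>
          rw [hv] at hw
          exact (lexLT_append_left_iff e1 e2 hna (by simp)).1.1 hw
      rcases k1 with k1 | k1
      · rw [k1] at k2; exact lexLT_irrefl _ k2
      · exact lexLT_irrefl _ (lexLT_trans ham w.2 ham k2 k1)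
    obtain ⟨δ, hδ⟩ := hwa
    rw [hδ] at h
    have h1 : δ < [leftCount (v : BiWord ℕ) p + 1] := (lexLT_append_iff a δ [_]).1 h
    have hwm := w.2
    rw [hδ] at hwm hw
    rw [hv, lexLT_append_iff] at hw
    cases δ with
    | nil => cases β <;> cases hw
    | cons i δ =>
      have h2 : i ≤ leftCount (v : BiWord ℕ) p := by
        rw [List.cons_lt_cons_iff] at h1
        rcases h1 with h1 | ⟨-, h1⟩
        · omega
        · cases δ <;> cases h1
      have h3 := mem_of_append_mem (u := a.child i) (w := δ) hwm
      rw [child_mem_iff (T.parent_iterate_mem v.2 p)] at h3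
      cases p with
      | zero =>
        simp only [leftCount] at h2
        omega
      | succ p =>
        obtain ⟨w', -, hw'⟩ := exists_eq_append (v : BiWord ℕ) p
        have e : (v : BiWord ℕ) = a.append ((parent^[p] (v : BiWord ℕ)).last :: w') := by
          simp only [a]
          rw [Function.iterate_succ_apply', append_cons, child_parent_last]
          exact hw'
        have hβ' : β = (parent^[p] (v : BiWord ℕ)).last :: w' :=
          (append_right_inj a).1 (hv.symm.trans e)
        rw [hβ', List.cons_lt_cons_iff] at hw
        simp only [leftCount] at h2
        have h4 : i = (parent^[p] (v : BiWord ℕ)).last := by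
          rcases hw with hw | hw
          · omega
          · exact hw.1.symm
        have e' : a.append (i :: δ) = (parent^[p] (v : BiWord ℕ)).append δ := by
          simp only [a]
          rw [h4, Function.iterate_succ_apply', append_cons, child_parent_last]
        rw [e'] at hwm
        -- What remains is a vertex after `v` in the subtree of the previous ancestor, up to which
        -- no generation has a child on the right.
        refine not_lexLT_append v.2 (fun q' hq' => hq q' (by omega)) δ hwm ?_
        rw [← e', e, lexLT_append_iff, List.cons_lt_cons_iff]
        exact hw

end LTree

/-! ### The right-successor map and the successive labels, read on the code. -/

namespace Code

variable {b : ℕ}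

theorem dh_stepOf {x y : BiWord (Fin b)} (h : Adj x y) : dh (stepOf x y) = y.height - x.height := by
  have := height_moveBi x (stepOf x y)
  rw [moveBi_stepOf h] at this
  omega

/-- The label of the `n`-th vertex, according to the code. -/
def pos [NeZero b] (c : Code b) (n : ℕ) : BiWord (Fin b) :=
  ⟨∑ i ∈ Finset.range n, disp (next^[i] c), (next^[n] c).2.1⟩

theorem pos_add [NeZero b] (c : Code b) (k n : ℕ) :
    pos c (k + n) = (pos (next^[k] c) n).shift (-∑ i ∈ Finset.range k, disp (next^[i] c)) := by
  refine BiWord.ext ?_ ?_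
  · simp only [pos, BiWord.height_shift, Finset.sum_range_add, ← Function.iterate_add_apply]
    rw [sub_neg_eq_add, add_comm]
    congr 1
    exact Finset.sum_congr rfl fun i _ => by rw [add_comm]
  · simp only [pos, BiWord.shift, ← Function.iterate_add_apply]
    rw [add_comm]

theorem next_eq_launch [NeZero b] {c : Code b} {p r : ℕ} (hp : (climbC^[p] c).1.1 = r + 1)
    (hq : ∀ q < p, (climbC^[q] c).1.1 = 0) :
    next c = launch r (climbC^[p] c).1.2 (climbC^[p] c).2 := by
  induction p generalizing c with
  | zero => exact next_of_eq_succ hp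
  | succ p ih =>
    rw [next_of_eq_zero (show c.1.1 = 0 from hq 0 (Nat.succ_pos p))]
    exact ih hp fun q hqp => hq (q + 1) (Nat.succ_lt_succ hqp)

theorem disp_eq_sum {c : Code b} {p r : ℕ} (hp : (climbC^[p] c).1.1 = r + 1)
    (hq : ∀ q < p, (climbC^[q] c).1.1 = 0) :
    disp c = (∑ i ∈ Finset.range p, dh (c.2.2 i).1) +
      dh (splitMark ((climbC^[p] c).1.2 0)).1 := by
  induction p generalizing c with
  | zero =>
    rw [disp_of_ne_zero (by rw [show c.1.1 = r + 1 from hp]; exact Nat.succ_ne_zero r)]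
    simp
  | succ p ih =>
    have hn : HasNext c := ⟨p + 1, by rw [hp]; exact Nat.succ_ne_zero r⟩
    rw [disp_of_eq_zero (show c.1.1 = 0 from hq 0 (Nat.succ_pos p)) hn,
      ih (c := climbC c) hp fun q hqp => hq (q + 1) (Nat.succ_lt_succ hqp),
      Finset.sum_range_succ', add_comm (Finset.sum _ _) (dh (c.2.2 0).1), add_assoc]
    rfl

end Code

namespace LTree

open BiWord PTree Code

variable {b : ℕ}

/-- Each vertex on the right of the distinguished point has a successor. -/
def AllSucc (x : LTree (BiWord (Fin b))) : Prop :=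
  ∀ v : x.carrier, ((v : BiWord ℕ) = x.pt ∨ LexLT x.pt v) → ∃ s, x.IsSucc v s

variable {x : LTree (BiWord (Fin b))}

theorem AllSucc.exists_lexLT (hx : x.AllSucc) : ∃ w ∈ x.carrier, LexLT x.pt w := by
  obtain ⟨s, hs⟩ := hx x.root (Or.inl rfl)
  exact ⟨s, s.2, hs.1⟩

theorem AllSucc.lexLT_vertex (hx : x.AllSucc) (n : ℕ) :
    ((x.vertex n : BiWord ℕ) = x.pt ∨ LexLT x.pt (x.vertex n)) ∧
      x.IsSucc (x.vertex n) (x.vertex (n + 1)) := by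
  have hstep : ∀ n, x.vertex (n + 1) = x.succ (x.vertex n) := fun n =>
    Function.iterate_succ_apply' _ _ _
  induction n with
  | zero =>
    refine ⟨Or.inl rfl, ?_⟩
    rw [hstep]
    exact isSucc_succ (hx _ (Or.inl rfl))
  | succ n ih =>
    have h1 : LexLT x.pt (x.vertex (n + 1)) := by
      rcases ih.1 with h | h
      · rw [← h]; exact ih.2.1
      · exact lexLT_trans x.pt_mem (x.vertex n).2 (x.vertex (n + 1)).2 h ih.2.1
    refine ⟨Or.inr h1, ?_⟩
    rw [hstep (n + 1)]
    exact isSucc_succ (hx _ (Or.inr h1))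

theorem exists_leftCount_lt (hn : ∃ w ∈ x.carrier, LexLT x.pt w) :
    ∃ p, leftCount x.pt p < x.numChildren (parent^[p] x.pt) ∧
      ∀ q < p, x.numChildren (parent^[q] x.pt) ≤ leftCount x.pt q := by
  classical
  have hex : ∃ p, leftCount x.pt p < x.numChildren (parent^[p] x.pt) := by
    by_contra hno
    push Not at hno
    obtain ⟨w, hw, hlt⟩ := hn
    obtain ⟨p, δ, rfl⟩ := exists_append_spine hw
    rw [spine_eq] at hw hlt
    exact not_lexLT_append x.pt_mem (fun q _ => hno q) δ hw hlt
  exact ⟨Nat.find hex, Nat.find_spec hex, fun q hq => not_lt.1 (Nat.find_min hex hq)⟩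

variable [NeZero b]

/-- The trees that the branching random walk almost surely takes for values. -/
structure Good (x : LTree (BiWord (Fin b))) : Prop where
  height_pt : x.pt.height = 0
  height_rootLabel : x.rootLabel.height = 0
  spine_last : ∀ p, (x.spine p).last = 1
  adj : x.AdjLabels

theorem lab_pt (hx : x.Good) : (x.lab x.pt).height = 0 := by
  rw [lab_eq x x.pt_mem]
  exact hx.height_rootLabel

theorem sum_dh_spine (hx : x.Good) (p : ℕ) :
    (∑ i ∈ Finset.range p, dh (x.code.2.2 i).1) = (x.lab (parent^[p] x.pt)).height := by
  have e1 : ∀ i, dh (x.code.2.2 i).1 =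
      (x.lab (parent^[i + 1] x.pt)).height - (x.lab (parent^[i] x.pt)).height := by
    intro i
    have := hx.adj _ (x.parent_iterate_mem x.pt_mem i)
    rw [← Function.iterate_succ_apply' parent] at this
    exact dh_stepOf this.symm
  simp_rw [e1]
  rw [Finset.sum_range_sub (fun i => (x.lab (parent^[i] x.pt)).height)]
  have := lab_pt hx
  simp [this]

/-- Both searches stop at the first ancestor that has a child on the right: `leftCount` detects it
in the tree, and the numbers of children along `climbC` detect it in the code. -/
theorem Good.next_code (hx : x.Good) (hn : ∃ w ∈ x.carrier, LexLT x.pt w) :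
    x.IsSucc x.root (x.succ x.root) ∧
    next x.code = x.codeFrom (x.succ x.root) 0 ∧
    (x.lab (x.succ x.root)).height = disp x.code ∧
    (∀ n, (parent^[n + 1] (x.succ x.root : BiWord ℕ)).last = 1) := by
  obtain ⟨p, hp, hq⟩ := exists_leftCount_lt hn
  have hpm := x.parent_iterate_mem x.pt_mem p
  have hm : (parent^[p] x.pt).child (leftCount x.pt p + 1) ∈ x.carrier := by
    rw [child_mem_iff hpm]; omega
  have hs : x.IsSucc x.root ⟨(parent^[p] x.pt).child (leftCount x.pt p + 1), hm⟩ :=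
    isSucc_child (v := x.root) hp hq hm
  have hsucc : x.succ x.root = ⟨(parent^[p] x.pt).child (leftCount x.pt p + 1), hm⟩ :=
    succ_eq_of_isSucc hs
  have hsv : (x.succ x.root : BiWord ℕ) = (parent^[p] x.pt).child (leftCount x.pt p + 1) :=
    congrArg Subtype.val hsucc
  have hit : ∀ q, climbC^[q] x.code = x.codeFrom (parent^[q] x.pt) (leftCount x.pt q) :=
    climbC_iterate_codeFrom hx.adj x.pt_mem
  obtain ⟨r, hr⟩ : ∃ r, x.numChildren (parent^[p] x.pt) - leftCount x.pt p = r + 1 :=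
    Nat.exists_eq_succ_of_ne_zero (by omega)
  have hadj := hx.adj _ hm
  rw [parent_child] at hadj
  have hp1 : (climbC^[p] x.code).1.1 = r + 1 := by
    rw [hit]
    exact hr
  have hq1 : ∀ q < p, (climbC^[q] x.code).1.1 = 0 := fun q hqp => by
    rw [hit]
    exact Nat.sub_eq_zero_of_le (hq q hqp)
  rw [hsv]
  refine ⟨by rw [hsucc]; exact hs, ?_, ?_, ?_⟩
  · rw [next_eq_launch hp1 hq1, hit]
    exact launch_codeFrom hx.adj hpm hr
  · rw [disp_eq_sum hp1 hq1, hit, sum_dh_spine hx]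
    have e3 : (splitMark ((x.codeFrom (parent^[p] x.pt) (leftCount x.pt p)).1.2 0)).1 =
        stepOf (x.lab (parent^[p] x.pt))
          (x.lab ((parent^[p] x.pt).child (leftCount x.pt p + 1))) := by
      show (x.markAt _).2 = _
      rw [append_nil, add_zero, markAt, if_pos hm, parent_child]
    rw [e3, dh_stepOf hadj]
    ring
  · intro n
    rw [Function.iterate_succ_apply, parent_child, ← Function.iterate_add_apply, ← spine_eq]
    exact hx.spine_last _

section RightMap

variable {y : LTree (BiWord (Fin b))} {r : BiWord ℕ} {ψ : y.carrier → x.carrier} {h k : ℤ}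

theorem lab_of_rightMap
    (hlab : ∀ v, y.label v = (x.label (ψ v)).shift k) (v : y.carrier) :
    y.lab v = (x.lab (ψ v)).shift k := by
  rw [lab_eq y v.2, lab_eq x (ψ v).2]
  exact hlab v

theorem markAt_of_rightMap (H : RightMap x.toPTree r y.toPTree ψ h)
    (hlab : ∀ v, y.label v = (x.label (ψ v)).shift k) (v : y.carrier)
    (hv : (ψ v : BiWord ℕ) = r ∨ LexLT r (ψ v)) (w : List ℕ) :
    y.markAt ((v : BiWord ℕ).append w) = x.markAt ((ψ v : BiWord ℕ).append w) := by
  obtain ⟨h1, h2⟩ := H.append_mem_iff v hv w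
  by_cases hm : (v : BiWord ℕ).append w ∈ y.carrier
  · have e := h2 hm
    have hge : (ψ ⟨_, hm⟩ : BiWord ℕ) = r ∨ LexLT r (ψ ⟨_, hm⟩) := by
      rw [e]
      cases w with
      | nil => exact hv
      | cons i w =>
        right
        have h3 : LexLT (ψ v : BiWord ℕ) ((ψ v : BiWord ℕ).append (i :: w)) :=
          (lexLT_append_iff _ [] _).2 List.Lex.nil
        rcases hv with hv | hv
        · rw [← hv]; exact h3
        · exact lexLT_trans H.mem (ψ v).2 (h1.1 hm) hv h3
    rw [markAt, markAt, if_pos hm, if_pos (h1.1 hm), (H.map_children_of_ge ⟨_, hm⟩ hge).1, e]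
    have e1 := lab_of_rightMap hlab ⟨_, hm⟩
    have e2 := lab_of_rightMap hlab (RightMap.par ⟨_, hm⟩)
    rw [H.map_parent] at e2
    simp only [e] at e1 e2
    rw [e1, e2, stepOf_shift]
  · rw [markAt, markAt, if_neg hm, if_neg (mt h1.2 hm)]

/-- The code sees the tree only through the vertices on the right, and the labels only through steps
and letters, so neither the renumbering of the children nor the shift of the heights changes it. -/
theorem code_of_rightMap (H : RightMap x.toPTree r y.toPTree ψ h)
    (hlab : ∀ v, y.label v = (x.label (ψ v)).shift k) :
    y.code = x.codeFrom r 0 := by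
  have hsp : ∀ p, y.lab (parent^[p] y.pt) = (x.lab (parent^[p] r)).shift k := by
    intro p
    have := lab_of_rightMap hlab ⟨y.spine p, y.spine_mem p⟩
    rw [H.map_spine] at this
    have e := y.spine_eq p
    rw [← e]
    exact this
  refine Prod.ext ?_ (Prod.ext ?_ ?_)
  · have hr : (ψ y.root : BiWord ℕ) = r ∨ LexLT r (ψ y.root) := Or.inl H.root
    obtain ⟨h1, h2, h3⟩ := H.map_children_of_ge y.root hr
    rw [H.root] at h1
    refine Prod.ext (by show _ - 0 = _ - 0; rw [← h1]; rfl) ?_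
    funext i w
    show y.markAt _ = x.markAt _
    rw [zero_add]
    by_cases hm : y.pt.child (1 + i) ∈ y.carrier
    · have h3' : (ψ ⟨y.pt.child (1 + i), hm⟩ : BiWord ℕ) = r.child (1 + i) :=
        (h3 i hm).trans (by rw [H.root])
      have := markAt_of_rightMap H hlab ⟨_, hm⟩ (by
        right
        rw [h3']
        exact lexLT_child _ _) w
      rwa [h3'] at this
    · have hm' := mt (h2 i).2 hm
      rw [H.root] at hm'
      rw [markAt, markAt, if_neg (fun hh => hm (mem_of_append_mem hh)),
        if_neg (fun hh => hm' (mem_of_append_mem hh))]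
  · show (y.lab y.pt).letter = (x.lab r).letter
    have := hsp 0
    simp only [Function.iterate_zero, id_eq] at this
    rw [this]
    rfl
  · funext p
    refine Prod.ext ?_ ?_
    · show stepOf (y.lab (parent^[p] y.pt)) (y.lab (parent^[p + 1] y.pt)) = _
      rw [hsp, hsp, stepOf_shift]
      rfl
    · obtain ⟨h1, h2, h3⟩ := H.map_children_spine p
      have hl := H.spine_last p
      have e1 : (parent^[p + 1] r).child (parent^[p] r).last = parent^[p] r := by
        rw [Function.iterate_succ_apply', child_parent_last]
      have hpos : 1 ≤ (parent^[p] r).last := by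
        have m0 := x.parent_iterate_mem H.mem p
        rw [← e1, child_mem_iff (x.parent_iterate_mem H.mem _)] at m0
        exact m0.1
      rw [spine_eq] at h1 h2 h3 hl
      show y.bodyFrom (parent^[p + 1] y.pt) (parent^[p] y.pt).last =
        x.bodyFrom (parent^[p + 1] r) (parent^[p] r).last
      rw [hl]
      refine Prod.ext ?_ ?_
      · show y.numChildren _ - 1 = x.numChildren _ - _
        rw [h1]
        omega
      · funext i w
        show y.markAt _ = x.markAt _
        rw [show 1 + 1 + i = 2 + i by ring]
        by_cases hm : (parent^[p + 1] y.pt).child (2 + i) ∈ y.carrier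
        · have h3' := h3 i hm
          have := markAt_of_rightMap H hlab ⟨_, hm⟩ (by
            right
            rw [h3']
            obtain ⟨w', -, hw'⟩ := exists_eq_append r p
            conv_lhs => rw [hw', ← e1]
            exact (lexLT_append_iff (parent^[p + 1] r) ((parent^[p] r).last :: w') [_]).2
              (List.Lex.rel (by omega))) w
          rwa [h3'] at this
        · have hm' := mt (h2 i).2 hm
          rw [markAt, markAt, if_neg (fun hh => hm (mem_of_append_mem hh)),
            if_neg (fun hh => hm' (mem_of_append_mem hh))]

end RightMap

/-- The right-successor map, seen on the codes. -/
theorem Good.sccPlus (hx : x.Good) (hn : ∃ w ∈ x.carrier, LexLT x.pt w) :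
    x.sccPlus.Good ∧ x.sccPlus.code = next x.code := by
  obtain ⟨-, h2, h3, h4⟩ := hx.next_code hn
  obtain ⟨ψ, H, h5, h6⟩ := exists_rightMap_sccPlus x h4
  refine ⟨⟨h5, ?_, H.spine_last, fun v hv => ?_⟩, by rw [code_of_rightMap H h6, h2]⟩
  · show (x.sccPlus.label x.sccPlus.root).height = 0
    rw [h6, show ψ x.sccPlus.root = x.succ x.root from Subtype.ext H.root]
    simp
  · have e1 := lab_of_rightMap h6 ⟨v, hv⟩
    have e2 := lab_of_rightMap h6 (RightMap.par ⟨v, hv⟩)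
    rw [H.map_parent] at e2
    simp only at e1 e2
    rw [e1, e2]
    exact (hx.adj _ (ψ ⟨v, hv⟩).2).shift _

/-- The labels of the successive vertices, seen on the codes. -/
theorem Good.label_vertex (hx : x.Good) (hs : x.AllSucc) (n : ℕ) :
    x.label (x.vertex n) = pos x.code n := by
  induction n generalizing x with
  | zero =>
    refine BiWord.ext ?_ ?_
    · simp only [pos, Finset.range_zero, Finset.sum_empty]
      exact hx.height_rootLabel
    · show _ = (x.lab x.pt).letter
      rw [lab_eq x x.pt_mem]
      rfl
  | succ n ih =>
    obtain ⟨h1, h2, h3, h4⟩ := hx.next_code hs.exists_lexLT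
    obtain ⟨hg, hc⟩ := hx.sccPlus hs.exists_lexLT
    obtain ⟨ψ, H, h5, h6⟩ := exists_rightMap_sccPlus x h4
    have hge : ∀ v : x.sccPlus.carrier, ((v : BiWord ℕ) = x.sccPlus.pt ∨ LexLT x.sccPlus.pt v) →
        ((ψ v : BiWord ℕ) = x.succ x.root ∨ LexLT (x.succ x.root) (ψ v)) := by
      rintro v (hv | hv)
      · left
        rw [show v = x.sccPlus.root from Subtype.ext hv, H.root]
      · right
        have := H.mono x.sccPlus.root v hv
        rwa [H.root] at this
    have hs' : x.sccPlus.AllSucc := by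
      intro v hv
      have hv' := hge v hv
      obtain ⟨s, hs1⟩ := hs (ψ v) (by
        right
        rcases hv' with h | h
        · rw [h]; exact h1.1
        · exact lexLT_trans x.pt_mem (x.succ x.root).2 (ψ v).2 h1.1 h)
      obtain ⟨s', -, hs2⟩ := H.map_isSucc hv' hs1
      exact ⟨s', hs2⟩
    -- The list of vertices of the right part is that of `x` shifted by one, which is what the
    -- induction on `n` needs.
    have hψ : ∀ m, ψ (x.sccPlus.vertex m) = x.vertex (m + 1) := by
      intro m
      induction m with
      | zero => exact Subtype.ext H.root
      | succ m ihm =>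
        have hl := (hs'.lexLT_vertex m)
        have hl2 := (hs.lexLT_vertex (m + 1)).2
        rw [← ihm] at hl2
        obtain ⟨s', e1, e2⟩ := H.map_isSucc (hge _ hl.1) hl2
        have : x.sccPlus.vertex (m + 1) = s' := by
          rw [show x.sccPlus.vertex (m + 1) = x.sccPlus.succ (x.sccPlus.vertex m) from
            Function.iterate_succ_apply' _ _ _]
          exact succ_eq_of_isSucc e2
        rw [this, e1]
    have e := ih hg hs'
    rw [h6, hψ, hc] at e
    rw [add_comm n 1, pos_add, add_comm 1 n]
    simp only [Finset.sum_range_one, Function.iterate_zero, id_eq, Function.iterate_one]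
    rw [← e, ← lab_eq x (x.succ x.root).2, h3]
    simp

end LTree

/-! ### Product measures: uniqueness criteria and rearrangements of coordinates. -/

namespace MeasureTheory

/-- A measure on a product which has the right value on the boxes built from generating
`π`-systems is the product measure. -/
theorem eq_infinitePi_of_generateFrom {ι : Type*} {X : ι → Type*} [mX : ∀ i, MeasurableSpace (X i)]
    (μ : ∀ i, Measure (X i)) [∀ i, IsProbabilityMeasure (μ i)] (C : ∀ i, Set (Set (X i)))
    (hC : ∀ i, MeasurableSpace.generateFrom (C i) = mX i) (hC' : ∀ i, IsPiSystem (C i))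
    (hC'' : ∀ i, Set.univ ∈ C i) {ν : Measure (∀ i, X i)}
    (hν : ∀ s : Finset ι, ∀ t : ∀ i, Set (X i), (∀ i, t i ∈ C i) →
      ν (Set.pi s t) = ∏ i ∈ s, μ i (t i)) :
    ν = Measure.infinitePi μ := by
  classical
  refine ((Measure.isProjectiveLimit_infinitePi μ).unique fun s => ?_).symm
  have hm : ∀ i, ∀ t ∈ C i, MeasurableSet t := fun i t ht => by
    have := MeasurableSpace.measurableSet_generateFrom ht
    rwa [hC i] at this
  refine (Measure.pi_eq_generateFrom (C := fun i : s => C i) (fun i => hC i) (fun i => hC' i)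
    (fun i => ⟨fun _ => Set.univ, fun _ => hC'' _, fun _ => measure_lt_top _ _,
      Set.iUnion_const _⟩) fun t ht => ?_).symm
  have ht' : ∀ i, (if hi : i ∈ s then t ⟨i, hi⟩ else Set.univ) ∈ C i := fun i => by
    split_ifs with hi
    · exact ht ⟨i, hi⟩
    · exact hC'' i
  have := hν s (fun i => if hi : i ∈ s then t ⟨i, hi⟩ else Set.univ) ht'
  rw [Measure.map_apply (by fun_prop) (MeasurableSet.univ_pi fun i => hm _ _ (ht i))]
  rw [← Finset.prod_coe_sort] at this
  refine Eq.trans ?_ (this.trans ?_)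
  · congr 1
    ext x
    simp only [Set.mem_preimage, Set.mem_pi, Set.mem_univ, true_implies, Finset.mem_coe]
    constructor
    · intro h i hi
      rw [dif_pos hi]
      exact h ⟨i, hi⟩
    · intro h i
      have := h i i.2
      rwa [dif_pos i.2] at this
  · exact Finset.prod_congr rfl fun i _ => by rw [dif_pos i.2]

section

variable {ι κ : Type*} {X Y : Type*} [MeasurableSpace X] [MeasurableSpace Y]

/-- A product of products of measures. -/
theorem measurePreserving_zip (μ : ι → Measure X) (ν : ι → Measure Y)
    [∀ i, IsProbabilityMeasure (μ i)] [∀ i, IsProbabilityMeasure (ν i)] :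
    MeasurePreserving (fun (p : (ι → X) × (ι → Y)) (i : ι) => (p.1 i, p.2 i))
      ((Measure.infinitePi μ).prod (Measure.infinitePi ν))
      (Measure.infinitePi fun i => (μ i).prod (ν i)) := by
  classical
  have hmeas : Measurable (fun (p : (ι → X) × (ι → Y)) (i : ι) => (p.1 i, p.2 i)) := by fun_prop
  refine ⟨hmeas, ?_⟩
  refine eq_infinitePi_of_generateFrom _
    (fun _ => Set.image2 (· ×ˢ ·) {s : Set X | MeasurableSet s} {t : Set Y | MeasurableSet t})
    (fun _ => generateFrom_prod) (fun _ => isPiSystem_prod)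
    (fun _ => ⟨Set.univ, MeasurableSet.univ, Set.univ, MeasurableSet.univ, Set.univ_prod_univ⟩)
    fun s t ht => ?_
  choose a ha b hb hab using ht
  have hm : MeasurableSet (Set.pi (s : Set ι) t) :=
    MeasurableSet.pi s.countable_toSet fun i _ => by
      rw [← hab i]; exact MeasurableSet.prod (ha i) (hb i)
  rw [Measure.map_apply hmeas hm]
  have e : (fun (p : (ι → X) × (ι → Y)) (i : ι) => (p.1 i, p.2 i)) ⁻¹' Set.pi (s : Set ι) t =
      Set.pi (s : Set ι) a ×ˢ Set.pi (s : Set ι) b := by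
    ext p
    simp only [← hab, Set.mem_preimage, Set.mem_pi, Set.mem_prod]
    exact ⟨fun h => ⟨fun i hi => (h i hi).1, fun i hi => (h i hi).2⟩,
      fun h i hi => ⟨h.1 i hi, h.2 i hi⟩⟩
  rw [e, Measure.prod_prod, Measure.infinitePi_pi _ (fun i _ => ha i),
    Measure.infinitePi_pi _ (fun i _ => hb i), ← Finset.prod_mul_distrib]
  exact Finset.prod_congr rfl fun i _ => by rw [← hab i, Measure.prod_prod]

/-- Adding one coordinate to a product. -/
theorem measurePreserving_optionElim (μ : Option κ → Measure X)
    [∀ i, IsProbabilityMeasure (μ i)] :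
    MeasurePreserving (fun (p : X × (κ → X)) (i : Option κ) => i.elim p.1 p.2)
      ((μ none).prod (Measure.infinitePi fun k => μ (some k))) (Measure.infinitePi μ) := by
  classical
  have hmeas : Measurable (fun (p : X × (κ → X)) (i : Option κ) => i.elim p.1 p.2) := by
    refine measurable_pi_lambda _ fun i => ?_
    cases i with
    | none => exact measurable_fst
    | some k => exact (measurable_pi_apply k).comp measurable_snd
  refine ⟨hmeas, Measure.eq_infinitePi _ fun s t ht => ?_⟩
  rw [Measure.map_apply hmeas (MeasurableSet.pi s.countable_toSet fun i _ => ht i)]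
  have e : (fun (p : X × (κ → X)) (i : Option κ) => i.elim p.1 p.2) ⁻¹' Set.pi (s : Set _) t =
      (if none ∈ s then t none else Set.univ) ×ˢ
        Set.pi (Finset.eraseNone s : Set κ) fun k => t (some k) := by
    ext p
    simp only [Set.mem_preimage, Set.mem_pi, Set.mem_prod, Finset.mem_coe, Finset.mem_eraseNone]
    constructor
    · intro h
      refine ⟨?_, fun k hk => h _ hk⟩
      split_ifs with hn
      · exact h _ hn
      · trivial
    · rintro ⟨h1, h2⟩ i hi
      cases i with
      | none => rwa [if_pos hi] at h1
      | some k => exact h2 k hi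
  rw [e, Measure.prod_prod, Measure.infinitePi_pi _ (fun k _ => ht (some k))]
  by_cases hn : none ∈ s
  · rw [if_pos hn]
    conv_rhs => rw [← Finset.insert_eq_of_mem hn, ← Finset.insertNone_eraseNone,
      Finset.prod_insertNone]
  · rw [if_neg hn, measure_univ, one_mul]
    conv_rhs => rw [← Finset.erase_eq_of_notMem hn, ← Finset.map_some_eraseNone, Finset.prod_map]
    rfl

/-- Splitting a coordinate off a product. -/
theorem measurePreserving_split (μ : ι → Measure X) [∀ i, IsProbabilityMeasure (μ i)] (j : ι)
    (e : κ → ι) (he : Function.Injective e) (hj : ∀ k, e k ≠ j) :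
    MeasurePreserving (fun (x : ι → X) => (x j, fun k => x (e k)))
      (Measure.infinitePi μ) ((μ j).prod (Measure.infinitePi fun k => μ (e k))) := by
  have hinj : Function.Injective (fun i : Option κ => i.elim j e) := by
    intro a b h
    cases a <;> cases b <;> simp_all [he.eq_iff, eq_comm]
  have h1 : MeasurePreserving (fun (x : ι → X) (i : Option κ) => x (i.elim j e))
      (Measure.infinitePi μ) (Measure.infinitePi fun i : Option κ => μ (i.elim j e)) :=
    ⟨by fun_prop, Measure.map_infinitePi_infinitePi_of_inj (P := μ) hinj⟩
  have h2 := measurePreserving_optionElim (fun i : Option κ => μ (i.elim j e))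
  refine ⟨by fun_prop, ?_⟩
  have h3 : Measurable (fun x : Option κ → X => (x none, fun k => x (some k))) := by fun_prop
  calc _ = ((Measure.infinitePi μ).map (fun x (i : Option κ) => x (i.elim j e))).map
        (fun x => (x none, fun k => x (some k))) := by
          rw [Measure.map_map h3 h1.measurable]; rfl
    _ = _ := by
      rw [h1.map_eq, ← h2.map_eq, Measure.map_map h3 h2.measurable]
      exact Measure.map_id

theorem measurePreserving_consSeq (μ : ℕ → Measure X) [∀ i, IsProbabilityMeasure (μ i)] :
    MeasurePreserving (fun (p : X × (ℕ → X)) => consSeq p.1 p.2)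
      ((μ 0).prod (Measure.infinitePi fun n => μ (n + 1))) (Measure.infinitePi μ) := by
  have hmeas : Measurable (fun (p : X × (ℕ → X)) => consSeq p.1 p.2) := by
    refine measurable_pi_lambda _ fun i => ?_
    cases i with
    | zero => exact measurable_fst
    | succ k => exact (measurable_pi_apply k).comp measurable_snd
  refine ⟨hmeas, ?_⟩
  rw [← (measurePreserving_split μ 0 Nat.succ Nat.succ_injective Nat.succ_ne_zero).map_eq,
    Measure.map_map hmeas (by fun_prop)]
  convert Measure.map_id
  funext x n
  cases n <;> rfl

theorem measurePreserving_uncons (μ : ℕ → Measure X) [∀ i, IsProbabilityMeasure (μ i)] :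
    MeasurePreserving (fun (x : ℕ → X) => (x 0, fun n => x (n + 1)))
      (Measure.infinitePi μ) ((μ 0).prod (Measure.infinitePi fun n => μ (n + 1))) :=
  measurePreserving_split μ 0 Nat.succ Nat.succ_injective Nat.succ_ne_zero

end

end MeasureTheory

/-! ### The product law of the code, and its invariance under the successor map. -/

instance Option.instMeasurableSpaceFin (b : ℕ) : MeasurableSpace (Option (Fin b)) := ⊤

instance Option.instDiscreteMeasurableSpaceFin (b : ℕ) :
    DiscreteMeasurableSpace (Option (Fin b)) := ⟨fun _ => trivial⟩

namespace Code

variable {b : ℕ}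

/-- The probability of a step. -/
def stepW (b : ℕ) : Step b → ℝ≥0∞
  | none => 2⁻¹
  | some _ => (2 * (b : ℝ≥0∞))⁻¹

/-- The law of a step. -/
def stepM (b : ℕ) : Measure (Step b) := ∑ s, stepW b s • Measure.dirac s

theorem lintegral_stepM (f : Step b → ℝ≥0∞) :
    ∫⁻ s, f s ∂stepM b = 2⁻¹ * f none + ∑ i, (2 * (b : ℝ≥0∞))⁻¹ * f (some i) := by
  rw [stepM, lintegral_finsetSum_measure]
  simp [lintegral_smul_measure, stepW, Fintype.sum_option]

theorem stepM_singleton (s : Step b) : stepM b {s} = stepW b s := by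
  rw [← lintegral_indicator_one (MeasurableSet.singleton s), lintegral_stepM]
  cases s with
  | none => simp [stepW]
  | some i => simp [stepW, Set.indicator_apply]

theorem inv_two_mul_eq [NeZero b] : (2 * (b : ℝ≥0∞))⁻¹ = 2⁻¹ * (b : ℝ≥0∞)⁻¹ :=
  ENNReal.mul_inv (Or.inl two_ne_zero) (Or.inl ENNReal.ofNat_ne_top)

theorem natCast_mul_inv [NeZero b] : (b : ℝ≥0∞) * (b : ℝ≥0∞)⁻¹ = 1 :=
  ENNReal.mul_inv_cancel (by simp [NeZero.ne b]) (ENNReal.natCast_ne_top b)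

instance [NeZero b] : IsProbabilityMeasure (stepM b) := by
  refine ⟨?_⟩
  rw [← lintegral_one, lintegral_stepM]
  simp only [mul_one, Finset.sum_const, Finset.card_univ, Fintype.card_fin, nsmul_eq_mul]
  rw [inv_two_mul_eq, mul_left_comm, natCast_mul_inv, mul_one, ENNReal.inv_two_add_inv_two]

variable (b) in
/-- The uniform law on letters. -/
def letterM [NeZero b] : Measure (Fin b) := (PMF.uniformOfFintype (Fin b)).toMeasure

instance [NeZero b] : IsProbabilityMeasure (letterM b) := by unfold letterM; infer_instance

theorem letterM_singleton [NeZero b] (i : Fin b) : letterM b {i} = (b : ℝ≥0∞)⁻¹ := by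
  rw [letterM, PMF.toMeasure_apply_singleton _ _ (MeasurableSet.singleton i)]
  simp

theorem lintegral_letterM [NeZero b] (f : Fin b → ℝ≥0∞) :
    ∫⁻ i, f i ∂letterM b = ∑ i, (b : ℝ≥0∞)⁻¹ * f i := by
  rw [lintegral_fintype]
  exact Finset.sum_congr rfl fun i _ => by rw [letterM_singleton, mul_comm]

variable (b) in
/-- The law of a uniform word. -/
def wordM [NeZero b] : Measure (Word b) := Measure.infinitePi fun _ => letterM b

instance [NeZero b] : IsProbabilityMeasure (wordM b) := by unfold wordM; infer_instance

theorem measurable_consSeq {X : Type*} [MeasurableSpace X] :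
    Measurable (fun (p : X × (ℕ → X)) => consSeq p.1 p.2) := by
  refine measurable_pi_lambda _ fun i => ?_
  cases i with
  | zero => exact measurable_fst
  | succ k => exact (measurable_pi_apply k).comp measurable_snd

theorem lintegral_wordM [NeZero b] {f : Word b → ℝ≥0∞} (hf : Measurable f) :
    ∫⁻ w, f w ∂wordM b = ∑ i, (b : ℝ≥0∞)⁻¹ * ∫⁻ w, f (consSeq i w) ∂wordM b := by
  have h := (measurePreserving_consSeq (fun _ : ℕ => letterM b)).lintegral_comp hf
  have hf' : Measurable fun p : Fin b × (ℕ → Fin b) => f (consSeq p.1 p.2) :=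
    hf.comp measurable_consSeq
  rw [wordM, ← h, lintegral_prod _ hf'.aemeasurable, lintegral_letterM]

theorem measurable_move : Measurable (fun p : Word b × Step b => move p.1 p.2) := by
  refine measurable_from_prod_countable_left fun s => ?_
  cases s with
  | none => exact measurable_pi_lambda _ fun j => measurable_pi_apply (j + 1)
  | some i => exact measurable_consSeq.comp (measurable_const.prodMk measurable_id)

theorem measurable_rev : Measurable (fun p : Word b × Step b => rev p.1 p.2) := by
  refine measurable_from_prod_countable_left fun s => ?_
  cases s with
  | none =>
    exact (Measurable.of_discrete (f := fun i : Fin b => (some i : Step b))).comp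
      (measurable_pi_apply 0)
  | some i => exact measurable_const

/-- The walk on uniform words is reversible. -/
theorem measurePreserving_rev [NeZero b] :
    MeasurePreserving (fun p : Word b × Step b => (move p.1 p.2, rev p.1 p.2))
      ((wordM b).prod (stepM b)) ((wordM b).prod (stepM b)) := by
  have hmeas : Measurable (fun p : Word b × Step b => (move p.1 p.2, rev p.1 p.2)) :=
    measurable_move.prodMk measurable_rev
  refine ⟨hmeas, Measure.ext_of_lintegral _ fun f hf => ?_⟩
  have h1 : ∀ s : Step b, Measurable fun w => f (w, s) := fun s => by fun_prop
  have h2 : ∀ s : Step b, Measurable fun w => f (move w s, rev w s) := fun s =>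
    (hf.comp hmeas).comp (measurable_id.prodMk measurable_const)
  have hf' : Measurable fun p : Word b × Step b => f (move p.1 p.2, rev p.1 p.2) :=
    hf.comp hmeas
  rw [lintegral_map hf hmeas, lintegral_prod _ hf'.aemeasurable,
    lintegral_prod _ hf.aemeasurable]
  simp only [lintegral_stepM]
  rw [lintegral_add_left ((h2 none).const_mul _), lintegral_add_left ((h1 none).const_mul _),
    lintegral_finsetSum _ fun i _ => (h2 (some i)).const_mul _,
    lintegral_finsetSum _ fun i _ => (h1 (some i)).const_mul _]
  simp_rw [lintegral_const_mul _ (h2 _), lintegral_const_mul _ (h1 _)]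
  -- With the last letter `i` split off, the step to the parent has weight `1/2 · 1/b`, which is
  -- that of its reversal, the step to the child `i`. The reversal exchanges the two terms.
  rw [lintegral_wordM (h2 none), lintegral_wordM (h1 none), add_comm]
  congr 1
  · rw [Finset.mul_sum]
    refine Finset.sum_congr rfl fun i _ => ?_
    rw [inv_two_mul_eq, mul_assoc]
    rfl
  · rw [Finset.mul_sum]
    refine Finset.sum_congr rfl fun i _ => ?_
    rw [inv_two_mul_eq, mul_assoc]
    rfl

section

variable (b) [NeZero b]

/-- The law of independent marks. -/
def markM (μ : PMF ℕ) : Measure (Mark b) := Measure.infinitePi fun _ => μ.toMeasure.prod (stepM b)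

instance (μ : PMF ℕ) : IsProbabilityMeasure (markM b μ) := by unfold markM; infer_instance

/-- The law of a sequence of independent families of marks. -/
def marksM (μ : PMF ℕ) : Measure (ℕ → Mark b) := Measure.infinitePi fun _ => markM b μ

instance (μ : PMF ℕ) : IsProbabilityMeasure (marksM b μ) := by unfold marksM; infer_instance

/-- The law of a body whose root has offspring distribution `ρ`. -/
def bodyM (μ ρ : PMF ℕ) : Measure (Body b) := ρ.toMeasure.prod (marksM b μ)

instance (μ ρ : PMF ℕ) : IsProbabilityMeasure (bodyM b μ ρ) := by unfold bodyM; infer_instance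

/-- The law of the spine. -/
def spineM (μ ρ : PMF ℕ) : Measure (Spine b) :=
  Measure.infinitePi fun _ => (stepM b).prod (bodyM b μ ρ)

instance (μ ρ : PMF ℕ) : IsProbabilityMeasure (spineM b μ ρ) := by unfold spineM; infer_instance

/-- The law of the code. -/
def codeM (μ ρ : PMF ℕ) : Measure (Code b) :=
  (bodyM b μ μ).prod ((wordM b).prod (spineM b μ ρ))

instance (μ ρ : PMF ℕ) : IsProbabilityMeasure (codeM b μ ρ) := by unfold codeM; infer_instance

end

variable [NeZero b]

theorem measurePreserving_uncurryMark (μ : PMF ℕ) :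
    MeasurePreserving (fun (m : Mark b) => (m [], fun (i : ℕ) (w : List ℕ) => m (i :: w)))
      (markM b μ) ((μ.toMeasure.prod (stepM b)).prod (marksM b μ)) := by
  have h1 := measurePreserving_split (fun _ : List ℕ => μ.toMeasure.prod (stepM b)) []
    (fun p : ℕ × List ℕ => p.1 :: p.2) (fun p q h => by
      simp only [List.cons.injEq] at h
      exact Prod.ext h.1 h.2) (fun p => List.cons_ne_nil _ _)
  have h2 : MeasurePreserving (MeasurableEquiv.curry ℕ (List ℕ) (ℕ × Step b))
      (Measure.infinitePi fun _ => μ.toMeasure.prod (stepM b)) (marksM b μ) :=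
    ⟨(MeasurableEquiv.curry _ _ _).measurable,
      Measure.infinitePi_map_curry (fun _ _ => μ.toMeasure.prod (stepM b))⟩
  exact ((MeasurePreserving.id _).prod h2).comp h1

/-- The children of the root are the letters `i + 1`: the marks behind the letter `0` are dropped,
and the others remain independent. -/
theorem measurePreserving_splitMark (μ : PMF ℕ) :
    MeasurePreserving (splitMark (b := b)) (markM b μ) ((stepM b).prod (bodyM b μ μ)) := by
  have h1 := measurePreserving_uncurryMark (b := b) μ
  have h2 : MeasurePreserving (fun (x : ℕ → Mark b) (n : ℕ) => x (n + 1)) (marksM b μ)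
      (marksM b μ) :=
    ⟨by fun_prop, Measure.map_infinitePi_infinitePi_of_inj (P := fun _ : ℕ => markM b μ)
      Nat.succ_injective⟩
  have h3 := (MeasurePreserving.prod (Measure.measurePreserving_swap
    (μ := μ.toMeasure) (ν := stepM b)) h2).comp h1
  exact (measurePreserving_prodAssoc _ _ _).comp h3

/-- Reversing the first step makes it independent of the walk that is left. This gives the
invariance of the law under `climb`, and later its ergodicity. -/
theorem measurePreserving_climb {Y : Type*} [MeasurableSpace Y] (ν : Measure Y)
    [IsProbabilityMeasure ν] :
    MeasurePreserving (fun v : Word b × (ℕ → Step b × Y) =>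
        ((rev v.1 (v.2 0).1, (v.2 0).2), climb v))
      ((wordM b).prod (Measure.infinitePi fun _ => (stepM b).prod ν))
      (((stepM b).prod ν).prod ((wordM b).prod (Measure.infinitePi fun _ => (stepM b).prod ν))) := by
  have h1 := (MeasurePreserving.id (wordM b)).prod
    (measurePreserving_uncons (fun _ : ℕ => (stepM b).prod ν))
  have hA : MeasurePreserving (fun p : Word b × ((Step b × Y) × (ℕ → Step b × Y)) =>
      ((p.1, p.2.1.1), (p.2.1.2, p.2.2))) ((wordM b).prod (((stepM b).prod ν).prod
        (Measure.infinitePi fun _ => (stepM b).prod ν)))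
      (((wordM b).prod (stepM b)).prod (ν.prod (Measure.infinitePi fun _ => (stepM b).prod ν))) := by
    have e1 := (measurePreserving_prodAssoc (wordM b) (stepM b)
      (ν.prod (Measure.infinitePi fun _ : ℕ => (stepM b).prod ν))).symm
    have e2 := (MeasurePreserving.id (wordM b)).prod (measurePreserving_prodAssoc (stepM b) ν
      (Measure.infinitePi fun _ : ℕ => (stepM b).prod ν))
    exact e1.comp e2
  have hB := (measurePreserving_rev (b := b)).prod
    (MeasurePreserving.id (ν.prod (Measure.infinitePi fun _ : ℕ => (stepM b).prod ν)))
  have hC : MeasurePreserving (fun p : (Word b × Step b) × (Y × (ℕ → Step b × Y)) =>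
      ((p.1.2, p.2.1), (p.1.1, p.2.2)))
      (((wordM b).prod (stepM b)).prod (ν.prod (Measure.infinitePi fun _ => (stepM b).prod ν)))
      (((stepM b).prod ν).prod
        ((wordM b).prod (Measure.infinitePi fun _ => (stepM b).prod ν))) := by
    refine ⟨by fun_prop, Eq.symm ?_⟩
    refine Measure.prod_eq_generateFrom (C := Set.image2 (· ×ˢ ·) {s | MeasurableSet s}
      {t | MeasurableSet t}) (D := Set.image2 (· ×ˢ ·) {s | MeasurableSet s}
      {t | MeasurableSet t}) generateFrom_prod generateFrom_prod isPiSystem_prod isPiSystem_prod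
      ⟨fun _ => Set.univ, fun _ => ⟨Set.univ, .univ, Set.univ, .univ, Set.univ_prod_univ⟩,
        fun _ => measure_lt_top _ _, Set.iUnion_const _⟩
      ⟨fun _ => Set.univ, fun _ => ⟨Set.univ, .univ, Set.univ, .univ, Set.univ_prod_univ⟩,
        fun _ => measure_lt_top _ _, Set.iUnion_const _⟩ ?_
    rintro _ ⟨s, hs, t, ht, rfl⟩ _ ⟨u, hu, v, hv, rfl⟩
    simp only [Set.mem_ofPred_eq] at hs ht hu hv
    rw [Measure.map_apply (by fun_prop) ((hs.prod ht).prod (hu.prod hv))]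
    have : (fun p : (Word b × Step b) × (Y × (ℕ → Step b × Y)) =>
      ((p.1.2, p.2.1), (p.1.1, p.2.2))) ⁻¹' ((s ×ˢ t) ×ˢ (u ×ˢ v)) =
        (u ×ˢ s) ×ˢ (t ×ˢ v) := by
      ext p
      simp only [Set.mem_preimage, Set.mem_prod]
      tauto
    rw [this]
    simp only [Measure.prod_prod]
    ring
  exact hC.comp (hB.comp (hA.comp h1))

end Code

namespace MeasureTheory

variable {A B C D : Type*} [MeasurableSpace A] [MeasurableSpace B] [MeasurableSpace C]
  [MeasurableSpace D] (α : Measure A) (β : Measure B) (γ : Measure C) (δ : Measure D)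
  [IsProbabilityMeasure α] [IsProbabilityMeasure β] [IsProbabilityMeasure γ]
  [IsProbabilityMeasure δ]

theorem measurePreserving_leftComm :
    MeasurePreserving (fun p : A × (B × C) => (p.2.1, (p.1, p.2.2)))
      (α.prod (β.prod γ)) (β.prod (α.prod γ)) :=
  (measurePreserving_prodAssoc β α γ).comp
    ((Measure.measurePreserving_swap.prod (MeasurePreserving.id γ)).comp
      (measurePreserving_prodAssoc α β γ).symm)

theorem measurePreserving_prodProdComm :
    MeasurePreserving (fun p : (A × B) × (C × D) => ((p.1.1, p.2.1), (p.1.2, p.2.2)))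
      ((α.prod β).prod (γ.prod δ)) ((α.prod γ).prod (β.prod δ)) :=
  (measurePreserving_prodAssoc α γ (β.prod δ)).symm.comp
    (((MeasurePreserving.id α).prod (measurePreserving_leftComm β γ δ)).comp
      (measurePreserving_prodAssoc α β (γ.prod δ)))

end MeasureTheory

namespace Code

variable {b : ℕ}

theorem measurable_splitMark : Measurable (splitMark (b := b)) := by
  refine Measurable.prodMk (by fun_prop) (Measurable.prodMk (by fun_prop) ?_)
  exact measurable_pi_lambda _ fun i => measurable_pi_lambda _ fun w => by fun_prop

theorem measurable_climb {Y : Type*} [MeasurableSpace Y] :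
    Measurable (climb (b := b) (Y := Y)) := by
  refine Measurable.prodMk (measurable_move.comp (f := fun v : Word b × (ℕ → Step b × Y) =>
    (v.1, (v.2 0).1)) ?_) ?_
  · fun_prop
  · fun_prop

theorem measurable_climbC : Measurable (climbC (b := b)) :=
  Measurable.prodMk (f := fun c : Code b => (c.2.2 0).2) (by fun_prop)
    (measurable_climb.comp measurable_snd)

theorem measurable_climbC_iterate (p : ℕ) : Measurable (climbC (b := b))^[p] :=
  measurable_climbC.iterate p

theorem measurable_launch :
    Measurable fun p : Body b × (Word b × Spine b) => launch p.1.1 p.1.2 p.2 := by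
  have h0 : Measurable fun p : Body b × (Word b × Spine b) => splitMark (p.1.2 0) :=
    measurable_splitMark.comp (by fun_prop)
  have h1 : Measurable fun p : Body b × (Word b × Spine b) =>
      (p.2.1, (splitMark (p.1.2 0)).1) :=
    Measurable.prodMk (by fun_prop) h0.fst
  refine Measurable.prodMk h0.snd (Measurable.prodMk (measurable_move.comp h1) ?_)
  refine measurable_consSeq.comp (f := fun p : Body b × (Word b × Spine b) =>
    ((rev p.2.1 (splitMark (p.1.2 0)).1, (p.1.1, fun i => p.1.2 (i + 1))), p.2.2)) ?_
  exact Measurable.prodMk (Measurable.prodMk (measurable_rev.comp h1) (by fun_prop)) (by fun_prop)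

/-- The first ancestor that has a child on the right is the `p`-th one. -/
def firstAt (b p : ℕ) : Set (Code b) :=
  {c | (climbC^[p] c).1.1 ≠ 0 ∧ ∀ q < p, (climbC^[q] c).1.1 = 0}

theorem measurableSet_firstAt (p : ℕ) : MeasurableSet (firstAt b p) := by
  have h : ∀ q, Measurable fun c : Code b => (climbC^[q] c).1.1 := fun q =>
    (measurable_climbC_iterate q).fst.fst
  refine MeasurableSet.inter ?_ ?_
  · exact (h p) (measurableSet_singleton 0).compl
  · have : {c : Code b | ∀ q < p, (climbC^[q] c).1.1 = 0} =
        ⋂ q, ⋂ (_ : q < p), (fun c : Code b => (climbC^[q] c).1.1) ⁻¹' {0} := by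
      ext c; simp
    show MeasurableSet {c : Code b | ∀ q < p, (climbC^[q] c).1.1 = 0}
    rw [this]
    exact MeasurableSet.iInter fun q => MeasurableSet.iInter fun _ =>
      (h q) (measurableSet_singleton 0)

theorem hasNext_iff {c : Code b} : HasNext c ↔ ∃ p, c ∈ firstAt b p := by
  classical
  constructor
  · intro h
    exact ⟨Nat.find h, Nat.find_spec h, fun q hq => not_not.1 (Nat.find_min h hq)⟩
  · rintro ⟨p, hp⟩
    exact ⟨p, hp.1⟩

theorem measurableSet_hasNext : MeasurableSet {c : Code b | HasNext c} := by
  have : {c : Code b | HasNext c} = ⋃ p, firstAt b p := by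
    ext c; simp [hasNext_iff]
  rw [this]
  exact MeasurableSet.iUnion measurableSet_firstAt

/-- For `next` and `disp`, which are given by one formula on each event `firstAt b p` and by a
constant when there is no successor. -/
theorem measurable_of_firstAt {X : Type*} [MeasurableSpace X] {f : Code b → X} (g : ℕ → Code b → X)
    (hg : ∀ p, Measurable (g p)) (x : X) (h : ∀ p, ∀ c ∈ firstAt b p, f c = g p c)
    (hx : ∀ c, ¬ HasNext c → f c = x) : Measurable f := by
  intro S hS
  have : f ⁻¹' S = (⋃ p, firstAt b p ∩ g p ⁻¹' S) ∪
      ({c | HasNext c}ᶜ ∩ {_c | x ∈ S}) := by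
    ext c
    simp only [Set.mem_preimage, Set.mem_union, Set.mem_iUnion, Set.mem_inter_iff,
      Set.mem_compl_iff, Set.mem_ofPred_eq]
    by_cases hc : HasNext c
    · obtain ⟨p, hp⟩ := hasNext_iff.1 hc
      constructor
      · intro h1
        exact Or.inl ⟨p, hp, by rwa [← h p c hp]⟩
      · rintro (⟨q, hq, h1⟩ | h1)
        · rwa [h q c hq]
        · exact absurd hc h1.1
    · rw [hx c hc]
      constructor
      · intro h1; exact Or.inr ⟨hc, h1⟩
      · rintro (⟨q, hq, h1⟩ | h1)
        · exact absurd (hasNext_iff.2 ⟨q, hq⟩) hc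
        · exact h1.2
  rw [this]
  exact (MeasurableSet.iUnion fun p => (measurableSet_firstAt p).inter (hg p hS)).union
    (measurableSet_hasNext.compl.inter (MeasurableSet.const _))

theorem measurable_dh : Measurable (dh (b := b)) := Measurable.of_discrete

variable [NeZero b]

theorem measurable_next : Measurable (next (b := b)) := by
  refine measurable_of_firstAt (fun p c => launch ((climbC^[p] c).1.1 - 1) (climbC^[p] c).1.2
    (climbC^[p] c).2) (fun p => ?_) default (fun p c hc => ?_) (fun c hc => dif_neg hc)
  · have h := measurable_climbC_iterate (b := b) p
    have h2 : Measurable fun k : ℕ => k - 1 := Measurable.of_discrete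
    exact measurable_launch.comp (f := fun c : Code b => (((climbC^[p] c).1.1 - 1,
      (climbC^[p] c).1.2), (climbC^[p] c).2))
      (((h2.comp h.fst.fst).prodMk h.fst.snd).prodMk h.snd)
  · obtain ⟨r, hr⟩ := Nat.exists_eq_succ_of_ne_zero hc.1
    rw [next_eq_launch hr hc.2, hr]
    rfl

theorem measurable_disp : Measurable (disp (b := b)) := by
  refine measurable_of_firstAt (fun p c => (∑ i ∈ Finset.range p, dh (c.2.2 i).1) +
      dh (splitMark ((climbC^[p] c).1.2 0)).1) (fun p => ?_) 0 (fun p c hc => ?_)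
      (fun c hc => dif_neg hc)
  · refine Measurable.add ?_ ?_
    · exact Finset.measurable_sum _ fun i _ => measurable_dh.comp (by fun_prop)
    · have h1 : Measurable fun c : Code b => (climbC^[p] c).1.2 0 :=
        (measurable_pi_apply 0).comp (measurable_climbC_iterate p).fst.snd
      exact measurable_dh.comp (measurable_fst.comp (measurable_splitMark.comp h1))
  · obtain ⟨r, hr⟩ := Nat.exists_eq_succ_of_ne_zero hc.1
    exact disp_eq_sum hr hc.2

/-- The first mark of `N` gives the step to the first child and its body, of root law `μ`; the
number `r`, of law `ρ`, and the other marks form the body left on the right of the line.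
Reversibility puts the word and the reversed step in place. -/
theorem measurePreserving_launch (μ ρ : PMF ℕ) :
    MeasurePreserving (fun p : Body b × (Word b × Spine b) => launch p.1.1 p.1.2 p.2)
      ((bodyM b μ ρ).prod ((wordM b).prod (spineM b μ ρ))) (codeM b μ ρ) := by
  set A := ρ.toMeasure
  set B := stepM b
  set C := bodyM b μ μ
  set D := marksM b μ
  set E := wordM b
  set F := spineM b μ ρ
  have h1 : MeasurePreserving (fun N : ℕ → Mark b => (splitMark (N 0), fun i => N (i + 1)))
      D ((B.prod C).prod D) := by
    have e1 := (measurePreserving_splitMark (b := b) μ).prod (MeasurePreserving.id D)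
    have e2 := measurePreserving_uncons (fun _ : ℕ => markM b μ)
    exact e1.comp e2
  have h2 : MeasurePreserving (fun p : ℕ × (ℕ → Mark b) =>
      (((splitMark (p.2 0)).2, (splitMark (p.2 0)).1), (p.1, fun i => p.2 (i + 1))))
      (A.prod D) ((C.prod B).prod (A.prod D)) :=
    (Measure.measurePreserving_swap.prod (MeasurePreserving.id _)).comp
      ((measurePreserving_leftComm A (B.prod C) D).comp ((MeasurePreserving.id A).prod h1))
  have h3 : MeasurePreserving (fun p : ((Body b × Step b) × Body b) × (Word b × Spine b) =>
      (p.1.1.1, ((p.2.1, p.1.1.2), (p.1.2, p.2.2))))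
      (((C.prod B).prod (A.prod D)).prod (E.prod F)) (C.prod ((E.prod B).prod ((A.prod D).prod F))) :=
    ((MeasurePreserving.id C).prod (Measure.measurePreserving_swap.prod
      (MeasurePreserving.id ((A.prod D).prod F)))).comp
      ((measurePreserving_prodAssoc C (B.prod E) ((A.prod D).prod F)).comp
        (((measurePreserving_prodAssoc C B E).prod (MeasurePreserving.id ((A.prod D).prod F))).comp
          (measurePreserving_prodProdComm (C.prod B) (A.prod D) E F)))
  have h4 : MeasurePreserving (fun p : (Word b × Step b) × (Body b × Spine b) =>
      (move p.1.1 p.1.2, consSeq (rev p.1.1 p.1.2, p.2.1) p.2.2))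
      ((E.prod B).prod ((A.prod D).prod F)) (E.prod F) := by
    have e1 := (measurePreserving_rev (b := b)).prod (MeasurePreserving.id ((A.prod D).prod F))
    have e2 := measurePreserving_prodAssoc E B ((A.prod D).prod F)
    have e3 := (MeasurePreserving.id E).prod
      (measurePreserving_prodAssoc B (A.prod D) F).symm
    have e4 := (MeasurePreserving.id E).prod
      (measurePreserving_consSeq (fun _ : ℕ => B.prod (A.prod D)))
    exact e4.comp (e3.comp (e2.comp e1))
  exact ((MeasurePreserving.id C).prod h4).comp (h3.comp (h2.prod (MeasurePreserving.id _)))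

/-- The tail of the offspring distribution. -/
def tailPMF (μ : PMF ℕ) (hμ : ∑' k : ℕ, (k : ℝ≥0∞) * μ k = 1) : PMF ℕ :=
  ⟨fun r => ∑' l : ℕ, if r + 1 ≤ l then μ l else 0, by
    have : ∑' r : ℕ, ∑' l : ℕ, (if r + 1 ≤ l then μ l else 0) = 1 := by
      rw [ENNReal.tsum_comm, ← hμ]
      refine tsum_congr fun l => ?_
      rw [tsum_eq_sum (s := Finset.range l) fun r hr => if_neg (by
        rw [Finset.mem_range] at hr; omega)]
      rw [Finset.sum_congr rfl fun r hr => if_pos (by rw [Finset.mem_range] at hr; omega)]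
      simp
    rw [← this]
    exact ENNReal.summable.hasSum⟩

variable {μ : PMF ℕ} (hμ : ∑' k : ℕ, (k : ℝ≥0∞) * μ k = 1)

theorem tailPMF_apply (r : ℕ) : tailPMF μ hμ r = ∑' l : ℕ, if r + 1 ≤ l then μ l else 0 := rfl

/-- This and `apply_zero_add_tailPMF` are the two properties of the tail law on which the invariance
rests. -/
theorem tailPMF_succ (r : ℕ) : tailPMF μ hμ r = μ (r + 1) + tailPMF μ hμ (r + 1) := by
  have : ∀ l, (if r + 1 ≤ l then μ l else 0) =
      (if l = r + 1 then μ l else 0) + (if r + 1 + 1 ≤ l then μ l else 0) := by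
    intro l
    split_ifs <;> first | omega | simp
  rw [tailPMF_apply, tailPMF_apply, tsum_congr this, ENNReal.tsum_add, tsum_ite_eq]

theorem apply_zero_add_tailPMF : μ 0 + tailPMF μ hμ 0 = 1 := by
  have : ∀ l, μ l = (if l = 0 then μ l else 0) + (if 0 + 1 ≤ l then μ l else 0) := by
    intro l
    split_ifs <;> first | omega | simp
  rw [← μ.tsum_coe, tsum_congr this, ENNReal.tsum_add, tsum_ite_eq, tailPMF_apply]

theorem lintegral_toMeasure (ρ : PMF ℕ) (f : ℕ → ℝ≥0∞) :
    ∫⁻ k, f k ∂ρ.toMeasure = ∑' k, ρ k * f k := by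
  rw [lintegral_countable']
  exact tsum_congr fun k => by
    rw [PMF.toMeasure_apply_singleton _ _ (measurableSet_singleton k), mul_comm]

theorem lintegral_bodyM (μ ρ : PMF ℕ) {f : Body b → ℝ≥0∞} (hf : Measurable f) :
    ∫⁻ y, f y ∂bodyM b μ ρ = ∑' k, ρ k * ∫⁻ N, f (k, N) ∂marksM b μ := by
  rw [bodyM, lintegral_prod _ hf.aemeasurable, lintegral_toMeasure]

/-- The right-successor map preserves the law of the code. -/
theorem measurePreserving_next :
    MeasurePreserving next (codeM b μ (tailPMF μ hμ)) (codeM b μ (tailPMF μ hμ)) := by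
  refine ⟨measurable_next, Measure.ext fun S hS => ?_⟩
  set ρ := tailPMF μ hμ with hρ
  set V := (wordM b).prod (spineM b μ ρ) with hV
  rw [Measure.map_apply measurable_next hS]
  have hnS := measurable_next hS
  set f : Code b → ℝ≥0∞ := S.indicator 1
  have hf : Measurable f := measurable_one.indicator hS
  have hfn : Measurable fun c => f (next c) := hf.comp measurable_next
  let H : Body b → ℝ≥0∞ := fun y => ∫⁻ v, f (next (y, v)) ∂V
  have hH : Measurable H := hfn.lintegral_prod_right'
  -- `F r` is the probability that the successor is in `S` when `r + 1` children are left, and `G`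
  -- the same probability when the search starts from an ancestor, whose body has root law `ρ`.
  let F : ℕ → ℝ≥0∞ := fun r => ∫⁻ N, ∫⁻ v, f (launch r N v) ∂V ∂marksM b μ
  let G : ℝ≥0∞ := ∫⁻ y, H y ∂bodyM b μ ρ
  have hfl : ∀ c, f c ≤ 1 := fun c => Set.indicator_le_self' (by simp) c |>.trans (by simp)
  have hG1 : G ≤ 1 := by
    refine (lintegral_mono fun y => lintegral_mono fun v => hfl _).trans ?_
    simp
  have hsucc : ∀ r, ∫⁻ N, H (r + 1, N) ∂marksM b μ = F r := fun r =>
    lintegral_congr fun N => lintegral_congr fun v => by rw [next_of_eq_succ (r := r) rfl]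
  -- Without a child, the search restarts at the parent, whose body is independent of its own word
  -- and spine, and these have the law `V` again.
  have hzero : ∀ N, H (0, N) = G := by
    intro N
    have h1 : ∀ v, f (next ((0, N), v)) = f (next ((v.2 0).2, climb v)) := fun v => by
      rw [next_of_eq_zero rfl]; rfl
    show ∫⁻ v, f (next ((0, N), v)) ∂V = G
    simp_rw [h1]
    have h2 := (measurePreserving_climb (b := b) (bodyM b μ ρ))
    have h3 : MeasurePreserving (fun v : Word b × Spine b => ((v.2 0).2, climb v)) V
        ((bodyM b μ ρ).prod V) :=
      ((measurePreserving_snd (μ := stepM b) (ν := bodyM b μ ρ)).prod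
        (MeasurePreserving.id V)).comp h2
    rw [h3.lintegral_comp hfn, lintegral_prod _ hfn.aemeasurable]
  have hbody : ∀ ν : PMF ℕ, ∫⁻ y, H y ∂bodyM b μ ν = ν 0 * G + ∑' r, ν (r + 1) * F r := by
    intro ν
    rw [lintegral_bodyM μ ν hH, tsum_eq_zero_add' ENNReal.summable]
    simp_rw [hsucc, hzero]
    simp
  have hGeq : G = ρ 0 * G + ∑' r, ρ (r + 1) * F r := hbody ρ
  have hl : codeM b μ ρ (next ⁻¹' S) = μ 0 * G + ∑' r, μ (r + 1) * F r := by
    rw [← hbody μ, ← lintegral_indicator_one hnS, codeM]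
    rw [lintegral_prod _ (measurable_one.indicator hnS).aemeasurable]
    rfl
  have hr : codeM b μ ρ S = ∑' r, ρ r * F r := by
    have h1 := (measurePreserving_launch (b := b) μ ρ).lintegral_comp hf
    have h2 : Measurable fun p : Body b × (Word b × Spine b) => f (launch p.1.1 p.1.2 p.2) :=
      hf.comp measurable_launch
    rw [← lintegral_indicator_one hS]
    show ∫⁻ c, f c ∂_ = _
    rw [← h1, lintegral_prod _ h2.aemeasurable, lintegral_bodyM μ ρ h2.lintegral_prod_right']
  -- `μ 0 * G + ρ 0 * G = G`, and the finite term `ρ 0 * G` cancels with the one in `hGeq`.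
  have hμG : μ 0 * G = ∑' r, ρ (r + 1) * F r := by
    have h0 : ρ 0 * G ≠ ∞ := ENNReal.mul_ne_top (ρ.apply_ne_top 0) (ne_top_of_le_ne_top
      ENNReal.one_ne_top hG1)
    have h1 : μ 0 * G + ρ 0 * G = G := by
      rw [← add_mul, apply_zero_add_tailPMF hμ, one_mul]
    rw [add_comm] at h1
    exact (ENNReal.add_right_inj h0).1 (h1.trans hGeq)
  rw [hl, hr, hμG, ← ENNReal.tsum_add]
  refine tsum_congr fun r => ?_
  rw [← add_mul, add_comm, hρ, ← tailPMF_succ hμ r]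

end Code

/-! ### Erasing the marks outside of the tree. -/

/-- The words that belong to the tree with given offspring numbers. -/
def present : (List ℕ → ℕ) → List ℕ → Prop
  | _, [] => True
  | n, i :: w => (1 ≤ i ∧ i ≤ n []) ∧ present (fun u => n (i :: u)) w

theorem present_nil (n : List ℕ → ℕ) : present n [] := trivial

theorem present_cons (n : List ℕ → ℕ) (i : ℕ) (w : List ℕ) :
    present n (i :: w) ↔ (1 ≤ i ∧ i ≤ n []) ∧ present (fun u => n (i :: u)) w := Iff.rfl

namespace Code

variable {b : ℕ}

open Classical in
/-- The marks of the vertices outside of the tree get a default value. -/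
def resetMark (m : Mark b) : Mark b := fun w =>
  if present (fun u => (m u).1) w then m w else (0, none)

/-- The marks of the vertices outside of the tree get a default value. -/
def resetBody (y : Body b) : Body b :=
  (y.1, fun i => if i < y.1 then resetMark (y.2 i) else fun _ => (0, none))

/-- The marks of the vertices outside of the tree get a default value. -/
def reset (c : Code b) : Code b :=
  (resetBody c.1, c.2.1, fun p => ((c.2.2 p).1, resetBody (c.2.2 p).2))

theorem splitMark_resetMark (m : Mark b) :
    splitMark (resetMark m) = ((splitMark m).1, resetBody (splitMark m).2) := by
  have h : resetMark m [] = m [] := if_pos trivial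
  refine Prod.ext ?_ (Prod.ext ?_ ?_)
  · show (resetMark m []).2 = (m []).2
    rw [h]
  · show (resetMark m []).1 = (m []).1
    rw [h]
  · funext i w
    show resetMark m ((i + 1) :: w) = (if i < (m []).1 then _ else _ : Mark b) w
    by_cases hi : i < (m []).1
    · rw [if_pos hi]
      have : present (fun u => (m u).1) ((i + 1) :: w) ↔
          present (fun u => ((splitMark m).2.2 i u).1) w := by
        rw [present_cons]
        exact and_iff_right ⟨by omega, hi⟩
      by_cases hp : present (fun u => (m u).1) ((i + 1) :: w)
      · exact (if_pos hp).trans (if_pos (this.1 hp)).symm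
      · exact (if_neg hp).trans (if_neg (mt this.2 hp)).symm
    · rw [if_neg hi, resetMark, if_neg]
      rw [present_cons]
      rintro ⟨⟨-, h2⟩, -⟩
      exact hi h2

theorem climbC_reset (c : Code b) : climbC (reset c) = reset (climbC c) := rfl

theorem climbC_iterate_reset (c : Code b) (p : ℕ) :
    climbC^[p] (reset c) = reset (climbC^[p] c) :=
  (Function.Commute.iterate_left (f := climbC) (g := reset) climbC_reset p c)

theorem launch_reset {r : ℕ} {c : Code b} (h : c.1.1 = r + 1) :
    launch r (reset c).1.2 (reset c).2 = reset (launch r c.1.2 c.2) := by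
  have h0 : (reset c).1.2 0 = resetMark (c.1.2 0) := if_pos (by omega)
  rw [launch, h0, splitMark_resetMark]
  refine Prod.ext rfl (Prod.ext rfl ?_)
  funext p
  cases p with
  | zero =>
    refine Prod.ext rfl (Prod.ext rfl ?_)
    funext i
    show (if i + 1 < c.1.1 then resetMark (c.1.2 (i + 1)) else _) =
      if i < r then resetMark (c.1.2 (i + 1)) else _
    rw [h]
    simp only [Nat.add_lt_add_iff_right]
  | succ p => rfl

theorem hasNext_reset (c : Code b) : HasNext (reset c) ↔ HasNext c := by
  unfold HasNext
  simp only [climbC_iterate_reset]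
  rfl

theorem firstAt_reset {c : Code b} {p : ℕ} : reset c ∈ firstAt b p ↔ c ∈ firstAt b p := by
  unfold firstAt
  simp only [Set.mem_ofPred_eq, climbC_iterate_reset]
  rfl

theorem disp_reset (c : Code b) : disp (reset c) = disp c := by
  by_cases hc : HasNext c
  · obtain ⟨p, hp⟩ := hasNext_iff.1 hc
    have hp' := firstAt_reset.2 hp
    obtain ⟨r, hr⟩ := Nat.exists_eq_succ_of_ne_zero hp.1
    obtain ⟨r', hr'⟩ := Nat.exists_eq_succ_of_ne_zero hp'.1
    rw [disp_eq_sum hr hp.2, disp_eq_sum hr' hp'.2, climbC_iterate_reset]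
    congr 2
    have h0 : (reset (climbC^[p] c)).1.2 0 = resetMark ((climbC^[p] c).1.2 0) :=
      if_pos (by rw [hr]; omega)
    rw [h0, splitMark_resetMark]
  · have e1 : disp (reset c) = 0 := dif_neg (mt (hasNext_reset c).1 hc)
    have e2 : disp c = 0 := dif_neg hc
    rw [e1, e2]

/-- `next` reads only marks of vertices of the tree. As the code of the random tree is distributed
as a reset code of law `codeM`, this transfers the invariance to it. -/
theorem next_reset [NeZero b] (c : Code b) : next (reset c) = reset (next c) := by
  by_cases hc : HasNext c
  · obtain ⟨p, hp⟩ := hasNext_iff.1 hc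
    have hp' := firstAt_reset.2 hp
    obtain ⟨r, hr⟩ := Nat.exists_eq_succ_of_ne_zero hp.1
    have hr' : (climbC^[p] (reset c)).1.1 = r + 1 := by
      rw [climbC_iterate_reset]
      exact hr
    rw [next_eq_launch hr hp.2, next_eq_launch hr' hp'.2, climbC_iterate_reset]
    exact launch_reset hr
  · have e1 : next (reset c) = default := dif_neg (mt (hasNext_reset c).1 hc)
    have e2 : next c = default := dif_neg hc
    rw [e1, e2]
    -- The junk value `default` has to be fixed by `reset`: its marks are already `(0, none)`.
    have hm : ∀ w, resetMark (default : Mark b) w = (0, none) := fun w => by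
      unfold resetMark
      split_ifs <;> rfl
    have hb : resetBody (default : Body b) = default := by
      refine Prod.ext rfl ?_
      funext i w
      exact congrFun (if_neg (Nat.not_lt_zero i) :
        (if i < 0 then resetMark ((default : Body b).2 i) else fun _ => (0, none)) = _) w
    refine Prod.ext hb.symm (Prod.ext rfl ?_)
    funext p
    exact Prod.ext rfl hb.symm

theorem next_iterate_reset [NeZero b] (c : Code b) (n : ℕ) :
    next^[n] (reset c) = reset (next^[n] c) :=
  (Function.Commute.iterate_left (f := next) (g := reset) next_reset n c)

theorem pos_reset [NeZero b] (c : Code b) (n : ℕ) : pos (reset c) n = pos c n := by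
  refine BiWord.ext ?_ ?_
  · simp only [pos, next_iterate_reset, disp_reset]
  · simp only [pos, next_iterate_reset]
    rfl

theorem measurableSet_present {X : Type*} [MeasurableSpace X] (f : X → List ℕ → ℕ)
    (hf : Measurable f) (w : List ℕ) : MeasurableSet {x | present (f x) w} := by
  induction w generalizing f with
  | nil => exact MeasurableSet.univ
  | cons i w ih =>
    have h1 : Measurable fun x => f x [] := (measurable_pi_apply _).comp hf
    have h2 := ih (fun x u => f x (i :: u)) (measurable_pi_lambda _ fun u =>
      (measurable_pi_apply _).comp hf)
    exact ((MeasurableSet.const _).inter (measurableSet_le measurable_const h1)).inter h2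

theorem measurable_resetMark : Measurable (resetMark (b := b)) := by
  refine measurable_pi_lambda _ fun w => ?_
  refine Measurable.ite ?_ (measurable_pi_apply w) measurable_const
  exact measurableSet_present (fun (m : Mark b) u => (m u).1) (by fun_prop) w

theorem measurable_resetBody : Measurable (resetBody (b := b)) := by
  refine Measurable.prodMk measurable_fst (measurable_pi_lambda _ fun i => ?_)
  refine Measurable.ite ?_ (measurable_resetMark.comp (by fun_prop)) measurable_const
  exact measurableSet_lt measurable_const measurable_fst

theorem measurable_reset : Measurable (reset (b := b)) := by
  refine Measurable.prodMk (measurable_resetBody.comp measurable_fst)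
    (Measurable.prodMk (by fun_prop) (measurable_pi_lambda _ fun p => ?_))
  exact Measurable.prodMk (by fun_prop) (measurable_resetBody.comp (by fun_prop))

end Code

/-! ### The law of the offspring numbers of a Galton–Watson tree. -/

/-- The subtree that stems from a child of the root. -/
def subTree (i : ℕ) (t : Set (List ℕ)) : Set (List ℕ) := {w | (i + 1) :: w ∈ t}

open Classical in
/-- The offspring numbers of a rooted tree. -/
def offs (t : Set (List ℕ)) (w : List ℕ) : ℕ := if w ∈ t then {i | w ++ [i] ∈ t}.ncard else 0

open Classical in
/-- The offspring numbers of the vertices that are not in the tree are replaced with `0`. -/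
def resetOffs (n : List ℕ → ℕ) (w : List ℕ) : ℕ := if present n w then n w else 0

/-- The offspring numbers of a tree, from the offspring numbers of the subtrees. -/
def glue (k : ℕ) (g : Fin k → List ℕ → ℕ) : List ℕ → ℕ
  | [] => k
  | 0 :: _ => 0
  | (i + 1) :: w => if h : i < k then g ⟨i, h⟩ w else 0

/-- Truncation at a given height. -/
def truncO (n : ℕ) (f : List ℕ → ℕ) (w : List ℕ) : ℕ := if w.length < n then f w else 0

theorem truncO_glue (n k : ℕ) (g : Fin k → List ℕ → ℕ) :
    truncO (n + 1) (glue k g) = glue k (fun i => truncO n (g i)) := by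
  funext w
  match w with
  | [] => simp [truncO, glue]
  | 0 :: w => simp [truncO, glue]
  | (i + 1) :: w =>
    simp only [truncO, glue, List.length_cons, Nat.add_lt_add_iff_right]
    split_ifs <;> rfl

/-- `IsRootedTree.offs_eq_glue` is the same recursion at the root for the offspring numbers of a
tree; comparing the two recursions identifies the laws, one generation at a time. -/
theorem resetOffs_eq_glue (m : List ℕ → ℕ) :
    resetOffs m = glue (m []) (fun i => resetOffs (fun w => m ((i + 1) :: w))) := by
  funext w
  match w with
  | [] => simp [resetOffs, glue, present]
  | 0 :: w => simp [resetOffs, glue, present]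
  | (i + 1) :: w =>
    by_cases h : i < m []
    · have h' : 1 ≤ i + 1 ∧ i + 1 ≤ m [] := ⟨by omega, h⟩
      have e : present m ((i + 1) :: w) ↔ present (fun u => m ((i + 1) :: u)) w :=
        (present_cons _ _ _).trans (and_iff_right h')
      show _ = if h : i < m [] then _ else 0
      rw [dif_pos h]
      by_cases hp : present m ((i + 1) :: w)
      · exact (if_pos hp).trans (if_pos (e.1 hp)).symm
      · exact (if_neg hp).trans (if_neg (mt e.2 hp)).symm
    · have : ¬ (i + 1 ≤ m []) := by omega
      simp [resetOffs, glue, present, h]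

theorem resetOffs_nil (m : List ℕ → ℕ) : resetOffs m [] = m [] := if_pos trivial

theorem present_resetOffs (m : List ℕ → ℕ) (w : List ℕ) :
    present (resetOffs m) w ↔ present m w := by
  induction w generalizing m with
  | nil => exact Iff.rfl
  | cons i w ih =>
    rw [present_cons, present_cons, resetOffs_nil]
    refine and_congr_right fun h => ?_
    rw [← ih (fun u => m (i :: u))]
    have : (fun u => resetOffs m (i :: u)) = resetOffs (fun u => m (i :: u)) := by
      funext u
      by_cases hp : present (fun u => m (i :: u)) u
      · exact (if_pos ((present_cons m i u).2 ⟨h, hp⟩)).trans (if_pos hp).symm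
      · exact (if_neg fun h' => hp ((present_cons m i u).1 h').2).trans (if_neg hp).symm
    rw [this]

namespace IsRootedTree

variable {t : Set (List ℕ)}

theorem mem_of_append (ht : IsRootedTree t) (u w : List ℕ) (h : u ++ w ∈ t) : u ∈ t := by
  induction w using List.reverseRecOn with
  | nil => simpa using h
  | append_singleton w i ih => exact ih (ht.parent_mem _ i (by simpa using h))

theorem append_mem_iff (ht : IsRootedTree t) {u : List ℕ} (hu : u ∈ t) (i : ℕ) :
    u ++ [i] ∈ t ↔ 1 ≤ i ∧ i ≤ offs t u := by
  obtain ⟨k, hk⟩ := ht.children u hu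
  have : {i | u ++ [i] ∈ t} = Set.Icc 1 k := by
    ext j; exact hk j
  rw [hk, offs, if_pos hu, this, Set.ncard_eq_toFinset_card']
  simp

theorem offs_nil (ht : IsRootedTree t) : offs t [] = {i | [i] ∈ t}.ncard := if_pos ht.nil_mem

theorem cons_mem_iff (ht : IsRootedTree t) (i : ℕ) : [i] ∈ t ↔ 1 ≤ i ∧ i ≤ offs t [] := ht.append_mem_iff ht.nil_mem i

theorem subTree (ht : IsRootedTree t) (i : ℕ) (hi : i < offs t []) : IsRootedTree (subTree i t) where
  nil_mem := (ht.cons_mem_iff (i + 1)).2 ⟨by omega, hi⟩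
  parent_mem w j h := ht.parent_mem ((i + 1) :: w) j h
  children w hw := ht.children ((i + 1) :: w) hw

theorem offs_eq_glue (ht : IsRootedTree t) : offs t = glue (offs t []) (fun i => offs (_root_.subTree i t)) := by
  funext w
  match w with
  | [] => simp [glue]
  | 0 :: w =>
    refine if_neg fun h => ?_
    have := (ht.cons_mem_iff 0).1 (ht.mem_of_append [0] w h)
    omega
  | (i + 1) :: w =>
    show _ = if h : i < offs t [] then _ else 0
    by_cases h : i < offs t []
    · rw [dif_pos h]; rfl
    · rw [dif_neg h]
      refine if_neg fun h' => ?_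
      have := (ht.cons_mem_iff (i + 1)).1 (ht.mem_of_append [i + 1] w h')
      omega

theorem mem_iff_present {t : Set (List ℕ)} (ht : IsRootedTree t) (w : List ℕ) :
    w ∈ t ↔ present (offs t) w := by
  induction w generalizing t with
  | nil => exact iff_of_true ht.nil_mem trivial
  | cons i w ih =>
    rw [present_cons, ← ht.cons_mem_iff]
    constructor
    · intro h
      have h1 := ht.mem_of_append [i] w h
      refine ⟨h1, ?_⟩
      obtain ⟨h2, h3⟩ := (ht.cons_mem_iff i).1 h1
      obtain ⟨j, rfl⟩ : ∃ j, i = j + 1 := ⟨i - 1, by omega⟩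
      exact (ih (ht.subTree j h3)).1 h
    · rintro ⟨h1, h⟩
      obtain ⟨h2, h3⟩ := (ht.cons_mem_iff i).1 h1
      obtain ⟨j, rfl⟩ : ∃ j, i = j + 1 := ⟨i - 1, by omega⟩
      exact (ih (ht.subTree j h3)).2 h

end IsRootedTree

theorem measurable_subTree (i : ℕ) : Measurable (subTree i) :=
  measurable_set_iff.2 fun _ => measurable_set_mem _

theorem measurable_offs : Measurable offs := by
  refine measurable_pi_lambda _ fun w => Measurable.ite (measurableSet_mem w) ?_ measurable_const
  exact measurable_ncard.comp (measurable_set_iff.2 fun i => measurable_set_mem _)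

theorem measurable_resetOffs : Measurable resetOffs :=
  measurable_pi_lambda _ fun w => Measurable.ite (Code.measurableSet_present id measurable_id w)
    (measurable_pi_apply w) measurable_const

theorem measurable_truncO (n : ℕ) : Measurable (truncO n) :=
  measurable_pi_lambda _ fun w => by
    unfold truncO
    split_ifs
    · exact measurable_pi_apply w
    · exact measurable_const

theorem measurable_glue (k : ℕ) : Measurable (glue k) := by
  refine measurable_pi_lambda _ fun w => ?_
  match w with
  | [] => exact measurable_const
  | 0 :: w => exact measurable_const
  | (i + 1) :: w =>
    show Measurable fun g : Fin k → List ℕ → ℕ => if h : i < k then g ⟨i, h⟩ w else 0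
    split_ifs
    · fun_prop
    · exact measurable_const

/-- Two laws on families of offspring numbers with the same truncations are equal. -/
theorem measure_ext_truncO {α β : Measure (List ℕ → ℕ)} [IsFiniteMeasure α] [IsFiniteMeasure β]
    (h : ∀ n, α.map (truncO n) = β.map (truncO n)) : α = β := by
  refine IsProjectiveLimit.unique (P := fun I => β.map I.restrict) (fun I => ?_) (fun I => rfl)
  obtain ⟨n, hn⟩ : ∃ n, ∀ w ∈ I, w.length < n :=
    ⟨I.sup List.length + 1, fun w hw => Nat.lt_succ_of_le (Finset.le_sup (f := List.length) hw)⟩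
  have e : I.restrict ∘ truncO n = (I.restrict : (List ℕ → ℕ) → _) := by
    funext f w
    exact if_pos (hn w w.2)
  have h1 := congrArg (fun m => Measure.map I.restrict m) (h n)
  simp only [Measure.map_map (Finset.measurable_restrict I) (measurable_truncO n), e] at h1
  exact h1

/-- The law of the offspring numbers of a Galton--Watson tree. -/
def offsM (μ : PMF ℕ) : Measure (List ℕ → ℕ) :=
  (Measure.infinitePi fun _ => μ.toMeasure).map resetOffs

instance (μ : PMF ℕ) : IsProbabilityMeasure (offsM μ) :=
  Measure.isProbabilityMeasure_map measurable_resetOffs.aemeasurable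

theorem offsM_truncO_succ (μ : PMF ℕ) (n : ℕ) {S : Set (List ℕ → ℕ)} (hS : MeasurableSet S) :
    (offsM μ).map (truncO (n + 1)) S = ∑' k, μ k *
      (Measure.infinitePi fun _ : Fin k => (offsM μ).map (truncO n)) (glue k ⁻¹' S) := by
  have hmp : MeasurePreserving (fun m : List ℕ → ℕ => (m [], fun (i : ℕ) w => m ((i + 1) :: w)))
      (Measure.infinitePi fun _ => μ.toMeasure)
      (μ.toMeasure.prod (Measure.infinitePi fun _ => Measure.infinitePi fun _ => μ.toMeasure)) := by
    have h1 := measurePreserving_split (fun _ : List ℕ => μ.toMeasure) []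
      (fun p : ℕ × List ℕ => (p.1 + 1) :: p.2) (fun p q h => by
        simp only [List.cons.injEq, Nat.add_right_cancel_iff] at h
        exact Prod.ext h.1 h.2) (fun p => List.cons_ne_nil _ _)
    have h2 : MeasurePreserving (MeasurableEquiv.curry ℕ (List ℕ) ℕ)
        (Measure.infinitePi fun _ => μ.toMeasure)
        (Measure.infinitePi fun _ => Measure.infinitePi fun _ => μ.toMeasure) :=
      ⟨(MeasurableEquiv.curry _ _ _).measurable,
        Measure.infinitePi_map_curry (fun _ _ => μ.toMeasure)⟩
    exact ((MeasurePreserving.id _).prod h2).comp h1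
  have hT := (measurable_truncO (n + 1)).comp measurable_resetOffs
  have hG : ∀ k, Measurable fun h : ℕ → List ℕ → ℕ =>
      glue k (fun i : Fin k => truncO n (resetOffs (h i))) := fun k =>
    (measurable_glue k).comp (measurable_pi_lambda _ fun i =>
      (measurable_truncO n).comp (measurable_resetOffs.comp (measurable_pi_apply _)))
  have hGm : Measurable fun p : ℕ × (ℕ → List ℕ → ℕ) =>
      glue p.1 (fun i : Fin p.1 => truncO n (resetOffs (p.2 i))) :=
    measurable_from_prod_countable_right hG
  have e : (fun m : List ℕ → ℕ => truncO (n + 1) (resetOffs m)) =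
      (fun p : ℕ × (ℕ → List ℕ → ℕ) =>
        glue p.1 (fun i : Fin p.1 => truncO n (resetOffs (p.2 i)))) ∘
      (fun m : List ℕ → ℕ => (m [], fun (i : ℕ) w => m ((i + 1) :: w))) := by
    funext m
    rw [resetOffs_eq_glue, truncO_glue]
    rfl
  have e0 : (offsM μ).map (truncO (n + 1)) = (Measure.infinitePi fun _ => μ.toMeasure).map
      (fun m : List ℕ → ℕ => truncO (n + 1) (resetOffs m)) :=
    Measure.map_map (measurable_truncO _) measurable_resetOffs
  rw [e0, e, ← Measure.map_map hGm hmp.measurable, hmp.map_eq,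
    Measure.map_apply hGm hS, Measure.prod_apply (hGm hS), Code.lintegral_toMeasure]
  refine tsum_congr fun k => ?_
  congr 1
  have h1 : (Measure.infinitePi fun _ : ℕ => Measure.infinitePi fun _ : List ℕ => μ.toMeasure).map
      (fun h (i : Fin k) => truncO n (resetOffs (h i))) =
      Measure.infinitePi fun _ : Fin k => (offsM μ).map (truncO n) := by
    have e1 := Measure.map_infinitePi_infinitePi_of_inj
      (P := fun _ : ℕ => Measure.infinitePi fun _ : List ℕ => μ.toMeasure)
      (Fin.val_injective (n := k))
    have e2 := Measure.infinitePi_map_pi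
      (μ := fun _ : Fin k => Measure.infinitePi fun _ : List ℕ => μ.toMeasure)
      (f := fun _ => truncO n ∘ resetOffs)
      (fun _ => (measurable_truncO n).comp measurable_resetOffs)
    rw [← e1, Measure.map_map (by
      exact measurable_pi_lambda _ fun i => ((measurable_truncO n).comp
        measurable_resetOffs).comp (measurable_pi_apply i)) (by fun_prop)] at e2
    rw [offsM, Measure.map_map (measurable_truncO _) measurable_resetOffs, ← e2]
    rfl
  have h2 : Measurable fun (h : ℕ → List ℕ → ℕ) (i : Fin k) => truncO n (resetOffs (h i)) :=
    measurable_pi_lambda _ fun i =>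
      (measurable_truncO n).comp (measurable_resetOffs.comp (measurable_pi_apply _))
  rw [← h1, Measure.map_apply h2 (measurable_glue k hS)]
  rfl

theorem IsGWLaw.truncO_succ {μ : PMF ℕ} {ν : Measure (Set (List ℕ))} (h : IsGWLaw μ ν) (n : ℕ)
    {S : Set (List ℕ → ℕ)} (hS : MeasurableSet S) :
    (ν.map offs).map (truncO (n + 1)) S = ∑' k, μ k *
      (Measure.infinitePi fun _ : Fin k => (ν.map offs).map (truncO n)) (glue k ⁻¹' S) := by
  have := h.isProbabilityMeasure
  have hT := (measurable_truncO (n + 1)).comp measurable_offs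
  have hk : Measurable fun t : Set (List ℕ) => {i | [i] ∈ t}.ncard :=
    measurable_ncard.comp (measurable_set_iff.2 fun i => measurable_set_mem _)
  rw [Measure.map_map (measurable_truncO _) measurable_offs, Measure.map_apply hT hS]
  have hU : (⋃ k, {t : Set (List ℕ) | {i | [i] ∈ t}.ncard = k}) = Set.univ := by
    ext t; simp
  rw [← Set.univ_inter ((truncO (n + 1) ∘ offs) ⁻¹' S), ← hU, Set.iUnion_inter,
    measure_iUnion (f := fun k => {t : Set (List ℕ) | {i | [i] ∈ t}.ncard = k} ∩
      (truncO (n + 1) ∘ offs) ⁻¹' S) (fun i j hij => Set.disjoint_left.2 fun t h1 h2 =>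
      hij (h1.1.symm.trans h2.1)) (fun k => (hk (measurableSet_singleton k)).inter (hT hS))]
  refine tsum_congr fun k => ?_
  set E := {t : Set (List ℕ) | {i | [i] ∈ t}.ncard = k} with hE
  have hEm : MeasurableSet E := hk (measurableSet_singleton k)
  have hEk : ν E = μ k := h.offspring k
  by_cases hμk : μ k = 0
  · rw [hμk, zero_mul]
    exact measure_mono_null Set.inter_subset_left (hEk.trans hμk)
  have hE0 : ν E ≠ 0 := by rwa [hEk]
  have hcp : IsProbabilityMeasure (ProbabilityTheory.cond ν E) := cond_isProbabilityMeasure hE0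
  have hfm : Measurable fun t : Set (List ℕ) => fun i : Fin k => truncO n (offs (subTree i t)) :=
    measurable_pi_lambda _ fun i => (measurable_truncO n).comp
      (measurable_offs.comp (measurable_subTree i))
  have hlaw : (ProbabilityTheory.cond ν E).map
      (fun t (i : Fin k) => truncO n (offs (subTree i t))) =
      Measure.infinitePi fun _ : Fin k => (ν.map offs).map (truncO n) := by
    have hind : iIndepFun (fun (i : Fin k) (t : Set (List ℕ)) => subTree i t)
        (ProbabilityTheory.cond ν E) := by
      -- The hypothesis on the subtrees starts at `k = 1`; for `k = 0` the family is empty.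
      rcases Nat.eq_zero_or_pos k with h0 | h1
      · subst h0
        exact iIndepFun.of_subsingleton
      · exact h.subtrees_indep k h1 hμk
    have hl : ∀ i : Fin k, (ProbabilityTheory.cond ν E).map (subTree i) = ν := fun i =>
      h.subtrees_law k (by have := i.2; omega) hμk i
    have hind2 := hind.comp (fun _ => truncO n ∘ offs)
      (fun _ => (measurable_truncO n).comp measurable_offs)
    have := (iIndepFun_iff_map_fun_eq_infinitePi_map (fun i => ((measurable_truncO n).comp
      measurable_offs).comp (measurable_subTree _))).1 hind2
    refine this.trans ?_
    congr 1
    funext i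
    rw [← Measure.map_map ((measurable_truncO n).comp measurable_offs) (measurable_subTree _), hl,
      Measure.map_map (measurable_truncO n) measurable_offs]
  have hc : ν (E ∩ (truncO (n + 1) ∘ offs) ⁻¹' S) =
      μ k * ProbabilityTheory.cond ν E ((truncO (n + 1) ∘ offs) ⁻¹' S) := by
    rw [cond_apply hEm, ← hEk, ← mul_assoc, ENNReal.mul_inv_cancel hE0 (measure_ne_top _ _),
      one_mul]
  rw [hc, ← hlaw, Measure.map_apply hfm (measurable_glue k hS)]
  congr 1
  refine measure_congr ?_
  have hae : ∀ᵐ t ∂ProbabilityTheory.cond ν E, IsRootedTree t :=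
    cond_absolutelyContinuous.ae_le h.ae_tree
  have haeE : ∀ᵐ t ∂ProbabilityTheory.cond ν E, t ∈ E := ae_cond_mem hEm
  filter_upwards [hae, haeE] with t ht htE
  have e1 : offs t [] = k := ht.offs_nil.trans htE
  have e2 := ht.offs_eq_glue
  rw [e1] at e2
  have e3 : truncO (n + 1) (offs t) = glue k fun i => truncO n (offs (subTree i t)) := by
    rw [e2, truncO_glue]
  exact congrArg (· ∈ S) e3

/-- The law of the offspring numbers of a Galton--Watson tree. -/
theorem IsGWLaw.map_offs {μ : PMF ℕ} {ν : Measure (Set (List ℕ))} (h : IsGWLaw μ ν) :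
    ν.map offs = offsM μ := by
  have := h.isProbabilityMeasure
  have h2 : IsProbabilityMeasure (ν.map offs) :=
    Measure.isProbabilityMeasure_map measurable_offs.aemeasurable
  refine measure_ext_truncO fun n => ?_
  induction n with
  | zero =>
    have e : truncO 0 = fun _ => 0 := by
      funext f w
      exact if_neg (Nat.not_lt_zero _)
    rw [e, Measure.map_const, Measure.map_const, measure_univ, measure_univ]
  | succ n ih =>
    refine Measure.ext fun S hS => ?_
    rw [h.truncO_succ n hS, offsM_truncO_succ μ n hS, ih]

/-! ### The law of an infinite pointed Galton–Watson tree, level by level. -/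

namespace MeasureTheory

/-- A measure on sequences which has the right value on the boxes built from generating
`π`-systems is the product measure. -/
theorem eq_infinitePi_nat {X : ℕ → Type*} [mX : ∀ i, MeasurableSpace (X i)]
    (μ : ∀ i, Measure (X i)) [∀ i, IsProbabilityMeasure (μ i)] (C : ∀ i, Set (Set (X i)))
    (hC : ∀ i, MeasurableSpace.generateFrom (C i) = mX i) (hC' : ∀ i, IsPiSystem (C i))
    (hC'' : ∀ i, IsCountablySpanning (C i)) {ν : Measure (∀ i, X i)}
    (hν : ∀ m : ℕ, ∀ t : ∀ i, Set (X i), (∀ i, t i ∈ C i) →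
      ν {x | ∀ i < m + 1, x i ∈ t i} = ∏ i ∈ Finset.range (m + 1), μ i (t i)) :
    ν = Measure.infinitePi μ := by
  classical
  have hm : ∀ i, ∀ t ∈ C i, MeasurableSet t := fun i t ht => by
    have := MeasurableSpace.measurableSet_generateFrom ht
    rwa [hC i] at this
  refine ((Measure.isProjectiveLimit_infinitePi μ).unique
    ((isProjectiveLimit_nat_iff' (isProjectiveMeasureFamily_pi μ) _ 0).2 fun m _ => ?_)).symm
  choose u hu hu' using hC''
  refine (Measure.pi_eq_generateFrom (C := fun i : Finset.Iic m => C i) (fun i => hC i)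
    (fun i => hC' i) (fun i => ⟨u i, hu i, fun _ => measure_lt_top _ _, hu' i⟩)
    fun t ht => ?_).symm
  -- Coordinates beyond `m` are not constrained; any member of the class serves there, since `univ`
  -- need not be one.
  let t' : ∀ i, Set (X i) := fun i => if hi : i ∈ Finset.Iic m then t ⟨i, hi⟩ else u i 0
  have ht' : ∀ i, t' i ∈ C i := fun i => by
    simp only [t']
    split_ifs with hi
    · exact ht ⟨i, hi⟩
    · exact hu i 0
  have e : ∀ i : Finset.Iic m, t' i = t i := fun i => dif_pos i.2
  have := hν m t' ht'
  rw [Measure.map_apply (by fun_prop) (MeasurableSet.univ_pi fun i => hm _ _ (ht i))]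
  have hr : Finset.range (m + 1) = Finset.Iic m := by
    ext i; simp [Nat.lt_succ_iff]
  rw [hr, ← Finset.prod_coe_sort] at this
  refine Eq.trans ?_ (this.trans (Finset.prod_congr rfl fun i _ => by rw [e]))
  congr 1
  ext x
  simp only [Set.mem_preimage, Set.mem_pi, Set.mem_univ, true_implies, Set.mem_ofPred_eq]
  constructor
  · intro h i hi
    have := h ⟨i, Finset.mem_Iic.2 (Nat.lt_succ_iff.1 hi)⟩
    rw [← e] at this
    exact this
  · intro h i
    rw [← e]
    exact h i (Nat.lt_succ_iff.2 (Finset.mem_Iic.1 i.2))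

end MeasureTheory

/-- The number of children of a vertex, and the offspring numbers in the trees stemming from
them. -/
abbrev Level := ℕ × (ℕ → List ℕ → ℕ)

/-- The offspring numbers of the vertices that are not in the tree are replaced with `0`. -/
def resetLevel (y : Level) : Level :=
  (y.1, fun i => if i < y.1 then resetOffs (y.2 i) else fun _ => 0)

theorem measurable_resetLevel : Measurable resetLevel := by
  refine Measurable.prodMk measurable_fst (measurable_pi_lambda _ fun i => ?_)
  refine Measurable.ite ?_ (measurable_resetOffs.comp (by fun_prop)) measurable_const
  exact measurableSet_lt measurable_const measurable_fst

/-- The law of independent levels. -/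
def freeLevelM (μ ρ : PMF ℕ) : Measure Level :=
  ρ.toMeasure.prod (Measure.infinitePi fun _ => Measure.infinitePi fun _ => μ.toMeasure)

instance (μ ρ : PMF ℕ) : IsProbabilityMeasure (freeLevelM μ ρ) := by
  unfold freeLevelM; infer_instance

/-- The law of a level of a Galton--Watson tree. -/
def levelM (μ ρ : PMF ℕ) : Measure Level := (freeLevelM μ ρ).map resetLevel

instance (μ ρ : PMF ℕ) : IsProbabilityMeasure (levelM μ ρ) :=
  Measure.isProbabilityMeasure_map measurable_resetLevel.aemeasurable

-- Beyond the `r` children, `resetLevel` puts the zero family, which makes these factors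
-- deterministic.
open Classical in
theorem levelM_box (μ ρ : PMF ℕ) (r : ℕ) (s : Finset ℕ) (B : ℕ → Set (List ℕ → ℕ))
    (hB : ∀ i, MeasurableSet (B i)) :
    levelM μ ρ ({r} ×ˢ (s : Set ℕ).pi B) =
      ρ r * ∏ i ∈ s, if i < r then offsM μ (B i) else if (fun _ => 0) ∈ B i then 1 else 0 := by
  rw [levelM, Measure.map_apply measurable_resetLevel ((measurableSet_singleton r).prod
    (MeasurableSet.pi s.countable_toSet fun i _ => hB i))]
  have e : resetLevel ⁻¹' ({r} ×ˢ (s : Set ℕ).pi B) = {r} ×ˢ (s : Set ℕ).pi (fun i =>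
      if i < r then resetOffs ⁻¹' B i else if (fun _ => 0) ∈ B i then Set.univ else ∅) := by
    ext y
    simp only [resetLevel, Set.mem_preimage, Set.mem_prod, Set.mem_singleton_iff, Set.mem_pi]
    refine and_congr_right fun hr => forall₂_congr fun i _ => ?_
    rw [hr]
    split_ifs with h1 h2 <;> simp_all
  rw [e, freeLevelM, Measure.prod_prod, PMF.toMeasure_apply_singleton _ _
    (measurableSet_singleton r), Measure.infinitePi_pi]
  · congr 1
    refine Finset.prod_congr rfl fun i _ => ?_
    split_ifs
    · rw [offsM, Measure.map_apply measurable_resetOffs (hB i)]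
    · simp
    · simp
  · intro i _
    split_ifs
    · exact measurable_resetOffs (hB i)
    · exact MeasurableSet.univ
    · exact MeasurableSet.empty

/-- The offspring numbers of a rooted tree, as a level. -/
def levelOf (n : List ℕ → ℕ) : Level := (n [], fun i w => n ((i + 1) :: w))

theorem measurable_levelOf : Measurable levelOf := by
  refine Measurable.prodMk (measurable_pi_apply _) ?_
  exact measurable_pi_lambda _ fun i => measurable_pi_lambda _ fun w => measurable_pi_apply _

theorem levelOf_resetOffs (n : List ℕ → ℕ) : levelOf (resetOffs n) = resetLevel (levelOf n) := by
  refine Prod.ext (resetOffs_nil n) ?_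
  funext i w
  show resetOffs n ((i + 1) :: w) = (if i < n [] then _ else fun _ => 0 : List ℕ → ℕ) w
  rw [resetOffs_eq_glue]
  show (if h : i < n [] then _ else 0) = _
  by_cases h : i < n []
  · rw [dif_pos h, if_pos h]
    rfl
  · rw [dif_neg h, if_neg h]

theorem measurePreserving_levelOf (μ : PMF ℕ) :
    MeasurePreserving levelOf (Measure.infinitePi fun _ => μ.toMeasure) (freeLevelM μ μ) := by
  have h1 := measurePreserving_split (fun _ : List ℕ => μ.toMeasure) []
    (fun p : ℕ × List ℕ => (p.1 + 1) :: p.2) (fun p q h => by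
      simp only [List.cons.injEq, Nat.add_right_cancel_iff] at h
      exact Prod.ext h.1 h.2) (fun p => List.cons_ne_nil _ _)
  have h2 : MeasurePreserving (MeasurableEquiv.curry ℕ (List ℕ) ℕ)
      (Measure.infinitePi fun _ => μ.toMeasure)
      (Measure.infinitePi fun _ => Measure.infinitePi fun _ => μ.toMeasure) :=
    ⟨(MeasurableEquiv.curry _ _ _).measurable,
      Measure.infinitePi_map_curry (fun _ _ => μ.toMeasure)⟩
  exact ((MeasurePreserving.id _).prod h2).comp h1

theorem map_levelOf_offsM (μ : PMF ℕ) : (offsM μ).map levelOf = levelM μ μ := by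
  rw [offsM, levelM, ← (measurePreserving_levelOf μ).map_eq,
    Measure.map_map measurable_levelOf measurable_resetOffs,
    Measure.map_map measurable_resetLevel measurable_levelOf]
  congr 1
  funext n
  exact levelOf_resetOffs n

namespace PTree

open BiWord

variable {T : PTree}

theorem isRootedTree_subtree {u : BiWord ℕ} (hu : u ∈ T.carrier) :
    IsRootedTree (T.subtree u) where
  nil_mem := hu
  parent_mem w i h := by
    have h1 := T.isTree.parent_mem _ (show u.append (w ++ [i]) ∈ T.carrier from h)
    rw [append_concat, parent_child] at h1
    exact h1
  children w hw := by
    obtain ⟨k, hk⟩ := T.isTree.children _ hw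
    refine ⟨k, fun i => ?_⟩
    rw [← hk, ← append_concat]
    rfl

theorem offs_subtree {u : BiWord ℕ} {w : List ℕ} (h : u.append w ∈ T.carrier) :
    offs (T.subtree u) w = T.numChildren (u.append w) := by
  refine (if_pos h).trans ?_
  congr 1
  ext i
  show u.append (w ++ [i]) ∈ T.carrier ↔ (u.append w).child i ∈ T.carrier
  rw [append_concat]

theorem subtree_eq_empty {u : BiWord ℕ} (hu : u ∉ T.carrier) : T.subtree u = ∅ := by
  ext w
  exact iff_of_false (fun h => hu (mem_of_append_mem h)) (Set.notMem_empty w)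

theorem offs_empty : offs ∅ = fun _ => 0 := by
  funext w
  exact if_neg (Set.notMem_empty w)

/-- The offspring numbers in the right part of a tree. -/
def levels (T : PTree) : ℕ → Level
  | 0 => levelOf (offs (T.subtree T.pt))
  -- The first child of `ϱ(p + 1)` is meant to be `ϱ(p)`: it is not counted, and the others begin at
  -- the letter `2`.
  | p + 1 => (T.numChildren (T.spine (p + 1)) - 1,
      fun i => offs (T.subtree ((T.spine (p + 1)).child (2 + i))))

theorem measurable_pt : Measurable PTree.pt :=
  measurable_fst.comp (comap_measurable (fun T : PTree => (T.pt, fun p => T.subtree (T.spine p))))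

theorem measurable_subtree_spine (p : ℕ) : Measurable fun T : PTree => T.subtree (T.spine p) :=
  ((measurable_pi_apply p).comp measurable_snd).comp
    (comap_measurable (fun T : PTree => (T.pt, fun p => T.subtree (T.spine p))))

theorem measurable_subtree_append (p : ℕ) (u : List ℕ) :
    Measurable fun T : PTree => T.subtree ((T.spine p).append u) := by
  refine measurable_set_iff.2 fun w => ?_
  have := measurable_set_iff.1 (measurable_subtree_spine p) (u ++ w)
  have e : (fun T : PTree => w ∈ T.subtree ((T.spine p).append u)) =
      fun T => u ++ w ∈ T.subtree (T.spine p) := by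
    funext T
    show (((T.spine p).append u).append w ∈ T.carrier) = ((T.spine p).append (u ++ w) ∈ T.carrier)
    rw [append_append]
  rwa [e]

theorem measurable_numChildren_append (p : ℕ) (u : List ℕ) :
    Measurable fun T : PTree => T.numChildren ((T.spine p).append u) := by
  refine measurable_ncard.comp (measurable_set_iff.2 fun i => ?_)
  have := measurable_set_iff.1 (measurable_subtree_spine p) (u ++ [i])
  have e : (fun T : PTree => i ∈ {i | ((T.spine p).append u).child i ∈ T.carrier}) =
      fun T => u ++ [i] ∈ T.subtree (T.spine p) := by
    funext T
    show (((T.spine p).append u).child i ∈ T.carrier) = ((T.spine p).append (u ++ [i]) ∈ T.carrier)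
    rw [append_concat]
  rwa [e]

theorem measurable_levels : Measurable levels := by
  refine measurable_pi_lambda _ fun p => ?_
  cases p with
  | zero =>
    refine measurable_levelOf.comp (measurable_offs.comp ?_)
    have := measurable_subtree_spine 0
    simpa only [spine_zero] using this
  | succ p =>
    refine Measurable.prodMk ?_ (measurable_pi_lambda _ fun i => measurable_offs.comp
      (measurable_subtree_append (p + 1) [2 + i]))
    exact (Measurable.of_discrete (f := fun k : ℕ => k - 1)).comp
      (measurable_numChildren_append (p + 1) [])

end PTree

/-- The boxes of levels. -/
def levelBoxes : Set (Set Level) :=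
  Set.image2 (· ×ˢ ·) (Set.range fun r : ℕ => ({r} : Set ℕ))
    (squareCylinders fun _ : ℕ => {s : Set (List ℕ → ℕ) | MeasurableSet s})

theorem generateFrom_levelBoxes :
    MeasurableSpace.generateFrom levelBoxes = (inferInstance : MeasurableSpace Level) := by
  refine generateFrom_eq_prod ?_ generateFrom_squareCylinders
    ⟨fun r => {r}, fun r => ⟨r, rfl⟩, Set.iUnion_of_singleton ℕ⟩
    ⟨fun _ => Set.univ, fun _ => ⟨∅, fun _ => Set.univ, fun _ _ => by simp, by simp⟩,
      Set.iUnion_const _⟩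
  refine le_antisymm (fun s _ => trivial) fun s _ => ?_
  rw [← Set.biUnion_of_singleton s]
  exact MeasurableSet.biUnion s.to_countable fun r _ =>
    MeasurableSpace.measurableSet_generateFrom ⟨r, rfl⟩

theorem isPiSystem_levelBoxes : IsPiSystem levelBoxes := by
  refine IsPiSystem.prod ?_ (isPiSystem_squareCylinders
    (fun _ => MeasurableSpace.isPiSystem_measurableSet) (fun _ => by simp))
  rintro _ ⟨r, rfl⟩ _ ⟨r', rfl⟩ ⟨x, hx, hx'⟩
  simp only [Set.mem_singleton_iff] at hx hx'
  subst hx hx'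
  exact ⟨x, (Set.inter_self _).symm⟩

theorem isCountablySpanning_levelBoxes : IsCountablySpanning levelBoxes := by
  refine ⟨fun r => {r} ×ˢ Set.univ, fun r => ⟨{r}, ⟨r, rfl⟩, Set.univ, ⟨∅, fun _ => Set.univ,
    fun _ _ => by simp, by simp⟩, rfl⟩, ?_⟩
  ext y
  simp

namespace IsInfPointedGW

open BiWord PTree

variable {μ : PMF ℕ} (hμ : ∑' k : ℕ, (k : ℝ≥0∞) * μ k = 1) {Ω : Type*} [MeasurableSpace Ω]
  {P : Measure Ω} {τ : Ω → PTree}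

theorem rightDispatch_apply (s : ℕ) :
    rightDispatch μ (1, s + 1) = Code.tailPMF μ hμ s := by
  rw [rightDispatch, if_pos ⟨rfl, by simp⟩, hμ, div_one]
  rfl

theorem measurable_spineType (h : IsInfPointedGW μ (rightDispatch μ) P τ) (p : ℕ) :
    Measurable fun ω => (((τ ω).spine p).last, (τ ω).numChildren ((τ ω).spine (p + 1))) := by
  refine Measurable.prodMk ?_ ((measurable_numChildren_append (p + 1) []).comp h.measurable)
  have h1 : Measurable fun T : PTree => (T.spine p).last := by
    have e : (fun T : PTree => (T.spine p).last) = fun T => T.pt.letter p := by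
      funext T
      rw [spine_eq, last, letter_parent_iterate]
      simp
    rw [e]
    have h2 : Measurable fun u : BiWord ℕ => u.letter p :=
      ((measurable_pi_apply p).comp measurable_snd).comp
        (comap_measurable (fun u : BiWord ℕ => (u.height, u.letter)))
    exact h2.comp measurable_pt
  exact h1.comp h.measurable

theorem ae_spineType (h : IsInfPointedGW μ (rightDispatch μ) P τ) :
    ∀ᵐ ω ∂P, ∀ p, ((τ ω).spine p).last = 1 ∧ 1 ≤ (τ ω).numChildren ((τ ω).spine (p + 1)) := by
  refine ae_all_iff.2 fun p => ?_
  have h1 : ∀ s : ℕ × ℕ, ∀ᵐ ω ∂P, ¬ (s.1 = 1 ∧ 1 ≤ s.2) →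
      (((τ ω).spine p).last, (τ ω).numChildren ((τ ω).spine (p + 1))) ≠ s := by
    intro s
    by_cases hs : s.1 = 1 ∧ 1 ≤ s.2
    · exact Filter.Eventually.of_forall fun ω h => absurd hs h
    · have := h.spine_law p s
      rw [rightDispatch, if_neg hs] at this
      filter_upwards [measure_eq_zero_iff_ae_notMem.1 this] with ω hω _ hs'
      exact hω hs'
  filter_upwards [ae_all_iff.2 h1] with ω hω
  by_contra hno
  exact hω _ hno rfl

theorem measure_spineTypes (h : IsInfPointedGW μ (rightDispatch μ) P τ) (m : ℕ) (s : ℕ → ℕ) :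
    P {ω | ∀ p < m, (((τ ω).spine p).last, (τ ω).numChildren ((τ ω).spine (p + 1))) =
      (1, s p + 1)} = ∏ p ∈ Finset.range m, Code.tailPMF μ hμ (s p) := by
  have h1 := h.spine_indep.measure_inter_preimage_eq_mul (Finset.range m)
    (sets := fun p => {((1, s p + 1) : ℕ × ℕ)}) (fun p _ => measurableSet_singleton _)
  have e : {ω | ∀ p < m, (((τ ω).spine p).last, (τ ω).numChildren ((τ ω).spine (p + 1))) =
      (1, s p + 1)} = ⋂ p ∈ Finset.range m, (fun ω => (((τ ω).spine p).last,
        (τ ω).numChildren ((τ ω).spine (p + 1)))) ⁻¹' {(1, s p + 1)} := by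
    ext ω; simp
  rw [e, h1]
  exact Finset.prod_congr rfl fun p _ => (h.spine_law p _).trans (rightDispatch_apply hμ _)

variable [IsProbabilityMeasure P]

open Classical in
/-- The law of finitely many levels. -/
theorem measure_levels (h : IsInfPointedGW μ (rightDispatch μ) P τ) (m : ℕ) (A : Set Level)
    (hA : MeasurableSet A) (s : ℕ → ℕ) (I : ℕ → Finset ℕ) (B : ℕ → ℕ → Set (List ℕ → ℕ))
    (hB : ∀ p i, MeasurableSet (B p i)) :
    P {ω | levels (τ ω) 0 ∈ A ∧ ∀ p < m, levels (τ ω) (p + 1) ∈ {s p} ×ˢ (I p : Set ℕ).pi (B p)} =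
      levelM μ μ A * ∏ p ∈ Finset.range m,
        levelM μ (Code.tailPMF μ hμ) ({s p} ×ˢ (I p : Set ℕ).pi (B p)) := by
  obtain ⟨ν, hν, hsub⟩ := h.subtrees
  have hCs : ∀ p, MeasurableSet {ω | (((τ ω).spine p).last,
      (τ ω).numChildren ((τ ω).spine (p + 1))) = (1, s p + 1)} := fun p =>
    h.measurable_spineType p (measurableSet_singleton _)
  -- The hypothesis conditions on the spine types of the first ancestors. If this event is null,
  -- both sides vanish.
  by_cases hC : P {ω | ∀ p < m, (((τ ω).spine p).last,
      (τ ω).numChildren ((τ ω).spine (p + 1))) = (1, s p + 1)} = 0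
  · have h2 := measure_spineTypes hμ h m s
    rw [hC] at h2
    have h3 : ∏ p ∈ Finset.range m,
        levelM μ (Code.tailPMF μ hμ) ({s p} ×ˢ (I p : Set ℕ).pi (B p)) = 0 := by
      obtain ⟨p, hp, hp0⟩ := Finset.prod_eq_zero_iff.1 h2.symm
      refine Finset.prod_eq_zero hp ?_
      rw [levelM_box _ _ _ _ _ (hB p), hp0, zero_mul]
    rw [h3, mul_zero]
    refine measure_mono_null_ae ?_ hC
    filter_upwards [h.ae_spineType] with ω hω hmem p hp
    have := (hmem.2 p hp).1
    simp only [levels, Set.mem_singleton_iff] at this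
    have h4 := hω p
    exact Prod.ext h4.1 (by simp only; omega)
  set C := {ω | ∀ p < m, (((τ ω).spine p).last,
      (τ ω).numChildren ((τ ω).spine (p + 1))) = (1, s p + 1)} with hCdef
  have hCm : MeasurableSet C := by
    have : C = ⋂ p, ⋂ (_ : p < m), {ω | (((τ ω).spine p).last,
        (τ ω).numChildren ((τ ω).spine (p + 1))) = (1, s p + 1)} := by
      ext ω; simp [hCdef]
    rw [this]
    exact MeasurableSet.iInter fun p => MeasurableSet.iInter fun _ => hCs p
  obtain ⟨f, ⟨hind, hlaw⟩, hf0, hf1⟩ : ∃ f : Option {q : ℕ × ℕ // q.1 < m ∧ 1 ≤ q.2 ∧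
      q.2 ≤ s q.1 + 1 ∧ q.2 ≠ 1} → Ω → Set (List ℕ),
      (iIndepFun f (ProbabilityTheory.cond P C) ∧
        ∀ a, (ProbabilityTheory.cond P C).map (f a) = ν) ∧
      (∀ ω, f none ω = (τ ω).subtree (τ ω).pt) ∧
      ∀ q ω, f (some q) ω = (τ ω).subtree (((τ ω).spine (q.1.1 + 1)).child q.1.2) :=
    ⟨_, hsub m (fun p => (1, s p + 1)) hC, fun _ => rfl, fun _ _ => rfl⟩
  have := hν.isProbabilityMeasure
  have hcp : IsProbabilityMeasure (ProbabilityTheory.cond P C) := cond_isProbabilityMeasure hC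
  -- The constrained children that exist. The index `i` stands for the letter `2 + i`, and `ϱ(p +
  -- 1)` has such a child exactly when `i < s p`.
  let Sf : Finset (Σ _ : ℕ, ℕ) :=
    (Finset.range m).sigma fun p => (I p).filter (· < s p)
  have hSf : ∀ q : Sf, q.1.1 < m ∧ q.1.2 ∈ I q.1.1 ∧ q.1.2 < s q.1.1 := fun q => by
    have h1 := Finset.mem_sigma.1 q.2
    have h2 := Finset.mem_filter.1 h1.2
    exact ⟨Finset.mem_range.1 h1.1, h2.1, h2.2⟩
  let e : Option Sf → Option {q : ℕ × ℕ // q.1 < m ∧ 1 ≤ q.2 ∧ q.2 ≤ s q.1 + 1 ∧ q.2 ≠ 1} :=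
    Option.map fun q => ⟨(q.1.1, 2 + q.1.2), (hSf q).1, by simp only; omega, by
      have := (hSf q).2.2
      simp only; omega, by simp only; omega⟩
  have he : Function.Injective e := by
    refine Option.map_injective fun q q' hqq => ?_
    simp only [Subtype.mk.injEq, Prod.mk.injEq, Nat.add_left_cancel_iff] at hqq
    exact Subtype.ext (Sigma.ext hqq.1 (heq_of_eq hqq.2))
  let K : Option Sf → Set (Set (List ℕ)) := fun a => match a with
    | none => (fun t => levelOf (offs t)) ⁻¹' A
    | some q => offs ⁻¹' B q.1.1 q.1.2
  have hK : ∀ a, MeasurableSet (K a) := fun a => by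
    cases a with
    | none => exact (measurable_levelOf.comp measurable_offs) hA
    | some q => exact measurable_offs (hB _ _)
  have hprod := (hind.precomp he).measure_inter_preimage_eq_mul Finset.univ
    (sets := K) (fun a _ => hK a)
  have hm : ∀ a, ProbabilityTheory.cond P C (f (e a) ⁻¹' K a) = ν (K a) := fun a => by
    have h1 : AEMeasurable (f (e a)) (ProbabilityTheory.cond P C) := by
      -- Measurability follows from the law: the image of a measure by a map that is not almost
      -- everywhere measurable is zero, and `ν` is not zero.
      by_contra hno
      have h2 := hlaw (e a)
      rw [Measure.map_of_not_aemeasurable hno] at h2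
      exact IsProbabilityMeasure.ne_zero ν h2.symm
    rw [← Measure.map_apply_of_aemeasurable h1 (hK a), hlaw]
  simp only [hm, Fintype.prod_option] at hprod
  have hKν : ∀ q : Sf, ν (K (some q)) = offsM μ (B q.1.1 q.1.2) := fun q => by
    rw [← hν.map_offs, Measure.map_apply measurable_offs (hB _ _)]
  have hK0 : ν (K none) = levelM μ μ A := by
    rw [← map_levelOf_offsM, ← hν.map_offs, Measure.map_map measurable_levelOf measurable_offs,
      Measure.map_apply (measurable_levelOf.comp measurable_offs) hA]
    rfl
  simp only [hKν, hK0] at hprod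
  rw [Finset.prod_coe_sort Sf (fun q => offsM μ (B q.1 q.2)), Finset.prod_sigma] at hprod
  set G := ⋂ a ∈ (Finset.univ : Finset (Option Sf)), f (e a) ⁻¹' K a with hG
  have hmem : ∀ ω, ω ∈ G ↔ levelOf (offs ((τ ω).subtree (τ ω).pt)) ∈ A ∧
      ∀ p < m, ∀ i ∈ I p, i < s p →
        offs ((τ ω).subtree (((τ ω).spine (p + 1)).child (2 + i))) ∈ B p i := by
    intro ω
    simp only [hG, Set.mem_iInter, Finset.mem_univ, true_implies]
    constructor
    · intro hh
      refine ⟨by have := hh none; rwa [Set.mem_preimage, show e none = none from rfl, hf0] at this,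
        fun p hp i hi his => ?_⟩
      have := hh (some ⟨⟨p, i⟩, by simp [Sf, Finset.mem_sigma, hp, hi, his]⟩)
      rwa [Set.mem_preimage, show e (some _) = some _ from rfl, hf1] at this
    · rintro ⟨h1, h2⟩ a
      cases a with
      | none => rw [Set.mem_preimage, show e none = none from rfl, hf0]; exact h1
      | some q =>
        rw [Set.mem_preimage, show e (some _) = some _ from rfl, hf1]
        exact h2 _ (hSf q).1 _ (hSf q).2.1 (hSf q).2.2
  -- The other constrained children are absent and have zero offspring numbers, so that the
  -- constraint on them does not depend on `ω`.
  have hev : ∀ᵐ ω ∂P, (levels (τ ω) 0 ∈ A ∧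
      ∀ p < m, levels (τ ω) (p + 1) ∈ {s p} ×ˢ (I p : Set ℕ).pi (B p)) ↔
      (ω ∈ C ∩ G ∧ ∀ p < m, ∀ i ∈ I p, ¬ i < s p → (fun _ => 0) ∈ B p i) := by
    filter_upwards [h.ae_spineType] with ω hω
    have hCi : ω ∈ C ↔ ∀ p < m, (τ ω).numChildren ((τ ω).spine (p + 1)) - 1 = s p := by
      refine forall₂_congr fun p _ => ?_
      have h4 := hω p
      rw [Prod.mk.injEq]
      constructor
      · rintro ⟨-, h5⟩; omega
      · intro h5; exact ⟨h4.1, by omega⟩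
    have hab : ω ∈ C → ∀ p < m, ∀ i, ¬ i < s p →
        offs ((τ ω).subtree (((τ ω).spine (p + 1)).child (2 + i))) = fun _ => 0 := by
      intro hωC p hp i hi
      rw [subtree_eq_empty, offs_empty]
      rw [child_mem_iff ((τ ω).spine_mem _)]
      have := hCi.1 hωC p hp
      omega
    rw [Set.mem_inter_iff, hmem]
    simp only [levels, Set.mem_prod, Set.mem_singleton_iff, Set.mem_pi, Finset.mem_coe]
    constructor
    · rintro ⟨h1, h2⟩
      have hωC := hCi.2 fun p hp => (h2 p hp).1
      exact ⟨⟨hωC, h1, fun p hp i hi _ => (h2 p hp).2 i hi⟩, fun p hp i hi his => by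
        rw [← hab hωC p hp i his]
        exact (h2 p hp).2 i hi⟩
    · rintro ⟨⟨hωC, h1, h2⟩, h3⟩
      refine ⟨h1, fun p hp => ⟨hCi.1 hωC p hp, fun i hi => ?_⟩⟩
      by_cases his : i < s p
      · exact h2 p hp i hi his
      · rw [hab hωC p hp i his]
        exact h3 p hp i hi his
  have hPG : P (C ∩ G) = P C * (levelM μ μ A * ∏ p ∈ Finset.range m,
      ∏ i ∈ (I p).filter (· < s p), offsM μ (B p i)) := by
    rw [← hprod, cond_apply hCm, ← mul_assoc, ENNReal.mul_inv_cancel hC (measure_ne_top _ _),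
      one_mul]
  have hPC := measure_spineTypes hμ h m s
  refine (measure_congr (Filter.eventuallyEq_set.2 hev)).trans ?_
  by_cases habs : ∀ p < m, ∀ i ∈ I p, ¬ i < s p → (fun _ => 0) ∈ B p i
  · have e1 : {ω | ω ∈ C ∩ G ∧ ∀ p < m, ∀ i ∈ I p, ¬ i < s p → (fun _ => 0) ∈ B p i} = C ∩ G := by
      ext ω
      exact and_iff_left habs
    refine (congrArg P e1).trans ?_
    rw [hPG, hPC, mul_left_comm, ← Finset.prod_mul_distrib]
    congr 1
    refine Finset.prod_congr rfl fun p hp => ?_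
    rw [levelM_box _ _ _ _ _ (hB p), Finset.prod_filter]
    congr 1
    refine Finset.prod_congr rfl fun i hi => ?_
    by_cases his : i < s p
    · rw [if_pos his, if_pos his]
    · rw [if_neg his, if_neg his, if_pos (habs p (Finset.mem_range.1 hp) i hi his)]
  · have e1 : {ω | ω ∈ C ∩ G ∧ ∀ p < m, ∀ i ∈ I p, ¬ i < s p → (fun _ => 0) ∈ B p i} = ∅ := by
      ext ω
      exact iff_of_false (fun hh => habs hh.2) (Set.notMem_empty _)
    refine (congrArg P e1).trans ?_
    rw [measure_empty]
    push Not at habs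
    obtain ⟨p, hp, i, hi, his, hB0⟩ := habs
    symm
    refine mul_eq_zero_of_right _ (Finset.prod_eq_zero (Finset.mem_range.2 hp) ?_)
    rw [levelM_box _ _ _ _ _ (hB p)]
    refine mul_eq_zero_of_right _ (Finset.prod_eq_zero hi ?_)
    rw [if_neg (not_lt.2 his), if_neg hB0]

/-- The law of the offspring numbers in the right part of an infinite Galton--Watson tree. -/
theorem map_levels (h : IsInfPointedGW μ (rightDispatch μ) P τ) :
    P.map (fun ω => levels (τ ω)) =
      Measure.infinitePi (fun p => levelM μ (consSeq μ (fun _ => Code.tailPMF μ hμ) p)) := by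
  have hmeas : Measurable fun ω => levels (τ ω) := measurable_levels.comp h.measurable
  -- Level `0` comes from one Galton–Watson tree and allows all measurable sets; on the other levels
  -- a box prescribes the number of children, on which one can then condition.
  let D : ℕ → Set (Set Level) := consSeq {s | MeasurableSet s} (fun _ => levelBoxes)
  refine eq_infinitePi_nat _ D (fun i => ?_) (fun i => ?_) (fun i => ?_) fun m t ht => ?_
  · cases i with
    | zero => exact MeasurableSpace.generateFrom_measurableSet
    | succ i => exact generateFrom_levelBoxes
  · cases i with
    | zero => exact MeasurableSpace.isPiSystem_measurableSet
    | succ i => exact isPiSystem_levelBoxes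
  · cases i with
    | zero => exact isCountablySpanning_measurableSet
    | succ i => exact isCountablySpanning_levelBoxes
  · have h0 : MeasurableSet (t 0) := ht 0
    have h1 : ∀ p, ∃ (r : ℕ) (I : Finset ℕ) (B : ℕ → Set (List ℕ → ℕ)),
        (∀ i, MeasurableSet (B i)) ∧ t (p + 1) = {r} ×ˢ (I : Set ℕ).pi B := by
      intro p
      obtain ⟨_, ⟨r, rfl⟩, _, ⟨I, B, hB, rfl⟩, hr⟩ := ht (p + 1)
      exact ⟨r, I, B, fun i => hB i trivial, hr.symm⟩
    choose s I B hB ht1 using h1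
    have hbox : ∀ p, MeasurableSet (t (p + 1)) := fun p => by
      rw [ht1]
      exact (measurableSet_singleton _).prod
        (MeasurableSet.pi (I p).countable_toSet fun i _ => hB p i)
    have e : {x : ℕ → Level | ∀ i < m + 1, x i ∈ t i} =
        {x | x 0 ∈ t 0 ∧ ∀ p < m, x (p + 1) ∈ t (p + 1)} := by
      ext x
      constructor
      · intro hx
        exact ⟨hx 0 (Nat.succ_pos m), fun p hp => hx (p + 1) (Nat.succ_lt_succ hp)⟩
      · rintro ⟨hx0, hx⟩ i hi
        cases i with
        | zero => exact hx0
        | succ i => exact hx i (Nat.lt_of_succ_lt_succ hi)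
    have hms : MeasurableSet {x : ℕ → Level | ∀ i < m + 1, x i ∈ t i} := by
      have : {x : ℕ → Level | ∀ i < m + 1, x i ∈ t i} =
          ⋂ i, ⋂ (_ : i < m + 1), (fun x : ℕ → Level => x i) ⁻¹' t i := by
        ext x; simp
      rw [this]
      refine MeasurableSet.iInter fun i => MeasurableSet.iInter fun _ => measurable_pi_apply i ?_
      cases i with
      | zero => exact h0
      | succ i => exact hbox i
    rw [Measure.map_apply hmeas hms, e, Finset.prod_range_succ']
    have := measure_levels hμ h m (t 0) h0 s I B hB
    simp only [← ht1] at this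
    exact this.trans (mul_comm _ _)

end IsInfPointedGW

/-! ### Independence of the steps of the branching random walk. -/

namespace BiWord

variable {A : Type*} [MeasurableSpace A]

theorem measurable_height_letter : Measurable fun u : BiWord A => (u.height, u.letter) :=
  comap_measurable _

theorem measurable_height : Measurable (height : BiWord A → ℤ) :=
  measurable_fst.comp measurable_height_letter

theorem measurable_letter : Measurable (letter : BiWord A → ℕ → A) :=
  measurable_snd.comp measurable_height_letter

theorem measurable_of_height_letter {X : Type*} [MeasurableSpace X] {f : X → BiWord A}
    (h1 : Measurable fun x => (f x).height) (h2 : Measurable fun x => (f x).letter) :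
    Measurable f := by
  rintro _ ⟨S, hS, rfl⟩
  exact (h1.prodMk h2) hS

theorem measurableSet_eq_biWord [MeasurableSingletonClass A] [Countable A] {X : Type*}
    [MeasurableSpace X]
    {f g : X → BiWord A} (hf : Measurable f) (hg : Measurable g) : MeasurableSet {x | f x = g x} := by
  have e : {x | f x = g x} = {x | (f x).height = (g x).height} ∩
      ⋂ j, {x | (f x).letter j = (g x).letter j} := by
    ext x
    simp only [Set.mem_ofPred_eq, Set.mem_inter_iff, Set.mem_iInter, BiWord.ext_iff, funext_iff]
  rw [e]
  refine (measurableSet_eq_fun (measurable_height.comp hf) (measurable_height.comp hg)).inter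
    (MeasurableSet.iInter fun j => ?_)
  have h1 : ∀ f : X → BiWord A, Measurable f → Measurable fun x => (f x).letter j :=
    fun f hf => (measurable_pi_apply j).comp (measurable_letter.comp hf)
  have : {x | (f x).letter j = (g x).letter j} =
      ⋃ a, (fun x => (f x).letter j) ⁻¹' {a} ∩ (fun x => (g x).letter j) ⁻¹' {a} := by
    ext x
    simp [eq_comm]
  rw [this]
  exact MeasurableSet.iUnion fun a => ((h1 f hf) (measurableSet_singleton a)).inter
    ((h1 g hg) (measurableSet_singleton a))

theorem measurable_parent : Measurable (parent : BiWord A → BiWord A) := by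
  refine measurable_of_height_letter (measurable_height.sub_const 1) ?_
  exact measurable_pi_lambda _ fun j => (measurable_pi_apply (j + 1)).comp measurable_letter

theorem measurable_last : Measurable (last : BiWord A → A) :=
  (measurable_pi_apply 0).comp measurable_letter

theorem eq_parent_iterate_or (u v : BiWord ℕ) :
    (∃ k, v = parent^[k] u) ∨ parentToward u v = v.parent := by
  by_cases h : u.trunc v.height = v
  · left
    rcases le_or_gt v.height u.height with h1 | h1
    · refine ⟨(u.height - v.height).toNat, ?_⟩
      rw [← trunc_sub]
      conv_lhs => rw [← h]
      congr 1
      omega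
    · exact ⟨0, by rw [trunc_eq_self _ h1.le] at h; exact h.symm⟩
  · right
    rw [parentToward, if_neg h]

end BiWord

namespace Code

variable {b : ℕ}

theorem measurable_stepOf :
    Measurable fun p : BiWord (Fin b) × BiWord (Fin b) => stepOf p.1 p.2 := by
  refine Measurable.ite ?_ measurable_const ?_
  · exact BiWord.measurableSet_eq_biWord measurable_snd (BiWord.measurable_parent.comp measurable_fst)
  · exact (Measurable.of_discrete (f := fun i : Fin b => (some i : Step b))).comp
      (BiWord.measurable_last.comp measurable_snd)

theorem stepProb_moveBi (x : BiWord (Fin b)) (s : Step b) :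
    stepProb x (moveBi x s) = stepW b s := by
  classical
  have h1 : ∀ s', (moveBi x s = moveBi x s') ↔ s = s' := fun s' => (moveBi_injective x).eq_iff
  have h2 : stepProb x (moveBi x s) = (if s = none then 2⁻¹ else 0) +
      ∑ i : Fin b, if s = some i then (2 * (b : ℝ≥0∞))⁻¹ else 0 := by
    unfold stepProb
    congr 1
    · exact if_congr (h1 none) rfl rfl
    · exact Finset.sum_congr rfl fun i _ => if_congr (h1 (some i)) rfl rfl
  rw [h2]
  cases s with
  | none => simp [stepW]
  | some i => simp [stepW]

end Code

namespace PTree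

open BiWord Code

variable {T : PTree}

theorem parentToward_mem {v : BiWord ℕ} (hv : v ∈ T.carrier) (hne : v ≠ T.pt) :
    parentToward T.pt v ∈ T.carrier := by
  rcases eq_parent_iterate_or T.pt v with ⟨k, hk⟩ | h
  · cases k with
    | zero => exact absurd hk hne
    | succ k =>
      rw [hk, parentToward_parent_iterate]
      exact T.parent_iterate_mem T.pt_mem k
  · rw [h]
    exact T.isTree.parent_mem v hv

theorem exists_iterate_parentToward {v : BiWord ℕ} (hv : v ∈ T.carrier) :
    ∃ n, (parentToward T.pt)^[n] v = T.pt := by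
  have h0 : ∀ p, ∃ n, (parentToward T.pt)^[n] (parent^[p] T.pt) = T.pt := by
    intro p
    induction p with
    | zero => exact ⟨0, rfl⟩
    | succ p ih =>
      obtain ⟨n, hn⟩ := ih
      exact ⟨n + 1, by rw [Function.iterate_succ_apply, parentToward_parent_iterate, hn]⟩
  obtain ⟨p, w, rfl⟩ := exists_append_spine hv
  clear hv
  induction w using List.reverseRecOn with
  | nil => rw [append_nil, spine_eq]; exact h0 p
  | append_singleton w i ih =>
    rcases eq_parent_iterate_or T.pt ((T.spine p).append (w ++ [i])) with ⟨k, hk⟩ | h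
    · rw [hk]; exact h0 k
    · rw [append_concat, parent_child] at h
      obtain ⟨n, hn⟩ := ih
      exact ⟨n + 1, by rw [Function.iterate_succ_apply, append_concat, h, hn]⟩

/-- A finite set of vertices is contained in a finite set that is connected to the point. -/
theorem exists_closed_finset (J : Finset (BiWord ℕ)) (hJ : ↑J ⊆ T.carrier) :
    ∃ F : Finset (BiWord ℕ), J ⊆ F ∧ ↑F ⊆ T.carrier ∧ T.pt ∈ F ∧
      ∀ v ∈ F, v ≠ T.pt → parentToward T.pt v ∈ F := by
  classical
  induction J using Finset.induction_on with
  | empty => exact ⟨{T.pt}, by simp, by simpa using T.pt_mem, by simp, by simp⟩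
  | insert v J _ ih =>
    obtain ⟨F, h1, h2, h3, h4⟩ := ih fun w hw => hJ (by simp [Finset.mem_coe.1 hw])
    have hv : v ∈ T.carrier := hJ (by simp)
    have key : ∀ n, ∀ v ∈ T.carrier, (parentToward T.pt)^[n] v = T.pt →
        ∃ F' : Finset (BiWord ℕ), F ⊆ F' ∧ v ∈ F' ∧ ↑F' ⊆ T.carrier ∧
          ∀ w ∈ F', w ≠ T.pt → parentToward T.pt w ∈ F' := by
      intro n
      induction n with
      | zero =>
        intro v hv hn
        exact ⟨F, Finset.Subset.refl F, by rw [show v = T.pt from hn]; exact h3, h2, h4⟩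
      | succ n ih =>
        intro v hv hn
        by_cases hne : v = T.pt
        · exact ⟨F, Finset.Subset.refl F, by rw [hne]; exact h3, h2, h4⟩
        obtain ⟨F', g1, g2, g3, g4⟩ := ih _ (parentToward_mem hv hne) hn
        refine ⟨insert v F', g1.trans (Finset.subset_insert _ _), Finset.mem_insert_self _ _, ?_, ?_⟩
        · intro w hw
          rcases Finset.mem_insert.1 (Finset.mem_coe.1 hw) with rfl | hw
          · exact hv
          · exact g3 hw
        · intro w hw hw'
          rcases Finset.mem_insert.1 hw with rfl | hw
          · exact Finset.mem_insert_of_mem g2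
          · exact Finset.mem_insert_of_mem (g4 w hw hw')
    obtain ⟨n, hn⟩ := exists_iterate_parentToward hv
    obtain ⟨F', g1, g2, g3, g4⟩ := key n v hv hn
    exact ⟨F', Finset.insert_subset g2 (h1.trans g1), g3, g1 h3, g4⟩

variable {b : ℕ}

/-- A labelling is determined by its steps. -/
theorem exists_labelling (T : PTree) (o : BiWord (Fin b)) (s : BiWord ℕ → Step b) :
    ∃ y : BiWord ℕ → BiWord (Fin b), y T.pt = o ∧
      ∀ v ∈ T.carrier, v ≠ T.pt → y v = moveBi (y (parentToward T.pt v)) (s v) := by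
  classical
  -- Recursion on the distance `N v` from `v` to `ϱ`.
  let Z : ℕ → BiWord ℕ → BiWord (Fin b) := fun n =>
    Nat.rec (fun _ => o) (fun _ f v => moveBi (f (parentToward T.pt v)) (s v)) n
  let N : BiWord ℕ → ℕ := fun v => if h : ∃ n, (parentToward T.pt)^[n] v = T.pt then Nat.find h else 0
  refine ⟨fun v => Z (N v) v, ?_, fun v hv hne => ?_⟩
  · have : N T.pt = 0 := by
      have h : ∃ n, (parentToward T.pt)^[n] T.pt = T.pt := ⟨0, rfl⟩
      simp only [N, dif_pos h]
      exact (Nat.find_eq_zero h).2 rfl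
    simp only [this]
    rfl
  · have h := exists_iterate_parentToward hv
    have h' := exists_iterate_parentToward (parentToward_mem hv hne)
    have : N v = N (parentToward T.pt v) + 1 := by
      simp only [N, dif_pos h, dif_pos h']
      exact Nat.find_comp_succ h h' hne
    simp only [this]
    rfl

open Classical in
/-- The finite-dimensional laws of the branching random walk. -/
def IsBRWFdd (o : BiWord (Fin b)) (T : PTree) (m : Measure (T.carrier → BiWord (Fin b))) : Prop :=
  ∀ F : Finset (BiWord ℕ), (↑F : Set (BiWord ℕ)) ⊆ T.carrier → T.pt ∈ F →
    (∀ v ∈ F, v ≠ T.pt → BiWord.parentToward T.pt v ∈ F) →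
    ∀ y : BiWord ℕ → BiWord (Fin b),
      m {x | ∀ v : T.carrier, (v : BiWord ℕ) ∈ F → x v = y v} =
        (if y T.pt = o then 1 else 0) *
          ∏ v ∈ F.erase T.pt, stepProb (y (BiWord.parentToward T.pt v)) (y v)

/-- The labelled tree with given labels. -/
def withLabel {E : Type*} (T : PTree) (x : T.carrier → E) : LTree E := { T with label := x }

variable [NeZero b]

/-- The steps of the branching random walk are independent. -/
theorem IsBRWFdd.steps {o : BiWord (Fin b)} {m : Measure (T.carrier → BiWord (Fin b))}
    [IsProbabilityMeasure m] (hm : IsBRWFdd o T m) {κ : Type*} (K : Finset κ) (V : κ → BiWord ℕ)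
    (hV : ∀ a ∈ K, V a ∈ T.carrier ∧ V a ≠ T.pt) (hinj : Set.InjOn V K)
    (S : κ → Set (Step b)) :
    (∀ᵐ x ∂m, (T.withLabel x).lab T.pt = o ∧ ∀ a ∈ K,
      Adj ((T.withLabel x).lab (parentToward T.pt (V a))) ((T.withLabel x).lab (V a))) ∧
    m {x | ∀ a ∈ K, stepOf ((T.withLabel x).lab (parentToward T.pt (V a)))
      ((T.withLabel x).lab (V a)) ∈ S a} = ∏ a ∈ K, stepM b (S a) := by
  classical
  obtain ⟨F, h1, h2, h3, h4⟩ := T.exists_closed_finset (K.image V) (by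
    intro v hv
    obtain ⟨a, ha, rfl⟩ := Finset.mem_image.1 (Finset.mem_coe.1 hv)
    exact (hV a ha).1)
  set F' := F.erase T.pt with hF'
  have hKF : ∀ a ∈ K, V a ∈ F' := fun a ha =>
    Finset.mem_erase.2 ⟨(hV a ha).2, h1 (Finset.mem_image_of_mem V ha)⟩
  let ext' : (F' → Step b) → BiWord ℕ → Step b := fun s v => if h : v ∈ F' then s ⟨v, h⟩ else none
  choose y hy0 hy using fun s : F' → Step b => T.exists_labelling o (ext' s)
  -- `E s` is the event that the labels on `F` are those built from `o` with the steps `s`.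
  let E : (F' → Step b) → Set (T.carrier → BiWord (Fin b)) := fun s =>
    {x | ∀ v : T.carrier, (v : BiWord ℕ) ∈ F → x v = y s v}
  have hEm : ∀ s, MeasurableSet (E s) := fun s => by
    have : E s = ⋂ v : F, {x | x ⟨v, h2 v.2⟩ = y s v} := by
      ext x
      simp only [E, Set.mem_ofPred_eq, Set.mem_iInter]
      exact ⟨fun h v => h ⟨v, h2 v.2⟩ v.2, fun h v hv => h ⟨v, hv⟩⟩
    rw [this]
    exact MeasurableSet.iInter fun v =>
      measurableSet_eq_biWord (measurable_pi_apply _) measurable_const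
  have hlab : ∀ s, ∀ x ∈ E s, ∀ v ∈ F, (T.withLabel x).lab v = y s v := fun s x hx v hv => by
    rw [LTree.lab_eq _ (h2 hv)]
    exact hx ⟨v, h2 hv⟩ hv
  have hFm : ∀ v ∈ F', v ≠ T.pt ∧ v ∈ T.carrier ∧ v ∈ F ∧ parentToward T.pt v ∈ F := fun v hv => by
    obtain ⟨g1, g2⟩ := Finset.mem_erase.1 hv
    exact ⟨g1, h2 g2, g2, h4 v g2 g1⟩
  have hstep : ∀ s, ∀ x ∈ E s, ∀ v (hv : v ∈ F'),
      (T.withLabel x).lab v = moveBi ((T.withLabel x).lab (parentToward T.pt v)) (s ⟨v, hv⟩) := by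
    intro s x hx v hv
    obtain ⟨g1, g2, g3, g4⟩ := hFm v hv
    rw [hlab s x hx v g3, hlab s x hx _ g4, hy s v g2 g1]
    simp only [ext', dif_pos hv]
  have hEmeas : ∀ s, m (E s) = ∏ v : F', stepW b (s v) := fun s => by
    rw [hm F h2 h3 h4 (y s), if_pos (hy0 s), one_mul, ← Finset.prod_coe_sort]
    refine Finset.prod_congr rfl fun v _ => ?_
    obtain ⟨g1, g2, g3, g4⟩ := hFm v v.2
    rw [hy s v g2 g1, stepProb_moveBi]
    exact congrArg (stepW b) (dif_pos v.2)
  have hdisj : Pairwise (Function.onFun Disjoint E) := fun s s' hss => by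
    refine Set.disjoint_left.2 fun x hx hx' => hss ?_
    funext v
    have e1 := hstep s x hx v v.2
    rw [hstep s' x hx' v v.2] at e1
    exact (moveBi_injective _ e1).symm
  have hsum : ∀ R : F' → Set (Step b), ∑ s : F' → Step b, (if ∀ v, s v ∈ R v then m (E s) else 0) =
      ∏ v : F', stepM b (R v) := by
    intro R
    have e1 : ∀ v : F', stepM b (R v) = ∑ σ : Step b, if σ ∈ R v then stepW b σ else 0 := by
      intro v
      rw [← lintegral_indicator_one (MeasurableSet.of_discrete), lintegral_fintype]
      refine Finset.sum_congr rfl fun σ _ => ?_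
      rw [stepM_singleton, Set.indicator_apply]
      split_ifs <;> simp
    simp_rw [e1, Finset.prod_univ_sum, Fintype.piFinset_univ]
    refine Finset.sum_congr rfl fun s _ => ?_
    rw [hEmeas]
    by_cases hs : ∀ v, s v ∈ R v
    · rw [if_pos hs]
      exact Finset.prod_congr rfl fun v _ => (if_pos (hs v)).symm
    · rw [if_neg hs]
      push Not at hs
      obtain ⟨v, hv⟩ := hs
      exact (Finset.prod_eq_zero (Finset.mem_univ v) (if_neg hv)).symm
  -- The disjoint events `E s` have total mass one, so almost surely the labels of neighbours are
  -- neighbours.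
  have hU : m (⋃ s, E s)ᶜ = 0 := by
    rw [prob_compl_eq_zero_iff (MeasurableSet.iUnion hEm), measure_iUnion hdisj hEm, tsum_fintype]
    have := hsum (fun _ => Set.univ)
    simpa using this
  have hae : ∀ᵐ x ∂m, ∃ s, x ∈ E s := by
    filter_upwards [measure_eq_zero_iff_ae_notMem.1 hU] with x hx
    simpa using hx
  refine ⟨?_, ?_⟩
  · filter_upwards [hae] with x ⟨s, hx⟩
    refine ⟨by rw [hlab s x hx _ h3, hy0], fun a ha => ?_⟩
    rw [hstep s x hx _ (hKF a ha)]
    exact adj_moveBi _ _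
  -- `R v` is `S a` if `v = V a` with `a ∈ K`, which is unambiguous by injectivity, and everything
  -- otherwise.
  · let R : F' → Set (Step b) := fun v => {σ | ∀ a ∈ K, V a = v → σ ∈ S a}
    have hR : ∀ a (ha : a ∈ K), R ⟨V a, hKF a ha⟩ = S a := fun a ha => by
      ext σ
      constructor
      · intro h; exact h a ha rfl
      · intro h a' ha' e
        rw [hinj ha' ha e]
        exact h
    have hset : {x | ∀ a ∈ K, stepOf ((T.withLabel x).lab (parentToward T.pt (V a)))
        ((T.withLabel x).lab (V a)) ∈ S a} =ᵐ[m]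
        ⋃ s ∈ Finset.univ.filter (fun s : F' → Step b => ∀ v, s v ∈ R v), E s := by
      refine Filter.eventuallyEq_set.2 ?_
      filter_upwards [hae] with x ⟨s, hx⟩
      have e : ∀ a (ha : a ∈ K), stepOf ((T.withLabel x).lab (parentToward T.pt (V a)))
          ((T.withLabel x).lab (V a)) = s ⟨V a, hKF a ha⟩ := fun a ha => by
        rw [hstep s x hx _ (hKF a ha), stepOf_moveBi]
      simp only [Set.mem_iUnion, Finset.mem_filter, Finset.mem_univ, true_and]
      constructor
      · intro h
        refine ⟨s, fun v a ha hav => ?_, hx⟩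
        have := h a ha
        rw [e a ha] at this
        rwa [show v = ⟨V a, hKF a ha⟩ from Subtype.ext hav.symm]
      · rintro ⟨s', hs', hx'⟩ a ha
        have : s = s' := by
          by_contra hne
          exact Set.disjoint_left.1 (hdisj hne) hx hx'
        subst this
        rw [e a ha, ← hR a ha]
        exact hs' _
    rw [measure_congr hset, measure_biUnion_finset (fun s _ s' _ h => hdisj h) (fun s _ => hEm s),
      Finset.sum_filter]
    refine Eq.trans (by convert hsum R) ?_
    rw [← Finset.prod_image (s := K) (g := fun a : κ => V a) (f := fun v : BiWord ℕ =>
      stepM b {σ | ∀ a ∈ K, V a = v → σ ∈ S a}) hinj |>.trans (Finset.prod_congr rfl fun a ha => by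
        rw [← hR a ha])]
    rw [Finset.prod_coe_sort F' (fun v => stepM b {σ | ∀ a ∈ K, V a = v → σ ∈ S a})]
    refine (Finset.prod_subset (fun v hv => ?_) fun v hv hno => ?_).symm
    · obtain ⟨a, ha, rfl⟩ := Finset.mem_image.1 hv
      exact hKF a ha
    · have : {σ : Step b | ∀ a ∈ K, V a = v → σ ∈ S a} = Set.univ := by
        refine Set.eq_univ_of_forall fun σ a ha e => absurd ?_ hno
        rw [← e]
        exact Finset.mem_image_of_mem V ha
      rw [this, measure_univ]

end PTree

/-! ### Addresses of the vertices; the code as a function of the letters, the levels and the steps.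
-/

/-- The addresses of the vertices in the right part of a tree: `(p, none)` is the ancestor
`ϱ(p)`, and `(p, some (i, u))` stands for a vertex of the subtree stemming from the `i`-th child of
`ϱ(p)` on the right of the line of ancestors. -/
abbrev Addr := ℕ × Option (ℕ × List ℕ)

/-- The first letter of the children on the right of the line of ancestors. -/
def firstChild : ℕ → ℕ
  | 0 => 1
  | _ + 1 => 2

/-- The addresses different from that of `ϱ` which belong to the tree with given offspring
numbers. -/
def presentAt (y : ℕ → Level) : Addr → Prop
  | (p, none) => p ≠ 0
  | (p, some (i, u)) => i < (y p).1 ∧ present ((y p).2 i) u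

theorem presentAt_resetLevel (y : ℕ → Level) (a : Addr) :
    presentAt (fun p => resetLevel (y p)) a ↔ presentAt y a := by
  obtain ⟨p, _ | ⟨i, u⟩⟩ := a
  · exact Iff.rfl
  · refine and_congr_right fun (h : i < (y p).1) => ?_
    have : (resetLevel (y p)).2 i = resetOffs ((y p).2 i) := if_pos h
    rw [this, present_resetOffs]

theorem measurableSet_presentAt (a : Addr) : MeasurableSet {y : ℕ → Level | presentAt y a} := by
  obtain ⟨p, _ | ⟨i, u⟩⟩ := a
  · exact MeasurableSet.const _
  · exact (measurableSet_lt (f := fun _ : ℕ → Level => i) (g := fun y => (y p).1) measurable_const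
      (by fun_prop)).inter
      (Code.measurableSet_present (fun y : ℕ → Level => (y p).2 i) (by fun_prop) u)

open Classical in
/-- The steps at the addresses that are not in the tree get a default value. -/
def maskSteps {b : ℕ} (y : ℕ → Level) (s : Addr → Step b) (a : Addr) : Step b :=
  if presentAt y a then s a else none

theorem measurable_maskSteps {b : ℕ} :
    Measurable fun p : (ℕ → Level) × (Addr → Step b) => maskSteps p.1 p.2 := by
  refine measurable_pi_lambda _ fun a => ?_
  exact Measurable.ite (measurable_fst (measurableSet_presentAt a)) (by fun_prop) measurable_const

namespace PTree

open BiWord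

variable (T : PTree)

/-- The vertex with a given address. -/
def vertexAt : Addr → BiWord ℕ
  | (p, none) => T.spine p
  | (p, some (i, u)) => ((T.spine p).child (firstChild p + i)).append u

variable {T}

theorem spine_eq_append (hT : ∀ p, (T.spine p).last = 1) (p n : ℕ) :
    T.spine p = (T.spine (p + n)).append (List.replicate n 1) := by
  induction n with
  | zero => rfl
  | succ n ih =>
    rw [ih, List.replicate_succ, append_cons, ← add_assoc, T.spine_eq_child (p + n), hT]

/-- Seen from the older of two distinct ancestors, the path to the younger one begins with the
letter `1`, while the other path is empty or begins with a letter at least `2`. -/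
theorem vertexAt_injective (hT : ∀ p, (T.spine p).last = 1) : Function.Injective T.vertexAt := by
  let tail : Addr → List ℕ := fun a => a.2.elim [] fun q => (firstChild a.1 + q.1) :: q.2
  have h0 : ∀ a, T.vertexAt a = (T.spine a.1).append (tail a) := by
    rintro ⟨p, _ | ⟨i, u⟩⟩ <;> rfl
  have key : ∀ (a a' : Addr) (n : ℕ), a'.1 = a.1 + n → T.vertexAt a = T.vertexAt a' → a = a' := by
    intro a a' n hn h
    rw [h0, h0, spine_eq_append hT a.1 n, hn, ← append_append, append_right_inj] at h
    obtain ⟨p, o⟩ := a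
    obtain ⟨q, o'⟩ := a'
    simp only at hn
    subst hn
    cases n with
    | zero =>
      rcases o with _ | ⟨i, u⟩ <;> rcases o' with _ | ⟨i', u'⟩ <;>
        simp_all [tail]
    | succ n =>
      rcases o' with _ | ⟨i', u'⟩
      · simp [tail] at h
      · simp only [tail, List.replicate_succ, List.cons_append, Option.elim, ← add_assoc] at h
        have := (List.cons.inj h).1
        simp only [firstChild] at this
        omega
  intro a a' h
  rcases le_total a.1 a'.1 with hl | hl
  · exact key a a' (a'.1 - a.1) (by omega) h
  · exact (key a' a (a.1 - a'.1) (by omega) h.symm).symm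

theorem numChildren_firstChild (hT : ∀ p, (T.spine p).last = 1) (p : ℕ) :
    (T.levels p).1 = T.numChildren (T.spine p) - (firstChild p - 1) ∧
      firstChild p - 1 ≤ T.numChildren (T.spine p) ∧
      ∀ i, (T.levels p).2 i = offs (T.subtree ((T.spine p).child (firstChild p + i))) := by
  cases p with
  | zero =>
    refine ⟨?_, Nat.zero_le _, fun i => ?_⟩
    · show offs (T.subtree T.pt) [] = _
      rw [offs_subtree T.pt_mem, spine_zero]
      rfl
    · funext w
      show offs (T.subtree T.pt) ((i + 1) :: w) = _
      have hm : (i + 1) :: w ∈ T.subtree T.pt ↔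
          w ∈ T.subtree ((T.spine 0).child (firstChild 0 + i)) := by
        rw [spine_zero, firstChild, add_comm 1 i]
        rfl
      by_cases h : (i + 1) :: w ∈ T.subtree T.pt
      · rw [offs_subtree h, offs_subtree (hm.1 h), append_cons, spine_zero, firstChild, add_comm 1]
      · exact (if_neg h).trans (if_neg (mt hm.2 h)).symm
  | succ p =>
    refine ⟨rfl, ?_, fun i => rfl⟩
    have h := T.spine_mem p
    rw [T.spine_eq_child p, hT, child_mem_iff (T.spine_mem _)] at h
    exact h.2

theorem presentAt_levels_iff (hT : ∀ p, (T.spine p).last = 1) (p i : ℕ) (u : List ℕ) :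
    presentAt T.levels (p, some (i, u)) ↔ T.vertexAt (p, some (i, u)) ∈ T.carrier := by
  obtain ⟨h1, h2, h3⟩ := numChildren_firstChild hT p
  show i < (T.levels p).1 ∧ present ((T.levels p).2 i) u ↔
    ((T.spine p).child (firstChild p + i)).append u ∈ T.carrier
  have hf : 1 ≤ firstChild p := by cases p <;> simp [firstChild]
  have hc : (T.spine p).child (firstChild p + i) ∈ T.carrier ↔ i < (T.levels p).1 := by
    rw [child_mem_iff (T.spine_mem p), h1]
    omega
  constructor
  · rintro ⟨h4, h5⟩
    rw [h3] at h5
    exact ((isRootedTree_subtree (hc.2 h4)).mem_iff_present u).2 h5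
  · intro h4
    have h5 := mem_of_append_mem h4
    refine ⟨hc.1 h5, ?_⟩
    rw [h3]
    exact ((isRootedTree_subtree h5).mem_iff_present u).1 h4

theorem vertexAt_mem (hT : ∀ p, (T.spine p).last = 1) {a : Addr} (ha : presentAt T.levels a) :
    T.vertexAt a ∈ T.carrier ∧ T.vertexAt a ≠ T.pt := by
  have h0 : T.pt = T.vertexAt (0, none) := T.spine_zero.symm
  obtain ⟨p, _ | ⟨i, u⟩⟩ := a
  · refine ⟨T.spine_mem p, fun h => ?_⟩
    rw [h0] at h
    exact ha (congrArg Prod.fst (vertexAt_injective hT h))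
  · refine ⟨(presentAt_levels_iff hT p i u).1 ha, fun h => ?_⟩
    rw [h0] at h
    have := congrArg Prod.snd (vertexAt_injective hT h)
    simp at this

theorem parentToward_vertexAt (hT : ∀ p, (T.spine p).last = 1) (p i : ℕ) (u : List ℕ) :
    parentToward T.pt (T.vertexAt (p, some (i, u))) = (T.vertexAt (p, some (i, u))).parent := by
  rcases eq_parent_iterate_or T.pt (T.vertexAt (p, some (i, u))) with ⟨k, hk⟩ | h
  · rw [← spine_eq] at hk
    have := congrArg Prod.snd (vertexAt_injective hT (a₂ := (k, none)) hk)
    simp at this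
  · exact h

theorem countable_carrier (T : PTree) : T.carrier.Countable := by
  refine (Set.countable_range fun q : ℕ × List ℕ => (T.spine q.1).append q.2).mono fun v hv => ?_
  obtain ⟨p, w, rfl⟩ := exists_append_spine hv
  exact ⟨(p, w), rfl⟩

end PTree

namespace Code

variable {b : ℕ}

/-- The numbers of a level and the corresponding steps. -/
def block (y : Level) (s : Option (ℕ × List ℕ) → Step b) : Step b × Body b :=
  (s none, y.1, fun i u => (y.2 i u, s (some (i, u))))

/-- The code with given word, offspring numbers and steps. -/
def assemble (w : Word b) (y : ℕ → Level) (s : Addr → Step b) : Code b :=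
  ((block (y 0) fun o => s (0, o)).2, w, fun p => block (y (p + 1)) fun o => s (p + 1, o))

theorem resetBody_block (y : ℕ → Level) (s : Addr → Step b) (p : ℕ) :
    (block (resetLevel (y p)) fun o => maskSteps (fun q => resetLevel (y q)) s (p, o)).2 =
      resetBody (block (y p) fun o => s (p, o)).2 := by
  refine Prod.ext rfl ?_
  funext i u
  show ((if i < (y p).1 then resetOffs ((y p).2 i) else fun _ => 0 : List ℕ → ℕ) u,
    maskSteps (fun q => resetLevel (y q)) s (p, some (i, u))) =
    (if i < (y p).1 then resetMark (fun u => ((y p).2 i u, s (p, some (i, u)))) else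
      fun _ => (0, none) : Mark b) u
  by_cases hi : i < (y p).1
  · rw [if_pos hi, if_pos hi]
    by_cases hu : present ((y p).2 i) u
    · have h1 : maskSteps (fun q => resetLevel (y q)) s (p, some (i, u)) = s (p, some (i, u)) :=
        if_pos ((presentAt_resetLevel y (p, some (i, u))).2 ⟨hi, hu⟩)
      rw [h1]
      exact (congrArg (·, s (p, some (i, u))) (if_pos hu)).trans (if_pos hu).symm
    · have h1 : maskSteps (fun q => resetLevel (y q)) s (p, some (i, u)) = none :=
        if_neg fun h => hu ((presentAt_resetLevel y (p, some (i, u))).1 h).2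
      rw [h1]
      exact (congrArg (·, none) (if_neg hu)).trans (if_neg hu).symm
  · have h1 : maskSteps (fun q => resetLevel (y q)) s (p, some (i, u)) = none :=
      if_neg fun h => hi ((presentAt_resetLevel y (p, some (i, u))).1 h).1
    rw [if_neg hi, if_neg hi, h1]

theorem reset_assemble (w : Word b) (y : ℕ → Level) (s : Addr → Step b) :
    assemble w (fun p => resetLevel (y p)) (maskSteps (fun p => resetLevel (y p)) s) =
      reset (assemble w y s) := by
  refine Prod.ext (resetBody_block y s 0) (Prod.ext rfl ?_)
  funext p
  refine Prod.ext ?_ (resetBody_block y s (p + 1))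
  exact if_pos (Nat.succ_ne_zero p)

end Code

namespace LTree

open BiWord PTree Code

variable {b : ℕ} [NeZero b]

/-- The steps of the labels. -/
def steps (x : LTree (BiWord (Fin b))) : Addr → Step b
  | (0, none) => none
  | (p + 1, none) => stepOf (x.lab (x.spine p)) (x.lab (x.spine (p + 1)))
  | (p, some (i, u)) => (x.markAt (x.vertexAt (p, some (i, u)))).2

variable {x : LTree (BiWord (Fin b))}

theorem steps_eq (hx : ∀ p, (x.spine p).last = 1) (a : Addr) :
    (presentAt x.levels a → x.steps a =
      stepOf (x.lab (parentToward x.pt (x.vertexAt a))) (x.lab (x.vertexAt a))) ∧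
    (¬ presentAt x.levels a → x.steps a = none) := by
  obtain ⟨p, _ | ⟨i, u⟩⟩ := a
  · cases p with
    | zero => exact ⟨fun h => absurd rfl h, fun _ => rfl⟩
    | succ p =>
      refine ⟨fun _ => ?_, fun h => absurd (Nat.succ_ne_zero p) h⟩
      have : parentToward x.pt (x.vertexAt (p + 1, none)) = x.spine p := by
        show parentToward x.pt (x.spine (p + 1)) = _
        rw [x.spine_eq, parentToward_parent_iterate, x.spine_eq]
      rw [this]
      rfl
  · have e : x.steps (p, some (i, u)) = (x.markAt (x.vertexAt (p, some (i, u)))).2 := by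
      cases p <;> rfl
    rw [parentToward_vertexAt hx, presentAt_levels_iff hx, e, markAt]
    exact ⟨fun h => by rw [if_pos h], fun h => by rw [if_neg h]⟩

/-- This makes the code a measurable function of three objects whose joint law can be computed. -/
theorem code_eq_assemble (hx : ∀ p, (x.spine p).last = 1) :
    x.code = assemble x.rootLabel.letter x.levels x.steps := by
  have hs : ∀ p i u, x.steps (p, some (i, u)) = (x.markAt (x.vertexAt (p, some (i, u)))).2 := by
    intro p i u
    cases p <;> rfl
  have key : ∀ p, x.bodyFrom (x.spine p) (firstChild p - 1) =
      (block (x.levels p) fun o => x.steps (p, o)).2 := by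
    intro p
    obtain ⟨h1, h2, h3⟩ := numChildren_firstChild (T := x.toPTree) hx p
    refine Prod.ext h1.symm ?_
    funext i u
    show x.markAt (((x.spine p).child (firstChild p - 1 + 1 + i)).append u) =
      ((x.levels p).2 i u, x.steps (p, some (i, u)))
    have hf : firstChild p - 1 + 1 = firstChild p := by cases p <;> rfl
    rw [hf, hs, h3]
    refine Prod.ext ?_ rfl
    show (x.markAt _).1 = _
    by_cases hm : ((x.spine p).child (firstChild p + i)).append u ∈ x.carrier
    · rw [offs_subtree hm, markAt, if_pos hm]
    · rw [markAt, if_neg hm]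
      exact (if_neg hm).symm
  refine Prod.ext ?_ (Prod.ext ?_ ?_)
  · have := key 0
    rw [spine_zero] at this
    exact this
  · show (x.lab x.pt).letter = _
    rw [lab_eq x x.pt_mem]
    rfl
  · funext p
    refine Prod.ext ?_ ?_
    · show stepOf (x.lab (parent^[p] x.pt)) (x.lab (parent^[p + 1] x.pt)) = _
      rw [← spine_eq, ← spine_eq]
      rfl
    · have := key (p + 1)
      show x.bodyFrom (parent^[p + 1] x.pt) (parent^[p] x.pt).last = _
      rw [← spine_eq, ← spine_eq, hx]
      exact this

theorem measurable_toPTree {E : Type*} [MeasurableSpace E] :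
    Measurable (LTree.toPTree : LTree E → PTree) :=
  (comap_measurable _).mono le_sup_left le_rfl

theorem measurable_lab {E : Type*} [Inhabited E] [MeasurableSpace E] (p : ℕ) (w : List ℕ) :
    Measurable fun x : LTree E => x.lab ((x.spine p).append w) := by
  have key : ∀ B : Set E, MeasurableSet B →
      MeasurableSet {x : LTree E | ∃ h : (x.spine p).append w ∈ x.carrier, x.label ⟨_, h⟩ ∈ B} :=
    fun B hB => (le_sup_right : _ ≤ (inferInstance : MeasurableSpace (LTree E))) _
      (MeasurableSpace.measurableSet_generateFrom ⟨p, w, B, hB, rfl⟩)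
  intro B hB
  have e : (fun x : LTree E => x.lab ((x.spine p).append w)) ⁻¹' B =
      {x : LTree E | ∃ h : (x.spine p).append w ∈ x.carrier, x.label ⟨_, h⟩ ∈ B} ∪
      ({x : LTree E | ∃ h : (x.spine p).append w ∈ x.carrier, x.label ⟨_, h⟩ ∈ Set.univ}ᶜ ∩
        {_x | default ∈ B}) := by
    ext x
    simp only [Set.mem_preimage, Set.mem_union, Set.mem_ofPred_eq, Set.mem_inter_iff,
      Set.mem_compl_iff, Set.mem_univ, exists_prop, and_true]
    by_cases h : (x.spine p).append w ∈ x.carrier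
    · simp [lab, h]
    · simp [lab, h]
  rw [e]
  exact (key B hB).union ((key _ MeasurableSet.univ).compl.inter (MeasurableSet.const _))

theorem measurable_rootLabel {E : Type*} [Inhabited E] [MeasurableSpace E] :
    Measurable (rootLabel : LTree E → E) := by
  have e : (rootLabel : LTree E → E) = fun x => x.lab ((x.spine 0).append []) := by
    funext x
    rw [append_nil, spine_zero, lab_eq x x.pt_mem]
    rfl
  rw [e]
  exact measurable_lab 0 []

theorem measurable_steps : Measurable (steps (b := b)) := by
  refine measurable_pi_lambda _ fun a => ?_
  obtain ⟨p, _ | ⟨i, u⟩⟩ := a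
  · cases p with
    | zero => exact measurable_const
    | succ p => exact measurable_stepOf.comp ((measurable_lab p []).prodMk (measurable_lab (p + 1) []))
  · have e : (fun x : LTree (BiWord (Fin b)) => x.steps (p, some (i, u))) =
        fun x => (x.markAt (x.vertexAt (p, some (i, u)))).2 := by
      funext x
      cases p <;> rfl
    rw [e]
    have h1 : MeasurableSet {x : LTree (BiWord (Fin b)) |
        x.vertexAt (p, some (i, u)) ∈ x.carrier} :=
      ((measurable_set_iff.1 ((measurable_subtree_spine p).comp measurable_toPTree))
        ((firstChild p + i) :: u)).setOf
    have e2 : (fun x : LTree (BiWord (Fin b)) => (x.markAt (x.vertexAt (p, some (i, u)))).2) =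
        fun x => haveI := Classical.dec (x.vertexAt (p, some (i, u)) ∈ x.carrier)
          if x.vertexAt (p, some (i, u)) ∈ x.carrier then
            stepOf (x.lab ((x.spine p).append ((firstChild p + i) :: u).dropLast))
              (x.lab ((x.spine p).append ((firstChild p + i) :: u))) else none := by
      funext x
      have hv : x.vertexAt (p, some (i, u)) = (x.spine p).append ((firstChild p + i) :: u) := rfl
      have hp : (x.vertexAt (p, some (i, u))).parent =
          (x.spine p).append ((firstChild p + i) :: u).dropLast := by
        conv_lhs => rw [hv, ← List.dropLast_append_getLast (List.cons_ne_nil (firstChild p + i) u)]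
        rw [append_concat, parent_child]
      rw [markAt, hp]
      by_cases h : x.vertexAt (p, some (i, u)) ∈ x.carrier
      · rw [if_pos h, if_pos h, hv]
      · rw [if_neg h, if_neg h]
    rw [e2]
    exact Measurable.ite h1 (measurable_stepOf.comp ((measurable_lab _ _).prodMk
      (measurable_lab _ _))) measurable_const

theorem measurable_withLabel {E : Type*} [MeasurableSpace E] (t : PTree) :
    Measurable (fun x : t.carrier → E => t.withLabel x) := by
  refine Measurable.of_le_map ?_
  refine sup_le ?_ (MeasurableSpace.generateFrom_le ?_)
  · rintro _ ⟨S, -, rfl⟩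
    show @MeasurableSet (t.carrier → E) _ _
    exact MeasurableSet.const (t ∈ S)
  · rintro _ ⟨p, w, B, hB, rfl⟩
    by_cases h : (t.spine p).append w ∈ t.carrier
    · have e : (fun x : t.carrier → E => t.withLabel x) ⁻¹'
          {T : LTree E | ∃ h : (T.spine p).append w ∈ T.carrier, T.label ⟨_, h⟩ ∈ B} =
          (fun x => x ⟨_, h⟩) ⁻¹' B := by
        ext x
        exact ⟨fun ⟨_, h2⟩ => h2, fun h2 => ⟨h, h2⟩⟩
      show @MeasurableSet (t.carrier → E) _ ((fun x : t.carrier → E => t.withLabel x) ⁻¹' _)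
      rw [e]
      exact measurable_pi_apply _ hB
    · have e : (fun x : t.carrier → E => t.withLabel x) ⁻¹'
          {T : LTree E | ∃ h : (T.spine p).append w ∈ T.carrier, T.label ⟨_, h⟩ ∈ B} = ∅ := by
        ext x
        exact iff_of_false (fun ⟨h1, _⟩ => h h1) (Set.notMem_empty _)
      show @MeasurableSet (t.carrier → E) _ ((fun x : t.carrier → E => t.withLabel x) ⁻¹' _)
      rw [e]
      exact MeasurableSet.empty

end LTree

namespace MeasureTheory

theorem measurePreserving_infinitePi_map {ι : Type*} {X Y : ι → Type*}
    [∀ i, MeasurableSpace (X i)] [∀ i, MeasurableSpace (Y i)] {μ : ∀ i, Measure (X i)}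
    {ν : ∀ i, Measure (Y i)} [∀ i, IsProbabilityMeasure (μ i)] [∀ i, IsProbabilityMeasure (ν i)]
    {f : ∀ i, X i → Y i} (hf : ∀ i, MeasurePreserving (f i) (μ i) (ν i)) :
    MeasurePreserving (fun (x : ∀ i, X i) i => f i (x i)) (Measure.infinitePi μ)
      (Measure.infinitePi ν) := by
  refine ⟨measurable_pi_lambda _ fun i => (hf i).measurable.comp (measurable_pi_apply i), ?_⟩
  rw [Measure.infinitePi_map_pi _ fun i => (hf i).measurable]
  congr 1
  funext i
  exact (hf i).map_eq

end MeasureTheory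

namespace Code

variable {b : ℕ} [NeZero b]

theorem measurePreserving_block (μ ρ : PMF ℕ) :
    MeasurePreserving (fun q : Level × (Option (ℕ × List ℕ) → Step b) => block q.1 q.2)
      ((freeLevelM μ ρ).prod (Measure.infinitePi fun _ => stepM b))
      ((stepM b).prod (bodyM b μ ρ)) := by
  have h1 := measurePreserving_split (fun _ : Option (ℕ × List ℕ) => stepM b) none
    (fun q : ℕ × List ℕ => some q) (Option.some_injective _) (fun q => Option.some_ne_none q)
  have h2 : MeasurePreserving (MeasurableEquiv.curry ℕ (List ℕ) (Step b))
      (Measure.infinitePi fun _ => stepM b)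
      (Measure.infinitePi fun _ => Measure.infinitePi fun _ => stepM b) :=
    ⟨(MeasurableEquiv.curry _ _ _).measurable,
      Measure.infinitePi_map_curry (fun _ _ => stepM b)⟩
  have h3 := (MeasurePreserving.id (freeLevelM μ ρ)).prod
    (((MeasurePreserving.id (stepM b)).prod h2).comp h1)
  have h4 := (measurePreserving_infinitePi_map (fun _ : ℕ =>
    measurePreserving_zip (fun _ : List ℕ => μ.toMeasure) (fun _ : List ℕ => stepM b))).comp
    (measurePreserving_zip (fun _ : ℕ => Measure.infinitePi fun _ : List ℕ => μ.toMeasure)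
      (fun _ : ℕ => Measure.infinitePi fun _ : List ℕ => stepM b))
  have h5 := ((MeasurePreserving.id ρ.toMeasure).prod h4).comp (measurePreserving_prodAssoc _ _ _)
  exact (((MeasurePreserving.id (stepM b)).prod h5).comp (measurePreserving_leftComm _ _ _)).comp h3

theorem measurePreserving_assemble (μ ρ : PMF ℕ) :
    MeasurePreserving (fun q : (Word b × (ℕ → Level)) × (Addr → Step b) =>
        assemble q.1.1 q.1.2 q.2)
      (((wordM b).prod (Measure.infinitePi fun p => freeLevelM μ (consSeq μ (fun _ => ρ) p))).prod
        (Measure.infinitePi fun _ => stepM b)) (codeM b μ ρ) := by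
  have h2 : MeasurePreserving (MeasurableEquiv.curry ℕ (Option (ℕ × List ℕ)) (Step b))
      (Measure.infinitePi fun _ => stepM b)
      (Measure.infinitePi fun _ => Measure.infinitePi fun _ => stepM b) :=
    ⟨(MeasurableEquiv.curry _ _ _).measurable,
      Measure.infinitePi_map_curry (fun _ _ => stepM b)⟩
  have h3 := (measurePreserving_infinitePi_map (fun p : ℕ =>
    measurePreserving_block (b := b) μ (consSeq μ (fun _ => ρ) p))).comp
    (measurePreserving_zip _ _)
  have h4 := (measurePreserving_uncons _).comp h3
  have h5 : MeasurePreserving (Prod.snd : Step b × Body b → Body b)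
    ((stepM b).prod (bodyM b μ μ)) (bodyM b μ μ) := measurePreserving_snd
  have h6 : MeasurePreserving (fun q : (ℕ → Level) × (ℕ → Option (ℕ × List ℕ) → Step b) =>
      ((block (q.1 0) (q.2 0)).2, fun p => block (q.1 (p + 1)) (q.2 (p + 1))))
      ((Measure.infinitePi fun p => freeLevelM μ (consSeq μ (fun _ => ρ) p)).prod
        (Measure.infinitePi fun _ => Measure.infinitePi fun _ => stepM b))
      ((bodyM b μ μ).prod (spineM b μ ρ)) :=
    (h5.prod (MeasurePreserving.id (spineM b μ ρ))).comp h4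
  have h7 := (measurePreserving_prodAssoc (wordM b)
    (Measure.infinitePi fun p => freeLevelM μ (consSeq μ (fun _ => ρ) p))
    (Measure.infinitePi fun _ : ℕ => Measure.infinitePi fun _ : Option (ℕ × List ℕ) => stepM b))
  have h9 : IsProbabilityMeasure
      (Measure.infinitePi fun p => freeLevelM μ (consSeq μ (fun _ => ρ) p)) := inferInstance
  have h10 : IsProbabilityMeasure
      (Measure.infinitePi fun _ : ℕ => Measure.infinitePi fun _ : Option (ℕ × List ℕ) =>
        stepM b) := inferInstance
  have h11 := Measure.prod.instIsProbabilityMeasure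
    (Measure.infinitePi fun p => freeLevelM μ (consSeq μ (fun _ => ρ) p))
    (Measure.infinitePi fun _ : ℕ => Measure.infinitePi fun _ : Option (ℕ × List ℕ) => stepM b)
  have h8 := ((MeasurePreserving.id (wordM b)).prod h6).comp (h7.comp
    ((MeasurePreserving.id _).prod h2))
  exact (measurePreserving_leftComm (wordM b) (bodyM b μ μ) (spineM b μ ρ)).comp h8

end Code

namespace LTree

open BiWord PTree Code

variable {b : ℕ}


theorem measurableSet_adjLabels [NeZero b] :
    MeasurableSet {x : LTree (BiWord (Fin b)) | x.AdjLabels} := by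
  have e : {x : LTree (BiWord (Fin b)) | x.AdjLabels} = ⋂ (p : ℕ) (w : List ℕ) (i : ℕ),
      {x : LTree (BiWord (Fin b)) | (w ++ [i] ∈ x.subtree (x.spine p))}ᶜ ∪
      {x : LTree (BiWord (Fin b)) |
        Adj (x.lab ((x.spine p).append w)) (x.lab ((x.spine p).append (w ++ [i])))} := by
    ext x
    simp only [Set.mem_ofPred_eq, Set.mem_iInter, Set.mem_union, Set.mem_compl_iff]
    constructor
    · intro h p w i
      by_cases hm : w ++ [i] ∈ x.subtree (x.spine p)
      · right
        have := h _ hm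
        rw [append_concat, parent_child] at this
        rw [append_concat]
        exact this
      · exact Or.inl hm
    · intro h v hv
      obtain ⟨p, hp⟩ := exists_append_spine_ge hv
      obtain ⟨w, rfl⟩ := hp (p + 1) (Nat.le_succ p)
      induction w using List.reverseRecOn with
      | nil =>
        have := (h (p + 2) [] (x.spine (p + 1)).last).resolve_left fun h => h (by
          show (x.spine (p + 2)).child _ ∈ x.carrier
          rw [← spine_eq_child]
          exact x.spine_mem _)
        rw [append_nil, ← spine_succ]
        rw [List.nil_append, append_cons, append_nil, append_nil, ← spine_eq_child] at this
        exact this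
      | append_singleton w i _ =>
        have := (h (p + 1) w i).resolve_left fun h => h hv
        rw [append_concat, parent_child]
        rw [append_concat] at this
        exact this
  rw [e]
  refine MeasurableSet.iInter fun p => MeasurableSet.iInter fun w => MeasurableSet.iInter fun i => ?_
  refine MeasurableSet.union (MeasurableSet.compl ?_) ?_
  · exact ((measurable_set_iff.1 ((measurable_subtree_spine p).comp measurable_toPTree))
      (w ++ [i])).setOf
  · have h1 := measurable_lab (E := BiWord (Fin b)) p w
    have h2 := measurable_lab (E := BiWord (Fin b)) p (w ++ [i])
    exact (measurableSet_eq_biWord h2 (measurable_parent.comp h1)).union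
      (measurableSet_eq_biWord h1 (measurable_parent.comp h2))

end LTree

/-! ### The law of the code of the branching random walk. -/

namespace IsBRWLaw

open BiWord PTree LTree Code

variable {b : ℕ} [NeZero b] {o : BiWord (Fin b)} {t : PTree} {Q : Measure (LTree (BiWord (Fin b)))}

theorem ae_adjLabels (h : IsBRWLaw o t Q) : ∀ᵐ x ∂Q, x.AdjLabels := by
  obtain ⟨m, hm, hF, rfl⟩ := h
  have hF' : IsBRWFdd o t m := hF
  refine (ae_map_iff (measurable_withLabel t).aemeasurable measurableSet_adjLabels).2 ?_
  have h1 : ∀ v ∈ t.carrier, v ≠ t.pt → ∀ᵐ x ∂m,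
      Adj ((t.withLabel x).lab (parentToward t.pt v)) ((t.withLabel x).lab v) := by
    intro v hv hne
    have := (hF'.steps {v} id (by simpa using ⟨hv, hne⟩) (by simp) (fun _ => Set.univ)).1
    filter_upwards [this] with x hx
    exact hx.2 v (by simp)
  have h2 := (ae_ball_iff t.countable_carrier (p := fun x v _ => v ≠ t.pt →
    Adj ((t.withLabel x).lab (parentToward t.pt v)) ((t.withLabel x).lab v))).2 fun v hv => by
      by_cases hne : v = t.pt
      · exact Filter.Eventually.of_forall fun x hx => absurd hne hx
      · filter_upwards [h1 v hv hne] with x hx _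
        exact hx
  filter_upwards [h2] with x hx
  intro v hv
  have hv' : v ∈ t.carrier := hv
  -- On the ancestral line the labels propagate from a vertex to its parent, so the relation is read
  -- at `v.parent` and reversed.
  rcases eq_parent_iterate_or t.pt v with ⟨k, hk⟩ | hk
  · have hk' : v.parent = parent^[k + 1] t.pt := by
      rw [Function.iterate_succ_apply', hk]
    have := hx v.parent (t.isTree.parent_mem v hv') (by
      rw [hk']
      intro h
      have := congrArg height h
      rw [height_parent_iterate] at this
      push_cast at this
      omega)
    rw [hk', parentToward_parent_iterate, ← hk] at this
    rw [hk']
    exact this.symm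
  · by_cases hne : v = t.pt
    · have := hx v.parent (t.isTree.parent_mem v hv') (by
        intro h
        rw [hne] at h
        have := congrArg height h
        rw [height_parent] at this
        omega)
      rw [hne, show t.pt.parent = parent^[0 + 1] t.pt from rfl, parentToward_parent_iterate] at this
      rw [hne]
      exact this.symm
    · have := hx v hv' hne
      rwa [hk] at this

-- Given the tree, the steps at the addresses of the tree are independent of law `stepM`, and the
-- others equal `none`. Both sides are computed on boxes.
open Classical in
theorem map_steps (h : IsBRWLaw o t Q) (ht : ∀ p, (t.spine p).last = 1) :
    Q.map steps = (Measure.infinitePi fun _ : Addr => stepM b).map (maskSteps t.levels) := by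
  obtain ⟨m, hm, hF, rfl⟩ := h
  have hF' : IsBRWFdd o t m := hF
  refine (Measure.map_map measurable_steps (measurable_withLabel t)).trans ?_
  have e : maskSteps (b := b) t.levels = fun s a => (fun a => if presentAt t.levels a then id else
      fun _ => none : Addr → Step b → Step b) a (s a) := by
    funext s a
    by_cases ha : presentAt t.levels a
    · simp only [maskSteps, if_pos ha, id]
    · simp only [maskSteps, if_neg ha]
  rw [e, Measure.infinitePi_map_pi _ fun a => Measurable.of_discrete]
  have : ∀ a : Addr, IsProbabilityMeasure ((stepM b).map ((fun a => if presentAt t.levels a then id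
      else fun _ => none : Addr → Step b → Step b) a)) := fun a =>
    Measure.isProbabilityMeasure_map Measurable.of_discrete.aemeasurable
  refine Measure.eq_infinitePi _ fun s S hS => ?_
  rw [Measure.map_apply (measurable_steps.comp (measurable_withLabel t))
    (MeasurableSet.pi s.countable_toSet fun i _ => hS i)]
  have hpr : ∀ a, (stepM b).map ((fun a => if presentAt t.levels a then id else
      fun _ => none : Addr → Step b → Step b) a) (S a) =
      if presentAt t.levels a then stepM b (S a) else if none ∈ S a then 1 else 0 := by
    intro a
    by_cases ha : presentAt t.levels a
    · simp only [if_pos ha, Measure.map_id]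
    · simp only [if_neg ha, Measure.map_const, measure_univ, one_smul]
      rw [Measure.dirac_apply' _ (hS a), Set.indicator_apply]
      rfl
  simp_rw [hpr]
  -- An absent address whose set does not contain the default step `none` makes both sides zero.
  by_cases hno : ∃ a ∈ s, ¬ presentAt t.levels a ∧ none ∉ S a
  · obtain ⟨a, has, ha, haS⟩ := hno
    rw [Finset.prod_eq_zero has (by rw [if_neg ha, if_neg haS])]
    convert measure_empty (μ := m)
    refine Set.eq_empty_of_forall_notMem fun x hx => haS ?_
    have := hx a has
    rwa [show (steps ∘ fun x => t.withLabel x) x a = none from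
      (steps_eq (x := t.withLabel x) ht a).2 ha] at this
  · push Not at hno
    have := (hF'.steps (s.filter (presentAt t.levels)) t.vertexAt
      (fun a ha => vertexAt_mem ht (Finset.mem_filter.1 ha).2)
      (vertexAt_injective ht).injOn S).2
    rw [Finset.prod_filter] at this
    refine Eq.trans ?_ (this.trans (Finset.prod_congr rfl fun a ha => ?_))
    · congr 1
      ext x
      simp only [Set.mem_preimage, Set.mem_pi, Finset.mem_coe, Function.comp_apply,
        Finset.mem_filter, Set.mem_ofPred_eq]
      constructor
      · rintro hx a ⟨has, ha⟩
        have := hx a has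
        rwa [(steps_eq (x := t.withLabel x) ht a).1 ha] at this
      · intro hx a has
        by_cases ha : presentAt t.levels a
        · rw [(steps_eq (x := t.withLabel x) ht a).1 ha]
          exact hx a ⟨has, ha⟩
        · rw [(steps_eq (x := t.withLabel x) ht a).2 ha]
          exact hno a has ha
    · by_cases ha' : presentAt t.levels a
      · rw [if_pos ha', if_pos ha']
      · rw [if_neg ha', if_neg ha', if_pos (hno a ha ha')]

end IsBRWLaw

namespace IsUniformBRW

open BiWord PTree LTree Code

variable {b : ℕ} [NeZero b] {μ : PMF ℕ} {Ω : Type*} [MeasurableSpace Ω] {P : Measure Ω}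
  {Θ : Ω → LTree (BiWord (Fin b))}

theorem ae_good (h : IsUniformBRW μ b P Θ) : ∀ᵐ ω ∂P, (Θ ω).Good := by
  have h1 : ∀ᵐ ω ∂P, (Θ ω).AdjLabels := by
    obtain ⟨Q, hQ, hC⟩ := h.cond_law
    have := hC Set.univ {x | x.AdjLabels}ᶜ MeasurableSet.univ measurableSet_adjLabels.compl
    have h0 : ∀ o t, Q (o, t) {x | x.AdjLabels}ᶜ = 0 := fun o t => (hQ o t).ae_adjLabels
    simp only [h0, lintegral_zero, Set.mem_univ, true_and] at this
    exact this
  filter_upwards [h1, h.tree.height_eq, h.origin_height, h.tree.ae_spineType] with ω h2 h3 h4 h5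
  exact ⟨h3, h4, fun p => (h5 p).1, h2⟩

theorem map_letter (h : IsUniformBRW μ b P Θ) :
    P.map (fun ω => (Θ ω).rootLabel.letter) = wordM b := by
  have hm : ∀ j, Measurable fun ω => (Θ ω).rootLabel.letter j := fun j =>
    (measurable_pi_apply j).comp (measurable_letter.comp
      (measurable_rootLabel.comp h.measurable))
  refine (h.origin_indep.map_fun_eq_infinitePi_map hm).trans ?_
  rw [wordM]
  congr 1
  funext j
  refine Measure.ext_of_singleton fun i => ?_
  rw [Measure.map_apply (hm j) (measurableSet_singleton i), letterM_singleton]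
  exact h.origin_uniform j i

variable [IsProbabilityMeasure P] (hμ : ∑' k : ℕ, (k : ℝ≥0∞) * μ k = 1)

theorem map_letter_levels (h : IsUniformBRW μ b P Θ) :
    P.map (fun ω => ((Θ ω).rootLabel.letter, (Θ ω).levels)) =
      (wordM b).prod (Measure.infinitePi
        fun p => levelM μ (consSeq μ (fun _ => tailPMF μ hμ) p)) := by
  have hm1 : Measurable fun ω => (Θ ω).rootLabel.letter :=
    measurable_letter.comp (measurable_rootLabel.comp h.measurable)
  have hm2 : Measurable fun ω => (Θ ω).levels := measurable_levels.comp h.tree.measurable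
  have hi := h.origin_indep_tree.comp measurable_letter measurable_levels
  have := (indepFun_iff_map_prod_eq_prod_map_map hm1.aemeasurable hm2.aemeasurable).1 hi
  rw [← h.map_letter, ← h.tree.map_levels hμ]
  exact this

/-- The conditional law of the steps given the root label and the tree depends on the levels only,
so it can be integrated against the law of the letters and the levels. -/
theorem map_letter_levels_steps (h : IsUniformBRW μ b P Θ) :
    P.map (fun ω => (((Θ ω).rootLabel.letter, (Θ ω).levels), (Θ ω).steps)) =
      (((wordM b).prod (Measure.infinitePi
        fun p => levelM μ (consSeq μ (fun _ => tailPMF μ hμ) p))).prod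
        (Measure.infinitePi fun _ : Addr => stepM b)).map
          (fun q => (q.1, maskSteps q.1.2 q.2)) := by
  have hm1 : Measurable fun ω => (Θ ω).rootLabel.letter :=
    measurable_letter.comp (measurable_rootLabel.comp h.measurable)
  have hm2 : Measurable fun ω => (Θ ω).levels := measurable_levels.comp h.tree.measurable
  have hm3 : Measurable fun ω => (Θ ω).steps := measurable_steps.comp h.measurable
  have hmask : Measurable fun q : (Word b × (ℕ → Level)) × (Addr → Step b) =>
      (q.1, maskSteps q.1.2 q.2) :=
    Measurable.prodMk (by fun_prop) (measurable_maskSteps.comp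
      (f := fun q : (Word b × (ℕ → Level)) × (Addr → Step b) => (q.1.2, q.2)) (by fun_prop))
  have := Measure.isProbabilityMeasure_map (μ := P)
    ((hm1.prodMk hm2).prodMk hm3).aemeasurable
  refine Measure.ext_prod (μ := P.map (fun ω =>
    (((Θ ω).rootLabel.letter, (Θ ω).levels), (Θ ω).steps))) fun {C D} hC hD => ?_
  obtain ⟨Q, hQ, hlaw⟩ := h.cond_law
  have hmC : Measurable fun q : BiWord (Fin b) × PTree => (q.1.letter, q.2.levels) :=
    (measurable_letter.comp measurable_fst).prodMk (measurable_levels.comp measurable_snd)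
  have h1 := hlaw _ _ (hmC hC) (measurable_steps hD)
  rw [Measure.map_apply ((hm1.prodMk hm2).prodMk hm3) (hC.prod hD)]
  refine h1.trans ?_
  have h2 : ∀ᵐ ω ∂P, Q ((Θ ω).rootLabel, (Θ ω).toPTree) (steps ⁻¹' D) =
      (Measure.infinitePi fun _ : Addr => stepM b)
        {s | maskSteps (Θ ω).levels s ∈ D} := by
    filter_upwards [h.tree.ae_spineType] with ω hω
    rw [← Measure.map_apply measurable_steps hD, (hQ _ _).map_steps fun p => (hω p).1,
      Measure.map_apply _ hD]
    · rfl
    · exact measurable_maskSteps.comp (f := fun s : Addr → Step b => ((Θ ω).levels, s)) (by fun_prop)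
  refine (setLIntegral_congr_fun_ae ((hm1.prodMk hm2) hC)
    (h2.mono fun ω hω _ => hω)).trans ?_
  have hF : Measurable fun q : Word b × (ℕ → Level) =>
      (Measure.infinitePi fun _ : Addr => stepM b) {s | maskSteps q.2 s ∈ D} := by
    have hS : MeasurableSet {r : (Word b × (ℕ → Level)) × (Addr → Step b) |
        maskSteps r.1.2 r.2 ∈ D} := (measurable_snd.comp hmask) hD
    exact measurable_measure_prodMk_left hS
  refine (setLIntegral_map (μ := P) hC hF (hm1.prodMk hm2)).symm.trans ?_
  rw [h.map_letter_levels hμ, Measure.map_apply hmask (hC.prod hD),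
    Measure.prod_apply (hmask (hC.prod hD)), ← lintegral_indicator hC]
  refine lintegral_congr fun q => ?_
  by_cases hq : q ∈ C
  · rw [Set.indicator_of_mem hq]
    congr 1
    ext s
    exact (and_iff_right hq).symm
  · rw [Set.indicator_of_notMem hq]
    symm
    convert measure_empty (μ := Measure.infinitePi fun _ : Addr => stepM b)
    refine Set.eq_empty_of_forall_notMem fun s hs => hq hs.1

/-- The law of the code of the branching random walk. -/
theorem map_code (h : IsUniformBRW μ b P Θ) :
    AEMeasurable (fun ω => (Θ ω).code) P ∧
    P.map (fun ω => (Θ ω).code) = (codeM b μ (tailPMF μ hμ)).map reset := by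
  have hm1 : Measurable fun ω => (Θ ω).rootLabel.letter :=
    measurable_letter.comp (measurable_rootLabel.comp h.measurable)
  have hm2 : Measurable fun ω => (Θ ω).levels := measurable_levels.comp h.tree.measurable
  have hm3 : Measurable fun ω => (Θ ω).steps := measurable_steps.comp h.measurable
  have hA : Measurable fun q : (Word b × (ℕ → Level)) × (Addr → Step b) =>
      assemble q.1.1 q.1.2 q.2 := (measurePreserving_assemble μ μ).measurable
  have hmask : Measurable fun q : (Word b × (ℕ → Level)) × (Addr → Step b) =>
      (q.1, maskSteps q.1.2 q.2) :=
    Measurable.prodMk (by fun_prop) (measurable_maskSteps.comp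
      (f := fun q : (Word b × (ℕ → Level)) × (Addr → Step b) => (q.1.2, q.2)) (by fun_prop))
  have hae : (fun ω => (Θ ω).code) =ᵐ[P]
      fun ω => assemble (Θ ω).rootLabel.letter (Θ ω).levels (Θ ω).steps := by
    filter_upwards [h.ae_good] with ω hω
    exact code_eq_assemble hω.spine_last
  have hmeas := hA.comp ((hm1.prodMk hm2).prodMk hm3)
  refine ⟨⟨_, hmeas, hae⟩, ?_⟩
  rw [Measure.map_congr hae]
  have e1 := Measure.map_map (μ := P) hA ((hm1.prodMk hm2).prodMk hm3)
  refine e1.symm.trans ?_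
  have e2 := h.map_letter_levels_steps hμ
  refine (congrArg (Measure.map _) e2).trans ?_
  -- The levels of the tree have the law of reset free levels; masking the steps as well amounts to
  -- applying `reset` to the assembled code (`reset_assemble`).
  have e3 : (Measure.infinitePi fun p => levelM μ (consSeq μ (fun _ => tailPMF μ hμ) p)) =
      (Measure.infinitePi fun p => freeLevelM μ (consSeq μ (fun _ => tailPMF μ hμ) p)).map
        (fun y p => resetLevel (y p)) :=
    (Measure.infinitePi_map_pi _ fun _ => measurable_resetLevel).symm
  have hrl : Measurable fun (y : ℕ → Level) p => resetLevel (y p) :=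
    measurable_pi_lambda _ fun p => measurable_resetLevel.comp (measurable_pi_apply p)
  have e4 := ((MeasurePreserving.id (wordM b)).prod
    (MeasurePreserving.mk hrl e3.symm)).prod
      (MeasurePreserving.id (Measure.infinitePi fun _ : Addr => stepM b))
  rw [← e4.map_eq, Measure.map_map hmask e4.measurable,
    Measure.map_map hA (hmask.comp e4.measurable), ← (measurePreserving_assemble μ _).map_eq,
    Measure.map_map measurable_reset hA]
  congr 1
  funext q
  exact reset_assemble q.1.1 q.1.2 q.2

end IsUniformBRW

/-! ### Finiteness of critical Galton–Watson trees, and the two shapes of the right part. -/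

/-- The trees stemming from the children are finite. -/
def FinLevel (y : Level) : Prop := {a : ℕ × List ℕ | a.1 < y.1 ∧ present (y.2 a.1) a.2}.Finite

theorem finLevel_iff (y : Level) : FinLevel y ↔ ∀ i < y.1, {u | present (y.2 i) u}.Finite := by
  constructor
  · intro h i hi
    refine (h.image Prod.snd).subset fun u hu => ⟨(i, u), ⟨hi, hu⟩, rfl⟩
  · intro h
    refine ((Set.finite_lt_nat y.1).biUnion fun i hi => (h i hi).image (Prod.mk i)).subset ?_
    rintro ⟨i, u⟩ ⟨h1, h2⟩
    exact Set.mem_biUnion h1 ⟨u, h2, rfl⟩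

theorem finLevel_resetLevel (y : Level) : FinLevel (resetLevel y) ↔ FinLevel y := by
  rw [finLevel_iff, finLevel_iff]
  refine forall₂_congr fun i (hi : i < y.1) => ?_
  have : (resetLevel y).2 i = resetOffs (y.2 i) := if_pos hi
  simp only [this, present_resetOffs]

theorem present_finite_iff (n : List ℕ → ℕ) : {u | present n u}.Finite ↔ FinLevel (levelOf n) := by
  have e : {u | present n u} = insert [] ((fun a : ℕ × List ℕ => (a.1 + 1) :: a.2) ''
      {a : ℕ × List ℕ | a.1 < (levelOf n).1 ∧ present ((levelOf n).2 a.1) a.2}) := by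
    ext u
    match u with
    | [] => simp [present_nil]
    | 0 :: u => simp [present_cons]
    | (i + 1) :: u =>
      simp only [Set.mem_ofPred_eq, present_cons, Set.mem_insert_iff, reduceCtorEq, Set.mem_image,
        List.cons.injEq, Nat.add_right_cancel_iff, Prod.exists, false_or]
      constructor
      · rintro ⟨⟨-, h1⟩, h2⟩
        exact ⟨i, u, ⟨h1, h2⟩, rfl, rfl⟩
      · rintro ⟨i', u', ⟨h1, h2⟩, rfl, rfl⟩
        exact ⟨⟨Nat.succ_pos _, h1⟩, h2⟩
  rw [e, Set.finite_insert, FinLevel, Set.finite_image_iff]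
  rintro ⟨i, u⟩ - ⟨i', u'⟩ - h
  simp only [List.cons.injEq, Nat.add_right_cancel_iff] at h
  exact Prod.ext h.1 h.2

theorem measurableSet_finite {X ι : Type*} [MeasurableSpace X] [Countable ι] {A : ι → Set X}
    (hA : ∀ i, MeasurableSet (A i)) : MeasurableSet {x | {i | x ∈ A i}.Finite} := by
  have e : {x | {i | x ∈ A i}.Finite} = ⋃ F : Finset ι, ⋂ i, ⋂ (_ : i ∉ F), (A i)ᶜ := by
    ext x
    simp only [Set.mem_ofPred_eq, Set.mem_iUnion, Set.mem_iInter, Set.mem_compl_iff]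
    constructor
    · intro h
      exact ⟨h.toFinset, fun i hi => by simpa using hi⟩
    · rintro ⟨F, hF⟩
      refine F.finite_toSet.subset fun i hi => ?_
      by_contra h
      exact hF i h hi
  rw [e]
  exact MeasurableSet.iUnion fun F => MeasurableSet.iInter fun i => MeasurableSet.iInter fun _ =>
    (hA i).compl

theorem measurableSet_finite_present :
    MeasurableSet {n : List ℕ → ℕ | {u | present n u}.Finite} :=
  measurableSet_finite fun u => Code.measurableSet_present id measurable_id u

theorem measurableSet_finLevel : MeasurableSet {y : Level | FinLevel y} :=
  measurableSet_finite fun a => (measurableSet_lt (f := fun _ : Level => a.1) (g := fun y => y.1)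
    measurable_const (by fun_prop)).inter
    (Code.measurableSet_present (fun y : Level => y.2 a.1) (by fun_prop) a.2)

section critical

variable {μ : PMF ℕ}

/-- Without mass at `0`, mean one leaves no room for offspring numbers above `1`: the tail law is
then concentrated at `0`. -/
theorem apply_zero_ne_zero (hμ : ∑' k : ℕ, (k : ℝ≥0∞) * μ k = 1)
    (h : μ ≠ PMF.pure 1) : μ 0 ≠ 0 := by
  intro h0
  refine h ?_
  have h1 := Code.apply_zero_add_tailPMF hμ
  rw [h0, zero_add] at h1
  have h2 : ∀ l, 2 ≤ l → μ l = 0 := by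
    intro l hl
    have h3 := (PMF.apply_eq_one_iff _ 0).1 h1
    have h4 : Code.tailPMF μ hμ 1 = 0 := by
      rw [PMF.apply_eq_zero_iff, h3]
      simp
    rw [Code.tailPMF_apply, ENNReal.tsum_eq_zero] at h4
    simpa [hl] using h4 l
  have h3 : μ 1 = 1 := by
    rw [← hμ, tsum_eq_single 1]
    · simp
    · intro k hk
      rcases Nat.lt_or_ge k 2 with h4 | h4
      · have : k = 0 := by omega
        simp [this]
      · rw [h2 k h4, mul_zero]
  have h4 := (PMF.apply_eq_one_iff _ 1).1 h3
  refine PMF.ext fun k => ?_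
  by_cases hk : k = 1
  · rw [hk, h3]; simp
  · rw [PMF.pure_apply_of_ne _ _ hk, PMF.apply_eq_zero_iff, h4]
    simpa using hk

/-- The generating function of a critical offspring distribution has no fixed point but `1`. -/
theorem eq_one_of_fixed (hμ : ∑' k : ℕ, (k : ℝ≥0∞) * μ k = 1)
    (h : μ ≠ PMF.pure 1) {e : ℝ≥0∞} (he : e ≤ 1)
    (hfix : ∑' k, μ k * e ^ k = e) : e = 1 := by
  obtain ⟨k, hk2, hk⟩ : ∃ k, 2 ≤ k ∧ μ k ≠ 0 := by
    by_contra hno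
    push Not at hno
    refine apply_zero_ne_zero hμ h ?_
    have h1 : ∑' k : ℕ, (k : ℝ≥0∞) * μ k = μ 1 := by
      rw [tsum_eq_single 1]
      · simp
      · intro k hk
        rcases Nat.lt_or_ge k 2 with h4 | h4
        · have : k = 0 := by omega
          simp [this]
        · rw [hno k h4, mul_zero]
    rw [hμ] at h1
    have := (PMF.apply_eq_one_iff _ 1).1 h1.symm
    rw [PMF.apply_eq_zero_iff, this]
    simp
  by_contra hne
  have hlt : e < 1 := lt_of_le_of_ne he hne
  set x := e.toReal
  have hx : e = ENNReal.ofReal x := (ENNReal.ofReal_toReal (ne_top_of_lt hlt)).symm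
  have hx0 : 0 ≤ x := ENNReal.toReal_nonneg
  have hx1 : x < 1 := by
    have := (ENNReal.toReal_lt_toReal (ne_top_of_lt hlt) ENNReal.one_ne_top).2 hlt
    simpa using this
  have hd : e + ENNReal.ofReal (1 - x) = 1 := by
    rw [hx, ← ENNReal.ofReal_add hx0 (by linarith)]
    simp
  -- Bernoulli's inequality `1 ≤ x ^ k + k (1 - x)`, strict as soon as `k ≥ 2`. Summed against `μ`,
  -- of mean one, it would give `1 < e + (1 - e)`.
  have hle : ∀ k : ℕ, (1 : ℝ≥0∞) ≤ e ^ k + k * ENNReal.ofReal (1 - x) := by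
    intro k
    have h1 := one_add_mul_le_pow (a := x - 1) (by linarith) k
    rw [add_sub_cancel] at h1
    rw [hx, ← ENNReal.ofReal_pow hx0, ← ENNReal.ofReal_natCast, ← ENNReal.ofReal_mul (by positivity),
      ← ENNReal.ofReal_add (by positivity) (mul_nonneg (by positivity) (by linarith)),
      ENNReal.one_le_ofReal]
    nlinarith
  have hlt' : (1 : ℝ≥0∞) < e ^ k + k * ENNReal.ofReal (1 - x) := by
    obtain ⟨j, rfl⟩ := Nat.exists_eq_add_of_le hk2
    have h1 := one_add_mul_le_pow (a := x - 1) (by linarith) (1 + j)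
    rw [add_sub_cancel] at h1
    rw [hx, ← ENNReal.ofReal_pow hx0, ← ENNReal.ofReal_natCast, ← ENNReal.ofReal_mul (by positivity),
      ← ENNReal.ofReal_add (by positivity) (mul_nonneg (by positivity) (by linarith)),
      ENNReal.one_lt_ofReal, show 2 + j = (1 + j) + 1 by ring, pow_succ]
    push_cast at h1 ⊢
    nlinarith [mul_le_mul_of_nonneg_right h1 hx0, mul_pos (sub_pos.2 hx1) (sub_pos.2 hx1),
      mul_nonneg (sq_nonneg (1 - x)) (Nat.cast_nonneg (α := ℝ) j)]
  have hsum : ∑' k : ℕ, μ k * (e ^ k + k * ENNReal.ofReal (1 - x)) = 1 := by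
    simp_rw [mul_add]
    rw [ENNReal.tsum_add, hfix]
    have : ∀ k : ℕ, μ k * (k * ENNReal.ofReal (1 - x)) =
        (k * μ k) * ENNReal.ofReal (1 - x) := fun k => by ring
    simp_rw [this]
    rw [ENNReal.tsum_mul_right, hμ, one_mul, hd]
  have h3 : ∑' k, μ k < ∑' k : ℕ, μ k * (e ^ k + k * ENNReal.ofReal (1 - x)) := by
    refine ENNReal.tsum_lt_tsum (i := k) (by rw [μ.tsum_coe]; exact ENNReal.one_ne_top)
      (fun k => ?_) ?_
    · calc μ k = μ k * 1 := (mul_one _).symm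
        _ ≤ _ := by gcongr; exact hle k
    · calc μ k = μ k * 1 := (mul_one _).symm
        _ < _ := ENNReal.mul_lt_mul_right hk (PMF.apply_ne_top _ _) hlt'
  rw [hsum, μ.tsum_coe] at h3
  exact lt_irrefl _ h3

/-- By the decomposition at the root, the probability of finiteness is a fixed point of the
generating function. -/
theorem ae_finite_present (hμ : ∑' k : ℕ, (k : ℝ≥0∞) * μ k = 1)
    (h : μ ≠ PMF.pure 1) :
    ∀ᵐ n ∂Measure.infinitePi fun _ : List ℕ => μ.toMeasure, {u | present n u}.Finite := by
  set M := Measure.infinitePi fun _ : List ℕ => μ.toMeasure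
  set e := M {n : List ℕ → ℕ | {u | present n u}.Finite} with he
  have h1 : e = freeLevelM μ μ {y | FinLevel y} := by
    rw [← (measurePreserving_levelOf μ).measure_preimage measurableSet_finLevel.nullMeasurableSet]
    simp only [he, present_finite_iff]
    rfl
  have h2 : e = ∑' k, μ k * e ^ k := by
    conv_lhs => rw [h1, freeLevelM, Measure.prod_apply measurableSet_finLevel,
      Code.lintegral_toMeasure]
    refine tsum_congr fun k => ?_
    congr 1
    have : Prod.mk k ⁻¹' {y : Level | FinLevel y} =
        Set.pi (Finset.range k) fun _ => {n : List ℕ → ℕ | {u | present n u}.Finite} := by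
      ext N
      simp only [Set.mem_preimage, Set.mem_ofPred_eq, finLevel_iff, Set.mem_pi, Finset.coe_range,
        Set.mem_Iio]
    rw [this, Measure.infinitePi_pi _ fun _ _ => measurableSet_finite_present]
    simp [he, M]
  exact (prob_compl_eq_zero_iff measurableSet_finite_present).2
    (eq_one_of_fixed hμ h prob_le_one h2.symm)

end critical

namespace Code

variable {b : ℕ}

/-- The body of a vertex of the ancestral line. -/
def bodyAt (c : Code b) : ℕ → Body b
  | 0 => c.1
  | p + 1 => (c.2.2 p).2

/-- The offspring numbers in a body. -/
def bodyLevel (y : Body b) : Level := (y.1, fun i u => (y.2 i u).1)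

/-- The offspring numbers in a code. -/
def levels (c : Code b) (p : ℕ) : Level := bodyLevel (c.bodyAt p)

theorem levels_reset (c : Code b) : (reset c).levels = fun p => resetLevel (c.levels p) := by
  have : ∀ y : Body b, bodyLevel (resetBody y) = resetLevel (bodyLevel y) := by
    intro y
    refine Prod.ext rfl ?_
    funext i u
    show ((if i < y.1 then resetMark (y.2 i) else fun _ => (0, none) : Mark b) u).1 =
      (if i < y.1 then resetOffs (fun u => (y.2 i u).1) else fun _ => 0 : List ℕ → ℕ) u
    by_cases hi : i < y.1
    · rw [if_pos hi, if_pos hi]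
      by_cases hu : present (fun u => (y.2 i u).1) u
      · exact (congrArg Prod.fst (if_pos hu)).trans (if_pos hu).symm
      · exact (congrArg Prod.fst (if_neg hu)).trans (if_neg hu).symm
    · rw [if_neg hi, if_neg hi]
  funext p
  cases p with
  | zero => exact this _
  | succ p => exact this _

theorem measurable_bodyLevel : Measurable (bodyLevel (b := b)) := by
  refine Measurable.prodMk measurable_fst ?_
  exact measurable_pi_lambda _ fun i => measurable_pi_lambda _ fun u => by fun_prop

theorem measurable_levels : Measurable (levels (b := b)) := by
  refine measurable_pi_lambda _ fun p => measurable_bodyLevel.comp ?_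
  cases p with
  | zero => exact measurable_fst
  | succ p => exact Measurable.snd (by fun_prop)

/-- All the trees grafted on the ancestral line are finite, and infinitely many are non-empty. -/
def FinLevels (y : ℕ → Level) : Prop := (∀ p, FinLevel (y p)) ∧ ∀ p, ∃ q > p, (y q).1 ≠ 0

/-- The vertices after `ϱ` form an infinite line. -/
def LineLevels (y : ℕ → Level) : Prop :=
  ∀ p i u, presentAt y (p, some (i, u)) ↔ p = 0 ∧ i = 0 ∧ ∃ n, u = List.replicate n 1

theorem finLevels_reset (y : ℕ → Level) : FinLevels (fun p => resetLevel (y p)) ↔ FinLevels y :=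
  and_congr (forall_congr' fun p => finLevel_resetLevel (y p)) Iff.rfl

theorem lineLevels_reset (y : ℕ → Level) : LineLevels (fun p => resetLevel (y p)) ↔ LineLevels y :=
  forall_congr' fun _ => forall₂_congr fun _ _ => iff_congr (presentAt_resetLevel _ _) Iff.rfl

theorem measurableSet_finLevels : MeasurableSet {y | FinLevels y} := by
  refine MeasurableSet.inter (s₁ := {y : ℕ → Level | ∀ p, FinLevel (y p)})
    (s₂ := {y : ℕ → Level | ∀ p, ∃ q > p, (y q).1 ≠ 0}) ?_ ?_
  · rw [Set.ofPred_forall]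
    exact MeasurableSet.iInter fun p =>
      (measurable_pi_apply (X := fun _ : ℕ => Level) p) measurableSet_finLevel
  · have e : {y : ℕ → Level | ∀ p, ∃ q > p, (y q).1 ≠ 0} =
        ⋂ p, ⋃ q, ⋃ (_ : q > p), {y : ℕ → Level | (y q).1 = 0}ᶜ := by
      ext y; simp
    rw [e]
    refine MeasurableSet.iInter fun p => MeasurableSet.iUnion fun q => MeasurableSet.iUnion fun _ =>
      MeasurableSet.compl ?_
    exact measurableSet_eq_fun (by fun_prop) measurable_const

theorem measurableSet_lineLevels : MeasurableSet {y | LineLevels y} := by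
  simp only [LineLevels, Set.ofPred_forall]
  refine MeasurableSet.iInter fun p => MeasurableSet.iInter fun i => MeasurableSet.iInter fun u => ?_
  by_cases h : p = 0 ∧ i = 0 ∧ ∃ n, u = List.replicate n 1
  · simp only [h]
    simpa using measurableSet_presentAt (0, some (0, u))
  · simp only [h, iff_false]
    exact (measurableSet_presentAt (p, some (i, u))).compl

variable [NeZero b] (μ ρ : PMF ℕ)

theorem measurePreserving_bodyAt (p : ℕ) :
    MeasurePreserving (fun c : Code b => c.bodyAt p) (codeM b μ ρ)
      (bodyM b μ (consSeq μ (fun _ => ρ) p)) := by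
  cases p with
  | zero => exact measurePreserving_fst
  | succ p =>
    have h1 : MeasurePreserving (fun v : Spine b => v p) (spineM b μ ρ)
      ((stepM b).prod (bodyM b μ ρ)) := measurePreserving_eval_infinitePi _ p
    have h2 : MeasurePreserving (Prod.snd : Step b × Body b → Body b)
      ((stepM b).prod (bodyM b μ ρ)) (bodyM b μ ρ) := measurePreserving_snd
    have h3 : MeasurePreserving (Prod.snd : Word b × Spine b → Spine b)
      ((wordM b).prod (spineM b μ ρ)) (spineM b μ ρ) := measurePreserving_snd
    have h4 : MeasurePreserving (Prod.snd : Code b → Word b × Spine b)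
      (codeM b μ ρ) ((wordM b).prod (spineM b μ ρ)) := measurePreserving_snd
    exact h2.comp (h1.comp (h3.comp h4))

theorem measurePreserving_bodyLevel :
    MeasurePreserving (bodyLevel (b := b)) (bodyM b μ ρ) (freeLevelM μ ρ) := by
  have h1 : MeasurePreserving (Prod.fst : ℕ × Step b → ℕ) (μ.toMeasure.prod (stepM b))
    μ.toMeasure := measurePreserving_fst
  exact (MeasurePreserving.id _).prod (measurePreserving_infinitePi_map fun _ =>
    measurePreserving_infinitePi_map fun _ => h1)

theorem measurePreserving_level (p : ℕ) :
    MeasurePreserving (fun c : Code b => c.levels p) (codeM b μ ρ)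
      (freeLevelM μ (consSeq μ (fun _ => ρ) p)) :=
  (measurePreserving_bodyLevel _ _).comp (measurePreserving_bodyAt μ ρ p)

variable {μ}

theorem ae_finLevel (hμ : ∑' k : ℕ, (k : ℝ≥0∞) * μ k = 1)
    (h : μ ≠ PMF.pure 1) : ∀ᵐ y ∂freeLevelM μ ρ, FinLevel y := by
  have h1 : ∀ᵐ N ∂Measure.infinitePi fun _ : ℕ => Measure.infinitePi fun _ : List ℕ => μ.toMeasure,
      ∀ i, {u | present (N i) u}.Finite :=
    ae_all_iff.2 fun i => (measurePreserving_eval_infinitePi (fun _ : ℕ =>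
      Measure.infinitePi fun _ : List ℕ => μ.toMeasure) i).quasiMeasurePreserving.ae
      (p := fun n => {u | present n u}.Finite) (ae_finite_present hμ h)
  have h2 : ∀ᵐ y ∂freeLevelM μ ρ, ∀ i, {u | present (y.2 i) u}.Finite :=
    Measure.quasiMeasurePreserving_snd.ae h1
  filter_upwards [h2] with y hy
  exact (finLevel_iff y).2 fun i _ => hy i

variable (hμ : ∑' k : ℕ, (k : ℝ≥0∞) * μ k = 1)

theorem ae_finLevels (h : μ ≠ PMF.pure 1) :
    ∀ᵐ c ∂codeM b μ (tailPMF μ hμ), FinLevels c.levels := by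
  set ρ := tailPMF μ hμ
  have h1 : ∀ᵐ c ∂codeM b μ ρ, ∀ p, FinLevel (c.levels p) := ae_all_iff.2 fun p =>
    (measurePreserving_level μ ρ p).quasiMeasurePreserving.ae (ae_finLevel _ hμ h)
  have h0 : ρ 0 < 1 := by
    have e := apply_zero_add_tailPMF hμ
    refine lt_of_le_of_ne (PMF.coe_le_one _ _) fun h2 => apply_zero_ne_zero hμ h ?_
    change μ 0 + ρ 0 = 1 at e
    rw [h2] at e
    exact ENNReal.add_right_inj ENNReal.one_ne_top |>.1 (by rw [add_zero, add_comm]; exact e)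
  have h2 : ∀ᵐ v ∂spineM b μ ρ, ∀ p, ∃ q ≥ p, (v q).2.1 ≠ 0 := by
    refine ae_all_iff.2 fun p => ?_
    -- `n` consecutive empty bodies have probability `ρ 0 ^ n`, and `ρ 0 < 1`.
    have h3 : ∀ n : ℕ, spineM b μ ρ {v | ¬ ∃ q ≥ p, (v q).2.1 ≠ 0} ≤ ρ 0 ^ n := by
      intro n
      have h4 := Measure.infinitePi_pi (fun _ : ℕ => (stepM b).prod (bodyM b μ ρ))
        (s := Finset.Ico p (p + n)) (t := fun _ => Set.univ ×ˢ ({0} ×ˢ Set.univ))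
        (fun _ _ => MeasurableSet.univ.prod ((measurableSet_singleton 0).prod MeasurableSet.univ))
      simp only [Measure.prod_prod, measure_univ, one_mul, bodyM, mul_one,
        PMF.toMeasure_apply_singleton _ _ (measurableSet_singleton 0), Finset.prod_const,
        Nat.card_Ico, add_tsub_cancel_left] at h4
      rw [← h4]
      refine measure_mono fun v hv => ?_
      intro q hq
      have hv' : ∀ q ≥ p, (v q).2.1 = 0 := by
        intro q hq
        by_contra h
        exact hv ⟨q, hq, h⟩
      have := hv' q (Finset.mem_Ico.1 hq).1
      simp [this]
    exact le_antisymm (ge_of_tendsto' (ENNReal.tendsto_pow_atTop_nhds_zero_of_lt_one h0) h3)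
      zero_le
  have h3 : ∀ᵐ c ∂codeM b μ ρ, ∀ p, ∃ q ≥ p, (c.2.2 q).2.1 ≠ 0 :=
    Measure.quasiMeasurePreserving_snd.ae (Measure.quasiMeasurePreserving_snd.ae h2)
  filter_upwards [h1, h3] with c hc1 hc2
  refine ⟨hc1, fun p => ?_⟩
  obtain ⟨q, hq, hq'⟩ := hc2 p
  exact ⟨q + 1, Nat.lt_succ_of_le hq, hq'⟩

/-- When every vertex has exactly one child, the tail law is the Dirac mass at `0`: nothing is
grafted on the ancestors, and a single infinite line starts from `ϱ`. -/
theorem ae_lineLevels (h : μ = PMF.pure 1) :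
    ∀ᵐ c ∂codeM b μ (tailPMF μ hμ), LineLevels c.levels := by
  have hρ : tailPMF μ hμ = PMF.pure 0 := by
    have : tailPMF μ hμ 0 = 1 := by
      have e := apply_zero_add_tailPMF hμ
      have h0 : μ 0 = 0 := by rw [h, PMF.pure_apply_of_ne _ _ zero_ne_one]
      rwa [h0, zero_add] at e
    have h4 := (PMF.apply_eq_one_iff _ 0).1 this
    refine PMF.ext fun k => ?_
    by_cases hk : k = 0
    · rw [hk, this]; simp
    · rw [PMF.pure_apply_of_ne _ _ hk, PMF.apply_eq_zero_iff, h4]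
      simpa using hk
  set ρ := tailPMF μ hμ
  have h1 : ∀ (k : ℕ), ∀ᵐ j ∂(PMF.pure k).toMeasure, j = k := fun k => by
    rw [PMF.toMeasure_pure]
    exact (ae_dirac_iff (measurableSet_singleton k)).2 rfl
  have h2 : ∀ᵐ c ∂codeM b μ ρ, ∀ p, (c.levels p).1 = if p = 0 then 1 else 0 := by
    refine ae_all_iff.2 fun p => ?_
    refine (measurePreserving_level μ ρ p).quasiMeasurePreserving.ae
      (p := fun y => y.1 = if p = 0 then 1 else 0) ?_
    refine Measure.quasiMeasurePreserving_fst.ae (p := fun j => j = if p = 0 then 1 else 0) ?_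
    cases p with
    | zero => rw [consSeq, h]; exact h1 1
    | succ p => rw [consSeq, hρ]; exact h1 0
  have h3 : ∀ᵐ c ∂codeM b μ ρ, ∀ u, (c.levels 0).2 0 u = 1 := by
    refine ae_all_iff.2 fun u => ?_
    refine (measurePreserving_level μ ρ 0).quasiMeasurePreserving.ae
      (p := fun y : Level => y.2 0 u = 1) ?_
    refine Measure.quasiMeasurePreserving_snd.ae (p := fun N : ℕ → List ℕ → ℕ => N 0 u = 1) ?_
    refine (measurePreserving_eval_infinitePi (fun _ : ℕ =>
      Measure.infinitePi fun _ : List ℕ => μ.toMeasure) 0).quasiMeasurePreserving.ae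
      (p := fun n : List ℕ → ℕ => n u = 1) ?_
    refine (measurePreserving_eval_infinitePi (fun _ : List ℕ => μ.toMeasure)
      u).quasiMeasurePreserving.ae (p := fun n => n = 1) ?_
    rw [h]
    exact h1 1
  filter_upwards [h2, h3] with c hc2 hc3 p i u
  show i < (c.levels p).1 ∧ present ((c.levels p).2 i) u ↔ _
  rw [hc2]
  by_cases hp : p = 0
  · subst hp
    simp only [if_pos, true_and, Nat.lt_one_iff]
    refine and_congr_right fun hi => ?_
    subst hi
    rw [show (c.levels 0).2 0 = fun _ => 1 from funext hc3]
    induction u with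
    | nil => exact iff_of_true trivial ⟨0, rfl⟩
    | cons j u ih =>
      rw [present_cons, ih]
      constructor
      · rintro ⟨⟨h4, h5⟩, n, rfl⟩
        exact ⟨n + 1, by rw [List.replicate_succ, le_antisymm h5 h4]⟩
      · rintro ⟨n, hn⟩
        cases n with
        | zero => simp at hn
        | succ n =>
          rw [List.replicate_succ] at hn
          obtain ⟨rfl, rfl⟩ := List.cons.inj hn
          exact ⟨⟨le_rfl, le_rfl⟩, n, rfl⟩
  · simp [hp]

end Code

/-! ### The iterated successors of `ϱ` list the right part. -/

namespace PTree

open BiWord Code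

variable {T : PTree}

theorem exists_vertexAt (hT : ∀ p, (T.spine p).last = 1) {v : BiWord ℕ} (hv : v ∈ T.carrier)
    (h : LexLT T.pt v) :
    ∃ p i u, presentAt T.levels (p, some (i, u)) ∧ v = T.vertexAt (p, some (i, u)) := by
  suffices H : ∃ p i u, v = T.vertexAt (p, some (i, u)) by
    obtain ⟨p, i, u, rfl⟩ := H
    exact ⟨p, i, u, (presentAt_levels_iff hT p i u).2 hv, rfl⟩
  obtain ⟨p, w, rfl⟩ := exists_append_spine hv
  induction p generalizing w with
  | zero =>
    cases w with
    | nil => rw [append_nil, spine_zero] at h; exact absurd h (lexLT_irrefl _)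
    | cons j w =>
      have h1 := (child_mem_iff (T.spine_mem 0) j).1 (mem_of_append_mem hv)
      exact ⟨0, j - 1, w, by
        show _ = ((T.spine 0).child (1 + (j - 1))).append w
        rw [append_cons, show 1 + (j - 1) = j by omega]⟩
  | succ p ih =>
    cases w with
    | nil =>
      have h1 := RightMap.lexLT_parent_iterate T.pt p
      rw [append_nil] at h hv
      rw [← spine_eq] at h1
      exact absurd (lexLT_trans hv T.pt_mem hv h1 h) (lexLT_irrefl _)
    | cons j w =>
      have h1 := (child_mem_iff (T.spine_mem (p + 1)) j).1 (mem_of_append_mem hv)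
      by_cases hj : j = 1
      · subst hj
        have e : (T.spine (p + 1)).child 1 = T.spine p := by rw [T.spine_eq_child p, hT]
        rw [append_cons, e] at h hv ⊢
        exact ih w hv h
      · exact ⟨p + 1, j - 2, w, by
          show _ = ((T.spine (p + 1)).child (2 + (j - 2))).append w
          rw [append_cons, show 2 + (j - 2) = j by omega]⟩

theorem lexLT_vertexAt (hT : ∀ p, (T.spine p).last = 1) {p q : ℕ} (hpq : p < q)
    (x y : ℕ × List ℕ) : LexLT (T.vertexAt (p, some x)) (T.vertexAt (q, some y)) := by
  obtain ⟨n, rfl⟩ := Nat.exists_eq_add_of_lt hpq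
  show LexLT ((T.spine p).append ((firstChild p + x.1) :: x.2))
    ((T.spine (p + n + 1)).append ((2 + y.1) :: y.2))
  rw [spine_eq_append hT p (n + 1), ← append_append, ← add_assoc, lexLT_append_iff,
    List.replicate_succ]
  exact List.Lex.rel (by omega)

theorem lexLT_vertexAt_pt (hT : ∀ p, (T.spine p).last = 1) (p : ℕ) (x : ℕ × List ℕ) :
    LexLT T.pt (T.vertexAt (p, some x)) := by
  show LexLT T.pt ((T.spine p).append ((firstChild p + x.1) :: x.2))
  have h := spine_eq_append hT 0 p
  rw [spine_zero, zero_add] at h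
  rw [h, lexLT_append_iff]
  cases p with
  | zero => exact List.Lex.nil
  | succ p =>
    rw [List.replicate_succ]
    exact List.Lex.rel (by simp only [firstChild]; omega)

/-- No vertex is the last one, and there are finitely many vertices between `ϱ` and a vertex. -/
structure RightDiscrete (T : PTree) : Prop where
  exists_gt : ∀ v ∈ T.carrier, (v = T.pt ∨ LexLT T.pt v) → ∃ w ∈ T.carrier, LexLT v w
  finite_lt : ∀ v ∈ T.carrier, {w ∈ T.carrier | LexLT T.pt w ∧ LexLT w v}.Finite

/-- Vertices grafted on younger ancestors come first (`lexLT_vertexAt`): before a given vertex there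
are finitely many levels, all finite, and beyond it there is another non-empty one. -/
theorem rightDiscrete_of_finLevels (hT : ∀ p, (T.spine p).last = 1) (h : FinLevels T.levels) :
    T.RightDiscrete where
  exists_gt v hv hr := by
    have key : ∀ p, ∃ q > p, T.vertexAt (q, some (0, [])) ∈ T.carrier := by
      intro p
      obtain ⟨q, hq, h0⟩ := h.2 p
      exact ⟨q, hq, (vertexAt_mem hT (a := (q, some (0, []))) ⟨Nat.pos_of_ne_zero h0, trivial⟩).1⟩
    rcases hr with rfl | hr
    · obtain ⟨q, -, hq⟩ := key 0
      exact ⟨_, hq, lexLT_vertexAt_pt hT q _⟩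
    · obtain ⟨p, i, u, -, rfl⟩ := exists_vertexAt hT hv hr
      obtain ⟨q, hq1, hq⟩ := key p
      exact ⟨_, hq, lexLT_vertexAt hT hq1 _ _⟩
  finite_lt v hv := by
    by_cases hr : LexLT T.pt v
    · obtain ⟨p, i, u, -, rfl⟩ := exists_vertexAt hT hv hr
      refine ((Set.finite_le_nat p).biUnion fun q _ =>
        ((h.1 q).image fun x => T.vertexAt (q, some x))).subset ?_
      rintro w ⟨hw, h1, h2⟩
      obtain ⟨q, j, u', hp, rfl⟩ := exists_vertexAt hT hw h1
      refine Set.mem_biUnion (x := q) ?_ ⟨(j, u'), hp, rfl⟩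
      by_contra hq
      exact lexLT_irrefl _ (lexLT_trans hw hv hw h2
        (lexLT_vertexAt hT (not_le.1 hq) _ _))
    · refine (Set.finite_empty).subset ?_
      rintro w ⟨hw, h1, h2⟩
      exact hr (lexLT_trans T.pt_mem hw hv h1 h2)

theorem rightDiscrete_of_lineLevels (hT : ∀ p, (T.spine p).last = 1) (h : LineLevels T.levels) :
    T.RightDiscrete := by
  have key : ∀ v ∈ T.carrier, LexLT T.pt v → ∃ n, v = T.pt.append (List.replicate (n + 1) 1) := by
    intro v hv hr
    obtain ⟨p, i, u, hp, rfl⟩ := exists_vertexAt hT hv hr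
    obtain ⟨rfl, rfl, n, rfl⟩ := (h p i u).1 hp
    refine ⟨n, ?_⟩
    show ((T.spine 0).child 1).append _ = _
    rw [spine_zero, List.replicate_succ, append_cons]
  have hmem : ∀ n, T.pt.append (List.replicate (n + 1) 1) ∈ T.carrier := by
    intro n
    have := (vertexAt_mem hT ((h 0 0 _).2 ⟨rfl, rfl, n, rfl⟩)).1
    have e : T.vertexAt (0, some (0, List.replicate n 1)) =
        T.pt.append (List.replicate (n + 1) 1) := by
      show ((T.spine 0).child 1).append _ = _
      rw [spine_zero, List.replicate_succ, append_cons]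
    rwa [e] at this
  have hlt : ∀ n m, n < m → LexLT (T.pt.append (List.replicate n 1))
      (T.pt.append (List.replicate m 1)) := by
    intro n m hnm
    obtain ⟨k, rfl⟩ := Nat.exists_eq_add_of_lt hnm
    rw [show n + k + 1 = n + (k + 1) by ring, List.replicate_add, append_append]
    exact (lexLT_append_iff _ [] _).2 List.Lex.nil
  refine ⟨fun v hv hr => ?_, fun v hv => ?_⟩
  · rcases hr with rfl | hr
    · exact ⟨_, hmem 0, hlt 0 1 one_pos⟩
    · obtain ⟨n, rfl⟩ := key v hv hr
      exact ⟨_, hmem (n + 1), hlt _ _ (Nat.lt_succ_self _)⟩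
  · by_cases hr : LexLT T.pt v
    · obtain ⟨n, rfl⟩ := key v hv hr
      refine ((Set.finite_le_nat n).image fun m => T.pt.append (List.replicate (m + 1) 1)).subset ?_
      rintro w ⟨hw, h1, h2⟩
      obtain ⟨m, rfl⟩ := key w hw h1
      refine ⟨m, ?_, rfl⟩
      by_contra hm
      exact lexLT_irrefl _ (lexLT_trans hw hv hw h2 (hlt _ _ (by simp only [Set.mem_ofPred_eq] at hm; omega)))
    · refine (Set.finite_empty).subset ?_
      rintro w ⟨hw, h1, h2⟩
      exact hr (lexLT_trans T.pt_mem hw hv h1 h2)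

theorem RightDiscrete.exists_isSucc (h : T.RightDiscrete) (v : T.carrier)
    (hv : (v : BiWord ℕ) = T.pt ∨ LexLT T.pt v) : ∃ s, T.IsSucc v s := by
  obtain ⟨w₀, hw₀, hlt⟩ := h.exists_gt v v.2 hv
  let A : BiWord ℕ → Set (BiWord ℕ) := fun w => {x ∈ T.carrier | LexLT v x ∧ LexLT x w}
  have hfin : ∀ w ∈ T.carrier, (A w).Finite := by
    intro w hw
    refine (h.finite_lt w hw).subset ?_
    rintro x ⟨hx, h1, h2⟩
    refine ⟨hx, ?_, h2⟩
    rcases hv with hv | hv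
    · rwa [← hv]
    · exact lexLT_trans T.pt_mem v.2 hx hv h1
  let S : Set (BiWord ℕ) := {w ∈ T.carrier | LexLT v w}
  -- The successor is the later vertex with the fewest vertices between `v` and itself.
  obtain ⟨w, ⟨hw, hvw⟩, hmin⟩ := (InvImage.wf (fun w => (A w).ncard) Nat.lt_wfRel.wf).has_min S
    ⟨w₀, hw₀, hlt⟩
  refine ⟨⟨w, hw⟩, hvw, fun z hz => ?_⟩
  rcases lexLT_trichotomy hw z.2 with h1 | h1 | h1
  · exact Or.inr h1
  · exact Or.inl (Subtype.ext h1)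
  · refine absurd ?_ (hmin z ⟨z.2, hz⟩)
    refine Set.ncard_lt_ncard ⟨?_, ?_⟩ (hfin w hw)
    · rintro x ⟨hx, h2, h3⟩
      exact ⟨hx, h2, lexLT_trans hx z.2 hw h3 h1⟩
    · intro h2
      exact lexLT_irrefl _ (h2 (show (z : BiWord ℕ) ∈ A w from ⟨z.2, hz, h1⟩)).2.2

end PTree

namespace LTree

open BiWord PTree Code

variable {b : ℕ} {x : LTree (BiWord (Fin b))}

theorem allSucc_of_rightDiscrete (h : x.RightDiscrete) : x.AllSucc :=
  fun v hv => h.exists_isSucc v hv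

/-- The successors list all the vertices on the right of the distinguished point. -/
theorem mem_range_vertex_iff (h : x.RightDiscrete) (v : x.carrier) :
    v ∈ Set.range x.vertex ↔ (v : BiWord ℕ) = x.pt ∨ LexLT x.pt v := by
  have hs := allSucc_of_rightDiscrete h
  constructor
  · rintro ⟨n, rfl⟩
    exact (hs.lexLT_vertex n).1
  · intro hv
    by_contra hno
    -- A vertex missed by the list would be preceded by all the `v_n`, that is by infinitely many
    -- vertices after `ϱ`.
    have hlt : ∀ n, LexLT (x.vertex n) v := by
      intro n
      induction n with
      | zero =>
        rcases hv with hv | hv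
        · exact absurd ⟨0, Subtype.ext hv.symm⟩ hno
        · exact hv
      | succ n ih =>
        rcases (hs.lexLT_vertex n).2.2 v ih with h1 | h1
        · exact absurd ⟨n + 1, h1⟩ hno
        · exact h1
    have hmono : ∀ n m, n < m → LexLT (x.vertex n) (x.vertex m) := by
      intro n m hnm
      induction m, hnm using Nat.le_induction with
      | base => exact (hs.lexLT_vertex n).2.1
      | succ m _ ih =>
        exact lexLT_trans (x.vertex n).2 (x.vertex m).2 (x.vertex (m + 1)).2 ih
          (hs.lexLT_vertex m).2.1
    refine Set.infinite_of_injective_forall_mem (f := fun n => (x.vertex (n + 1) : BiWord ℕ)) ?_ ?_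
      (h.finite_lt v v.2)
    · intro n m hnm
      rcases lt_trichotomy n m with h1 | h1 | h1
      · have := hmono _ _ (Nat.succ_lt_succ h1)
        rw [show (x.vertex (n + 1) : BiWord ℕ) = x.vertex (m + 1) from hnm] at this
        exact absurd this (lexLT_irrefl _)
      · exact h1
      · have := hmono _ _ (Nat.succ_lt_succ h1)
        rw [show (x.vertex (n + 1) : BiWord ℕ) = x.vertex (m + 1) from hnm] at this
        exact absurd this (lexLT_irrefl _)
    · intro n
      exact ⟨(x.vertex (n + 1)).2, hmono 0 (n + 1) (Nat.succ_pos n), hlt (n + 1)⟩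

variable [NeZero b]

theorem levels_code (hx : ∀ p, (x.spine p).last = 1) : x.code.levels = x.levels := by
  rw [code_eq_assemble hx]
  funext p
  cases p <;> rfl

end LTree

namespace IsUniformBRW

open BiWord PTree LTree Code

variable {b : ℕ} [NeZero b] {μ : PMF ℕ} {Ω : Type*} [MeasurableSpace Ω] {P : Measure Ω}
  [IsProbabilityMeasure P] {Θ : Ω → LTree (BiWord (Fin b))}

/-- An almost sure property of the code of independent marks which does not depend on the marks
outside of the tree holds almost surely for the code of the branching random walk. -/
theorem ae_code (hμ : ∑' k : ℕ, (k : ℝ≥0∞) * μ k = 1)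
    (h : IsUniformBRW μ b P Θ) {p : Code b → Prop} (hp : MeasurableSet {c | p c})
    (hr : ∀ c, p (reset c) ↔ p c) (hc : ∀ᵐ c ∂codeM b μ (tailPMF μ hμ), p c) :
    ∀ᵐ ω ∂P, p (Θ ω).code := by
  obtain ⟨h1, h2⟩ := h.map_code hμ
  refine ae_of_ae_map h1 ?_
  rw [h2, ae_map_iff measurable_reset.aemeasurable hp]
  filter_upwards [hc] with c hc
  exact (hr c).2 hc

theorem ae_rightDiscrete (hμ : ∑' k : ℕ, (k : ℝ≥0∞) * μ k = 1)
    (h : IsUniformBRW μ b P Θ) : ∀ᵐ ω ∂P, (Θ ω).RightDiscrete := by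
  by_cases h1 : μ = PMF.pure 1
  · filter_upwards [h.ae_good, ae_code hμ h (p := fun c => LineLevels c.levels)
      (measurable_levels measurableSet_lineLevels)
      (fun c => by rw [levels_reset]; exact lineLevels_reset _) (ae_lineLevels hμ h1)] with ω h2 h3
    rw [levels_code h2.spine_last] at h3
    exact rightDiscrete_of_lineLevels h2.spine_last h3
  · filter_upwards [h.ae_good, ae_code hμ h (p := fun c => FinLevels c.levels)
      (measurable_levels measurableSet_finLevels)
      (fun c => by rw [levels_reset]; exact finLevels_reset _) (ae_finLevels hμ h1)] with ω h2 h3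
    rw [levels_code h2.spine_last] at h3
    exact rightDiscrete_of_finLevels h2.spine_last h3

end IsUniformBRW

/-! ### The sigma-field of local convergence and the code; invariance of the law of the tree. -/

namespace Code

variable {b : ℕ}

theorem measurable_moveBi :
    Measurable fun p : BiWord (Fin b) × Step b => moveBi p.1 p.2 := by
  refine BiWord.measurable_of_height_letter ?_ ?_
  · simp only [height_moveBi]
    exact (BiWord.measurable_height.comp measurable_fst).add
      ((Measurable.of_discrete (f := dh)).comp measurable_snd)
  · simp only [letter_moveBi]
    exact measurable_move.comp (((BiWord.measurable_letter.comp measurable_fst)).prodMk measurable_snd)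

end Code

/-- The good trees, with the sigma-field generated by the code. -/
def GoodTree (b : ℕ) [NeZero b] : Type := {x : LTree (BiWord (Fin b)) // x.Good}

namespace GoodTree

open BiWord PTree LTree Code

variable {b : ℕ} [NeZero b]

instance : MeasurableSpace (GoodTree b) := MeasurableSpace.comap (fun x => x.1.code) inferInstance

theorem measurable_code : Measurable fun x : GoodTree b => x.1.code := comap_measurable _

theorem measurable_levels : Measurable fun x : GoodTree b => x.1.levels := by
  have e : (fun x : GoodTree b => x.1.levels) = fun x => x.1.code.levels := by
    funext x
    exact (levels_code x.2.spine_last).symm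
  rw [e]
  exact Code.measurable_levels.comp measurable_code

theorem measurableSet_vertexAt_mem (a : Addr) :
    MeasurableSet {x : GoodTree b | x.1.vertexAt a ∈ x.1.carrier} := by
  obtain ⟨p, _ | ⟨i, u⟩⟩ := a
  · have e : {x : GoodTree b | x.1.vertexAt (p, none) ∈ x.1.carrier} = Set.univ :=
      Set.eq_univ_of_forall fun x => x.1.spine_mem p
    rw [e]
    exact MeasurableSet.univ
  · have e : {x : GoodTree b | x.1.vertexAt (p, some (i, u)) ∈ x.1.carrier} =
        {x | presentAt x.1.levels (p, some (i, u))} := by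
      ext x
      exact (presentAt_levels_iff x.2.spine_last p i u).symm
    rw [e]
    exact (measurable_levels (b := b)) (measurableSet_presentAt (p, some (i, u)))

theorem measurable_lab_spine (p : ℕ) : Measurable fun x : GoodTree b => x.1.lab (x.1.spine p) := by
  induction p with
  | zero =>
    refine measurable_of_height_letter ?_ ?_
    · have e : (fun x : GoodTree b => (x.1.lab (x.1.spine 0)).height) = fun _ => 0 := by
        funext x
        rw [spine_zero]
        exact lab_pt x.2
      rw [e]
      exact measurable_const
    · have e : (fun x : GoodTree b => (x.1.lab (x.1.spine 0)).letter) = fun x => x.1.code.2.1 := by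
        funext x
        rw [spine_zero]
        rfl
      rw [e]
      exact Measurable.fst (measurable_code.snd)
  | succ p ih =>
    have e : (fun x : GoodTree b => x.1.lab (x.1.spine (p + 1))) =
        fun x => moveBi (x.1.lab (x.1.spine p)) (x.1.code.2.2 p).1 := by
      funext x
      have h1 := (x.2.adj _ (x.1.spine_mem p)).symm
      rw [← spine_succ] at h1
      show _ = moveBi _ (stepOf (x.1.lab (parent^[p] x.1.pt)) (x.1.lab (parent^[p + 1] x.1.pt)))
      rw [← spine_eq, ← spine_eq, moveBi_stepOf h1]
    rw [e]
    refine measurable_moveBi.comp (ih.prodMk ?_)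
    exact ((measurable_pi_apply p).comp measurable_code.snd.snd).fst

/-- Labels are rebuilt from that of `ϱ` by following the steps stored in the code, letter after
letter of the path. -/
theorem measurable_lab_vertexAt (a : Addr) :
    Measurable fun x : GoodTree b => x.1.lab (x.1.vertexAt a) := by
  classical
  obtain ⟨p, _ | ⟨i, u⟩⟩ := a
  · exact measurable_lab_spine p
  have key : ∀ (u : List ℕ) (a' : Addr), (∀ x : GoodTree b, (x.1.vertexAt (p, some (i, u))).parent =
      x.1.vertexAt a') → Measurable (fun x : GoodTree b => x.1.lab (x.1.vertexAt a')) →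
      Measurable fun x : GoodTree b => x.1.lab (x.1.vertexAt (p, some (i, u))) := by
    intro u a' ha' hm
    have hs : Measurable fun x : GoodTree b => (x.1.markAt (x.1.vertexAt (p, some (i, u)))).2 := by
      have e : (fun x : GoodTree b => (x.1.markAt (x.1.vertexAt (p, some (i, u)))).2) =
          fun x => ((x.1.code.bodyAt p).2 i u).2 := by
        funext x
        rw [code_eq_assemble x.2.spine_last]
        cases p <;> rfl
      rw [e]
      cases p with
      | zero => exact Measurable.snd ((measurable_pi_apply u).comp
          ((measurable_pi_apply i).comp measurable_code.fst.snd))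
      | succ p => exact Measurable.snd ((measurable_pi_apply u).comp
          ((measurable_pi_apply i).comp
            ((measurable_pi_apply p).comp measurable_code.snd.snd).snd.snd))
    have e : (fun x : GoodTree b => x.1.lab (x.1.vertexAt (p, some (i, u)))) = fun x =>
        if x.1.vertexAt (p, some (i, u)) ∈ x.1.carrier then
          moveBi (x.1.lab (x.1.vertexAt a')) (x.1.markAt (x.1.vertexAt (p, some (i, u)))).2
        else default := by
      funext x
      by_cases h : x.1.vertexAt (p, some (i, u)) ∈ x.1.carrier
      · have h1 := x.2.adj _ h
        rw [ha'] at h1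
        rw [if_pos h, markAt, if_pos h, ha', moveBi_stepOf h1]
      · rw [if_neg h]
        exact dif_neg h
    rw [e]
    exact Measurable.ite (measurableSet_vertexAt_mem _) (measurable_moveBi.comp (hm.prodMk hs))
      measurable_const
  induction u using List.reverseRecOn with
  | nil => exact key [] (p, none) (fun x => parent_child _ _) (measurable_lab_spine p)
  | append_singleton u j ih =>
    refine key _ (p, some (i, u)) (fun x => ?_) ih
    show (((x.1.spine p).child (firstChild p + i)).append (u ++ [j])).parent = _
    rw [append_concat, parent_child]
    rfl

/-- The letter `1` leads from `ϱ(p + 1)` back to `ϱ(p)`, so every path from an ancestor reduces to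
an address, unless it leaves the line by the letter `0`. -/
theorem exists_addr (p : ℕ) (w : List ℕ) :
    (∃ a, ∀ x : GoodTree b, (x.1.spine p).append w = x.1.vertexAt a) ∨
      ∀ x : GoodTree b, (x.1.spine p).append w ∉ x.1.carrier := by
  induction p generalizing w with
  | zero =>
    match w with
    | [] => exact Or.inl ⟨(0, none), fun x => rfl⟩
    | 0 :: w =>
      refine Or.inr fun x hx => ?_
      have := (child_mem_iff (x.1.spine_mem 0) 0).1 (mem_of_append_mem hx)
      omega
    | (j + 1) :: w =>
      refine Or.inl ⟨(0, some (j, w)), fun x => ?_⟩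
      show _ = ((x.1.spine 0).child (1 + j)).append w
      rw [append_cons, add_comm]
  | succ p ih =>
    match w with
    | [] => exact Or.inl ⟨(p + 1, none), fun x => rfl⟩
    | 0 :: w =>
      refine Or.inr fun x hx => ?_
      have := (child_mem_iff (x.1.spine_mem (p + 1)) 0).1 (mem_of_append_mem hx)
      omega
    | 1 :: w =>
      have e : ∀ x : GoodTree b, (x.1.spine (p + 1)).append (1 :: w) = (x.1.spine p).append w := by
        intro x
        rw [append_cons, x.1.spine_eq_child p, x.2.spine_last]
      simp only [e]
      exact ih w
    | (j + 2) :: w =>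
      refine Or.inl ⟨(p + 1, some (j, w)), fun x => ?_⟩
      show _ = ((x.1.spine (p + 1)).child (2 + j)).append w
      rw [append_cons, add_comm j 2]

theorem measurableSet_append_mem (p : ℕ) (w : List ℕ) :
    MeasurableSet {x : GoodTree b | (x.1.spine p).append w ∈ x.1.carrier} := by
  rcases exists_addr (b := b) p w with ⟨a, ha⟩ | h
  · simp only [ha]
    exact measurableSet_vertexAt_mem a
  · have e : {x : GoodTree b | (x.1.spine p).append w ∈ x.1.carrier} = ∅ :=
      Set.eq_empty_of_forall_notMem h
    rw [e]
    exact MeasurableSet.empty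

/-- On good trees, the sigma-field of local convergence is generated by the code. -/
theorem measurable_val : Measurable fun x : GoodTree b => x.1 := by
  have h1 : Measurable fun x : GoodTree b => x.1.pt := by
    refine measurable_of_height_letter ?_ (measurable_pi_lambda _ fun j => ?_)
    · have e : (fun x : GoodTree b => x.1.pt.height) = fun _ => 0 := funext fun x => x.2.height_pt
      rw [e]
      exact measurable_const
    · have e : (fun x : GoodTree b => x.1.pt.letter j) = fun _ => 1 := by
        funext x
        rw [← x.2.spine_last j, spine_eq, last, letter_parent_iterate, zero_add]
      rw [e]
      exact measurable_const
  have h2 : Measurable fun x : GoodTree b =>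
      (x.1.pt, fun p : ℕ => x.1.subtree (x.1.spine p)) :=
    h1.prodMk (measurable_pi_lambda _ fun p => measurable_set_iff.2 fun w =>
      measurable_to_prop (by
        have := measurableSet_append_mem (b := b) p w
        convert this using 1
        ext x
        simp [subtree]))
  refine Measurable.of_le_map (sup_le ?_ (MeasurableSpace.generateFrom_le ?_))
  · rintro _ ⟨_, ⟨S, hS, rfl⟩, rfl⟩
    exact h2 hS
  · rintro _ ⟨p, w, B, hB, rfl⟩
    show @MeasurableSet (GoodTree b) _ ((fun x : GoodTree b => x.1) ⁻¹' _)
    rcases exists_addr (b := b) p w with ⟨a, ha⟩ | h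
    · have e : (fun x : GoodTree b => x.1) ⁻¹' {T : LTree (BiWord (Fin b)) |
          ∃ h : (T.spine p).append w ∈ T.carrier, T.label ⟨_, h⟩ ∈ B} =
          {x | (x.1.spine p).append w ∈ x.1.carrier} ∩
            {x | x.1.lab (x.1.vertexAt a) ∈ B} := by
        ext x
        constructor
        · rintro ⟨h3, h4⟩
          refine ⟨h3, ?_⟩
          show x.1.lab (x.1.vertexAt a) ∈ B
          rw [← ha, lab_eq _ h3]
          exact h4
        · rintro ⟨h3, h4⟩
          refine ⟨h3, ?_⟩
          rw [← lab_eq _ h3, ha]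
          exact h4
      rw [e]
      exact (measurableSet_append_mem p w).inter (measurable_lab_vertexAt a hB)
    · have e : (fun x : GoodTree b => x.1) ⁻¹' {T : LTree (BiWord (Fin b)) |
          ∃ h : (T.spine p).append w ∈ T.carrier, T.label ⟨_, h⟩ ∈ B} = ∅ :=
        Set.eq_empty_of_forall_notMem fun x ⟨h3, _⟩ => h x h3
      rw [e]
      exact MeasurableSet.empty

/-- Local events of good trees are events of the code; the invariance can then be proved on codes,
without studying `sccPlus` on all trees. -/
theorem exists_code_mem_iff {D : Set (LTree (BiWord (Fin b)))} (hD : MeasurableSet D) :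
    ∃ E : Set (Code b), MeasurableSet E ∧
      ∀ x : LTree (BiWord (Fin b)), x.Good → (x.code ∈ E ↔ x ∈ D) := by
  obtain ⟨E, hE, h⟩ := measurable_val hD
  exact ⟨E, hE, fun x hx => iff_of_eq (congrFun h ⟨x, hx⟩)⟩

end GoodTree

namespace IsUniformBRW

open BiWord PTree LTree Code

variable {b : ℕ} [NeZero b] {μ : PMF ℕ} {Ω : Type*} [MeasurableSpace Ω] {P : Measure Ω}
  [IsProbabilityMeasure P] {Θ : Ω → LTree (BiWord (Fin b))}

/-- The law of the branching random walk is invariant under the right-successor map. -/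
theorem identDistrib_sccPlus (hμ : ∑' k : ℕ, (k : ℝ≥0∞) * μ k = 1) (h : IsUniformBRW μ b P Θ) :
    IdentDistrib (fun ω => (Θ ω).sccPlus) Θ P P := by
  classical
  obtain ⟨hc, hlaw⟩ := h.map_code hμ
  have hgood : ∀ᵐ ω ∂P, (Θ ω).Good ∧ (Θ ω).sccPlus.Good ∧
      (Θ ω).sccPlus.code = next (hc.mk _ ω) ∧ (Θ ω).code = hc.mk _ ω := by
    filter_upwards [h.ae_good, h.ae_rightDiscrete hμ, hc.ae_eq_mk] with ω h1 h2 h3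
    obtain ⟨h4, h5⟩ := h1.sccPlus (allSucc_of_rightDiscrete h2).exists_lexLT
    exact ⟨h1, h4, by rw [h5, h3], h3⟩
  obtain ⟨S, hS, hSm, hS0⟩ := exists_measurable_superset_of_null hgood
  obtain ⟨ω₀⟩ := nonempty_of_isProbabilityMeasure P
  have hSc : ∀ᵐ ω ∂P, ω ∉ S := measure_eq_zero_iff_ae_notMem.1 hS0
  have hmem : ∀ ω ∉ S, (Θ ω).Good ∧ (Θ ω).sccPlus.Good ∧
      (Θ ω).sccPlus.code = next (hc.mk _ ω) ∧ (Θ ω).code = hc.mk _ ω := fun ω hω => by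
    by_contra hno
    exact hω (hS hno)
  have hcm := hc.measurable_mk
  have hae : AEMeasurable (fun ω => (Θ ω).sccPlus) P := by
    -- Off the null set `S` the events of `sccPlus` are read on the code; on `S` a constant value is
    -- substituted.
    refine ⟨fun ω => if ω ∈ S then Θ ω₀ else (Θ ω).sccPlus, fun D hD => ?_, ?_⟩
    · obtain ⟨E, hE, hED⟩ := GoodTree.exists_code_mem_iff hD
      have e : (fun ω => if ω ∈ S then Θ ω₀ else (Θ ω).sccPlus) ⁻¹' D =
          (S ∩ {_ω | Θ ω₀ ∈ D}) ∪ (Sᶜ ∩ {ω | next (hc.mk _ ω) ∈ E}) := by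
        ext ω
        by_cases hω : ω ∈ S
        · simp [hω]
        · obtain ⟨-, h1, h2, -⟩ := hmem ω hω
          have h3 := hED _ h1
          rw [h2] at h3
          simp [hω, h3]
      rw [e]
      exact (hSm.inter (MeasurableSet.const _)).union
        (hSm.compl.inter ((measurable_next.comp hcm) hE))
    · filter_upwards [hSc] with ω hω
      rw [if_neg hω]
  refine ⟨hae, h.measurable.aemeasurable, Measure.ext fun D hD => ?_⟩
  obtain ⟨E, hE, hED⟩ := GoodTree.exists_code_mem_iff hD
  have hlaw' : P.map (hc.mk _) = (codeM b μ (tailPMF μ hμ)).map reset := by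
    rw [← hlaw]
    exact Measure.map_congr hc.ae_eq_mk.symm
  rw [Measure.map_apply_of_aemeasurable hae hD, Measure.map_apply h.measurable hD]
  have h1 : P ((fun ω => (Θ ω).sccPlus) ⁻¹' D) = P (hc.mk _ ⁻¹' (next ⁻¹' E)) := by
    refine measure_congr (Filter.eventuallyEq_set.2 ?_)
    filter_upwards [hSc] with ω hω
    obtain ⟨-, h1, h2, -⟩ := hmem ω hω
    show _ ↔ next (hc.mk _ ω) ∈ E
    rw [← h2]
    exact (hED _ h1).symm
  have h2 : P (Θ ⁻¹' D) = P (hc.mk _ ⁻¹' E) := by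
    refine measure_congr (Filter.eventuallyEq_set.2 ?_)
    filter_upwards [hSc] with ω hω
    obtain ⟨h1, -, -, h2⟩ := hmem ω hω
    show _ ↔ hc.mk _ ω ∈ E
    rw [← h2]
    exact (hED _ h1).symm
  rw [h1, h2, ← Measure.map_apply hcm (measurable_next hE), ← Measure.map_apply hcm hE, hlaw',
    Measure.map_apply measurable_reset (measurable_next hE), Measure.map_apply measurable_reset hE]
  have e : reset ⁻¹' (next ⁻¹' E) = next ⁻¹' (reset ⁻¹' E : Set (Code b)) := by
    ext c
    simp only [Set.mem_preimage, next_reset]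
  rw [e, (measurePreserving_next hμ).measure_preimage (measurable_reset hE).nullMeasurableSet]

end IsUniformBRW

/-! ### The simple walk of the heights: it goes arbitrarily far down. -/

namespace Code

variable {b : ℕ}

variable (b) in
/-- The walk with given steps stays above `-h` up to time `n`. -/
def stay (n h : ℕ) : Set (ℕ → Step b) :=
  {s | ∀ k ≤ n, -(h : ℤ) < ∑ i ∈ Finset.range k, dh (s i)}

theorem measurable_sum_dh (k : ℕ) :
    Measurable fun s : ℕ → Step b => ∑ i ∈ Finset.range k, dh (s i) :=
  Finset.measurable_fun_sum _ fun i _ => measurable_dh.comp (measurable_pi_apply i)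

theorem measurableSet_stay (n h : ℕ) : MeasurableSet (stay b n h) := by
  have e : stay b n h = ⋂ k, ⋂ (_ : k ≤ n),
      {s | -(h : ℤ) < ∑ i ∈ Finset.range k, dh (s i)} := by
    ext s; simp [stay]
  rw [e]
  exact MeasurableSet.iInter fun k => MeasurableSet.iInter fun _ =>
    measurableSet_lt measurable_const (measurable_sum_dh k)

theorem stay_zero (n : ℕ) : stay b n 0 = ∅ :=
  Set.eq_empty_of_forall_notMem fun s hs => by simpa using hs 0 (Nat.zero_le n)

theorem stay_anti {n m : ℕ} (h : ℕ) (hnm : n ≤ m) : stay b m h ⊆ stay b n h :=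
  fun _ hs k hk => hs k (hk.trans hnm)

theorem consSeq_mem_stay (n h : ℕ) (σ : Step b) (s : ℕ → Step b) :
    consSeq σ s ∈ stay b (n + 1) (h + 1) ↔ s ∈ stay b n (h + if σ = none then 0 else 2) := by
  have hsum : ∀ k, ∑ i ∈ Finset.range (k + 1), dh (consSeq σ s i) =
      dh σ + ∑ i ∈ Finset.range k, dh (s i) := fun k => by
    rw [Finset.sum_range_succ', add_comm]
    rfl
  have hd : dh σ = -1 + ((if σ = none then 0 else 2 : ℕ) : ℤ) := by
    cases σ <;> rfl
  constructor
  · intro hs k hk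
    have := hs (k + 1) (Nat.succ_le_succ hk)
    rw [hsum, hd] at this
    push_cast at this ⊢
    linarith
  · intro hs k hk
    cases k with
    | zero => simp; omega
    | succ k =>
      have := hs k (Nat.le_of_succ_le_succ hk)
      rw [hsum, hd]
      push_cast at this ⊢
      linarith

variable [NeZero b]

variable (b) in
/-- The law of independent steps. -/
def stepsM : Measure (ℕ → Step b) := Measure.infinitePi fun _ => stepM b

instance : IsProbabilityMeasure (stepsM b) := by unfold stepsM; infer_instance

theorem measure_stay_succ (n h : ℕ) :
    (stepsM b).real (stay b (n + 1) (h + 1)) =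
      ((stepsM b).real (stay b n h) + (stepsM b).real (stay b n (h + 2))) / 2 := by
  have h1 := (measurePreserving_consSeq (fun _ : ℕ => stepM b)).measure_preimage
    (measurableSet_stay (n + 1) (h + 1)).nullMeasurableSet
  rw [Measure.prod_apply (measurable_consSeq (measurableSet_stay (n + 1) (h + 1)))] at h1
  have h2 : ∀ σ : Step b, Prod.mk σ ⁻¹' ((fun p : Step b × (ℕ → Step b) => consSeq p.1 p.2) ⁻¹'
      stay b (n + 1) (h + 1)) = stay b n (h + if σ = none then 0 else 2) := by
    intro σ
    ext s
    exact consSeq_mem_stay n h σ s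
  simp only [h2, lintegral_stepM, if_true, reduceCtorEq, if_false, Finset.sum_const,
    Finset.card_univ, Fintype.card_fin, nsmul_eq_mul, add_zero] at h1
  rw [inv_two_mul_eq, ← mul_assoc, mul_left_comm, natCast_mul_inv, mul_one] at h1
  have h3 := congrArg ENNReal.toReal h1
  rw [ENNReal.toReal_add (ENNReal.mul_ne_top (by simp) (measure_ne_top _ _))
    (ENNReal.mul_ne_top (by simp) (measure_ne_top _ _)), ENNReal.toReal_mul, ENNReal.toReal_mul,
    ENNReal.toReal_inv] at h3
  simp only [ENNReal.toReal_ofNat] at h3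
  rw [measureReal_def, measureReal_def, measureReal_def, stepsM, ← h3]
  ring

/-- For the walk started at `h`, the mean exit time from `(0, L)` is `h (L - h)`, and `h / L` is the
probability of leaving at `L`, in which case the whole time `n` is counted. The induction uses that
`h ↦ h (L - h)` decreases by `1` in mean at each step. -/
theorem sum_stay_le (L : ℕ) (hL : 0 < L) (n h : ℕ) (hh : h ≤ L) :
    ∑ j ∈ Finset.range n, (stepsM b).real (stay b j h) ≤ h * (L - h) + n * h / L := by
  have hL' : (0 : ℝ) < L := Nat.cast_pos.2 hL
  induction n generalizing h with
  | zero =>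
    have : (h : ℝ) ≤ L := Nat.cast_le.2 hh
    simp only [Finset.range_zero, Finset.sum_empty, Nat.cast_zero, zero_mul, zero_div, add_zero]
    exact mul_nonneg (Nat.cast_nonneg h) (sub_nonneg.2 this)
  | succ n ih =>
    cases h with
    | zero => simp [stay_zero]
    | succ h =>
      rcases hh.lt_or_eq with h1 | h1
      · rw [Finset.sum_range_succ']
        simp only [measure_stay_succ]
        rw [← Finset.sum_div, Finset.sum_add_distrib]
        have h2 := ih h (by omega)
        have h3 := ih (h + 2) (by omega)
        have h4 : (stepsM b).real (stay b 0 (h + 1)) ≤ 1 := measureReal_le_one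
        have h5 : (h : ℝ) * (L - h) + n * h / L + (((h + 2 : ℕ) : ℝ) * (L - (h + 2 : ℕ)) +
            n * (h + 2 : ℕ) / L) = 2 * (((h + 1 : ℕ) : ℝ) * (L - (h + 1 : ℕ)) +
            n * (h + 1 : ℕ) / L) - 2 := by
          push_cast
          field_simp
          ring
        have h6 : (n : ℝ) * (h + 1 : ℕ) / L ≤ (n + 1 : ℕ) * (h + 1 : ℕ) / L := by
          gcongr
          simp
        linarith
      · have h2 : ∑ j ∈ Finset.range (n + 1), (stepsM b).real (stay b j (h + 1)) ≤ (n + 1 : ℕ) := by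
          refine (Finset.sum_le_sum fun j _ => measureReal_le_one).trans ?_
          simp
        have h3 : (L : ℝ) = ((h + 1 : ℕ) : ℝ) := by rw [h1]
        rw [← h3, sub_self, mul_zero, zero_add, mul_div_assoc, div_self hL'.ne', mul_one]
        exact h2

/-- The walk reaches `-h` before time `n` with high probability. -/
theorem measure_stay_le (L n h : ℕ) (hL : 0 < L) (hn : 0 < n) :
    (stepsM b).real (stay b n h) ≤ h * L / n + h / L := by
  have hn' : (0 : ℝ) < n := Nat.cast_pos.2 hn
  have hL' : (0 : ℝ) < L := Nat.cast_pos.2 hL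
  rcases le_or_gt h L with h1 | h1
  · have h2 := sum_stay_le (b := b) L hL n h h1
    have h3 : (n : ℝ) * (stepsM b).real (stay b n h) ≤
        ∑ j ∈ Finset.range n, (stepsM b).real (stay b j h) := by
      have := Finset.card_nsmul_le_sum (Finset.range n)
        (fun j => (stepsM b).real (stay b j h)) ((stepsM b).real (stay b n h)) fun j hj =>
          measureReal_mono (stay_anti h (Finset.mem_range.1 hj).le)
      simpa using this
    have h4 : (h : ℝ) * (L - h) ≤ h * L := by
      nlinarith [Nat.cast_nonneg (α := ℝ) h]
    have h5 : (n : ℝ) * (stepsM b).real (stay b n h) ≤ h * L + n * h / L := by linarith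
    calc (stepsM b).real (stay b n h) = n * (stepsM b).real (stay b n h) / n := by field_simp
      _ ≤ (h * L + n * h / L) / n := by gcongr
      _ = h * L / n + h / L := by field_simp
  · have : (1 : ℝ) ≤ h / L := by
      rw [one_le_div hL']
      exact Nat.cast_le.2 h1.le
    have h2 : (0 : ℝ) ≤ h * L / n := by positivity
    linarith [measureReal_le_one (μ := stepsM b) (s := stay b n h)]

/-- The walk is not bounded from below. -/
theorem ae_exists_sum_dh_le (h : ℕ) :
    ∀ᵐ s ∂stepsM b, ∃ k, ∑ i ∈ Finset.range k, dh (s i) ≤ -(h : ℤ) := by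
  have h1 : (stepsM b).real {s | ¬ ∃ k, ∑ i ∈ Finset.range k, dh (s i) ≤ -(h : ℤ)} ≤ 0 := by
    have h2 : ∀ L : ℕ, (stepsM b).real {s | ¬ ∃ k, ∑ i ∈ Finset.range k, dh (s i) ≤ -(h : ℤ)} ≤
        2 * h * (1 / ((L : ℝ) + 1)) := by
      intro L
      have h3 : {s : ℕ → Step b | ¬ ∃ k, ∑ i ∈ Finset.range k, dh (s i) ≤ -(h : ℤ)} ⊆
          stay b ((L + 1) ^ 2) h := fun s hs k _ => by
        by_contra hno
        exact hs ⟨k, not_lt.1 hno⟩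
      -- With `n = (L + 1) ^ 2`, both terms of the bound equal `h / (L + 1)`.
      refine (measureReal_mono h3).trans ((measure_stay_le (L + 1) _ h (Nat.succ_pos L)
        (by positivity)).trans (le_of_eq ?_))
      push_cast
      have : (L : ℝ) + 1 ≠ 0 := by positivity
      field_simp
      ring
    have h3 := (tendsto_one_div_add_atTop_nhds_zero_nat (𝕜 := ℝ)).const_mul (2 * (h : ℝ))
    rw [mul_zero] at h3
    exact ge_of_tendsto' h3 h2
  have h2 := le_antisymm h1 measureReal_nonneg
  exact (measureReal_eq_zero_iff (measure_ne_top _ _)).1 h2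

end Code

/-! ### Ergodicity of the walk on words. -/

section

variable {X Y : Type*} [MeasurableSpace X] [MeasurableSpace Y] {T : X → X} {r : X → Y}
  {π : Measure X} [IsProbabilityMeasure π] {κ : Measure Y}

/-- An invariant set `B` is an event of `T x`, which is independent of `r x`: the factors `κ (t i)`
are split off one at a time. -/
theorem measure_inter_pi_of_prod (h : MeasurePreserving (fun x => (r x, T x)) π (κ.prod π))
    {B : Set X} (hB : MeasurableSet B) (hBT : T ⁻¹' B = B) (n : ℕ) (t : ℕ → Set Y)
    (ht : ∀ i, MeasurableSet (t i)) :
    π (B ∩ {x | ∀ i < n, r (T^[i] x) ∈ t i}) = π B * ∏ i ∈ Finset.range n, κ (t i) := by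
  have hT : Measurable T := h.measurable.snd
  have hr : Measurable r := h.measurable.fst
  have hm : ∀ (n : ℕ) (t : ℕ → Set Y), (∀ i, MeasurableSet (t i)) →
      MeasurableSet {x | ∀ i < n, r (T^[i] x) ∈ t i} := fun n t ht => by
    simp only [Set.ofPred_forall]
    exact MeasurableSet.iInter fun i => MeasurableSet.iInter fun _ =>
      (hr.comp (hT.iterate i)) (ht i)
  induction n generalizing t with
  | zero => simp
  | succ n ih =>
    have e : B ∩ {x | ∀ i < n + 1, r (T^[i] x) ∈ t i} = (fun x => (r x, T x)) ⁻¹'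
        (t 0 ×ˢ (B ∩ {x | ∀ i < n, r (T^[i] x) ∈ t (i + 1)})) := by
      ext x
      have hx : x ∈ B ↔ T x ∈ B := by
        conv_lhs => rw [← hBT]
        rfl
      simp only [Set.mem_inter_iff, Set.mem_preimage, Set.mem_prod, hx, Set.mem_ofPred_eq]
      constructor
      · rintro ⟨h1, h2⟩
        exact ⟨h2 0 n.succ_pos, h1, fun i hi => h2 (i + 1) (Nat.succ_lt_succ hi)⟩
      · rintro ⟨h1, h2, h3⟩
        refine ⟨h2, fun i hi => ?_⟩
        cases i with
        | zero => exact h1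
        | succ i => exact h3 i (Nat.lt_of_succ_lt_succ hi)
    rw [e, h.measure_preimage ((ht 0).prod (hB.inter (hm n _ fun i => ht _))).nullMeasurableSet,
      Measure.prod_prod, ih _ fun i => ht _, Finset.prod_range_succ']
    ring

variable [IsProbabilityMeasure κ]

theorem map_restrict_of_prod (h : MeasurePreserving (fun x => (r x, T x)) π (κ.prod π))
    {B : Set X} (hB : MeasurableSet B) (hBT : T ⁻¹' B = B) (h0 : π B ≠ 0) :
    (ProbabilityTheory.cond π B).map (fun x n => r (T^[n] x)) = Measure.infinitePi fun _ => κ := by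
  classical
  have hT : Measurable T := h.measurable.snd
  have hr : Measurable r := h.measurable.fst
  have hR : Measurable fun x (n : ℕ) => r (T^[n] x) :=
    measurable_pi_lambda _ fun n => hr.comp (hT.iterate n)
  refine Measure.eq_infinitePi _ fun s t ht => ?_
  obtain ⟨n, hn⟩ := s.exists_nat_subset_range
  have ht' : ∀ i, MeasurableSet (if i ∈ s then t i else Set.univ) := fun i => by
    split_ifs
    exacts [ht i, .univ]
  rw [Measure.map_apply hR (MeasurableSet.pi s.countable_toSet fun i _ => ht i),
    ProbabilityTheory.cond_apply hB]
  have e : (fun x (n : ℕ) => r (T^[n] x)) ⁻¹' (s : Set ℕ).pi t =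
      {x | ∀ i < n, r (T^[i] x) ∈ if i ∈ s then t i else Set.univ} := by
    ext x
    simp only [Set.mem_preimage, Set.mem_pi, Set.mem_ofPred_eq, Finset.mem_coe]
    constructor
    · intro hx i _
      split_ifs with hi
      exacts [hx i hi, trivial]
    · intro hx i hi
      have := hx i (Finset.mem_range.1 (hn hi))
      rwa [if_pos hi] at this
  rw [e, measure_inter_pi_of_prod h hB hBT n _ ht', ← mul_assoc,
    ENNReal.inv_mul_cancel h0 (measure_ne_top _ _), one_mul]
  rw [← Finset.prod_subset hn fun i _ hi => by rw [if_neg hi, measure_univ]]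
  exact Finset.prod_congr rfl fun i hi => by rw [if_pos hi]

/-- A transformation that is determined by independent variables, each of which is independent of
the next iterate, is ergodic. -/
theorem ergodic_of_prod (h : MeasurePreserving (fun x => (r x, T x)) π (κ.prod π))
    (hgen : ∀ B, MeasurableSet B → ∃ C : Set (ℕ → Y), MeasurableSet C ∧
      B =ᵐ[π] (fun x n => r (T^[n] x)) ⁻¹' C) : Ergodic T π := by
  refine ⟨(measurePreserving_snd (μ := κ) (ν := π)).comp h, ⟨fun {B} hB hBT => ?_⟩⟩
  have hT : Measurable T := h.measurable.snd
  have hr : Measurable r := h.measurable.fst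
  have hR : Measurable fun x (n : ℕ) => r (T^[n] x) :=
    measurable_pi_lambda _ fun n => hr.comp (hT.iterate n)
  rw [eventuallyConst_set']
  by_cases h0 : π B = 0
  · exact Or.inl (ae_eq_empty.2 h0)
  right
  obtain ⟨C, hC, hBC⟩ := hgen B hB
  -- The sequence has the same law under `π` and conditionally on `B`. As `B` is almost surely an
  -- event `C` of the sequence, `π B = π (B | B) = 1`.
  have h1 := congrArg (· C) (map_restrict_of_prod h hB hBT h0)
  have h2 := congrArg (· C) (map_restrict_of_prod h .univ rfl (by simp))
  simp only [ProbabilityTheory.cond_univ] at h2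
  rw [Measure.map_apply hR hC] at h1 h2
  rw [← h2, ← measure_congr hBC, ← measure_congr (ProbabilityTheory.cond_absolutelyContinuous.ae_eq hBC),
    ProbabilityTheory.cond_apply_self h0 (measure_ne_top _ _)] at h1
  exact (ae_eq_univ_iff_measure_eq hB.nullMeasurableSet).2 (by rw [← h1, measure_univ])

end

namespace Code

variable {b : ℕ} {Y : Type*}

/-- The steps of the reversed walk. -/
def back (v : Word b × (ℕ → Step b × Y)) : Step b × Y := (rev v.1 (v.2 0).1, (v.2 0).2)

/-- The word at time `0`, as a function of the first steps of the reversed walk. -/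
def unwind : ℕ → (ℕ → Step b × Y) → Word b → Word b
  | 0, _, w => w
  | P + 1, R, w => move (unwind P (fun n => R (n + 1)) w) (R 0).1

theorem climb_iterate_snd (v : Word b × (ℕ → Step b × Y)) (p n : ℕ) :
    (climb^[p] v).2 n = v.2 (n + p) := by
  induction p generalizing v with
  | zero => rfl
  | succ p ih =>
    rw [Function.iterate_succ_apply, ih]
    rfl

theorem unwind_back (P : ℕ) (v : Word b × (ℕ → Step b × Y)) :
    unwind P (fun n => back (climb^[n] v)) (climb^[P] v).1 = v.1 := by
  induction P generalizing v with
  | zero => rfl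
  | succ P ih =>
    have := ih (climb v)
    simp only [← Function.iterate_succ_apply] at this
    rw [unwind, this]
    exact move_move_rev v.1 (v.2 0).1

theorem unwind_add (P Q : ℕ) (R : ℕ → Step b × Y) (w : Word b) :
    unwind (P + Q) R w = unwind P R (unwind Q (fun n => R (n + P)) w) := by
  induction P generalizing R with
  | zero => rw [Nat.zero_add]; rfl
  | succ P ih =>
    rw [Nat.succ_add, unwind, ih, unwind]
    simp only [Nat.add_assoc]

/-- When the reversed steps rise by more than `j` in total, the letter `j` of the resulting word
lies above the height of the starting word, so it was written by one of the steps. -/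
theorem unwind_apply_congr {P j : ℕ} {R : ℕ → Step b × Y}
    (h : (j : ℤ) < ∑ i ∈ Finset.range P, dh (R i).1) (w w' : Word b) :
    unwind P R w j = unwind P R w' j := by
  induction P generalizing R j with
  | zero => simp at h; omega
  | succ P ih =>
    rw [Finset.sum_range_succ'] at h
    rw [unwind, unwind]
    cases hs : (R 0).1 with
    | none =>
      refine ih (R := fun n => R (n + 1)) ?_
      rw [hs] at h
      simp only [dh] at h ⊢
      push_cast
      linarith
    | some a =>
      cases j with
      | zero => rfl
      | succ j =>
        refine ih (R := fun n => R (n + 1)) ?_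
        rw [hs] at h
        simp only [dh] at h ⊢
        push_cast at h
        linarith

variable [MeasurableSpace Y]

theorem measurable_unwind (P : ℕ) (w : Word b) :
    Measurable fun R : ℕ → Step b × Y => unwind P R w := by
  induction P with
  | zero => exact measurable_const
  | succ P ih =>
    have h : Measurable fun R : ℕ → Step b × Y => (unwind P (fun n => R (n + 1)) w, (R 0).1) :=
      (ih.comp (f := fun (R : ℕ → Step b × Y) n => R (n + 1)) (by fun_prop)).prodMk (by fun_prop)
    exact measurable_move.comp h

variable [NeZero b] (ν : Measure Y) [IsProbabilityMeasure ν]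

/-- The reversed steps rise by as much as the walk goes down, and almost surely the walk goes
arbitrarily far down. -/
theorem ae_eventually_unwind (p j : ℕ) :
    ∀ᵐ v ∂(wordM b).prod (Measure.infinitePi fun _ : ℕ => (stepM b).prod ν),
      ∀ᶠ P in atTop, unwind P (fun n => back (climb^[n + p] v)) default j =
        (climb^[p] v).1 j := by
  have h1 : MeasurePreserving (climb (b := b) (Y := Y))
      ((wordM b).prod (Measure.infinitePi fun _ : ℕ => (stepM b).prod ν))
      ((wordM b).prod (Measure.infinitePi fun _ : ℕ => (stepM b).prod ν)) :=
    (measurePreserving_snd (μ := (stepM b).prod ν)).comp (measurePreserving_climb ν)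
  have h2 : MeasurePreserving (fun v : Word b × (ℕ → Step b × Y) => fun i => (v.2 i).1)
      ((wordM b).prod (Measure.infinitePi fun _ : ℕ => (stepM b).prod ν)) (stepsM b) :=
    (measurePreserving_infinitePi_map (fun _ : ℕ => measurePreserving_fst (μ := stepM b)
      (ν := ν))).comp (measurePreserving_snd (μ := wordM b))
  have h3 := (h2.comp (h1.iterate p)).quasiMeasurePreserving.ae (p := fun s => ∃ k,
    ∑ i ∈ Finset.range k, dh (s i) ≤ -((j + 1 : ℕ) : ℤ)) (ae_exists_sum_dh_le (j + 1))
  filter_upwards [h3] with v hv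
  obtain ⟨P, hP⟩ := hv
  refine eventually_atTop.2 ⟨P, fun P' hP' => ?_⟩
  obtain ⟨Q, rfl⟩ := Nat.exists_eq_add_of_le hP'
  have e := congrFun (unwind_back P (climb^[p] v)) j
  simp only [← Function.iterate_add_apply] at e
  rw [unwind_add, ← e]
  refine unwind_apply_congr ?_ _ _
  have h4 : ∀ i, dh (back (climb^[i + p] v)).1 = - dh ((climb^[p] v).2 i).1 := fun i => by
    rw [Function.iterate_add_apply, back, dh_rev, climb_iterate_snd _ i 0, Nat.zero_add]
  simp only [h4, Finset.sum_neg_distrib]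
  simp only [Function.comp_apply] at hP
  push_cast at hP
  linarith

/-- The shift of the walk is ergodic. -/
theorem ergodic_climb :
    Ergodic (climb (b := b) (Y := Y))
      ((wordM b).prod (Measure.infinitePi fun _ : ℕ => (stepM b).prod ν)) := by
  set π := (wordM b).prod (Measure.infinitePi fun _ : ℕ => (stepM b).prod ν) with hπ
  have hprod : MeasurePreserving (fun v : Word b × (ℕ → Step b × Y) => (back v, climb v)) π
      (((stepM b).prod ν).prod π) := measurePreserving_climb ν
  refine ergodic_of_prod hprod fun B hB => ?_
  set R : Word b × (ℕ → Step b × Y) → ℕ → Step b × Y := fun v n => back (climb^[n] v) with hR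
  -- Letters are almost surely limits of `unwind`, hence functions of the reversed steps up to null
  -- sets.
  have hlet : ∀ p j, EventuallyMeasurable (MeasurableSpace.comap R inferInstance) (ae π)
      fun v : Word b × (ℕ → Step b × Y) => (climb^[p] v).1 j := by
    intro p j
    refine @measurable_to_countable' _ _ _ _ (_) _ fun a => ?_
    refine ⟨R ⁻¹' {r | ∀ᶠ P in atTop, unwind P (fun n => r (n + p)) default j = a},
      ⟨_, ?_, rfl⟩, ?_⟩
    · simp only [eventually_atTop, Set.ofPred_exists, Set.ofPred_forall]
      refine MeasurableSet.iUnion fun P => MeasurableSet.iInter fun P' =>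
        MeasurableSet.iInter fun _ => ?_
      have h1 : Measurable fun r : ℕ → Step b × Y => unwind P' (fun n => r (n + p)) default j :=
        (measurable_pi_apply j).comp ((measurable_unwind P' default).comp
          (f := fun (r : ℕ → Step b × Y) n => r (n + p)) (by fun_prop))
      exact h1 (measurableSet_singleton a)
    · filter_upwards [ae_eventually_unwind ν p j] with v hv
      refine propext ⟨fun h => ?_, fun h => ?_⟩
      · filter_upwards [hv] with P hP
        exact hP.trans h
      · obtain ⟨P, h1, h2⟩ := (hv.and h).exists
        exact h1.symm.trans h2
  have hRm : ∀ n, EventuallyMeasurable (MeasurableSpace.comap R inferInstance) (ae π) fun v => R v n := fun n =>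
    ((measurable_pi_apply (X := fun _ : ℕ => Step b × Y) n).comp
      (comap_measurable R)).eventuallyMeasurable
  have hid : EventuallyMeasurable (MeasurableSpace.comap R inferInstance) (ae π) (id : Word b × (ℕ → Step b × Y) → _) := by
    refine @Measurable.prodMk _ _ _ _ _ (_) _ _ (@measurable_pi_lambda _ _ _ (_) _ _ fun j => hlet 0 j)
      (@measurable_pi_lambda _ _ _ (_) _ _ fun i => @Measurable.prodMk _ _ _ _ _ (_) _ _ ?_
        (measurable_snd.comp_eventuallyMeasurable (hRm i) |>.congr (EventuallyEq.of_eq ?_)))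
    -- The step is recovered by reversing the reversed step at the next word, of which only the
    -- letter `0` matters.
    · have h1 : EventuallyMeasurable (MeasurableSpace.comap R inferInstance) (ae π)
          fun v => ((climb^[i + 1] v).1 0, (R v i).1) :=
        @Measurable.prodMk _ _ _ _ _ (_) _ _ (hlet (i + 1) 0)
          (measurable_fst.comp_eventuallyMeasurable (hRm i))
      have h2 : Measurable fun q : Fin b × Step b => rev (fun _ => q.1) q.2 := .of_discrete
      refine (h2.comp_eventuallyMeasurable h1).congr (EventuallyEq.of_eq ?_)
      funext v
      have h3 := rev_move_rev (climb^[i] v).1 ((climb^[i] v).2 0).1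
      rw [climb_iterate_snd, Nat.zero_add] at h3
      simp only [Function.comp_apply]
      conv_lhs => rw [← h3]
      simp only [hR, back, Function.iterate_succ_apply', climb_iterate_snd, Nat.zero_add]
      rw [climb, climb_iterate_snd, Nat.zero_add]
      cases rev (climb^[i] v).1 (v.2 i).1 <;> rfl
    · funext v
      simp only [hR, back, Function.comp_apply, climb_iterate_snd, Nat.zero_add]
  obtain ⟨t, ⟨C, hC, rfl⟩, ht⟩ := hid hB
  exact ⟨C, hC, ht⟩

end Code

/-! ### The ergodic theorem for bounded functions. -/

section Birkhoff

variable {X : Type*} {T : X → X}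

/-- The maximum of the first Birkhoff sums. -/
def birkhoffMax (T : X → X) (h : X → ℝ) : ℕ → X → ℝ
  | 0, x => h x
  | n + 1, x => h x + max 0 (birkhoffMax T h n (T x))

theorem birkhoffMax_le_succ (h : X → ℝ) (n : ℕ) (x : X) :
    birkhoffMax T h n x ≤ birkhoffMax T h (n + 1) x := by
  induction n generalizing x with
  | zero => exact le_add_of_nonneg_right (le_max_left _ _)
  | succ n ih => exact add_le_add le_rfl (max_le_max le_rfl (ih (T x)))

theorem le_birkhoffMax (h : X → ℝ) (n : ℕ) (x : X) : h x ≤ birkhoffMax T h n x := by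
  cases n with
  | zero => exact le_rfl
  | succ n => exact le_add_of_nonneg_right (le_max_left _ _)

theorem birkhoffSum_le_birkhoffMax (h : X → ℝ) {n k : ℕ} (hk : k ≤ n) (x : X) :
    birkhoffSum T h (k + 1) x ≤ birkhoffMax T h n x := by
  induction n generalizing k x with
  | zero =>
    obtain rfl : k = 0 := by omega
    simp [birkhoffMax]
  | succ n ih =>
    rw [birkhoffSum_succ', birkhoffMax]
    refine add_le_add le_rfl ?_
    cases k with
    | zero => simp
    | succ k => exact (ih (Nat.le_of_succ_le_succ hk) (T x)).trans (le_max_right _ _)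

theorem abs_birkhoffMax_le {h : X → ℝ} {C : ℝ} (hC : ∀ x, |h x| ≤ C) (n : ℕ) (x : X) :
    |birkhoffMax T h n x| ≤ (n + 1) * C := by
  induction n generalizing x with
  | zero => simpa [birkhoffMax] using hC x
  | succ n ih =>
    have h0 : |max 0 (birkhoffMax T h n (T x))| ≤ (n + 1) * C := by
      refine (abs_max_le_max_abs_abs).trans (max_le ?_ (ih _))
      rw [abs_zero]
      exact (abs_nonneg _).trans (ih (T x))
    refine (abs_add_le _ _).trans ((add_le_add (hC x) h0).trans (le_of_eq ?_))
    push_cast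
    ring

variable [MeasurableSpace X]

theorem measurable_birkhoffSum (hT : Measurable T) {h : X → ℝ} (hh : Measurable h) (n : ℕ) :
    Measurable (birkhoffSum T h n) :=
  Finset.measurable_fun_sum _ fun i _ => hh.comp (hT.iterate i)

theorem measurable_birkhoffMax (hT : Measurable T) {h : X → ℝ} (hh : Measurable h) (n : ℕ) :
    Measurable (birkhoffMax T h n) := by
  induction n with
  | zero => exact hh
  | succ n ih => exact hh.add (measurable_const.max (ih.comp hT))

variable {π : Measure X} [IsProbabilityMeasure π]

/-- Garsia's argument: with `M n` the maximum of the first sums, `M (n + 1) - M n ∘ T` equals `h`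
plus the negative part of `M n ∘ T`. Its integral is nonnegative, since `M` increases and `T`
preserves `π`, and it tends to `h` wherever some sum started at `T x` is positive. -/
theorem integral_nonneg_of_birkhoffSum_unbounded (hT : MeasurePreserving T π π) {h : X → ℝ}
    (hh : Measurable h) {C : ℝ} (hC : ∀ x, |h x| ≤ C)
    (hA : ∀ᵐ x ∂π, ∃ n, 0 < birkhoffSum T h n x) : 0 ≤ ∫ x, h x ∂π := by
  have hM := measurable_birkhoffMax hT.measurable hh
  have hMi : ∀ n, Integrable (birkhoffMax T h n) π := fun n =>
    Integrable.of_bound (hM n).aestronglyMeasurable _ (ae_of_all _ fun x => abs_birkhoffMax_le hC n x)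
  set φ : ℕ → X → ℝ := fun n x => birkhoffMax T h (n + 1) x - birkhoffMax T h n (T x) with hφ
  have hφ' : ∀ n x, φ n x = h x + max (-birkhoffMax T h n (T x)) 0 := fun n x => by
    rw [hφ]
    simp only [birkhoffMax]
    rcases le_total 0 (birkhoffMax T h n (T x)) with h1 | h1
    · rw [max_eq_right h1, max_eq_right (neg_nonpos.2 h1)]; ring
    · rw [max_eq_left h1, max_eq_left (neg_nonneg.2 h1)]; ring
  have hint : ∀ n, 0 ≤ ∫ x, φ n x ∂π := fun n => by
    have h1 : Integrable (fun x => birkhoffMax T h n (T x)) π :=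
      (hT.integrable_comp (hM n).aestronglyMeasurable).2 (hMi n)
    have h2 : ∫ x, birkhoffMax T h n (T x) ∂π = ∫ x, birkhoffMax T h n x ∂π := by
      have := integral_map (μ := π) hT.measurable.aemeasurable
        (f := birkhoffMax T h n) (by rw [hT.map_eq]; exact (hM n).aestronglyMeasurable)
      rw [← this, hT.map_eq]
    rw [hφ, integral_sub (hMi (n + 1)) h1, h2, sub_nonneg]
    exact integral_mono (hMi n) (hMi (n + 1)) fun x => birkhoffMax_le_succ h n x
  have hlim : Tendsto (fun n => ∫ x, φ n x ∂π) atTop (𝓝 (∫ x, h x ∂π)) := by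
    refine tendsto_integral_of_dominated_convergence (fun _ => C + C)
      (fun n => ((hM (n + 1)).sub ((hM n).comp hT.measurable)).aestronglyMeasurable)
      (integrable_const _) (fun n => ae_of_all _ fun x => ?_) ?_
    · rw [hφ' n x, Real.norm_eq_abs]
      refine (abs_add_le _ _).trans (add_le_add (hC x) ?_)
      rw [abs_of_nonneg (le_max_right _ _)]
      refine max_le ?_ ((abs_nonneg _).trans (hC x))
      have h1 := le_birkhoffMax (T := T) h n (T x)
      have h2 := neg_le_of_abs_le (hC (T x))
      linarith
    · filter_upwards [hT.quasiMeasurePreserving.ae hA] with x hx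
      obtain ⟨k, hk⟩ := hx
      refine tendsto_const_nhds.congr' (eventually_atTop.2 ⟨k, fun n hn => ?_⟩)
      cases k with
      | zero => simp at hk
      | succ k =>
        have h1 := birkhoffSum_le_birkhoffMax (T := T) h (Nat.le_of_succ_le hn) (T x)
        show h x = φ n x
        rw [hφ' n x, max_eq_right (neg_nonpos.2 (hk.le.trans h1)), add_zero]
  exact ge_of_tendsto' hlim hint

/-- The boundedness of the sums is an invariant event, of probability zero or one. If it were zero,
positive sums would almost surely occur, and `integral_nonneg_of_birkhoffSum_unbounded` would
contradict `hneg`. -/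
theorem ae_bddAbove_birkhoffSum (hT : Ergodic T π) {h : X → ℝ} (hh : Measurable h) {C : ℝ}
    (hC : ∀ x, |h x| ≤ C) (hneg : ∫ x, h x ∂π < 0) :
    ∀ᵐ x ∂π, ∃ K : ℕ, ∀ n, birkhoffSum T h n x ≤ K := by
  set A : Set X := {x | ∃ K : ℕ, ∀ n, birkhoffSum T h n x ≤ K} with hAdef
  have hA : MeasurableSet A := by
    simp only [hAdef, Set.ofPred_exists, Set.ofPred_forall]
    exact MeasurableSet.iUnion fun K => MeasurableSet.iInter fun n =>
      measurableSet_le (measurable_birkhoffSum hT.measurable hh n) measurable_const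
  -- Since `h` is bounded, adding or dropping the first term changes the bound by a constant.
  have hAT : T ⁻¹' A = A := by
    ext x
    have e : ∀ n, birkhoffSum T h (n + 1) x = h x + birkhoffSum T h n (T x) := fun n =>
      birkhoffSum_succ' T h n x
    have hc := abs_le.1 (hC x)
    have hC' : C ≤ ⌈C⌉₊ := Nat.le_ceil C
    constructor
    · rintro ⟨K, hK⟩
      refine ⟨K + ⌈C⌉₊, fun n => ?_⟩
      push_cast
      cases n with
      | zero => simp; positivity
      | succ n =>
        rw [e]
        linarith [hK n]
    · rintro ⟨K, hK⟩
      refine ⟨K + ⌈C⌉₊, fun n => ?_⟩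
      push_cast
      have := hK (n + 1)
      rw [e] at this
      linarith
  rcases hT.toPreErgodic.ae_mem_or_ae_notMem hA hAT with h1 | h1
  · exact h1
  · refine absurd (integral_nonneg_of_birkhoffSum_unbounded hT.toMeasurePreserving hh hC ?_)
      (not_le.2 hneg)
    filter_upwards [h1] with x hx
    by_contra hno
    push Not at hno
    exact hx ⟨0, fun n => by simpa using hno n⟩

/-- The ergodic theorem, for bounded functions. -/
theorem ae_tendsto_birkhoffAverage (hT : Ergodic T π) {g : X → ℝ} (hg : Measurable g) {C : ℝ}
    (hC : ∀ x, |g x| ≤ C) :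
    ∀ᵐ x ∂π, Tendsto (fun n : ℕ => birkhoffSum T g n x / n) atTop (𝓝 (∫ y, g y ∂π)) := by
  -- The boundedness of the sums is applied to `f` minus its mean minus `ε`; the two bounds come
  -- from `f = g` and `f = -g`.
  have key : ∀ (f : X → ℝ), Measurable f → (∀ x, |f x| ≤ C) → ∀ ε : ℝ, 0 < ε →
      ∀ᵐ x ∂π, ∃ K : ℕ, ∀ n : ℕ, birkhoffSum T f n x ≤ K + n * (∫ y, f y ∂π + ε) := by
    intro f hf hfC ε hε
    have hi : Integrable f π := Integrable.of_bound hf.aestronglyMeasurable C (ae_of_all _ hfC)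
    have h1 := ae_bddAbove_birkhoffSum hT (h := fun x => f x - (∫ y, f y ∂π + ε))
      (hf.sub_const _) (C := C + |∫ y, f y ∂π + ε|)
      (fun x => (abs_sub _ _).trans (add_le_add (hfC x) le_rfl))
      (by rw [integral_sub hi (integrable_const _)]; simp [hε])
    filter_upwards [h1] with x hx
    obtain ⟨K, hK⟩ := hx
    refine ⟨K, fun n => ?_⟩
    have := hK n
    simp only [birkhoffSum, Finset.sum_sub_distrib, Finset.sum_const, Finset.card_range,
      nsmul_eq_mul] at this
    rw [birkhoffSum]
    linarith
  have hu := ae_all_iff.2 fun k : ℕ => key g hg hC (1 / ((k : ℝ) + 1)) Nat.one_div_pos_of_nat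
  have hl := ae_all_iff.2 fun k : ℕ => key (fun x => -g x) hg.neg (fun x => by rw [abs_neg]; exact hC x)
    (1 / ((k : ℝ) + 1)) Nat.one_div_pos_of_nat
  filter_upwards [hu, hl] with x h1 h2
  rw [Metric.tendsto_atTop]
  intro ε hε
  obtain ⟨k, hk⟩ := exists_nat_one_div_lt (half_pos hε)
  obtain ⟨K, hK⟩ := h1 k
  obtain ⟨L, hL⟩ := h2 k
  obtain ⟨N, hN⟩ := exists_nat_gt ((K + L + 1 : ℝ) / (ε / 2))
  have hN0 : (0 : ℝ) < N := lt_of_le_of_lt (by positivity) hN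
  refine ⟨N, fun n hn => ?_⟩
  have hn' : (N : ℝ) ≤ n := Nat.cast_le.2 hn
  have hn0 : (0 : ℝ) < n := hN0.trans_le hn'
  have h3 := hK n
  have h4 := hL n
  have e : birkhoffSum T (fun x => -g x) n x = - birkhoffSum T g n x := by
    simp [birkhoffSum]
  rw [e, integral_neg] at h4
  have h5 : (K + L + 1 : ℝ) < n * (ε / 2) := by
    rw [div_lt_iff₀ (half_pos hε)] at hN
    nlinarith
  have h6 : (n : ℝ) * (1 / ((k : ℝ) + 1)) ≤ n * (ε / 2) := by gcongr
  have hKL : (0 : ℝ) ≤ K ∧ (0 : ℝ) ≤ L := ⟨by positivity, by positivity⟩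
  rw [Real.dist_eq, div_sub' hn0.ne', abs_div, abs_of_pos hn0, div_lt_iff₀ hn0, abs_lt]
  constructor <;> nlinarith

end Birkhoff

/-! ### The density of the range of a process with stationary ergodic increments. -/

section Range

variable {E : Type*}

/-- Times whose value never comes back carry distinct values. -/
theorem card_le_ncard_image (p : ℕ → E) (n : ℕ) (S : Finset ℕ) (hS : ∀ k ∈ S, k ∈ Set.Icc 1 n)
    (h : ∀ k ∈ S, ∀ m, 1 ≤ m → p (k + m) ≠ p k) : S.card ≤ (p '' Set.Icc 1 n).ncard := by
  have hinj : Set.InjOn p S := by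
    intro i hi j hj hij
    by_contra hne
    rcases lt_or_gt_of_ne hne with h1 | h1
    · exact h i hi (j - i) (by omega) (by rw [Nat.add_sub_cancel' h1.le, hij])
    · exact h j hj (i - j) (by omega) (by rw [Nat.add_sub_cancel' h1.le, hij])
  rw [← Set.ncard_coe_finset, ← hinj.ncard_image]
  exact Set.ncard_le_ncard (Set.image_mono hS) ((Set.finite_Icc 1 n).image p)

theorem ncard_image_le (p : ℕ → E) (n N : ℕ) (S : Finset ℕ)
    (hS : ∀ k ∈ Set.Icc 1 n, (∀ m, 1 ≤ m → m ≤ N → p (k + m) ≠ p k) → k ∈ S) :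
    (p '' Set.Icc 1 n).ncard ≤ N + S.card := by
  classical
  have h1 : p '' Set.Icc 1 n ⊆ p '' ((Finset.Ioc (n - N) n ∪ S : Finset ℕ) : Set ℕ) := by
    rintro _ ⟨k, ⟨hk1, hk2⟩, rfl⟩
    -- Each value is represented by its last visit `k'` up to `n`: either `k'` is among the last `N`
    -- times, or the value does not come back during the `N` steps after `k'`.
    have hk := Nat.findGreatest_spec (P := fun j => p j = p k) hk2 rfl
    have hk' := Nat.le_findGreatest (P := fun j => p j = p k) hk2 rfl
    have hk'' := Nat.findGreatest_le (P := fun j => p j = p k) n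
    have hgt := fun j => Nat.findGreatest_is_greatest (P := fun j => p j = p k) (n := n) (k := j)
    set k' := Nat.findGreatest (fun j => p j = p k) n
    refine ⟨k', ?_, hk⟩
    simp only [Finset.coe_union, Set.mem_union, Finset.mem_coe, Finset.mem_Ioc]
    by_cases hN : n - N < k'
    · exact Or.inl ⟨hN, hk''⟩
    · refine Or.inr (hS k' ⟨hk1.trans hk', hk''⟩ fun m hm1 hm2 he => ?_)
      exact hgt (k' + m) (by omega) (by omega) (he.trans hk)
  refine (Set.ncard_le_ncard h1 (Set.toFinite _)).trans ((Set.ncard_image_le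
    (Finset.finite_toSet _)).trans ?_)
  rw [Set.ncard_coe_finset]
  refine (Finset.card_union_le _ _).trans ?_
  rw [Nat.card_Ioc]
  omega

open Classical in
theorem birkhoffSum_indicator {X : Type*} (T : X → X) (G : Set X) (n : ℕ) (x : X) :
    birkhoffSum T (G.indicator fun _ => (1 : ℝ)) n (T x) =
      ((Finset.Icc 1 n).filter fun k => T^[k] x ∈ G).card := by
  rw [birkhoffSum, Finset.card_filter, Finset.range_eq_Ico, Nat.cast_sum,
    ← Finset.Ico_add_one_right_eq_Icc,
    ← Finset.sum_Ico_add' (fun k => (((if T^[k] x ∈ G then 1 else 0 : ℕ)) : ℝ)) 0 n 1]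
  refine Finset.sum_congr rfl fun i _ => ?_
  rw [Set.indicator_apply, ← Function.iterate_succ_apply]
  split_ifs <;> simp

variable {X : Type*} [MeasurableSpace X] {T : X → X} {π : Measure X} [IsProbabilityMeasure π]

/-- The density of the range of a process with stationary and ergodic increments is its escape
probability. -/
theorem ae_tendsto_range (hT : Ergodic T π) (p : X → ℕ → E)
    (hp : ∀ x k i, p (T^[k] x) i = p (T^[k] x) 0 ↔ p x (k + i) = p x k)
    (hm : ∀ i, MeasurableSet {x | p x i = p x 0}) :
    ∀ᵐ x ∂π, Tendsto (fun n : ℕ => ((p x '' Set.Icc 1 n).ncard : ℝ) / n) atTop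
      (𝓝 (π.real {x | ∀ n, 1 ≤ n → p x n ≠ p x 0})) := by
  classical
  set G : Set X := {x | ∀ n, 1 ≤ n → p x n ≠ p x 0} with hG
  obtain ⟨GN, hGN⟩ : ∃ GN : ℕ → Set X, GN = fun N => {x | ∀ n, 1 ≤ n → n ≤ N → p x n ≠ p x 0} :=
    ⟨_, rfl⟩
  have hGm : MeasurableSet G := by
    simp only [hG, Set.ofPred_forall]
    exact MeasurableSet.iInter fun n => MeasurableSet.iInter fun _ => (hm n).compl
  have hGNm : ∀ N, MeasurableSet (GN N) := fun N => by
    simp only [hGN, Set.ofPred_forall]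
    exact MeasurableSet.iInter fun n => MeasurableSet.iInter fun _ =>
      MeasurableSet.iInter fun _ => (hm n).compl
  have hlim : Tendsto (fun N => π.real (GN N)) atTop (𝓝 (π.real G)) := by
    have e : G = ⋂ N, GN N := by
      ext x
      simp only [hG, hGN, Set.mem_iInter, Set.mem_ofPred_eq]
      exact ⟨fun h N n h1 _ => h n h1, fun h n h1 => h n n h1 le_rfl⟩
    have := tendsto_measure_iInter_atTop (μ := π) (fun N => (hGNm N).nullMeasurableSet)
      (by
        intro N M hNM
        rw [hGN]
        exact fun x hx n h1 h2 => hx n h1 (h2.trans hNM)) ⟨0, measure_ne_top _ _⟩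
    rw [← e] at this
    exact (ENNReal.tendsto_toReal (measure_ne_top _ _)).comp this
  have hav : ∀ S : Set X, MeasurableSet S → ∀ᵐ x ∂π, Tendsto (fun n : ℕ =>
      (((Finset.Icc 1 n).filter fun k => T^[k] x ∈ S).card : ℝ) / n) atTop (𝓝 (π.real S)) := by
    intro S hS
    have h1 := ae_tendsto_birkhoffAverage hT (g := S.indicator fun _ => (1 : ℝ))
      (measurable_const.indicator hS) (C := 1) fun x => by
        rw [Set.indicator_apply]; split_ifs <;> simp
    rw [integral_indicator_const _ hS, smul_eq_mul, mul_one] at h1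
    filter_upwards [hT.quasiMeasurePreserving.ae h1] with x hx
    simpa only [birkhoffSum_indicator] using hx
  filter_upwards [hav G hGm, ae_all_iff.2 fun N => hav (GN N) (hGNm N)] with x h1 h2
  -- Lower bound: count the times in `G`, with no return at all. Upper bound: count the times in `GN
  -- N`, with no return within `N` steps, whose probability tends to that of `G`.
  refine tendsto_order.2 ⟨fun a ha => ?_, fun a ha => ?_⟩
  · filter_upwards [h1.eventually (lt_mem_nhds ha)] with n hn
    refine hn.trans_le ?_
    gcongr
    refine card_le_ncard_image (p x) n _ (fun k hk => ?_) fun k hk m hm1 => ?_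
    · simpa using (Finset.mem_filter.1 hk).1
    · exact fun he => (Finset.mem_filter.1 hk).2 m hm1 ((hp x k m).2 he)
  · obtain ⟨N, hN⟩ := (hlim.eventually (gt_mem_nhds ha)).exists
    have h3 : Tendsto (fun n : ℕ => (N : ℝ) / n +
        (((Finset.Icc 1 n).filter fun k => T^[k] x ∈ GN N).card : ℝ) / n) atTop
        (𝓝 (0 + π.real (GN N))) :=
      (tendsto_const_div_atTop_nhds_zero_nat _).add (h2 N)
    rw [zero_add] at h3
    filter_upwards [h3.eventually (gt_mem_nhds hN)] with n hn
    refine lt_of_le_of_lt ?_ hn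
    rw [← add_div]
    gcongr
    have h4 := ncard_image_le (p x) n N ((Finset.Icc 1 n).filter fun k => T^[k] x ∈ GN N)
      fun k hk h => Finset.mem_filter.2 ⟨Finset.mem_Icc.2 hk, by
        rw [hGN]
        exact fun m hm1 hm2 he => h m hm1 hm2 ((hp x k m).1 he)⟩
    exact_mod_cast h4

end Range

/-! ### Ergodicity of the successor map, and the density of the range of the labels. -/

namespace Code

variable {b : ℕ}

/-- Induction on finite bodies, along the lexicographical order. -/
theorem finLevel_induction {p : Body b → Prop} (h0 : ∀ N, p (0, N))
    (h1 : ∀ r N, p (splitMark (N 0)).2 → p (r, fun i => N (i + 1)) → p (r + 1, N)) (y : Body b)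
    (hy : FinLevel (bodyLevel y)) : p y := by
  induction hn : {a : ℕ × List ℕ | a.1 < (bodyLevel y).1 ∧
    present ((bodyLevel y).2 a.1) a.2}.ncard using Nat.strong_induction_on generalizing y with
  | _ n ih =>
  obtain ⟨k, N⟩ := y
  cases k with
  | zero => exact h0 N
  | succ r =>
    set S := {a : ℕ × List ℕ | a.1 < (bodyLevel (r + 1, N)).1 ∧
      present ((bodyLevel (r + 1, N)).2 a.1) a.2} with hS
    have hS' : S.Finite := hy
    have hmem : ((0 : ℕ), ([] : List ℕ)) ∈ S := ⟨Nat.succ_pos r, present_nil _⟩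
    -- The body of the first child and the body without that child both embed in the vertices of
    -- `y`, and both miss the first child itself, so they have fewer vertices.
    have key : ∀ (y' : Body b) (f : ℕ × List ℕ → ℕ × List ℕ), Function.Injective f →
        (∀ a, f a ≠ (0, [])) → (∀ a : ℕ × List ℕ, a.1 < (bodyLevel y').1 →
          present ((bodyLevel y').2 a.1) a.2 → f a ∈ S) → p y' := by
      intro y' f hf hne hsub
      have hsub' : f '' {a : ℕ × List ℕ | a.1 < (bodyLevel y').1 ∧
          present ((bodyLevel y').2 a.1) a.2} ⊆ S := by
        rintro _ ⟨a, ⟨ha1, ha2⟩, rfl⟩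
        exact hsub a ha1 ha2
      refine ih _ ?_ y' (Set.Finite.of_finite_image (hS'.subset hsub') hf.injOn) rfl
      rw [← hn, ← hf.injOn.ncard_image]
      refine Set.ncard_lt_ncard ⟨hsub', fun hss => ?_⟩ hS'
      obtain ⟨a, -, ha⟩ := hss hmem
      exact hne a ha
    refine h1 r N (key _ (fun a => (0, (a.1 + 1) :: a.2)) ?_ (by simp) ?_)
      (key _ (fun a => (a.1 + 1, a.2)) ?_ (by simp) ?_)
    · rintro ⟨i, u⟩ ⟨i', u'⟩ h
      simpa using h
    · rintro ⟨i, u⟩ h2 h3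
      refine ⟨Nat.succ_pos r, ?_⟩
      rw [present_cons]
      exact ⟨⟨Nat.succ_pos i, h2⟩, h3⟩
    · rintro ⟨i, u⟩ ⟨i', u'⟩ h
      simpa using h
    · rintro ⟨i, u⟩ h2 h3
      exact ⟨Nat.succ_lt_succ h2, h3⟩

theorem climb_launch (r : ℕ) (N : ℕ → Mark b) (v : Word b × Spine b) :
    climbC (launch r N v) = ((r, fun i => N (i + 1)), v) := by
  refine Prod.ext rfl (Prod.ext ?_ rfl)
  exact move_move_rev _ _

variable [NeZero b]

/-- The orbit of a code under the right-successor map goes through the ancestors. -/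
theorem mem_iff_climbC_mem {A : Set (Code b)} (hA : next ⁻¹' A = A) (y : Body b)
    (hy : FinLevel (bodyLevel y)) (v : Word b × Spine b) : (y, v) ∈ A ↔ climbC (y, v) ∈ A := by
  have hA' : ∀ c, next c ∈ A ↔ c ∈ A := fun c => by
    conv_rhs => rw [← hA]
    rfl
  refine finLevel_induction (p := fun y => ∀ v, (y, v) ∈ A ↔ climbC (y, v) ∈ A) ?_ ?_ y hy v
  · intro N v
    rw [← hA', next_of_eq_zero rfl, hA']
  · intro r N ih1 ih2 v
    -- Launch to the first child, cross its body (`ih1`), come back to the vertex with one child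
    -- less (`climb_launch`), and cross the rest (`ih2`).
    rw [← hA', next_of_eq_succ (r := r) rfl]
    have e1 := ih1 (launch r N v).2
    have e2 := ih2 v
    have e3 := climb_launch r N v
    change launch r N v ∈ A ↔ climbC (launch r N v) ∈ A at e1
    rw [e1, e3, e2]
    rfl

variable {μ : PMF ℕ} (hμ : ∑' k : ℕ, (k : ℝ≥0∞) * μ k = 1)

/-- Bodies being finite, an invariant set does not distinguish a code from its image by `climbC`
(`mem_iff_climbC_mem`). It is thus almost surely a set of words and spines, invariant under the
ergodic map `climb`. -/
theorem ergodic_next (h : μ ≠ PMF.pure 1) :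
    Ergodic (next (b := b)) (codeM b μ (tailPMF μ hμ)) := by
  refine ⟨measurePreserving_next hμ, ⟨fun {A} hA hnext => ?_⟩⟩
  set ρ := tailPMF μ hμ with hρ
  have hfin : ∀ σ : PMF ℕ, ∀ᵐ y ∂bodyM b μ σ, FinLevel (bodyLevel y) := fun σ =>
    (measurePreserving_bodyLevel μ σ).quasiMeasurePreserving.ae (ae_finLevel _ hμ h)
  have herg : Ergodic (climb (b := b) (Y := Body b)) ((wordM b).prod (spineM b μ ρ)) :=
    ergodic_climb (bodyM b μ ρ)
  set B : Set (Word b × Spine b) := {v | ((v.2 0).2, climb v) ∈ A} with hB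
  have hBm : MeasurableSet B := by
    have h1 : Measurable fun v : Word b × Spine b => ((v.2 0).2, climb v) :=
      Measurable.prodMk (by fun_prop) measurable_climb
    exact h1 hA
  have hspine : ∀ᵐ v ∂(wordM b).prod (spineM b μ ρ), FinLevel (bodyLevel (v.2 0).2) := by
    have h1 : MeasurePreserving (fun v : Spine b => (v 0).2) (spineM b μ ρ) (bodyM b μ ρ) :=
      (measurePreserving_snd (μ := stepM b) (ν := bodyM b μ ρ)).comp
        (measurePreserving_eval_infinitePi (fun _ : ℕ => (stepM b).prod (bodyM b μ ρ)) 0)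
    exact (h1.comp (measurePreserving_snd (μ := wordM b))).quasiMeasurePreserving.ae (hfin ρ)
  have hBT : climb ⁻¹' B =ᵐ[(wordM b).prod (spineM b μ ρ)] B := by
    filter_upwards [hspine] with v hv
    exact propext (mem_iff_climbC_mem hnext _ hv (climb v)).symm
  have hAB : ∀ᵐ c ∂codeM b μ ρ, c ∈ A ↔ c.2 ∈ B := by
    have h1 : MeasurePreserving (Prod.fst : Code b → Body b) (codeM b μ ρ) (bodyM b μ μ) :=
      measurePreserving_fst
    filter_upwards [h1.quasiMeasurePreserving.ae (hfin μ)] with c hc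
    exact mem_iff_climbC_mem hnext c.1 hc c.2
  have h2 : MeasurePreserving (Prod.snd : Code b → Word b × Spine b) (codeM b μ ρ)
      ((wordM b).prod (spineM b μ ρ)) := measurePreserving_snd
  rw [eventuallyConst_set]
  refine (herg.quasiErgodic.ae_mem_or_ae_notMem₀ hBm.nullMeasurableSet hBT).imp
    (fun h3 => ?_) fun h3 => ?_
  · filter_upwards [hAB, h2.quasiMeasurePreserving.ae h3] with c h4 h5
    exact h4.2 h5
  · filter_upwards [hAB, h2.quasiMeasurePreserving.ae h3] with c h4 h5
    exact fun h6 => h5 (h4.1 h6)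

end Code

theorem measurableSet_biWord_eq {X : Type*} [MeasurableSpace X] {b : ℕ} {f g : X → BiWord (Fin b)}
    (hf : Measurable fun x => (f x).height) (hg : Measurable fun x => (g x).height)
    (hf' : Measurable fun x => (f x).letter) (hg' : Measurable fun x => (g x).letter) :
    MeasurableSet {x | f x = g x} := by
  have e : {x | f x = g x} = {x | (f x).height = (g x).height} ∩
      ⋂ j, {x | (f x).letter j = (g x).letter j} := by
    ext x
    simp [BiWord.ext_iff, funext_iff]
  rw [e]
  refine (measurableSet_eq_fun hf hg).inter ?_
  exact MeasurableSet.iInter fun j => measurableSet_eq_fun ((measurable_pi_apply j).comp hf')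
    ((measurable_pi_apply j).comp hg')

namespace Code

variable {b : ℕ}

/-- The positions of a walk. -/
def posWalk {Y : Type*} (v : Word b × (ℕ → Step b × Y)) (n : ℕ) : BiWord (Fin b) :=
  ⟨∑ i ∈ Finset.range n, dh (v.2 i).1, (climb^[n] v).1⟩

theorem posWalk_add {Y : Type*} (v : Word b × (ℕ → Step b × Y)) (k n : ℕ) :
    posWalk v (k + n) =
      (posWalk (climb^[k] v) n).shift (-∑ i ∈ Finset.range k, dh (v.2 i).1) := by
  refine BiWord.ext ?_ ?_
  · simp only [posWalk, BiWord.height_shift, Finset.sum_range_add, climb_iterate_snd]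
    rw [sub_neg_eq_add, add_comm]
    congr 1
    exact Finset.sum_congr rfl fun i _ => by rw [add_comm]
  · simp only [posWalk, BiWord.shift, ← Function.iterate_add_apply]
    rw [add_comm]

theorem measurableSet_posWalk_eq {Y : Type*} [MeasurableSpace Y] (n : ℕ) :
    MeasurableSet {v : Word b × (ℕ → Step b × Y) | posWalk v n = posWalk v 0} := by
  have h1 : ∀ n, Measurable fun v : Word b × (ℕ → Step b × Y) => (posWalk v n).height := fun n =>
    (measurable_sum_dh n).comp (f := fun (v : Word b × (ℕ → Step b × Y)) i => (v.2 i).1)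
      (by fun_prop)
  have h2 : ∀ n, Measurable fun v : Word b × (ℕ → Step b × Y) => (posWalk v n).letter := fun n =>
    (measurable_climb.iterate n).fst
  exact measurableSet_biWord_eq (h1 n) (h1 0) (h2 n) (h2 0)

/-- The walk along the first children. -/
def lineWalk (c : Code b) : Word b × (ℕ → Step b × Unit) :=
  (c.2.1, fun n => ((c.1.2 0 (List.replicate n 1)).2, ()))

variable [NeZero b]

theorem measurable_height_pos (n : ℕ) : Measurable fun c : Code b => (pos c n).height := by
  show Measurable fun c : Code b => ∑ i ∈ Finset.range n, disp (next^[i] c)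
  exact Finset.measurable_fun_sum _ fun i _ => measurable_disp.comp (measurable_next.iterate i)

theorem measurable_letter_pos (n : ℕ) : Measurable fun c : Code b => (pos c n).letter :=
  (measurable_next.iterate n).snd.fst

theorem measurableSet_pos_eq (n : ℕ) : MeasurableSet {c : Code b | pos c n = pos c 0} :=
  measurableSet_biWord_eq (measurable_height_pos n) (measurable_height_pos 0)
    (measurable_letter_pos n) (measurable_letter_pos 0)

theorem pos_eq_pos_iff (c : Code b) (k i j : ℕ) :
    pos (next^[k] c) i = pos (next^[k] c) j ↔ pos c (k + i) = pos c (k + j) := by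
  rw [pos_add, pos_add, (BiWord.shift_injective _).eq_iff]

theorem lineWalk_next {c : Code b} (h : c.1.1 ≠ 0) : lineWalk (next c) = climb (lineWalk c) := by
  obtain ⟨r, hr⟩ := Nat.exists_eq_succ_of_ne_zero h
  rw [next_of_eq_succ hr]
  rfl

theorem pos_eq_posWalk {c : Code b} (h : ∀ n, (next^[n] c).1.1 ≠ 0) (n : ℕ) :
    pos c n = posWalk (lineWalk c) n := by
  have h1 : ∀ n, lineWalk (next^[n] c) = climb^[n] (lineWalk c) := by
    intro n
    induction n with
    | zero => rfl
    | succ n ih => rw [Function.iterate_succ_apply', lineWalk_next (h n), ih,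
        Function.iterate_succ_apply']
  refine BiWord.ext ?_ ?_
  · show ∑ i ∈ Finset.range n, disp (next^[i] c) = ∑ i ∈ Finset.range n, dh ((lineWalk c).2 i).1
    refine Finset.sum_congr rfl fun i _ => ?_
    rw [disp_of_ne_zero (h i)]
    have h2 := congrArg (fun v => (v.2 0).1) (h1 i)
    simp only [climb_iterate_snd, Nat.zero_add] at h2
    rw [← h2]
    rfl
  · exact congrArg Prod.fst (h1 n)

variable (b) in
theorem measurePreserving_lineWalk (μ ρ : PMF ℕ) :
    MeasurePreserving (lineWalk (b := b)) (codeM b μ ρ) ((wordM b).prod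
      (Measure.infinitePi fun _ : ℕ => (stepM b).prod (Measure.dirac ()))) := by
  have h1 : MeasurePreserving (fun s : ℕ × Step b => (s.2, ())) (μ.toMeasure.prod (stepM b))
      ((stepM b).prod (Measure.dirac ())) :=
    MeasurePreserving.comp (f := Prod.snd) (g := fun s : Step b => (s, ()))
      ⟨by fun_prop, (Measure.prod_dirac ()).symm⟩ measurePreserving_snd
  have h2 : MeasurePreserving (fun (m : Mark b) (n : ℕ) => m (List.replicate n 1)) (markM b μ)
      (Measure.infinitePi fun _ => μ.toMeasure.prod (stepM b)) :=
    ⟨by fun_prop, Measure.map_infinitePi_infinitePi_of_inj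
      (P := fun _ : List ℕ => μ.toMeasure.prod (stepM b)) fun i j h => by
        simpa using congrArg List.length h⟩
  have h3 : MeasurePreserving (fun y : Body b => y.2 0) (bodyM b μ μ) (markM b μ) :=
    (measurePreserving_eval_infinitePi (fun _ : ℕ => markM b μ) 0).comp
      (measurePreserving_snd (μ := μ.toMeasure))
  have h4 : MeasurePreserving (fun v : Word b × Spine b => v.1)
      ((wordM b).prod (spineM b μ ρ)) (wordM b) := measurePreserving_fst
  exact (h4.prod ((measurePreserving_infinitePi_map fun _ => h1).comp (h2.comp h3))).comp
    (Measure.measurePreserving_swap (μ := bodyM b μ μ))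

variable {μ : PMF ℕ} (hμ : ∑' k : ℕ, (k : ℝ≥0∞) * μ k = 1)

/-- If `μ` is the Dirac mass at `1`, the tree above `ϱ` is infinite and `ergodic_next` does not
apply; but the labels then follow the walk `lineWalk` along a single line, for which `ergodic_climb`
is enough. -/
theorem ae_tendsto_range_pos : ∀ᵐ c ∂codeM b μ (tailPMF μ hμ),
    Tendsto (fun n : ℕ => ((pos c '' Set.Icc 1 n).ncard : ℝ) / n) atTop
      (𝓝 ((codeM b μ (tailPMF μ hμ)).real {c | ∀ n, 1 ≤ n → pos c n ≠ pos c 0})) := by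
  by_cases h : μ = PMF.pure 1
  · have h0 : ∀ᵐ c ∂codeM b μ (tailPMF μ hμ), c.1.1 ≠ 0 := by
      have h1 : MeasurePreserving (fun c : Code b => c.1.1) (codeM b μ (tailPMF μ hμ))
          μ.toMeasure := (measurePreserving_fst (ν := marksM b μ)).comp
        (measurePreserving_fst (μ := bodyM b μ μ))
      refine h1.quasiMeasurePreserving.ae (p := fun k => k ≠ 0) ?_
      have : μ.toMeasure {0} = 0 := by
        rw [PMF.toMeasure_apply_singleton _ _ (measurableSet_singleton 0), h,
          PMF.pure_apply_of_ne _ _ zero_ne_one]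
      rw [ae_iff]
      simpa using this
    have h1 : ∀ᵐ c ∂codeM b μ (tailPMF μ hμ), ∀ n, (next^[n] c).1.1 ≠ 0 := ae_all_iff.2 fun n =>
      ((measurePreserving_next hμ).iterate n).quasiMeasurePreserving.ae h0
    have h2 := ae_tendsto_range (ergodic_climb (b := b) (Measure.dirac ())) posWalk
      (fun v k i => by
        have e := posWalk_add v k 0
        rw [Nat.add_zero] at e
        rw [e, posWalk_add, (BiWord.shift_injective _).eq_iff])
      measurableSet_posWalk_eq
    have h3 := (measurePreserving_lineWalk b μ (tailPMF μ hμ)).quasiMeasurePreserving.ae h2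
    have h4 : (codeM b μ (tailPMF μ hμ)).real {c | ∀ n, 1 ≤ n → pos c n ≠ pos c 0} =
        ((wordM b).prod (Measure.infinitePi fun _ : ℕ => (stepM b).prod (Measure.dirac ()))).real
          {v | ∀ n, 1 ≤ n → posWalk v n ≠ posWalk v 0} := by
      have hm : MeasurableSet {v : Word b × (ℕ → Step b × Unit) |
          ∀ n, 1 ≤ n → posWalk v n ≠ posWalk v 0} := by
        simp only [Set.ofPred_forall]
        exact MeasurableSet.iInter fun n => MeasurableSet.iInter fun _ =>
          (measurableSet_posWalk_eq n).compl
      rw [measureReal_def, measureReal_def,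
        ← (measurePreserving_lineWalk b μ (tailPMF μ hμ)).measure_preimage hm.nullMeasurableSet]
      congr 1
      refine measure_congr ?_
      filter_upwards [h1] with c hc
      refine propext (forall₂_congr fun n _ => ?_)
      rw [pos_eq_posWalk hc, pos_eq_posWalk hc]
    rw [h4]
    filter_upwards [h1, h3] with c hc h5
    rwa [show pos c = posWalk (lineWalk c) from funext (pos_eq_posWalk hc)]
  · exact ae_tendsto_range (ergodic_next hμ h) pos
      (fun c k i => by rw [pos_eq_pos_iff, Nat.add_zero]) measurableSet_pos_eq

end Code

/-! ### The Green function of the walk on words. -/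

namespace BiWord

/-- `a` is an ancestor of `x`, possibly `x` itself. -/
def Anc {A : Type*} (a x : BiWord A) : Prop := ∃ j : ℕ, parent^[j] x = a

theorem Anc.height_le {A : Type*} {a x : BiWord A} (h : Anc a x) : a.height ≤ x.height := by
  obtain ⟨j, rfl⟩ := h
  rw [height_parent_iterate]
  omega

theorem anc_parent_iff {A : Type*} {a x : BiWord A} : Anc a x.parent ↔ Anc a x ∧ x ≠ a := by
  constructor
  · rintro ⟨j, hj⟩
    refine ⟨⟨j + 1, hj⟩, fun h => ?_⟩
    have h1 := Anc.height_le ⟨j, hj⟩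
    rw [h] at h1
    simp only [parent] at h1
    omega
  · rintro ⟨⟨j, hj⟩, hne⟩
    cases j with
    | zero => exact absurd hj hne
    | succ j => exact ⟨j, hj⟩

theorem anc_child_iff {A : Type*} {a x : BiWord A} (i : A) :
    Anc a (x.child i) ↔ Anc a x ∨ x.child i = a := by
  constructor
  · rintro ⟨j, hj⟩
    cases j with
    | zero => exact Or.inr hj
    | succ j =>
      rw [Function.iterate_succ_apply, parent_child] at hj
      exact Or.inl ⟨j, hj⟩
  · rintro (⟨j, hj⟩ | h)
    · exact ⟨j + 1, by rw [Function.iterate_succ_apply, parent_child, hj]⟩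
    · exact ⟨0, h⟩

end BiWord

namespace Code

open BiWord

variable {b : ℕ}

/-- The mean of a function after one step of the walk. -/
def walkMean (f : BiWord (Fin b) → ℝ≥0∞) (x : BiWord (Fin b)) : ℝ≥0∞ :=
  ∫⁻ s, f (moveBi x s) ∂stepM b

theorem walkMean_eq (f : BiWord (Fin b) → ℝ≥0∞) (x : BiWord (Fin b)) :
    walkMean f x = 2⁻¹ * f x.parent + ∑ i, (2 * (b : ℝ≥0∞))⁻¹ * f (x.child i) :=
  lintegral_stepM _

-- The indicator of the words that extend `a` is harmonic except at both ends of the edge below `a`: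
-- its mean loses `1/2` at `a` and gains `1/(2b)` at the parent of `a`.
open Classical in
theorem walkMean_anc [NeZero b] (a x : BiWord (Fin b)) :
    walkMean (fun x => if Anc a x then 1 else 0) x + 2⁻¹ * (if x = a then 1 else 0) =
      (if Anc a x then 1 else 0) + 2⁻¹ * (b : ℝ≥0∞)⁻¹ * (if x = a.parent then 1 else 0) := by
  rw [walkMean_eq]
  have h1 : (if Anc a x.parent then 1 else 0 : ℝ≥0∞) + (if x = a then 1 else 0) =
      if Anc a x then 1 else 0 := by
    simp only [anc_parent_iff]
    by_cases h : x = a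
    · subst h
      simp [show Anc x x from ⟨0, rfl⟩]
    · simp [h]
  have h2 : ∀ i, (if Anc a (x.child i) then 1 else 0 : ℝ≥0∞) =
      (if Anc a x then 1 else 0) + (if x.child i = a then 1 else 0) := by
    intro i
    simp only [anc_child_iff]
    by_cases h : x.child i = a
    · have : ¬ Anc a x := fun h' => by
        have := h'.height_le
        rw [← h] at this
        simp only [child] at this
        omega
      simp [h, this]
    · simp [h]
  have h3 : ∑ i, (if x.child i = a then 1 else 0 : ℝ≥0∞) = if x = a.parent then 1 else 0 := by
    have : ∀ i, x.child i = a ↔ x = a.parent ∧ i = a.last := fun i => by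
      constructor
      · rintro rfl
        exact ⟨(parent_child _ _).symm, rfl⟩
      · rintro ⟨rfl, rfl⟩
        exact child_parent_last a
    simp only [this]
    by_cases h : x = a.parent <;> simp [h]
  rw [← Finset.mul_sum, Finset.sum_congr rfl fun i _ => h2 i, Finset.sum_add_distrib, h3,
    Finset.sum_const, Finset.card_univ, Fintype.card_fin, nsmul_eq_mul, inv_two_mul_eq, mul_add]
  have h4 : (2⁻¹ : ℝ≥0∞) * (b : ℝ≥0∞)⁻¹ * (b * if Anc a x then 1 else 0) =
      2⁻¹ * if Anc a x then 1 else 0 := by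
    rw [mul_assoc, ← mul_assoc (b : ℝ≥0∞)⁻¹, mul_comm (b : ℝ≥0∞)⁻¹, natCast_mul_inv, one_mul]
  rw [h4]
  calc _ = 2⁻¹ * ((if Anc a x.parent then 1 else 0) + (if x = a then 1 else 0)) +
      2⁻¹ * (if Anc a x then 1 else 0) + 2⁻¹ * (b : ℝ≥0∞)⁻¹ * (if x = a.parent then 1 else 0) := by
        ring
    _ = _ := by
      rw [h1, ← add_mul, ENNReal.inv_two_add_inv_two, one_mul]

open Classical in
/-- Half of the Green function of the walk. -/
def green (z x : BiWord (Fin b)) : ℝ≥0∞ :=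
  ∑' n : ℕ, (b : ℝ≥0∞)⁻¹ ^ n * (if Anc (parent^[n] z) x then 1 else 0)

/-- A word at least `m` levels below `z` extends none of the first `m` words `z, z.parent, …`, so
the series starts at the rank `m`. -/
theorem green_le {b : ℕ} (hb : 2 ≤ b) (z x : BiWord (Fin b)) (m : ℕ)
    (h : x.height ≤ z.height - m) : green z x ≤ 2 * 2⁻¹ ^ m := by
  classical
  have hb' : (b : ℝ≥0∞)⁻¹ ≤ 2⁻¹ := ENNReal.inv_le_inv.2 (by exact_mod_cast hb)
  rw [green, ← ENNReal.summable.sum_add_tsum_nat_add' (k := m), Finset.sum_eq_zero, zero_add]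
  · calc _ ≤ ∑' n : ℕ, (2⁻¹ : ℝ≥0∞) ^ n * 2⁻¹ ^ m := by
          refine ENNReal.tsum_le_tsum fun n => ?_
          rw [← pow_add]
          refine (mul_le_of_le_one_right' (by split_ifs <;> simp)).trans ?_
          gcongr
      _ = _ := by
        rw [ENNReal.tsum_mul_right, ENNReal.tsum_geometric, ENNReal.one_sub_inv_two, inv_inv]
  · intro n hn
    rw [if_neg, mul_zero]
    intro ha
    have := ha.height_le
    rw [height_parent_iterate] at this
    have := Finset.mem_range.1 hn
    omega

theorem green_ne_top {b : ℕ} (hb : 2 ≤ b) (z x : BiWord (Fin b)) : green z x ≠ ∞ := by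
  classical
  have hb' : (b : ℝ≥0∞)⁻¹ ≤ 2⁻¹ := ENNReal.inv_le_inv.2 (by exact_mod_cast hb)
  refine ne_top_of_le_ne_top ENNReal.ofNat_ne_top (b := 2) ?_
  calc green z x ≤ ∑' n : ℕ, (2⁻¹ : ℝ≥0∞) ^ n :=
        ENNReal.tsum_le_tsum fun n =>
          (mul_le_of_le_one_right' (by split_ifs <;> simp)).trans (by gcongr)
    _ = 2 := by rw [ENNReal.tsum_geometric, ENNReal.one_sub_inv_two, inv_inv]

open Classical in
theorem walkMean_green [NeZero b] (z x : BiWord (Fin b)) :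
    walkMean (green z) x + 2⁻¹ * (if x = z then 1 else 0) = green z x := by
  set A : ℕ → ℝ≥0∞ := fun n => (b : ℝ≥0∞)⁻¹ ^ n * (if x = parent^[n] z then 1 else 0) with hA
  have h1 : walkMean (green z) x = ∑' n : ℕ, (b : ℝ≥0∞)⁻¹ ^ n *
      walkMean (fun x => if Anc (parent^[n] z) x then 1 else 0) x := by
    unfold walkMean green
    rw [lintegral_tsum fun n => Measurable.of_discrete.aemeasurable]
    exact tsum_congr fun n => lintegral_const_mul _ .of_discrete
  -- The weights `b⁻ⁿ` make the gain of the rank `n` compensate the loss of the rank `n + 1`; only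
  -- the loss at `z` is left.
  have h2 : walkMean (green z) x + 2⁻¹ * ∑' n, A n = green z x + 2⁻¹ * ∑' n, A (n + 1) := by
    rw [h1, green, ← ENNReal.tsum_mul_left, ← ENNReal.tsum_mul_left, ← ENNReal.tsum_add,
      ← ENNReal.tsum_add]
    refine tsum_congr fun n => ?_
    have h3 := walkMean_anc (parent^[n] z) x
    calc _ = (b : ℝ≥0∞)⁻¹ ^ n * (walkMean (fun x => if Anc (parent^[n] z) x then 1 else 0) x +
          2⁻¹ * (if x = parent^[n] z then 1 else 0)) := by simp only [hA]; ring
      _ = _ := by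
        rw [h3]
        simp only [hA, Function.iterate_succ_apply']
        ring
  have h4 : ∑' n, A n = (if x = z then 1 else 0) + ∑' n, A (n + 1) := by
    rw [tsum_eq_zero_add' ENNReal.summable]
    simp [hA]
  -- At most one term is nonzero; finiteness is needed to cancel the two sums.
  have h5 : ∑' n, A (n + 1) ≠ ∞ := by
    by_cases h : ∃ n, x = parent^[n + 1] z
    · obtain ⟨n, hn⟩ := h
      rw [tsum_eq_single n]
      · simp only [hA]
        split_ifs
        simp [NeZero.ne b]
      · intro m hm
        simp only [hA]
        rw [if_neg, mul_zero]
        intro h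
        have := congrArg height (hn.symm.trans h)
        rw [height_parent_iterate, height_parent_iterate] at this
        omega
    · push Not at h
      rw [ENNReal.tsum_eq_zero.2 fun n => by simp only [hA, if_neg (h n), mul_zero]]
      exact ENNReal.zero_ne_top
  rw [h4, mul_add, ← add_assoc] at h2
  exact (ENNReal.add_left_inj (ENNReal.mul_ne_top (by simp) h5)).1 h2

theorem walkMean_green_le [NeZero b] (z x : BiWord (Fin b)) :
    walkMean (green z) x ≤ green z x := by
  classical
  rw [← walkMean_green z x]
  exact le_self_add

end Code

/-! ### Mean numbers of visits in Galton–Watson trees. -/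

namespace Code

open BiWord

variable {b : ℕ}

open Classical in
/-- The number of visits of `z` in the first generations of a tree grafted at `x`. -/
def visitsUpTo (z : BiWord (Fin b)) : ℕ → Mark b → BiWord (Fin b) → ℝ≥0∞
  | 0, _, _ => 0
  | n + 1, m, x => (if moveBi x (splitMark m).1 = z then 1 else 0) +
      ∑ i ∈ Finset.range (splitMark m).2.1,
        visitsUpTo z n ((splitMark m).2.2 i) (moveBi x (splitMark m).1)

/-- The number of visits of `z` in a tree grafted at `x`. -/
def visits (z : BiWord (Fin b)) (m : Mark b) (x : BiWord (Fin b)) : ℝ≥0∞ :=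
  ⨆ n, visitsUpTo z n m x

/-- The number of visits of `z` in a body whose root has label `x`, outside of the root. -/
def bodyVisits (z : BiWord (Fin b)) (y : Body b) (x : BiWord (Fin b)) : ℝ≥0∞ :=
  ∑ i ∈ Finset.range y.1, visits z (y.2 i) x

theorem visitsUpTo_mono (z : BiWord (Fin b)) (m : Mark b) (x : BiWord (Fin b)) :
    Monotone fun n => visitsUpTo z n m x := by
  refine monotone_nat_of_le_succ fun n => ?_
  induction n generalizing m x with
  | zero => exact bot_le
  | succ n ih =>
    rw [visitsUpTo, visitsUpTo]
    exact add_le_add le_rfl (Finset.sum_le_sum fun i _ => ih _ _)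

open Classical in
theorem visits_eq (z : BiWord (Fin b)) (m : Mark b) (x : BiWord (Fin b)) :
    visits z m x = (if moveBi x (splitMark m).1 = z then 1 else 0) +
      bodyVisits z (splitMark m).2 (moveBi x (splitMark m).1) := by
  rw [visits, ← (visitsUpTo_mono z m x).iSup_nat_add 1, bodyVisits]
  simp only [visitsUpTo, visits]
  rw [ENNReal.finsetSum_iSup_of_monotone fun i => visitsUpTo_mono z _ _, ENNReal.add_iSup]

theorem measurable_sum_marks {f : Mark b → ℝ≥0∞} (hf : Measurable f) (k : ℕ) :
    Measurable fun N : ℕ → Mark b => ∑ i ∈ Finset.range k, f (N i) :=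
  Finset.measurable_fun_sum _ fun i _ => hf.comp (measurable_pi_apply (X := fun _ : ℕ => Mark b) i)

theorem measurable_sum_body {f : Mark b → ℝ≥0∞} (hf : Measurable f) :
    Measurable fun y : Body b => ∑ i ∈ Finset.range y.1, f (y.2 i) :=
  measurable_from_prod_countable_right fun k => measurable_sum_marks hf k

theorem measurable_visitsUpTo (z : BiWord (Fin b)) (n : ℕ) (x : BiWord (Fin b)) :
    Measurable fun m => visitsUpTo z n m x := by
  classical
  induction n generalizing x with
  | zero => exact measurable_const
  | succ n ih =>
    have h : Measurable fun q : Step b × Body b => (if moveBi x q.1 = z then 1 else 0 : ℝ≥0∞) +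
        ∑ i ∈ Finset.range q.2.1, visitsUpTo z n (q.2.2 i) (moveBi x q.1) :=
      measurable_from_prod_countable_right fun s =>
        (measurable_sum_body (ih (moveBi x s))).const_add (if moveBi x s = z then 1 else 0)
    exact h.comp measurable_splitMark

theorem measurable_visits (z : BiWord (Fin b)) (x : BiWord (Fin b)) :
    Measurable fun m => visits z m x := Measurable.iSup fun n => measurable_visitsUpTo z n x

theorem measurable_bodyVisits (z : BiWord (Fin b)) (x : BiWord (Fin b)) :
    Measurable fun y : Body b => bodyVisits z y x :=
  measurable_sum_body (measurable_visits z x)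

variable [NeZero b] {μ : PMF ℕ}

theorem lintegral_sum_marks (f : Mark b → ℝ≥0∞) (hf : Measurable f) (k : ℕ) :
    ∫⁻ N, ∑ i ∈ Finset.range k, f (N i) ∂marksM b μ = k * ∫⁻ m, f m ∂markM b μ := by
  rw [lintegral_finsetSum (f := fun i (N : ℕ → Mark b) => f (N i)) _ fun i _ =>
    hf.comp (measurable_pi_apply i)]
  have : ∀ i, ∫⁻ N, f (N i) ∂marksM b μ = ∫⁻ m, f m ∂markM b μ := fun i =>
    (measurePreserving_eval_infinitePi (fun _ : ℕ => markM b μ) i).lintegral_comp hf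
  simp [this]

/-- With offspring numbers of mean one, the mean number of visits in a tree is computed as for a
single walk, whose Green function is `2 green`: the identity `1_z + 2 walkMean (green z) = 2 green
z` closes the induction. -/
theorem lintegral_visitsUpTo_le (hμ : ∑' k : ℕ, (k : ℝ≥0∞) * μ k = 1) (z : BiWord (Fin b)) (n : ℕ)
    (x : BiWord (Fin b)) :
    ∫⁻ m, visitsUpTo z n m x ∂markM b μ ≤ 2 * walkMean (green z) x := by
  classical
  induction n generalizing x with
  | zero => simp [visitsUpTo]
  | succ n ih =>
    have hm : ∀ x, Measurable fun y : Body b => ∑ i ∈ Finset.range y.1,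
        visitsUpTo z n (y.2 i) x := fun x =>
      measurable_sum_body (measurable_visitsUpTo z n x)
    have hF : Measurable fun q : Step b × Body b => (if moveBi x q.1 = z then 1 else 0 : ℝ≥0∞) +
        ∑ i ∈ Finset.range q.2.1, visitsUpTo z n (q.2.2 i) (moveBi x q.1) :=
      measurable_from_prod_countable_right fun s => (hm (moveBi x s)).const_add (if moveBi x s = z then 1 else 0)
    have h1 : ∀ x, ∫⁻ y, ∑ i ∈ Finset.range y.1, visitsUpTo z n (y.2 i) x ∂bodyM b μ μ =
        ∫⁻ m, visitsUpTo z n m x ∂markM b μ := fun x => by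
      rw [lintegral_bodyM μ μ (hm x)]
      simp only [lintegral_sum_marks _ (measurable_visitsUpTo z n x)]
      simp only [← mul_assoc]
      rw [ENNReal.tsum_mul_right, tsum_congr fun k => mul_comm (μ k) (k : ℝ≥0∞), hμ, one_mul]
    simp only [visitsUpTo]
    rw [(measurePreserving_splitMark (b := b) μ).lintegral_comp hF, lintegral_prod _ hF.aemeasurable,
      walkMean, ← lintegral_const_mul _ .of_discrete]
    refine lintegral_mono fun s => ?_
    change ∫⁻ y : Body b, (if moveBi x s = z then 1 else 0) + ∑ i ∈ Finset.range y.1,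
      visitsUpTo z n (y.2 i) (moveBi x s) ∂bodyM b μ μ ≤ _
    rw [lintegral_add_right _ (hm (moveBi x s)), lintegral_const, measure_univ, mul_one, h1,
      ← walkMean_green z (moveBi x s), mul_add, ← mul_assoc,
      ENNReal.mul_inv_cancel two_ne_zero ENNReal.ofNat_ne_top, one_mul, add_comm]
    exact add_le_add (ih _) le_rfl

theorem lintegral_visits_le (hμ : ∑' k : ℕ, (k : ℝ≥0∞) * μ k = 1) (z x : BiWord (Fin b)) :
    ∫⁻ m, visits z m x ∂markM b μ ≤ 2 * green z x := by
  unfold visits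
  rw [lintegral_iSup (fun n => measurable_visitsUpTo z n x) fun n k hnk m =>
    visitsUpTo_mono z m x hnk]
  exact iSup_le fun n => (lintegral_visitsUpTo_le hμ z n x).trans
    (mul_le_mul_right (walkMean_green_le z x) 2)

/-- The root law `ρ` need not have a finite mean, so only almost sure finiteness is claimed: there
are finitely many trees, each with a finite mean number of visits. -/
theorem ae_bodyVisits_ne_top (hb : 2 ≤ b) (hμ : ∑' k : ℕ, (k : ℝ≥0∞) * μ k = 1) (ρ : PMF ℕ)
    (z x : BiWord (Fin b)) : ∀ᵐ y ∂bodyM b μ ρ, bodyVisits z y x ≠ ∞ := by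
  have h1 : ∀ᵐ m ∂markM b μ, visits z m x < ∞ :=
    ae_lt_top (measurable_visits z x) (ne_top_of_le_ne_top
      (ENNReal.mul_ne_top ENNReal.ofNat_ne_top (green_ne_top hb z x)) (lintegral_visits_le hμ z x))
  have h2 : ∀ᵐ N ∂marksM b μ, ∀ i, visits z (N i) x < ∞ := ae_all_iff.2 fun i =>
    (measurePreserving_eval_infinitePi (fun _ : ℕ => markM b μ) i).quasiMeasurePreserving.ae
      (p := fun m => visits z m x < ∞) h1
  have h3 : MeasurePreserving (Prod.snd : Body b → ℕ → Mark b) (bodyM b μ ρ) (marksM b μ) :=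
    measurePreserving_snd
  filter_upwards [h3.quasiMeasurePreserving.ae h2] with y hy
  exact (ENNReal.sum_lt_top.2 fun i _ => hy i).ne

/-- The mean number of visits of `z` in a body with a bounded number of trees. -/
theorem lintegral_bodyVisits_le (hμ : ∑' k : ℕ, (k : ℝ≥0∞) * μ k = 1) (ρ : PMF ℕ)
    (z x : BiWord (Fin b)) (S : Set ℕ) (e : ℝ≥0∞) (hS : ∀ k ∈ S, (k : ℝ≥0∞) ≤ e) :
    ∫⁻ y, {y | y.1 ∈ S}.indicator (fun y => bodyVisits z y x) y ∂bodyM b μ ρ ≤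
      e * (2 * green z x) := by
  classical
  have hSm : MeasurableSet {y : Body b | y.1 ∈ S} := measurable_fst (MeasurableSet.of_discrete (s := S))
  rw [lintegral_bodyM μ ρ ((measurable_bodyVisits z x).indicator hSm)]
  calc _ ≤ ∑' k, ρ k * (e * (2 * green z x)) := by
        refine ENNReal.tsum_le_tsum fun k => mul_le_mul_right ?_ _
        by_cases hk : k ∈ S
        · have : ∀ N, {y : Body b | y.1 ∈ S}.indicator (fun y => bodyVisits z y x) (k, N) =
              ∑ i ∈ Finset.range k, visits z (N i) x := fun N => Set.indicator_of_mem (by exact hk) _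
          simp only [this]
          rw [lintegral_sum_marks _ (measurable_visits z x)]
          exact mul_le_mul' (hS k hk) (lintegral_visits_le hμ z x)
        · have : ∀ N, {y : Body b | y.1 ∈ S}.indicator (fun y => bodyVisits z y x) (k, N) = 0 :=
            fun N => Set.indicator_of_notMem (by exact hk) _
          simp [this]
    _ = _ := by rw [ENNReal.tsum_mul_right, ρ.tsum_coe, one_mul]

end Code

/-! ### Visits along the exploration, and the escape probability. -/

namespace Code

open BiWord

variable {b : ℕ}

/-- The successive positions of a walk with given steps. -/
def walkPos (x : BiWord (Fin b)) (s : ℕ → Step b) : ℕ → BiWord (Fin b)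
  | 0 => x
  | p + 1 => walkPos (moveBi x (s 0)) (fun n => s (n + 1)) p

/-- The number of visits of `z` in the bodies grafted on the ancestors of a vertex with label `x`,
outside of these ancestors. -/
def lineVisits (z x : BiWord (Fin b)) (s : Spine b) : ℝ≥0∞ :=
  ∑' p, bodyVisits z (s p).2 (walkPos x (fun i => (s i).1) (p + 1))

theorem lineVisits_eq (z x : BiWord (Fin b)) (s : Spine b) :
    lineVisits z x s = bodyVisits z (s 0).2 (moveBi x (s 0).1) +
      lineVisits z (moveBi x (s 0).1) (fun n => s (n + 1)) := by
  rw [lineVisits, tsum_eq_zero_add' ENNReal.summable]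
  rfl

/-- The number of visits of `z` after a vertex whose label has height `h`. -/
def codeVisits (z : BiWord (Fin b)) (h : ℤ) (c : Code b) : ℝ≥0∞ :=
  bodyVisits z c.1 ⟨h, c.2.1⟩ + lineVisits z ⟨h, c.2.1⟩ c.2.2

theorem moveBi_mk (h : ℤ) (w : Word b) (s : Step b) : moveBi ⟨h, w⟩ s = ⟨h + dh s, move w s⟩ :=
  BiWord.ext (height_moveBi _ _) (letter_moveBi _ _)

theorem codeVisits_climbC {z : BiWord (Fin b)} {h : ℤ} {c : Code b} (hc : c.1.1 = 0) :
    codeVisits z h c = codeVisits z (h + dh (c.2.2 0).1) (climbC c) := by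
  rw [codeVisits, bodyVisits, hc, Finset.range_zero, Finset.sum_empty, zero_add, lineVisits_eq,
    moveBi_mk]
  rfl

open Classical in
theorem codeVisits_launch (z : BiWord (Fin b)) (h : ℤ) (r : ℕ) (N : ℕ → Mark b)
    (v : Word b × Spine b) :
    codeVisits z h ((r + 1, N), v) = (if moveBi ⟨h, v.1⟩ (splitMark (N 0)).1 = z then 1 else 0) +
      codeVisits z (h + dh (splitMark (N 0)).1) (launch r N v) := by
  have e1 : codeVisits z (h + dh (splitMark (N 0)).1) (launch r N v) =
      bodyVisits z (splitMark (N 0)).2 (moveBi ⟨h, v.1⟩ (splitMark (N 0)).1) +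
        (bodyVisits z (r, fun i => N (i + 1)) ⟨h, v.1⟩ + lineVisits z ⟨h, v.1⟩ v.2) := by
    have e2 := moveBi_moveBi_rev ⟨h, v.1⟩ (splitMark (N 0)).1
    rw [codeVisits, lineVisits_eq]
    simp only [launch, consSeq, ← moveBi_mk]
    simp only at e2
    rw [e2]
  have e2 : bodyVisits z (r + 1, N) ⟨h, v.1⟩ =
      bodyVisits z (r, fun i => N (i + 1)) ⟨h, v.1⟩ + visits z (N 0) ⟨h, v.1⟩ :=
    Finset.sum_range_succ' _ _
  rw [e1, codeVisits, e2, visits_eq]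
  ring

variable [NeZero b]

-- The successor is one of the vertices counted, and those counted from it are all the others:
-- climbing through empty bodies loses no visit, and launching only redistributes the bodies.
open Classical in
theorem codeVisits_next {z : BiWord (Fin b)} {h : ℤ} {c : Code b} (hc : HasNext c) :
    codeVisits z h c = (if ⟨h + disp c, (next c).2.1⟩ = z then 1 else 0) +
      codeVisits z (h + disp c) (next c) := by
  obtain ⟨p, hp⟩ := hc
  induction p generalizing c h with
  | zero =>
    obtain ⟨r, hr⟩ := Nat.exists_eq_succ_of_ne_zero hp
    have hr' : c.1.1 = r + 1 := hr
    obtain ⟨⟨k, N⟩, v⟩ := c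
    simp only at hr'
    subst hr'
    rw [codeVisits_launch, next_of_eq_succ rfl, disp_of_ne_zero (Nat.succ_ne_zero r), moveBi_mk]
    rfl
  | succ p ih =>
    by_cases h0 : c.1.1 = 0
    · have hn : HasNext c := ⟨p + 1, hp⟩
      rw [codeVisits_climbC h0, ih (c := climbC c) hp, next_of_eq_zero h0, disp_of_eq_zero h0 hn]
      simp only [add_assoc]
    · obtain ⟨r, hr⟩ := Nat.exists_eq_succ_of_ne_zero h0
      have hr' : c.1.1 = r + 1 := hr
      obtain ⟨⟨k, N⟩, v⟩ := c
      simp only at hr'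
      subst hr'
      rw [codeVisits_launch, next_of_eq_succ rfl, disp_of_ne_zero (Nat.succ_ne_zero r), moveBi_mk]
      rfl

-- Only an inequality, as nothing is assumed that would make the successors exhaust the vertices
-- counted by `codeVisits`.
open Classical in
theorem sum_visits_le {z : BiWord (Fin b)} {c : Code b} (hc : ∀ n, HasNext (next^[n] c)) (h : ℤ)
    (n : ℕ) : ∑ k ∈ Finset.range n, (if (pos c (k + 1)).shift (-h) = z then 1 else 0 : ℝ≥0∞) ≤
      codeVisits z h c := by
  induction n generalizing c h with
  | zero => simp
  | succ n ih =>
    rw [Finset.sum_range_succ', codeVisits_next (c := c) (hc 0), add_comm]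
    refine add_le_add (le_of_eq ?_) (le_trans (le_of_eq ?_)
      (ih (c := next c) (fun n => hc (n + 1)) (h + disp c)))
    · have : (pos c (0 + 1)).shift (-h) = ⟨h + disp c, (next c).2.1⟩ :=
        BiWord.ext (by simp [pos, BiWord.shift, add_comm]) rfl
      rw [this]
    · refine Finset.sum_congr rfl fun k _ => ?_
      have : (pos c (k + 1 + 1)).shift (-h) = (pos (next c) (k + 1)).shift (-(h + disp c)) := by
        rw [add_comm (k + 1) 1, pos_add]
        refine BiWord.ext ?_ rfl
        simp [BiWord.shift]
        ring
      rw [this]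

theorem finite_visits {c : Code b} (hc : ∀ n, HasNext (next^[n] c))
    (h : codeVisits (pos c 0) 0 c ≠ ∞) : {n | pos c n = pos c 0}.Finite := by
  classical
  have h1 : ∑' k, (if pos c (k + 1) = pos c 0 then 1 else 0 : ℝ≥0∞) ≠ ∞ := by
    refine ne_top_of_le_ne_top h (ENNReal.tsum_le_of_sum_range_le fun n => ?_)
    have := sum_visits_le (z := pos c 0) hc 0 n
    simpa [BiWord.shift] using this
  have h2 := ENNReal.finite_const_le_of_tsum_ne_top h1 one_ne_zero
  refine ((h2.image Nat.succ).union (Set.finite_singleton 0)).subset fun n hn => ?_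
  cases n with
  | zero => exact Or.inr rfl
  | succ n => exact Or.inl ⟨n, by simp only [Set.mem_ofPred_eq] at hn ⊢; simp [hn], rfl⟩

/-- If the walk almost surely visits its starting point finitely many times, then it does not come
back with positive probability. -/
theorem measure_escape_pos {μ : PMF ℕ} (hμ : ∑' k : ℕ, (k : ℝ≥0∞) * μ k = 1)
    (h : ∀ᵐ c ∂codeM b μ (tailPMF μ hμ), {n | pos c n = pos c 0}.Finite) :
    0 < (codeM b μ (tailPMF μ hμ)).real {c | ∀ n, 1 ≤ n → pos c n ≠ pos c 0} := by
  set π := codeM b μ (tailPMF μ hμ)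
  set G : Set (Code b) := {c | ∀ n, 1 ≤ n → pos c n ≠ pos c 0} with hG
  have hGm : MeasurableSet G := by
    simp only [hG, Set.ofPred_forall]
    exact MeasurableSet.iInter fun n => MeasurableSet.iInter fun _ => (measurableSet_pos_eq n).compl
  by_contra hno
  have h0 : π G = 0 :=
    (measureReal_eq_zero_iff (measure_ne_top _ _)).1 (le_antisymm (not_lt.1 hno) measureReal_nonneg)
  -- By invariance, if escape is almost surely impossible, then it is so from every later vertex.
  have h1 : ∀ᵐ c ∂π, ∀ n, next^[n] c ∉ G := ae_all_iff.2 fun n =>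
    ((measurePreserving_next hμ).iterate n).quasiMeasurePreserving.ae (p := fun c => c ∉ G)
      (measure_eq_zero_iff_ae_notMem.1 h0)
  have h2 : ∀ᵐ c ∂π, False := by
    filter_upwards [h, h1] with c hc hcG
    -- The last visit `n` of the starting point is followed by no return, so that `next^[n] c`
    -- belongs to `G`.
    obtain ⟨n, hn, hmax⟩ := hc.exists_maximal ⟨0, rfl⟩
    refine hcG n fun k hk he => ?_
    have he' := (pos_eq_pos_iff c n k 0).1 he
    rw [Nat.add_zero] at he'
    have := hmax (y := n + k) (he'.trans hn) (Nat.le_add_right n k)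
    omega
  simp at h2
  exact IsProbabilityMeasure.ne_zero π h2

end Code

/-! ### Decay of the Green function along the walk. -/

theorem ENNReal.tsum_ne_top_of_eventually_le {f g : ℕ → ℝ≥0∞} (h : ∀ᶠ n in atTop, f n ≤ g n)
    (hf : ∀ n, f n ≠ ∞) (hg : ∑' n, g n ≠ ∞) : ∑' n, f n ≠ ∞ := by
  obtain ⟨N, hN⟩ := eventually_atTop.1 h
  rw [← ENNReal.summable.sum_add_tsum_nat_add' (k := N)]
  refine ENNReal.add_ne_top.2 ⟨ENNReal.sum_ne_top.2 fun n _ => hf n, ?_⟩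
  refine ne_top_of_le_ne_top hg ((ENNReal.tsum_le_tsum fun n => hN (n + N) (Nat.le_add_left N n)).trans
    (ENNReal.tsum_comp_le_tsum_of_injective (add_left_injective N) g))

/-- `p ^ a + 2 log p` is negligible compared with `p ^ α`, so the terms are eventually at most
`p⁻²`. -/
theorem summable_exp_rpow_sub {a α c : ℝ} (ha : a < α) (hα : 0 < α) (hc : 0 < c) :
    Summable fun p : ℕ => Real.exp ((p : ℝ) ^ a - c * (p : ℝ) ^ α) := by
  have h0 : (fun x : ℝ => x ^ a) =o[atTop] fun x => x ^ α := by
    refine Asymptotics.isLittleO_of_tendsto' ?_ ?_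
    · filter_upwards [eventually_gt_atTop 0] with x hx h
      exact absurd h (Real.rpow_pos_of_pos hx α).ne'
    · refine (tendsto_rpow_neg_atTop (sub_pos.2 ha)).congr' ?_
      filter_upwards [eventually_gt_atTop 0] with x hx
      rw [← Real.rpow_sub hx, neg_sub]
  have h1 := (h0.add ((isLittleO_log_rpow_atTop hα).const_mul_left 2)).def hc
  have h2 := tendsto_natCast_atTop_atTop.eventually h1
  refine Summable.of_norm_bounded_eventually_nat
    (g := fun p : ℕ => 1 / (p : ℝ) ^ 2) (Real.summable_one_div_nat_pow.2 one_lt_two) ?_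
  filter_upwards [h2, eventually_gt_atTop 0] with p hp hp0
  have hp0' : (0 : ℝ) < p := Nat.cast_pos.2 hp0
  rw [Real.norm_of_nonneg (Real.exp_pos _).le, one_div, ← Real.exp_log (pow_pos hp0' 2),
    ← Real.exp_neg, Real.log_pow]
  refine Real.exp_le_exp.2 ?_
  rw [Real.norm_eq_abs, Real.norm_of_nonneg (Real.rpow_nonneg hp0'.le α)] at hp
  have := (le_abs_self _).trans hp
  push_cast
  linarith

namespace Code

open BiWord

variable {b : ℕ}

theorem height_walkPos (x : BiWord (Fin b)) (s : ℕ → Step b) (p : ℕ) :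
    (walkPos x s p).height = x.height + ∑ i ∈ Finset.range p, dh (s i) := by
  induction p generalizing x s with
  | zero => simp [walkPos]
  | succ p ih =>
    rw [walkPos, ih, height_moveBi, Finset.sum_range_succ']
    ring

theorem measurable_walkPos {X : Type*} [MeasurableSpace X] (f : BiWord (Fin b) → X)
    (x : BiWord (Fin b)) (p : ℕ) : Measurable fun s => f (walkPos x s p) := by
  induction p generalizing x with
  | zero => exact measurable_const (a := f x)
  | succ p ih =>
    have h : Measurable fun q : Step b × (ℕ → Step b) => f (walkPos (moveBi x q.1) q.2 p) :=
      measurable_from_prod_countable_right fun s => ih (moveBi x s)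
    exact h.comp (f := fun s : ℕ → Step b => (s 0, fun n => s (n + 1))) (by fun_prop)

open Classical in
/-- The Green function along the walk, once the walk has gone `m` steps below `z`. -/
def greenBelow (z x : BiWord (Fin b)) (m p : ℕ) (s : ℕ → Step b) : ℝ≥0∞ :=
  if ∃ i ≤ p, (walkPos x s i).height ≤ z.height - m then green z (walkPos x s p) else 0

theorem measurable_greenBelow (z x : BiWord (Fin b)) (m p : ℕ) :
    Measurable (greenBelow z x m p) := by
  classical
  refine Measurable.ite ?_ (measurable_walkPos (green z) x p) measurable_const
  have e : {s : ℕ → Step b | ∃ i ≤ p, (walkPos x s i).height ≤ z.height - m} =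
      ⋃ i, ⋃ (_ : i ≤ p), {s | (walkPos x s i).height ≤ z.height - m} := by
    ext s
    simp
  rw [e]
  exact MeasurableSet.iUnion fun i => MeasurableSet.iUnion fun _ =>
    measurableSet_le (measurable_walkPos height x i) measurable_const

theorem lintegral_stepsM [NeZero b] {f : (ℕ → Step b) → ℝ≥0∞} (hf : Measurable f) :
    ∫⁻ s, f s ∂stepsM b = ∫⁻ σ, ∫⁻ s, f (consSeq σ s) ∂stepsM b ∂stepM b := by
  have h := (measurePreserving_consSeq (fun _ : ℕ => stepM b)).lintegral_comp hf
  have hf' : Measurable fun p : Step b × (ℕ → Step b) => f (consSeq p.1 p.2) :=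
    hf.comp measurable_consSeq
  rw [lintegral_prod _ hf'.aemeasurable] at h
  exact h.symm

variable [NeZero b]

/-- The Green function is superharmonic (`walkMean_green_le`). -/
theorem lintegral_green_le (z x : BiWord (Fin b)) (p : ℕ) :
    ∫⁻ s, green z (walkPos x s p) ∂stepsM b ≤ green z x := by
  induction p generalizing x with
  | zero => simp [walkPos]
  | succ p ih =>
    rw [lintegral_stepsM (measurable_walkPos (green z) x (p + 1))]
    exact (lintegral_mono fun σ => ih (moveBi x σ)).trans (walkMean_green_le z x)

/-- Optional stopping: from above, the walk can only cross the height `z.height - m` by visiting it,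
there the Green function is at most `2 · 2⁻ᵐ`, and from there on its mean does not increase. -/
theorem lintegral_greenBelow_le (hb : 2 ≤ b) (z : BiWord (Fin b)) (m p : ℕ) (x : BiWord (Fin b))
    (hx : z.height - m ≤ x.height) :
    ∫⁻ s, greenBelow z x m p s ∂stepsM b ≤ 2 * 2⁻¹ ^ m := by
  induction p generalizing x with
  | zero =>
    rcases hx.eq_or_lt with h | h
    · refine (lintegral_mono fun s => ?_).trans ((lintegral_green_le z x 0).trans
        (green_le hb z x m h.ge))
      unfold greenBelow
      split_ifs
      exacts [le_rfl, zero_le]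
    · have : ∀ s : ℕ → Step b, greenBelow z x m 0 s = 0 := fun s => if_neg (by
        rintro ⟨i, hi, h2⟩
        obtain rfl : i = 0 := by omega
        exact absurd h2 (not_le.2 h))
      simp [this]
  | succ p ih =>
    rcases hx.eq_or_lt with h | h
    · refine (lintegral_mono fun s => ?_).trans ((lintegral_green_le z x (p + 1)).trans
        (green_le hb z x m h.ge))
      unfold greenBelow
      split_ifs
      exacts [le_rfl, zero_le]
    · rw [lintegral_stepsM (measurable_greenBelow z x m (p + 1))]
      have h1 : ∀ σ (s : ℕ → Step b), greenBelow z x m (p + 1) (consSeq σ s) =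
          greenBelow z (moveBi x σ) m p s := by
        intro σ s
        unfold greenBelow
        refine if_congr ⟨?_, ?_⟩ rfl rfl
        · rintro ⟨i, hi, h2⟩
          cases i with
          | zero => exact absurd h2 (not_le.2 h)
          | succ i => exact ⟨i, Nat.le_of_succ_le_succ hi, h2⟩
        · rintro ⟨i, hi, h2⟩
          exact ⟨i + 1, Nat.succ_le_succ hi, h2⟩
      simp only [h1]
      refine (lintegral_mono fun σ => ih (moveBi x σ) ?_).trans (by simp)
      rw [height_moveBi]
      have : -1 ≤ dh σ := by cases σ <;> simp [dh]
      omega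

/-- Borel–Cantelli at the times `4 ^ j`: `measure_stay_le` with `L = 2 ^ j` gives a bound of order
`4 ^ (α j) / 2 ^ j`, summable as `α < 1/2`. -/
theorem ae_eventually_notMem_stay {α : ℝ} (hα : α < 1 / 2) :
    ∀ᵐ s ∂stepsM b, ∀ᶠ j : ℕ in atTop, s ∉ stay b (4 ^ j) ⌈(4 : ℝ) ^ (α * j)⌉₊ := by
  refine ae_eventually_notMem ?_
  have h1 : ∀ j : ℕ, (stepsM b).real (stay b (4 ^ j) ⌈(4 : ℝ) ^ (α * j)⌉₊) ≤
      2 * ((4 : ℝ) ^ α / 2) ^ j + 2 * (1 / 2) ^ j := by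
    intro j
    have h2 := measure_stay_le (b := b) (2 ^ j) (4 ^ j) ⌈(4 : ℝ) ^ (α * j)⌉₊ (by positivity)
      (by positivity)
    have h3 : (⌈(4 : ℝ) ^ (α * j)⌉₊ : ℝ) ≤ ((4 : ℝ) ^ α) ^ j + 1 := by
      rw [← Real.rpow_mul_natCast (by norm_num)]
      exact (Nat.ceil_lt_add_one (by positivity)).le
    set H : ℝ := (⌈(4 : ℝ) ^ (α * j)⌉₊ : ℝ)
    have h4 : H * ((2 ^ j : ℕ) : ℝ) / ((4 ^ j : ℕ) : ℝ) + H / ((2 ^ j : ℕ) : ℝ) = 2 * H / 2 ^ j := by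
      push_cast
      rw [show (4 : ℝ) ^ j = 2 ^ j * 2 ^ j by rw [← mul_pow]; norm_num]
      field_simp
      ring
    rw [h4] at h2
    refine h2.trans ?_
    rw [div_pow, div_pow, one_pow, mul_div_assoc, ← mul_add, ← add_div]
    gcongr
  have h5 : (4 : ℝ) ^ α / 2 < 1 := by
    rw [div_lt_one two_pos]
    calc (4 : ℝ) ^ α < 4 ^ (1 / 2 : ℝ) := Real.rpow_lt_rpow_of_exponent_lt (by norm_num) hα
      _ = 2 := by
        rw [show (4 : ℝ) = 2 ^ (2 : ℝ) by norm_num, ← Real.rpow_mul (by norm_num)]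
        norm_num
  have h6 : Summable fun j : ℕ => (stepsM b).real (stay b (4 ^ j) ⌈(4 : ℝ) ^ (α * j)⌉₊) :=
    Summable.of_nonneg_of_le (fun _ => measureReal_nonneg) h1
      (((summable_geometric_of_lt_one (by positivity) h5).mul_left 2).add
        ((summable_geometric_of_lt_one (by norm_num) (by norm_num)).mul_left 2))
  have h7 := h6.tsum_ofReal_ne_top
  rwa [tsum_congr fun j => ofReal_measureReal] at h7

theorem tsum_exp_mul_half_pow_ne_top {a α : ℝ} (ha : a < α) (hα : 0 < α) (hα' : α < 1 / 2) :
    ∑' p : ℕ, ENNReal.ofReal (Real.exp ((p : ℝ) ^ a)) *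
      (2 * 2⁻¹ ^ ⌈(4 : ℝ) ^ (α * Nat.log 4 p)⌉₊) ≠ ∞ := by
  have h1 : ∀ p : ℕ, ENNReal.ofReal (Real.exp ((p : ℝ) ^ a)) *
      (2 * 2⁻¹ ^ ⌈(4 : ℝ) ^ (α * Nat.log 4 p)⌉₊) ≤
      2 * ENNReal.ofReal (Real.exp ((p : ℝ) ^ a - (Real.log 2 / 2) * (p : ℝ) ^ α)) := by
    intro p
    set m := ⌈(4 : ℝ) ^ (α * Nat.log 4 p)⌉₊ with hm
    -- Rounding `p` down to a power of `4` costs a factor at most `4 ^ α ≤ 2`.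
    have h2 : (p : ℝ) ^ α / 2 ≤ m := by
      refine le_trans ?_ (Nat.le_ceil _)
      have h3 : (p : ℝ) ≤ 4 ^ (Nat.log 4 p + 1) := by
        exact_mod_cast (Nat.lt_pow_succ_log_self (by norm_num) p).le
      have h4 : (p : ℝ) ^ α ≤ ((4 : ℝ) ^ (Nat.log 4 p + 1)) ^ α :=
        Real.rpow_le_rpow (Nat.cast_nonneg p) h3 hα.le
      have h5 : ((4 : ℝ) ^ (Nat.log 4 p + 1)) ^ α = 4 ^ (α * Nat.log 4 p) * 4 ^ α := by
        rw [← Real.rpow_natCast, ← Real.rpow_mul (by norm_num), ← Real.rpow_add (by norm_num)]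
        push_cast
        ring_nf
      have h6 : (4 : ℝ) ^ α ≤ 2 := by
        calc (4 : ℝ) ^ α ≤ 4 ^ (1 / 2 : ℝ) := Real.rpow_le_rpow_of_exponent_le (by norm_num) hα'.le
          _ = 2 := by
            rw [show (4 : ℝ) = 2 ^ (2 : ℝ) by norm_num, ← Real.rpow_mul (by norm_num)]
            norm_num
      have h7 : (0 : ℝ) ≤ 4 ^ (α * Nat.log 4 p) := by positivity
      nlinarith
    have h3 : (2⁻¹ : ℝ≥0∞) ^ m = ENNReal.ofReal (Real.exp (-(Real.log 2 * m))) := by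
      rw [mul_comm, ← mul_neg, Real.exp_nat_mul, Real.exp_neg, Real.exp_log two_pos,
        ENNReal.ofReal_pow (by positivity), ENNReal.ofReal_inv_of_pos two_pos]
      norm_num
    rw [h3, mul_left_comm, ← ENNReal.ofReal_mul (Real.exp_pos _).le, ← Real.exp_add]
    gcongr
    have := mul_le_mul_of_nonneg_left h2 (Real.log_nonneg one_le_two)
    linarith
  refine ne_top_of_le_ne_top ?_ (ENNReal.tsum_le_tsum h1)
  rw [ENNReal.tsum_mul_left]
  exact ENNReal.mul_ne_top ENNReal.ofNat_ne_top
    (summable_exp_rpow_sub ha hα (by positivity)).tsum_ofReal_ne_top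

/-- The Green function decreases fast along the walk. -/
theorem ae_tsum_green_ne_top (hb : 2 ≤ b) (z : BiWord (Fin b)) {a : ℝ} (ha : 0 ≤ a)
    (ha' : a < 1 / 2) : ∀ᵐ s ∂stepsM b,
      ∑' p : ℕ, ENNReal.ofReal (Real.exp ((p : ℝ) ^ a)) * green z (walkPos z s p) ≠ ∞ := by
  obtain ⟨α, hα, hα'⟩ := exists_between ha'
  set m : ℕ → ℕ := fun p => ⌈(4 : ℝ) ^ (α * Nat.log 4 p)⌉₊ with hm
  have hmeas : ∀ p : ℕ, Measurable fun s : ℕ → Step b =>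
      ENNReal.ofReal (Real.exp ((p : ℝ) ^ a)) * greenBelow z z (m p) p s := fun p =>
    (measurable_greenBelow z z (m p) p).const_mul _
  have h1 : ∫⁻ s, ∑' p : ℕ, ENNReal.ofReal (Real.exp ((p : ℝ) ^ a)) *
      greenBelow z z (m p) p s ∂stepsM b ≠ ∞ := by
    rw [lintegral_tsum fun p => (hmeas p).aemeasurable]
    refine ne_top_of_le_ne_top (tsum_exp_mul_half_pow_ne_top hα (ha.trans_lt hα) hα')
      (ENNReal.tsum_le_tsum fun p => ?_)
    rw [lintegral_const_mul _ (measurable_greenBelow z z (m p) p)]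
    exact mul_le_mul_right (lintegral_greenBelow_le hb z (m p) p z (by omega)) _
  filter_upwards [ae_lt_top (Measurable.tsum hmeas) h1, ae_eventually_notMem_stay hα']
    with s hs hstay
  refine ENNReal.tsum_ne_top_of_eventually_le ?_
    (fun p => ENNReal.mul_ne_top ENNReal.ofReal_ne_top (green_ne_top hb z _)) hs.ne
  have hlog : Tendsto (Nat.log 4) atTop atTop :=
    tendsto_atTop.2 fun j => eventually_atTop.2 ⟨4 ^ j, fun p hp =>
      Nat.le_log_of_pow_le (by norm_num) hp⟩
  filter_upwards [hlog.eventually hstay, eventually_ne_atTop 0] with p hp hp0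
  refine mul_le_mul_right (le_of_eq (if_pos ?_).symm) _
  -- The times between two powers of `4` are handled by the lower one: staying up to `p` implies
  -- staying up to `4 ^ Nat.log 4 p`.
  have hp' : s ∉ stay b p (m p) := fun h => hp (stay_anti _ (Nat.pow_log_le_self 4 hp0) h)
  simp only [stay, Set.mem_ofPred_eq, not_forall, not_lt] at hp'
  obtain ⟨k, hk, hk'⟩ := hp'
  refine ⟨k, hk, ?_⟩
  rw [height_walkPos]
  linarith

end Code

/-! ### The moment condition, and finiteness of the number of returns. -/

theorem tsum_ite_natCast_lt_le (y : ℝ) :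
    ∑' p : ℕ, (if (p : ℝ) < y then 1 else 0 : ℝ≥0∞) ≤ ENNReal.ofReal y + 1 := by
  rw [tsum_eq_sum (s := Finset.range ⌈y⌉₊) fun p hp => if_neg (not_lt.2 (by
    simpa [Nat.ceil_le] using hp))]
  calc _ ≤ ∑ p ∈ Finset.range ⌈y⌉₊, (1 : ℝ≥0∞) :=
        Finset.sum_le_sum fun p _ => by split_ifs <;> simp
    _ = ENNReal.ofReal (⌈y⌉₊ : ℝ) := by simp
    _ ≤ ENNReal.ofReal (max y 0 + 1) := ENNReal.ofReal_le_ofReal (by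
        rcases le_total y 0 with h | h
        · rw [Nat.ceil_eq_zero.2 h, max_eq_right h]; simp
        · rw [max_eq_left h]; exact (Nat.ceil_lt_add_one h).le)
    _ ≤ _ := by
        rw [ENNReal.ofReal_add (le_max_right _ _) zero_le_one, ENNReal.ofReal_max]
        simp

namespace Code

open BiWord

variable {b : ℕ} {μ : PMF ℕ}

/-- For `K` with the tail law, the sum over `p` of `P(p < l(K))` is at most `E[l(K)] + 1`, and
`E[l(K)] = ∑ₙ μ(n) ∑_{k < n} l(k) ≤ ∑ₙ n l(n) μ(n)`. -/
theorem tsum_tail_lt_ne_top (hμ : ∑' k : ℕ, (k : ℝ≥0∞) * μ k = 1) {l : ℕ → ℝ} (hl : Monotone l)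
    (hl0 : ∀ k, 0 ≤ l k) (hs : Summable fun k : ℕ => (k : ℝ) * l k * (μ k).toReal) :
    ∑' p : ℕ, (tailPMF μ hμ).toMeasure {k | l k ≤ p}ᶜ ≠ ∞ := by
  classical
  have h1 : ∀ p : ℕ, (tailPMF μ hμ).toMeasure {k | l k ≤ p}ᶜ =
      ∑' k, tailPMF μ hμ k * (if (p : ℝ) < l k then 1 else 0) := by
    intro p
    rw [PMF.toMeasure_apply _ MeasurableSet.of_discrete]
    refine tsum_congr fun k => ?_
    by_cases h : (p : ℝ) < l k <;> simp [h, not_le]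
  have h2 : ∑' k, tailPMF μ hμ k * ENNReal.ofReal (l k) ≠ ∞ := by
    refine ne_top_of_le_ne_top hs.tsum_ofReal_ne_top ?_
    simp only [tailPMF_apply, ← ENNReal.tsum_mul_right]
    rw [ENNReal.tsum_comm]
    refine ENNReal.tsum_le_tsum fun n => ?_
    rw [ENNReal.ofReal_mul (mul_nonneg (Nat.cast_nonneg n) (hl0 n)),
      ENNReal.ofReal_mul (Nat.cast_nonneg n), ENNReal.ofReal_natCast,
      ENNReal.ofReal_toReal (PMF.apply_ne_top μ n),
      tsum_eq_sum (s := Finset.range n) fun k hk => by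
        rw [if_neg (by simpa using hk), zero_mul]]
    calc _ ≤ ∑ k ∈ Finset.range n, μ n * ENNReal.ofReal (l n) := by
          refine Finset.sum_le_sum fun k hk => ?_
          have hkn := (Finset.mem_range.1 hk).le
          refine mul_le_mul' (by split_ifs <;> simp) (ENNReal.ofReal_le_ofReal (hl hkn))
      _ = _ := by
        rw [Finset.sum_const, Finset.card_range, nsmul_eq_mul]
        ring
  simp only [h1]
  rw [ENNReal.tsum_comm]
  refine ne_top_of_le_ne_top (ENNReal.add_ne_top.2 ⟨h2, (tailPMF μ hμ).tsum_coe_ne_top⟩) ?_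
  rw [← ENNReal.tsum_add]
  refine ENNReal.tsum_le_tsum fun k => ?_
  rw [ENNReal.tsum_mul_left]
  refine (mul_le_mul_right (tsum_ite_natCast_lt_le (l k)) _).trans (le_of_eq (by ring))

theorem natCast_le_exp_of_log_rpow_le {β : ℝ} (hβ : 0 < 1 + β) {k p : ℕ}
    (h : Real.log k ^ (1 + β) ≤ p) :
    (k : ℝ≥0∞) ≤ ENNReal.ofReal (Real.exp ((p : ℝ) ^ (1 + β)⁻¹)) := by
  rw [← ENNReal.ofReal_natCast]
  refine ENNReal.ofReal_le_ofReal ?_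
  rcases Nat.eq_zero_or_pos k with rfl | hk
  · simpa using (Real.exp_pos _).le
  · have hk' : (0 : ℝ) < k := Nat.cast_pos.2 hk
    have hlog : 0 ≤ Real.log k := Real.log_natCast_nonneg k
    rw [← Real.exp_log hk']
    refine Real.exp_le_exp.2 ?_
    calc Real.log k = (Real.log k ^ (1 + β)) ^ (1 + β)⁻¹ := (Real.rpow_rpow_inv hlog hβ.ne').symm
      _ ≤ _ := Real.rpow_le_rpow (Real.rpow_nonneg hlog _) h (by positivity)

variable [NeZero b]

variable (b) in
/-- The law of the bodies that are grafted on the ancestors. -/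
def bodiesM (μ ρ : PMF ℕ) : Measure (ℕ → Body b) := Measure.infinitePi fun _ => bodyM b μ ρ

instance (μ ρ : PMF ℕ) : IsProbabilityMeasure (bodiesM b μ ρ) := by unfold bodiesM; infer_instance

/-- The walk being fixed, the `p`-th body eventually has at most `exp(p ^ a)` trees, by the moment
condition and Borel–Cantelli; in mean each has at most `2 green` visits at the label of the
ancestor, and `ae_tsum_green_ne_top` makes the sum finite. -/
theorem ae_lineVisits_ne_top (hb : 2 ≤ b) (hμ : ∑' k : ℕ, (k : ℝ≥0∞) * μ k = 1) {β : ℝ}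
    (hβ : 1 < β) (hs : Summable fun k : ℕ => (k : ℝ) * Real.log k ^ (1 + β) * (μ k).toReal)
    (z : BiWord (Fin b)) :
    ∀ᵐ s ∂stepsM b, ∀ᵐ Y ∂bodiesM b μ (tailPMF μ hμ), lineVisits z z (fun p => (s p, Y p)) ≠ ∞ := by
  set ρ := tailPMF μ hμ
  have hβ0 : 0 < 1 + β := by linarith
  set a := (1 + β)⁻¹ with ha
  -- The condition `β > 1` enters here: the exponent `a` of the offspring bound must stay below
  -- `1/2`, the exponent of the descent of the walk.
  have ha' : a < 1 / 2 := by
    rw [ha, one_div]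
    exact inv_strictAnti₀ two_pos (by linarith)
  set e : ℕ → ℝ≥0∞ := fun p => ENNReal.ofReal (Real.exp ((p : ℝ) ^ a)) with he
  have hemono : ∀ p, e p ≤ e (p + 1) := fun p => by
    refine ENNReal.ofReal_le_ofReal (Real.exp_le_exp.2 (Real.rpow_le_rpow (Nat.cast_nonneg p) ?_
      (by positivity)))
    push_cast
    linarith
  set S : ℕ → Set ℕ := fun p => {k | Real.log k ^ (1 + β) ≤ p} with hS
  have heval : ∀ p, MeasurePreserving (fun Y : ℕ → Body b => Y p) (bodiesM b μ ρ) (bodyM b μ ρ) :=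
    fun p => measurePreserving_eval_infinitePi (fun _ : ℕ => bodyM b μ ρ) p
  have hBC : ∀ᵐ Y ∂bodiesM b μ ρ, ∀ᶠ p in atTop, (Y p).1 ∈ S p := by
    have h1 : ∀ p, bodiesM b μ ρ {Y | (Y p).1 ∉ S p} = ρ.toMeasure (S p)ᶜ := fun p =>
      ((measurePreserving_fst (μ := ρ.toMeasure) (ν := marksM b μ)).comp
        (heval p)).measure_preimage (s := (S p)ᶜ) MeasurableSet.of_discrete.nullMeasurableSet
    have hmono : Monotone fun k : ℕ => Real.log k ^ (1 + β) := by
      intro j k hjk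
      rcases Nat.eq_zero_or_pos j with rfl | hj
      · simp only [Nat.cast_zero, Real.log_zero, Real.zero_rpow hβ0.ne']
        exact Real.rpow_nonneg (Real.log_natCast_nonneg k) _
      · exact Real.rpow_le_rpow (Real.log_natCast_nonneg j)
          (Real.log_le_log (Nat.cast_pos.2 hj) (Nat.cast_le.2 hjk)) hβ0.le
    have h2 := ae_eventually_notMem (μ := bodiesM b μ ρ) (s := fun p => {Y | (Y p).1 ∉ S p})
      (by
        simp only [h1]
        exact tsum_tail_lt_ne_top hμ hmono
          (fun k => Real.rpow_nonneg (Real.log_natCast_nonneg k) _) hs)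
    filter_upwards [h2] with Y hY
    filter_upwards [hY] with p hp
    exact not_not.1 hp
  filter_upwards [ae_tsum_green_ne_top hb z (by positivity) ha'] with s hsum
  have hgm : ∀ p, Measurable fun Y : ℕ → Body b => {y : Body b | y.1 ∈ S p}.indicator
      (fun y => bodyVisits z y (walkPos z s (p + 1))) (Y p) := fun p =>
    ((measurable_bodyVisits z _).indicator (measurable_fst (MeasurableSet.of_discrete (s := S p)))).comp
      (measurable_pi_apply p)
  have hint : ∫⁻ Y, ∑' p, {y : Body b | y.1 ∈ S p}.indicator
      (fun y => bodyVisits z y (walkPos z s (p + 1))) (Y p) ∂bodiesM b μ ρ ≠ ∞ := by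
    rw [lintegral_tsum fun p => (hgm p).aemeasurable]
    have h1 : ∀ p, ∫⁻ Y, {y : Body b | y.1 ∈ S p}.indicator
        (fun y => bodyVisits z y (walkPos z s (p + 1))) (Y p) ∂bodiesM b μ ρ ≤
        2 * (e (p + 1) * green z (walkPos z s (p + 1))) := by
      intro p
      rw [(heval p).lintegral_comp (f := {y : Body b | y.1 ∈ S p}.indicator
        (fun y => bodyVisits z y (walkPos z s (p + 1)))) ((measurable_bodyVisits z _).indicator
          (measurable_fst (MeasurableSet.of_discrete (s := S p))))]
      refine (lintegral_bodyVisits_le hμ ρ z _ (S p) (e p)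
        fun k hk => natCast_le_exp_of_log_rpow_le hβ0 hk).trans ?_
      rw [mul_left_comm]
      gcongr
      exact hemono p
    refine ne_top_of_le_ne_top ?_ (ENNReal.tsum_le_tsum h1)
    rw [ENNReal.tsum_mul_left]
    refine ENNReal.mul_ne_top ENNReal.ofNat_ne_top (ne_top_of_le_ne_top hsum ?_)
    exact ENNReal.tsum_comp_le_tsum_of_injective (add_left_injective 1)
      fun p => e p * green z (walkPos z s p)
  have hfin : ∀ᵐ Y ∂bodiesM b μ ρ, ∀ p, bodyVisits z (Y p) (walkPos z s (p + 1)) ≠ ∞ :=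
    ae_all_iff.2 fun p => (heval p).quasiMeasurePreserving.ae (ae_bodyVisits_ne_top hb hμ ρ z _)
  filter_upwards [hBC, hfin, ae_lt_top (Measurable.tsum hgm) hint] with Y h1 h2 h3
  refine ENNReal.tsum_ne_top_of_eventually_le ?_ h2 h3.ne
  filter_upwards [h1] with p hp
  rw [Set.indicator_of_mem (by exact hp)]

/-- A code from independent parts. -/
def ofParts (q : Word b × ((ℕ → Step b) × ((ℕ → Body b) × Body b))) : Code b :=
  (q.2.2.2, (q.1, fun p => (q.2.1 p, q.2.2.1 p)))

theorem measurePreserving_ofParts (μ ρ : PMF ℕ) :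
    MeasurePreserving (ofParts (b := b))
      ((wordM b).prod ((stepsM b).prod ((bodiesM b μ ρ).prod (bodyM b μ μ)))) (codeM b μ ρ) := by
  have h1 := ((measurePreserving_zip (fun _ : ℕ => stepM b) (fun _ : ℕ => bodyM b μ ρ)).prod
    (MeasurePreserving.id (bodyM b μ μ))).comp
    (measurePreserving_prodAssoc (stepsM b) (bodiesM b μ ρ) (bodyM b μ μ)).symm
  have h2 := (measurePreserving_prodAssoc (wordM b) (spineM b μ ρ) (bodyM b μ μ)).symm.comp
    ((MeasurePreserving.id (wordM b)).prod h1)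
  exact (Measure.measurePreserving_swap (μ := (wordM b).prod (spineM b μ ρ))
    (ν := bodyM b μ μ)).comp h2

theorem ae_hasNext (hμ : ∑' k : ℕ, (k : ℝ≥0∞) * μ k = 1) :
    ∀ᵐ c ∂codeM b μ (tailPMF μ hμ), HasNext c := by
  by_cases h : μ = PMF.pure 1
  · filter_upwards [ae_lineLevels hμ h] with c hc
    have h1 := ((hc 0 0 []).2 ⟨rfl, rfl, 0, rfl⟩).1
    exact ⟨0, Nat.pos_iff_ne_zero.1 h1⟩
  · filter_upwards [ae_finLevels hμ h] with c hc
    obtain ⟨q, hq, hq'⟩ := hc.2 0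
    obtain ⟨p, rfl⟩ := Nat.exists_eq_succ_of_ne_zero hq.ne'
    refine ⟨p + 1, ?_⟩
    rw [Function.iterate_succ_apply']
    show ((climbC^[p] c).2.2 0).2.1 ≠ 0
    rw [climbC_iterate_spine, Nat.zero_add]
    exact hq'

/-- The word, the steps, the bodies of the ancestors and that of the vertex are independent, so by
Fubini the bounds for a deterministic `z` apply to the starting label `(0, w)`. -/
theorem ae_finite_visits (hb : 2 ≤ b) (hμ : ∑' k : ℕ, (k : ℝ≥0∞) * μ k = 1) {β : ℝ}
    (hβ : 1 < β) (hs : Summable fun k : ℕ => (k : ℝ) * Real.log k ^ (1 + β) * (μ k).toReal) :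
    ∀ᵐ c ∂codeM b μ (tailPMF μ hμ), {n | pos c n = pos c 0}.Finite := by
  have hnext : ∀ᵐ c ∂codeM b μ (tailPMF μ hμ), ∀ n, HasNext (next^[n] c) := ae_all_iff.2 fun n =>
    ((measurePreserving_next hμ).iterate n).quasiMeasurePreserving.ae (ae_hasNext hμ)
  have hmeas : MeasurableSet {c : Code b | (∀ n, HasNext (next^[n] c)) →
      {n | pos c n = pos c 0}.Finite} := by
    have h1 : MeasurableSet {c : Code b | ∀ n, HasNext (next^[n] c)} := by
      rw [Set.ofPred_forall]
      exact MeasurableSet.iInter fun n => (measurable_next.iterate n) measurableSet_hasNext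
    exact h1.imp (measurableSet_finite measurableSet_pos_eq)
  have hΦ := measurePreserving_ofParts (b := b) μ (tailPMF μ hμ)
  have key : ∀ᵐ c ∂codeM b μ (tailPMF μ hμ), (∀ n, HasNext (next^[n] c)) →
      {n | pos c n = pos c 0}.Finite := by
    rw [← hΦ.map_eq, ae_map_iff hΦ.measurable.aemeasurable hmeas]
    have h1 := hΦ.measurable hmeas
    refine (Measure.ae_prod_iff_ae_ae h1).2 (ae_of_all _ fun w => ?_)
    have h2 := measurable_prodMk_left (x := w) h1
    refine (Measure.ae_prod_iff_ae_ae h2).2 ?_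
    filter_upwards [ae_lineVisits_ne_top hb hμ hβ hs ⟨0, w⟩] with s hY
    have h3 := measurable_prodMk_left (x := s) h2
    refine (Measure.ae_prod_iff_ae_ae h3).2 ?_
    filter_upwards [hY] with Y h4
    filter_upwards [ae_bodyVisits_ne_top hb hμ μ ⟨0, w⟩ ⟨0, w⟩] with y h5 hn
    refine finite_visits hn ?_
    have e : pos (ofParts (w, (s, (Y, y)))) 0 = ⟨0, w⟩ := BiWord.ext rfl rfl
    rw [e]
    exact ENNReal.add_ne_top.2 ⟨h5, h4⟩
  filter_upwards [hnext, key] with c h1 h2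
  exact h2 h1

end Code

/-! ### From codes back to trees, and the theorem. -/

open Classical in
theorem ncard_image_Icc_eq_sum {E : Type*} (p : ℕ → E) (n : ℕ) :
    (p '' Set.Icc 1 n).ncard =
      ∑ k ∈ Finset.range n, if ∀ j < k, p (j + 1) ≠ p (k + 1) then 1 else 0 := by
  induction n with
  | zero => simp
  | succ n ih =>
    have e : p '' Set.Icc 1 (n + 1) = insert (p (n + 1)) (p '' Set.Icc 1 n) := by
      rw [← Set.image_insert_eq]
      congr 1
      ext k
      simp only [Set.mem_Icc, Set.mem_insert_iff]
      omega
    rw [e, Finset.sum_range_succ, ← ih]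
    split_ifs with h
    · rw [Set.ncard_insert_of_notMem _ ((Set.finite_Icc 1 n).image p)]
      rintro ⟨k, ⟨hk1, hk2⟩, hk⟩
      exact h (k - 1) (by omega) (by rwa [Nat.sub_add_cancel hk1])
    · push Not at h
      obtain ⟨j, hj, hj'⟩ := h
      have hm : p (n + 1) ∈ p '' Set.Icc 1 n := ⟨j + 1, ⟨by omega, by omega⟩, hj'⟩
      rw [Set.ncard_insert_of_mem hm, add_zero]

namespace Code

variable {b : ℕ} [NeZero b]

/-- Counting the times at which a new value appears turns the cardinality into a finite sum of
indicators. -/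
theorem measurable_range_pos (n : ℕ) :
    Measurable fun c : Code b => (pos c '' Set.Icc 1 n).ncard := by
  classical
  simp only [ncard_image_Icc_eq_sum]
  refine Finset.measurable_fun_sum _ fun k _ => Measurable.ite ?_ measurable_const measurable_const
  simp only [Set.ofPred_forall]
  exact MeasurableSet.iInter fun j => MeasurableSet.iInter fun _ =>
    (measurableSet_biWord_eq (measurable_height_pos _) (measurable_height_pos _)
      (measurable_letter_pos _) (measurable_letter_pos _)).compl

end Code

namespace IsUniformBRW

open Code LTree

variable {b : ℕ} [NeZero b] {μ : PMF ℕ} {Ω : Type*} [MeasurableSpace Ω] {P : Measure Ω}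
  [IsProbabilityMeasure P] {Θ : Ω → LTree (BiWord (Fin b))}

theorem ae_label_vertex (hμ : ∑' k : ℕ, (k : ℝ≥0∞) * μ k = 1) (h : IsUniformBRW μ b P Θ) :
    ∀ᵐ ω ∂P, ∀ n, (Θ ω).label ((Θ ω).vertex n) = pos (Θ ω).code n := by
  filter_upwards [h.ae_good, h.ae_rightDiscrete hμ] with ω h1 h2
  exact h1.label_vertex (allSucc_of_rightDiscrete h2)

theorem ae_tendsto_range (hμ : ∑' k : ℕ, (k : ℝ≥0∞) * μ k = 1) (h : IsUniformBRW μ b P Θ) :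
    ∀ᵐ ω ∂P, Tendsto (fun n : ℕ =>
      (((fun k => (Θ ω).label ((Θ ω).vertex k)) '' Set.Icc 1 n).ncard : ℝ) / n) atTop
      (𝓝 ((codeM b μ (tailPMF μ hμ)).real {c | ∀ n, 1 ≤ n → pos c n ≠ pos c 0})) := by
  have h1 := h.ae_code hμ (p := fun c => Tendsto (fun n : ℕ =>
      ((pos c '' Set.Icc 1 n).ncard : ℝ) / n) atTop
      (𝓝 ((codeM b μ (tailPMF μ hμ)).real {c | ∀ n, 1 ≤ n → pos c n ≠ pos c 0})))
    (measurableSet_tendsto _ fun n =>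
      ((Measurable.of_discrete (f := fun k : ℕ => (k : ℝ))).comp (measurable_range_pos n)).div_const _)
    (fun c => by rw [show pos (reset c) = pos c from funext (pos_reset c)])
    (ae_tendsto_range_pos hμ)
  filter_upwards [h1, h.ae_label_vertex hμ] with ω h2 h3
  simpa only [h3] using h2

theorem measureReal_escape (hμ : ∑' k : ℕ, (k : ℝ≥0∞) * μ k = 1) (h : IsUniformBRW μ b P Θ) :
    P.real {ω | ∀ n, 1 ≤ n → (Θ ω).label ((Θ ω).vertex n) ≠ (Θ ω).rootLabel} =
      (codeM b μ (tailPMF μ hμ)).real {c | ∀ n, 1 ≤ n → pos c n ≠ pos c 0} := by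
  have hG : MeasurableSet {c : Code b | ∀ n, 1 ≤ n → pos c n ≠ pos c 0} := by
    simp only [Set.ofPred_forall]
    exact MeasurableSet.iInter fun n => MeasurableSet.iInter fun _ => (measurableSet_pos_eq n).compl
  obtain ⟨h1, h2⟩ := h.map_code hμ
  have h3 := congrArg (· {c : Code b | ∀ n, 1 ≤ n → pos c n ≠ pos c 0}) h2
  simp only [Measure.map_apply_of_aemeasurable h1 hG, Measure.map_apply measurable_reset hG] at h3
  have h4 : reset ⁻¹' {c : Code b | ∀ n, 1 ≤ n → pos c n ≠ pos c 0} =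
      {c | ∀ n, 1 ≤ n → pos c n ≠ pos c 0} := by
    ext c
    simp only [Set.mem_preimage, Set.mem_ofPred_eq, pos_reset]
  rw [h4] at h3
  rw [measureReal_def, measureReal_def, ← h3]
  congr 1
  refine measure_congr ?_
  filter_upwards [h.ae_label_vertex hμ] with ω h5
  refine propext (forall₂_congr fun n _ => ?_)
  rw [h5 n, show (Θ ω).rootLabel = pos (Θ ω).code 0 from h5 0]

end IsUniformBRW

end

theorem mainTheorem4 (b : ℕ) (hb : 2 ≤ b) (μ : PMF ℕ)
    (hμ : ∑' k : ℕ, (k : ℝ≥0∞) * μ k = 1) :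
    ∃ c : ℝ, ∀ {Ω : Type*} [MeasurableSpace Ω] (P : Measure Ω) [IsProbabilityMeasure P]
      (Θ : Ω → LTree (BiWord (Fin b))), IsUniformBRW μ b P Θ →
      IdentDistrib (fun ω => (Θ ω).sccPlus) Θ P P ∧
      (∀ᵐ ω ∂P,
        (∀ n, BiWord.LexLT ((Θ ω).vertex n) ((Θ ω).vertex (n + 1))) ∧
        ∀ v : (Θ ω).carrier, v ∈ Set.range (Θ ω).vertex ↔
          (v : BiWord ℕ) = (Θ ω).pt ∨ BiWord.LexLT (Θ ω).pt v) ∧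
      (∀ᵐ ω ∂P, Tendsto
        (fun n : ℕ =>
          (((fun k => (Θ ω).label ((Θ ω).vertex k)) '' Set.Icc 1 n).ncard : ℝ) / n)
        atTop (𝓝 c)) ∧
      c = P.real {ω | ∀ n, 1 ≤ n → (Θ ω).label ((Θ ω).vertex n) ≠ (Θ ω).rootLabel} ∧
      ((∃ β : ℝ, 1 < β ∧
        Summable (fun k : ℕ => (k : ℝ) * Real.log k ^ (1 + β) * (μ k).toReal)) → 0 < c) := by
  have : NeZero b := ⟨by omega⟩
  -- The constant is computed under the law of the code, which involves only `μ` and `b`.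
  refine ⟨(Code.codeM b μ (Code.tailPMF μ hμ)).real
    {c | ∀ n, 1 ≤ n → Code.pos c n ≠ Code.pos c 0}, ?_⟩
  intro Ω _ P _ Θ h
  refine ⟨h.identDistrib_sccPlus hμ, ?_, h.ae_tendsto_range hμ, (h.measureReal_escape hμ).symm, ?_⟩
  · filter_upwards [h.ae_rightDiscrete hμ] with ω hω
    exact ⟨fun n => ((LTree.allSucc_of_rightDiscrete hω).lexLT_vertex n).2.1,
      LTree.mem_range_vertex_iff hω⟩
  · rintro ⟨β, hβ, hs⟩
    exact Code.measure_escape_pos hμ (Code.ae_finite_visits hb hμ hβ hs)
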